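/- Setting. Let $b,d,\xi>0$, $\Omega=\{(x,y,z):|x|,|y|<b,\ -\xi<z<d\}$, $\Gamma=\{|x|,|y|<b,\ z=-\xi\}$, $s>\xi$ and $0<\underline k<\overline k$. Functions are complex valued and spaces of such functions are regarded as real Hilbert spaces. $H_m$ is the space of $f(\mathbf x,k)$ with $\|f\|_{H_m}^2=\int_{\underline k}^{\overline k}\|f(\cdot,k)\|_{H^m(\Omega)}^2dk<\infty$, and $H_3^0$ is the subspace of $H_3$ of functions with $f|_{\partial\Omega}=0$, $f_z|_\Gamma=0$ for a.e. $k$; $B(R)=\{f\in H_3^0:\|f\|_{H_3}<R\}$. Put $\varphi_\lambda(z)=\exp(2\lambda(z+s)^{-\nu})$, $t_\nu=(s-\xi)^{-\nu}-(s+d)^{-\nu}$ and $\lambda(\delta)=\ln(\delta^{-1/(2t_\nu)})$. For $q\in H_3$, $V\in H^3(\Omega)$ let $v(\mathbf x,k)=V(\mathbf x)-\int_k^{\overline k}q(\mathbf x,\kappa)d\kappa$ and $$L(q;V)=\Delta q+2k\nabla v\cdot(k\nabla q+\nabla v)+2i(kq_z+v_z);$$ the coefficient reconstructed from $(q,V)$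 at the wavenumber $k$ is $c=1-\Delta v-k^2(\nabla v)^2-2ikv_z$. Noiseless data. $V_*\in H^3(\Omega)$ satisfies $\Delta V_*=0$ in $\Omega$ and $V_*=\psi_{0*}$, $\partial_zV_*=\psi_{1*}$ on $\Gamma$, $V_*=0$ on $\partial\Omega\setminus\Gamma$; $Q_*\in H^3(\Omega)$ has the same boundary data as $V_*$; $F_*\in H_4$ satisfies $F_*=\phi_{0*}$, $\partial_zF_*=\phi_{1*}$ on $\Gamma$, $F_*=0$ on $\partial\Omega\setminus\Gamma$, for a.e. $k$. The exact solution is $p_*\in H_3^0$ such that $q_*=p_*+F_*$ satisfies $L(q_*;V_*)=0$, and $c_*$ is the coefficient that generates it, that is, $c_*$ is the coefficient reconstructed from $(q_*,V_*)$ at every $k\in[\underline k,\overline k]$. Noisy data. For $\delta\in(0,1)$, $Q\in H^3(\Omega)$ and $F\in H_4$ satisfy the same conditions with noisy boundary data $\psi_0,\psi_1$ and $\phi_0,\phi_1$, with $\|Q-Q_*\|_{H^3(\Omega)}<\delta$, $\|F-F_*\|_{H_4}<\delta$. The tail function $V=V_\delta$ is the minimizer of $$e^{-2\mu(s+d)^{-\nu}}\int_\Omega|\Delta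 V|^2\varphi_\mu(z)\,d\mathbf x+\delta\|V\|_{H^3(\Omega)}^2,\qquad \mu=\lambda(\delta),$$ over all $V\in H^3(\Omega)$ with the boundary data of $Q$. For $p\in H_3^0$ let $$J_{\lambda,\rho}(p)=e^{-2\lambda(s+d)^{-\nu}}\int_{\underline k}^{\overline k}\int_\Omega|L(p+F;V_\delta)|^2\varphi_\lambda(z)\,d\mathbf x\,dk+\rho\|p\|_{H_3}^2 .$$ Theorem 4.6. There is $\nu_0=\nu_0(\Omega,s)\ge1$ such that for every fixed $\nu\ge\nu_0$ the following holds. There are numbers $\lambda_1\ge1$, $C_1>0$ depending only on $\Omega,s,\nu,\underline k,\overline k,R,\|F_*\|_{H_4},\|V_*\|_{H^3(\Omega)}$, a number $C_2>0$ depending only on $\Omega,s,\nu,\underline k,\overline k,R,\|F\|_{H_4},\|V_*\|_{H^3(\Omega)}$, a number $\omega_0\in(0,1)$ depending only on these last quantities and $\delta$, and a number $r\in(0,1)$ depending only on these, $\delta$ and $\omega$, such that for all $R>0$ and all data as above: (i) The tail function $V_\delta$ exists and is unique. For all $\lambda\ge\lambda_1$, $\rho>0$ the functional $J_{\lambda,\rho}$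 is Fréchet differentiable on $H_3^0$ and strictly convex on $\overline{B(R)}$: for all $p_1,p_2\in\overline{B(R)}$, $$J_{\lambda,\rho}(p_2)-J_{\lambda,\rho}(p_1)-J_{\lambda,\rho}'(p_1)(p_2-p_1)\ge\frac{C_1}{\lambda}\|p_2-p_1\|_{H_2}^2+\rho\|p_2-p_1\|_{H_3}^2,$$ and the same holds with $C_1\|p_2-p_1\|_{H_1}^2$ in place of $\frac{C_1}{\lambda}\|p_2-p_1\|_{H_2}^2$. (ii) Let $\delta_1\in(0,e^{-2\lambda_1t_\nu})$, $\delta\in(0,\delta_1)$, $\rho=\sqrt\delta$, $\lambda=\lambda(\delta)$, and let the exact solution $p_*$ exist and lie in $B(R)$. Then $J_{\lambda,\rho}$ has a unique minimizer $p_{\min}$ on $\overline{B(R)}$, and $$\|p_*-p_{\min}\|_{H_2}\le C_2\delta^{1/4}[\ln(\delta^{-1/(2t_\nu)})]^{3/4},\qquad \|c_*-c_{\min}\|_{L_2(\Omega)}\le C_2\delta^{1/4}[\ln(\delta^{-1/(2t_\nu)})]^{3/4},$$ where $c_{\min}$ is reconstructed from $(p_{\min}+F,V_\delta)$ at any wavenumber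 in $[\underline k,\overline k]$. Moreover, let $\omega\in(0,\omega_0)$, $p_0\in B(R)$ and $p_n=P(p_{n-1}-\omega J_{\lambda,\rho}'(p_{n-1}))$, $n\ge1$, where $P$ is the projection of the Hilbert space $H_3^0$ on $\overline{B(R)}$ and $J_{\lambda,\rho}'$ is identified with the gradient in $H_3^0$. Then for all $n$ $$\|p_{\min}-p_n\|_{H_3}\le r^n\|p_{\min}-p_0\|_{H_3},$$ $$\|p_*-p_n\|_{H_2}\le C_2\delta^{1/4}[\ln(\delta^{-1/(2t_\nu)})]^{3/4}+r^n\|p_{\min}-p_0\|_{H_3},$$ $$\|c_*-c_n\|_{L_2(\Omega)}\le C_2\delta^{1/4}[\ln(\delta^{-1/(2t_\nu)})]^{3/4}+C_2r^n\|p_{\min}-p_0\|_{H_3},$$ where $c_n$ is reconstructed from $(p_n+F,V_\delta)$ at any wavenumber in $[\underline k,\overline k]$. -/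

import Mathlib

open MeasureTheory Set
open scoped Gradient

noncomputable section

namespace Convexification

/-- Physical space, with Euclidean norm and Lebesgue measure. -/
abbrev E3 := EuclideanSpace ℝ (Fin 3)

/-- The unit multi-index. The coordinates `x, y, z` have indices `0, 1, 2`. -/
def unitIdx (i : Fin 3) : Fin 3 → ℕ := Pi.single i 1

/-- The three numbers that determine the domain. -/
structure Box where
  b : ℝ
  d : ℝ
  ξ : ℝ
  b_pos : 0 < b
  d_pos : 0 < d
  ξ_pos : 0 < ξ

/-- The box `|x| < b, |y| < b, -ξ < z < d`. -/
def Box.domain (B : Box) : Set E3 :=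
  {x | |x 0| < B.b ∧ |x 1| < B.b ∧ -B.ξ < x 2 ∧ x 2 < B.d}

/-- The backscattering face `|x| < b, |y| < b, z = -ξ`. -/
def Box.face (B : Box) : Set E3 :=
  {x | |x 0| < B.b ∧ |x 1| < B.b ∧ x 2 = -B.ξ}

/-- Integration over the backscattering face with respect to its surface measure. -/
def Box.faceIntegral (B : Box) (f : E3 → ℂ) : ℂ :=
  ∫ y in Ioo (-B.b) B.b ×ˢ Ioo (-B.b) B.b, f !₂[y.1, y.2, -B.ξ]

/-- Integrability over the backscattering face. -/
def Box.FaceIntegrable (B : Box) (f : E3 → ℂ) : Prop :=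
  IntegrableOn (fun y : ℝ × ℝ => f !₂[y.1, y.2, -B.ξ]) (Ioo (-B.b) B.b ×ˢ Ioo (-B.b) B.b)

/-- Lebesgue measure on the box. -/
def Box.vol (B : Box) : Measure E3 := volume.restrict B.domain

/-- Complex functions as pairs of real functions: `L²` as a real Hilbert space. -/
abbrev L2 (B : Box) := Lp ℂ 2 B.vol

/-! ### Test functions and classical partial derivatives -/

/-- Smooth and compactly supported in `ℝ³`. -/
def IsTest (φ : E3 → ℝ) : Prop := ContDiff ℝ (⊤ : ℕ∞) φ ∧ HasCompactSupport φ

/-- Classical partial derivative. -/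
def pd (i : Fin 3) (φ : E3 → ℝ) : E3 → ℝ :=
  fun x => fderiv ℝ φ x (EuclideanSpace.single i 1)

/-- Classical partial derivative of multi-index `α`. -/
def pdMulti (α : Fin 3 → ℕ) (φ : E3 → ℝ) : E3 → ℝ :=
  (pd 0)^[α 0] ((pd 1)^[α 1] ((pd 2)^[α 2] φ))

lemma IsTest.pd {φ : E3 → ℝ} (h : IsTest φ) (i : Fin 3) : IsTest (pd i φ) := by
  refine ⟨?_, ?_⟩
  · exact (h.1.fderiv_right (m := (⊤ : ℕ∞)) (by simp)).clm_apply contDiff_const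
  · exact h.2.fderiv_apply (𝕜 := ℝ) _

lemma IsTest.iter {φ : E3 → ℝ} (h : IsTest φ) (i : Fin 3) (n : ℕ) :
    IsTest ((Convexification.pd i)^[n] φ) := by
  induction n with
  | zero => exact h
  | succ n ih => rw [Function.iterate_succ_apply']; exact ih.pd i

lemma IsTest.pdMulti {φ : E3 → ℝ} (h : IsTest φ) (α : Fin 3 → ℕ) : IsTest (pdMulti α φ) :=
  ((h.iter 2 _).iter 1 _).iter 0 _

/-- The pairing `∫_Ω φ u dx`. -/
def pair {B : Box} (φ : E3 → ℝ) (u : L2 B) : ℂ := ∫ x, (φ x : ℂ) * u x ∂B.vol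

lemma IsTest.pair_clm {B : Box} {φ : E3 → ℝ} (h : IsTest φ) :
    ∃ T : L2 B →L[ℝ] ℂ, ∀ u, T u = pair φ u := by
  have hm : MemLp (fun x => (φ x : ℂ)) 2 B.vol := by
    have h1 : MemLp φ 2 (volume : Measure E3) := h.1.continuous.memLp_of_hasCompactSupport h.2
    exact (h1.mono_measure Measure.restrict_le_self).ofReal
  refine ⟨(innerSL ℂ (hm.toLp _)).restrictScalars ℝ, fun u => ?_⟩
  rw [ContinuousLinearMap.coe_restrictScalars', innerSL_apply_apply, L2.inner_def]
  refine integral_congr_ae ?_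
  filter_upwards [hm.coeFn_toLp] with x hx
  simp [hx, mul_comm]

/-! ### Sobolev spaces on the box -/

/-- Multi-indices of order at most `m`. -/
def multiIdx (m : ℕ) : Finset (Fin 3 → ℕ) :=
  (Fintype.piFinset fun _ => Finset.range (m + 1)).filter fun α => ∑ i, α i ≤ m

lemma mem_multiIdx {m : ℕ} {α : Fin 3 → ℕ} : α ∈ multiIdx m ↔ ∑ i, α i ≤ m := by
  simp only [multiIdx, Finset.mem_filter, Fintype.mem_piFinset, Finset.mem_range,
    and_iff_right_iff_imp]
  intro h i
  have := Finset.single_le_sum (f := α) (fun _ _ => Nat.zero_le _) (Finset.mem_univ i)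
  omega

lemma multiIdx_mono {m n : ℕ} (h : m ≤ n) {α : Fin 3 → ℕ} (hα : α ∈ multiIdx m) :
    α ∈ multiIdx n := by
  rw [mem_multiIdx] at *
  omega

/-- Families `(u_α)`, `|α| ≤ m`, of `L²` functions, with `‖u‖² = ∑ ‖u_α‖²`. -/
abbrev Jet (B : Box) (m : ℕ) := PiLp 2 fun _ : multiIdx m => L2 B

/-- The entry of multi-index `α` (zero if `|α| > m`). -/
def Jet.entry {B : Box} {m : ℕ} (α : Fin 3 → ℕ) : Jet B m →L[ℝ] L2 B :=
  if h : α ∈ multiIdx m then PiLp.proj 2 (fun _ : multiIdx m => L2 B) ⟨α, h⟩ else 0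

/-- The families `(u_α)`, `|α| ≤ m`, in which `u_α` is the weak derivative `D^α u_0`. -/
def weakJets (B : Box) (m : ℕ) : Submodule ℝ (Jet B m) where
  carrier := {u | ∀ α ∈ multiIdx m, ∀ φ, IsTest φ → tsupport φ ⊆ B.domain →
    pair (pdMulti α φ) (Jet.entry 0 u) = (-1) ^ (∑ i, α i) * pair φ (Jet.entry α u)}
  zero_mem' := by
    intro α hα φ hφ _
    obtain ⟨S, hS⟩ := (hφ.pdMulti α).pair_clm (B := B)
    obtain ⟨T, hT⟩ := hφ.pair_clm (B := B)
    simp [← hS, ← hT]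
  add_mem' := by
    intro u v hu hv α hα φ hφ hs
    obtain ⟨S, hS⟩ := (hφ.pdMulti α).pair_clm (B := B)
    obtain ⟨T, hT⟩ := hφ.pair_clm (B := B)
    have h1 := hu α hα φ hφ hs
    have h2 := hv α hα φ hφ hs
    rw [← hS, ← hT] at *
    simp only [map_add, h1, h2, mul_add]
  smul_mem' := by
    intro c u hu α hα φ hφ hs
    obtain ⟨S, hS⟩ := (hφ.pdMulti α).pair_clm (B := B)
    obtain ⟨T, hT⟩ := hφ.pair_clm (B := B)
    have h1 := hu α hα φ hφ hs
    rw [← hS, ← hT] at *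
    simp only [map_smul, h1, mul_smul_comm]

lemma weakJets.isClosed (B : Box) (m : ℕ) : IsClosed (weakJets B m : Set (Jet B m)) := by
  have : (weakJets B m : Set (Jet B m)) = ⋂ (α : Fin 3 → ℕ) (_ : α ∈ multiIdx m) (φ : E3 → ℝ)
      (_ : IsTest φ) (_ : tsupport φ ⊆ B.domain),
      {u | pair (pdMulti α φ) (Jet.entry 0 u) =
        (-1) ^ (∑ i, α i) * pair φ (Jet.entry α u)} := by
    ext u
    simp [weakJets]
  rw [this]
  refine isClosed_iInter fun α => isClosed_iInter fun _ => isClosed_iInter fun φ =>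
    isClosed_iInter fun hφ => isClosed_iInter fun _ => ?_
  obtain ⟨S, hS⟩ := (hφ.pdMulti α).pair_clm (B := B)
  obtain ⟨T, hT⟩ := hφ.pair_clm (B := B)
  simp only [← hS, ← hT]
  exact isClosed_eq (by fun_prop) (by fun_prop)

/-- The Sobolev space `H^m(Ω)` of complex valued functions, each function being listed together
with its weak derivatives of order at most `m`; `‖u‖² = ∑_{|α| ≤ m} ‖D^α u‖²`. -/
def Hm (B : Box) (m : ℕ) : Type := weakJets B m

instance (B : Box) (m : ℕ) : NormedAddCommGroup (Hm B m) :=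
  inferInstanceAs (NormedAddCommGroup (weakJets B m))

instance (B : Box) (m : ℕ) : InnerProductSpace ℝ (Hm B m) :=
  inferInstanceAs (InnerProductSpace ℝ (weakJets B m))

instance (B : Box) (m : ℕ) : CompleteSpace (Hm B m) :=
  (weakJets.isClosed B m).completeSpace_coe

/-- The weak derivative `D^α u` of `u ∈ H^m(Ω)`, for `|α| ≤ m`. -/
def D {B : Box} {m : ℕ} (α : Fin 3 → ℕ) : Hm B m →L[ℝ] L2 B :=
  (Jet.entry α).comp (weakJets B m).subtypeL

/-- The inclusion `H^n(Ω) ⊆ H^m(Ω)` for `m ≤ n`. -/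
def restr {B : Box} {m n : ℕ} (h : m ≤ n) (u : Hm B n) : Hm B m :=
  ⟨WithLp.toLp 2 fun α => D α.1 u, by
    have key : ∀ α ∈ multiIdx m,
        Jet.entry α (WithLp.toLp 2 fun β : multiIdx m => D β.1 u) = Jet.entry α u.1 := by
      intro α hα
      conv_lhs => rw [Jet.entry, dif_pos hα]
      rfl
    intro α hα φ hφ hs
    have h0 : (0 : Fin 3 → ℕ) ∈ multiIdx m := by simp [mem_multiIdx]
    rw [key α hα, key 0 h0]
    exact u.2 α (multiIdx_mono h hα) φ hφ hs⟩

/-- The Laplacian `Δu`. -/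
def lap {B : Box} {m : ℕ} (u : Hm B m) : L2 B := ∑ i, D (2 • unitIdx i) u

/-! ### Boundary data -/

/-- `u = g₀` and `∂_z u = g₁` on the face `Γ`, and `u = 0` on `∂Ω ∖ Γ`, in the sense of traces.
Traces are expressed by the Gauss-Green formula: on `Γ` the outer unit normal is `(0, 0, -1)`,
and test functions that vanish near `∂Ω ∖ Γ` see only the face `Γ`. -/
def HasBoundaryData {B : Box} {m : ℕ} (u : Hm B m) (g₀ g₁ : E3 → ℂ) : Prop :=
  B.FaceIntegrable g₀ ∧ B.FaceIntegrable g₁ ∧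
  (∀ φ, IsTest φ → ∀ i : Fin 3,
    pair (pd i φ) (D 0 u) + pair φ (D (unitIdx i) u) =
      if i = 2 then -B.faceIntegral (fun x => (φ x : ℂ) * g₀ x) else 0) ∧
  (∀ φ, IsTest φ → Disjoint (tsupport φ) (frontier B.domain \ B.face) →
    pair (pd 2 φ) (D (unitIdx 2) u) + pair φ (D (2 • unitIdx 2) u) =
      -B.faceIntegral (fun x => (φ x : ℂ) * g₁ x))

lemma hasBoundaryData_zero_iff {B : Box} {m : ℕ} (u : Hm B m) :
    HasBoundaryData u 0 0 ↔
      (∀ φ, IsTest φ → ∀ i : Fin 3,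
        pair (pd i φ) (D 0 u) + pair φ (D (unitIdx i) u) = 0) ∧
      (∀ φ, IsTest φ → Disjoint (tsupport φ) (frontier B.domain \ B.face) →
        pair (pd 2 φ) (D (unitIdx 2) u) + pair φ (D (2 • unitIdx 2) u) = 0) := by
  simp [HasBoundaryData, Box.FaceIntegrable, Box.faceIntegral]

/-- The subspace of `u ∈ H^m(Ω)` with `u = 0` on `∂Ω` and `∂_z u = 0` on `Γ`. -/
def zeroData (B : Box) (m : ℕ) : Submodule ℝ (Hm B m) where
  carrier := {u | HasBoundaryData u 0 0}
  zero_mem' := by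
    simp only [mem_ofPred_eq, hasBoundaryData_zero_iff, map_zero]
    refine ⟨fun φ hφ i => ?_, fun φ hφ _ => ?_⟩
    · obtain ⟨S, hS⟩ := (hφ.pd i).pair_clm (B := B)
      obtain ⟨T, hT⟩ := hφ.pair_clm (B := B)
      simp [← hS, ← hT]
    · obtain ⟨S, hS⟩ := (hφ.pd 2).pair_clm (B := B)
      obtain ⟨T, hT⟩ := hφ.pair_clm (B := B)
      simp [← hS, ← hT]
  add_mem' := by
    intro u v hu hv
    simp only [mem_ofPred_eq, hasBoundaryData_zero_iff] at *
    refine ⟨fun φ hφ i => ?_, fun φ hφ hs => ?_⟩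
    · obtain ⟨S, hS⟩ := (hφ.pd i).pair_clm (B := B)
      obtain ⟨T, hT⟩ := hφ.pair_clm (B := B)
      have h1 := hu.1 φ hφ i
      have h2 := hv.1 φ hφ i
      rw [← hS, ← hT] at *
      simp only [map_add]
      linear_combination h1 + h2
    · obtain ⟨S, hS⟩ := (hφ.pd 2).pair_clm (B := B)
      obtain ⟨T, hT⟩ := hφ.pair_clm (B := B)
      have h1 := hu.2 φ hφ hs
      have h2 := hv.2 φ hφ hs
      rw [← hS, ← hT] at *
      simp only [map_add]
      linear_combination h1 + h2
  smul_mem' := by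
    intro c u hu
    simp only [mem_ofPred_eq, hasBoundaryData_zero_iff] at *
    refine ⟨fun φ hφ i => ?_, fun φ hφ hs => ?_⟩
    · obtain ⟨S, hS⟩ := (hφ.pd i).pair_clm (B := B)
      obtain ⟨T, hT⟩ := hφ.pair_clm (B := B)
      have h1 := hu.1 φ hφ i
      rw [← hS, ← hT] at *
      simp only [map_smul, ← smul_add, h1, smul_zero]
    · obtain ⟨S, hS⟩ := (hφ.pd 2).pair_clm (B := B)
      obtain ⟨T, hT⟩ := hφ.pair_clm (B := B)
      have h1 := hu.2 φ hφ hs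
      rw [← hS, ← hT] at *
      simp only [map_smul, ← smul_add, h1, smul_zero]

lemma zeroData.isClosed (B : Box) (m : ℕ) : IsClosed (zeroData B m : Set (Hm B m)) := by
  have : (zeroData B m : Set (Hm B m)) =
      (⋂ (φ : E3 → ℝ) (_ : IsTest φ) (i : Fin 3),
        {u | pair (pd i φ) (D 0 u) + pair φ (D (unitIdx i) u) = 0}) ∩
      (⋂ (φ : E3 → ℝ) (_ : IsTest φ)
        (_ : Disjoint (tsupport φ) (frontier B.domain \ B.face)),
        {u | pair (pd 2 φ) (D (unitIdx 2) u) + pair φ (D (2 • unitIdx 2) u) = 0}) := by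
    ext u
    have : u ∈ zeroData B m ↔ HasBoundaryData u 0 0 := Iff.rfl
    simp only [SetLike.mem_coe, this, hasBoundaryData_zero_iff, mem_inter_iff, mem_iInter,
      mem_ofPred_eq]
  rw [this]
  refine IsClosed.inter ?_ ?_
  · refine isClosed_iInter fun φ => isClosed_iInter fun hφ => isClosed_iInter fun i => ?_
    obtain ⟨S, hS⟩ := (hφ.pd i).pair_clm (B := B)
    obtain ⟨T, hT⟩ := hφ.pair_clm (B := B)
    simp only [← hS, ← hT]
    exact isClosed_eq (by fun_prop) (by fun_prop)
  · refine isClosed_iInter fun φ => isClosed_iInter fun hφ => isClosed_iInter fun _ => ?_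
    obtain ⟨S, hS⟩ := (hφ.pd 2).pair_clm (B := B)
    obtain ⟨T, hT⟩ := hφ.pair_clm (B := B)
    simp only [← hS, ← hT]
    exact isClosed_eq (by fun_prop) (by fun_prop)

/-- The space `H₀^m(Ω)` of `u ∈ H^m(Ω)` with `u = 0` on `∂Ω` and `∂_z u = 0` on `Γ`, with the
norm of `H^m(Ω)`. -/
def Hm0 (B : Box) (m : ℕ) : Type := zeroData B m

instance (B : Box) (m : ℕ) : NormedAddCommGroup (Hm0 B m) :=
  inferInstanceAs (NormedAddCommGroup (zeroData B m))

instance (B : Box) (m : ℕ) : InnerProductSpace ℝ (Hm0 B m) :=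
  inferInstanceAs (InnerProductSpace ℝ (zeroData B m))

instance (B : Box) (m : ℕ) : CompleteSpace (Hm0 B m) :=
  (zeroData.isClosed B m).completeSpace_coe

/-- The inclusion `H₀^m(Ω) ⊆ H^m(Ω)`. -/
def Hm0.incl {B : Box} {m : ℕ} : Hm0 B m →L[ℝ] Hm B m := (zeroData B m).subtypeL

/-! ### Functions that depend on the wavenumber -/

/-- Lebesgue measure on the interval of wavenumbers. -/
def kVol (k₁ k₂ : ℝ) : Measure ℝ := volume.restrict (Icc k₁ k₂)

/-- `H_m`: functions of `(x, k)` with `‖f‖² = ∫ ‖f(·, k)‖²_{H^m(Ω)} dk < ∞`. -/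
abbrev HK (B : Box) (m : ℕ) (k₁ k₂ : ℝ) := Lp (Hm B m) 2 (kVol k₁ k₂)

/-- `H_m^0`: the functions in `H_m` with `f = 0` on `∂Ω` and `f_z = 0` on `Γ`, with the norm
of `H_m`. -/
abbrev HK0 (B : Box) (m : ℕ) (k₁ k₂ : ℝ) := Lp (Hm0 B m) 2 (kVol k₁ k₂)

/-- The norm of `H_j`, `j ≤ m`, on functions with values in `H₀^m(Ω)`. -/
def normHK {B : Box} {m j : ℕ} (h : j ≤ m) {k₁ k₂ : ℝ} (p : HK0 B m k₁ k₂) : ℝ :=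
  √(∫ k, ‖restr h (Hm0.incl (p k))‖ ^ 2 ∂kVol k₁ k₂)

/-- The sum `q = p + F`, as a function of `k` with values in `H³(Ω)`. -/
def addF {B : Box} {k₁ k₂ : ℝ} (p : HK0 B 3 k₁ k₂) (F : HK B 4 k₁ k₂) : ℝ → Hm B 3 :=
  fun k => Hm0.incl (p k) + restr (by norm_num) (F k)

/-! ### The integro-differential operator and the coefficient -/

/-- `D^α v(·, k)` for `v(x, k) = V(x) - ∫_k^{k₂} q(x, κ) dκ`. -/
def Dv {B : Box} (k₂ : ℝ) (V : Hm B 3) (q : ℝ → Hm B 3) (α : Fin 3 → ℕ) (k : ℝ) : L2 B :=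
  D α V - ∫ κ in k..k₂, D α (q κ)

/-- `L(q) = Δq + 2k ∇v · (k ∇q + ∇v) + 2i (k q_z + v_z)`, `v = V - ∫_k^{k₂} q dκ`. -/
def opL {B : Box} (k₂ : ℝ) (V : Hm B 3) (q : ℝ → Hm B 3) (k : ℝ) (x : E3) : ℂ :=
  lap (q k) x
    + 2 * k * ∑ i, Dv k₂ V q (unitIdx i) k x *
        (k * D (unitIdx i) (q k) x + Dv k₂ V q (unitIdx i) k x)
    + 2 * Complex.I * (k * D (unitIdx 2) (q k) x + Dv k₂ V q (unitIdx 2) k x)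

/-- The coefficient `c = 1 + β` that is reconstructed from `q` and `V` at the wavenumber `k`,
where `Δv + k² (∇v)² + 2ik v_z + β = 0`, `v = V - ∫_k^{k₂} q dκ`. -/
def coeff {B : Box} (k₂ : ℝ) (V : Hm B 3) (q : ℝ → Hm B 3) (k : ℝ) (x : E3) : ℂ :=
  1 - ((∑ i, Dv k₂ V q (2 • unitIdx i) k x)
    + k ^ 2 * ∑ i, (Dv k₂ V q (unitIdx i) k x) ^ 2
    + 2 * Complex.I * k * Dv k₂ V q (unitIdx 2) k x)

/-! ### The weighted functionals -/

/-- The Carleman weight function `φ_λ(z) = exp (2λ (z + s)^{-ν})`. -/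
def cwf (s ν lam z : ℝ) : ℝ := Real.exp (2 * lam * (z + s) ^ (-ν))

/-- `t_ν = (s - ξ)^{-ν} - (s + d)^{-ν}`. -/
def tNu (B : Box) (s ν : ℝ) : ℝ := (s - B.ξ) ^ (-ν) - (s + B.d) ^ (-ν)

/-- `ln (δ^{-1/(2 t_ν)})`, the value of both `μ(δ)` and `λ(δ)`. -/
def lamOf (B : Box) (s ν δ : ℝ) : ℝ := Real.log (δ ^ (-1 / (2 * tNu B s ν)))

/-- The functional for the tail function. -/
def tailI (B : Box) (s ν μ α : ℝ) (V : Hm B 3) : ℝ :=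
  Real.exp (-2 * μ * (s + B.d) ^ (-ν)) * ∫ x, ‖lap V x‖ ^ 2 * cwf s ν μ (x 2) ∂B.vol
    + α * ‖V‖ ^ 2

/-- `V` is a minimizer of the tail functional with `α = δ`, `μ = ln (δ^{-1/(2 t_ν)})` among all
functions with boundary data `ψ₀, ψ₁`. -/
def IsTail (B : Box) (s ν δ : ℝ) (ψ₀ ψ₁ : E3 → ℂ) (V : Hm B 3) : Prop :=
  HasBoundaryData V ψ₀ ψ₁ ∧
    IsMinOn (tailI B s ν (lamOf B s ν δ) δ) {W | HasBoundaryData W ψ₀ ψ₁} V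

/-- The weighted Tikhonov-like functional `J_{λ,ρ}`. -/
def J (B : Box) (s ν k₁ k₂ lam ρ : ℝ) (V : Hm B 3) (F : HK B 4 k₁ k₂)
    (p : HK0 B 3 k₁ k₂) : ℝ :=
  Real.exp (-2 * lam * (s + B.d) ^ (-ν)) *
      ∫ k, (∫ x, ‖opL k₂ V (addF p F) k x‖ ^ 2 * cwf s ν lam (x 2) ∂B.vol) ∂kVol k₁ k₂
    + ρ * ‖p‖ ^ 2

/-- `p` minimizes `f` on the set `K`. -/
def IsMinimizer {H : Type*} (f : H → ℝ) (K : Set H) (p : H) : Prop := p ∈ K ∧ IsMinOn f K p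

/-- `y` is the projection of `x` on `K`: a nearest point of `K`. -/
def IsProj {H : Type*} [Dist H] (K : Set H) (x y : H) : Prop :=
  y ∈ K ∧ ∀ w ∈ K, dist x y ≤ dist x w

/-! ### Exact and noisy data -/

/-- `V_*` solves `ΔV_* = 0` in `Ω` with boundary data `ψ₀, ψ₁`. -/
def IsExactTail {B : Box} (ψ₀ ψ₁ : E3 → ℂ) (V : Hm B 3) : Prop :=
  HasBoundaryData V ψ₀ ψ₁ ∧ ∀ᵐ x ∂B.vol, lap V x = 0

/-- `F` satisfies the boundary conditions with data `φ₀, φ₁` for (almost) all `k`. -/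
def HasBoundaryDataK {B : Box} {m : ℕ} {k₁ k₂ : ℝ} (F : HK B m k₁ k₂)
    (φ₀ φ₁ : E3 → ℝ → ℂ) : Prop :=
  ∀ᵐ k ∂kVol k₁ k₂, HasBoundaryData (F k) (φ₀ · k) (φ₁ · k)

/-- `q_* = p_* + F_*` solves `L(q_*) = 0` with the tail `V_*`, and is generated by `c_*`:
`Δv_* + k² (∇v_*)² + 2ik ∂_z v_* + c_* - 1 = 0` in `Ω` for all `k`. -/
def IsExactSolution {B : Box} {k₁ k₂ : ℝ} (V : Hm B 3) (F : HK B 4 k₁ k₂)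
    (p : HK0 B 3 k₁ k₂) (c : E3 → ℂ) : Prop :=
  (∀ᵐ k ∂kVol k₁ k₂, ∀ᵐ x ∂B.vol, opL k₂ V (addF p F) k x = 0) ∧
  ∀ k ∈ Icc k₁ k₂, ∀ᵐ x ∂B.vol, c x = coeff k₂ V (addF p F) k x

end Convexification

end

open MeasureTheory Set Filter Topology
open scoped Gradient

noncomputable section

namespace Convexification

section

/-! ### The box -/

/-! After normalization both functionals carry the weight $e^{2\lambda\psi}$, where
$\psi(z)=(z+s)^{-\nu}-(s+d)^{-\nu}$ is decreasing and convex and $0\le\psi\le t_\nu$ on the box. Let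
$E$ be multiplication by $e^{\lambda\psi}$ and $Q(p)=L(p+F;V)$, a quadratic map of $p$ with bilinear
part $N$. Then $J(p)=\|EQ(p)\|^2+\rho\|p\|^2$ (`J_eq_lsq`), and the remainder of $J$ beyond its
linear part is exactly $\|E(Q'(p)h+N(h,h))\|^2+2(EQ(p),EN(h,h))+\rho\|h\|^2$ (`QuadMap.lsq_add`).

Strict convexity rests on the Carleman estimate $\lambda^3\|Eu\|^2+\lambda\|E\nabla
u\|^2+\lambda^{-1}\|ED^2u\|^2\le C\|E\Delta u\|^2$ for $u\in H^3$ with zero data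
(`CarlemanWeight.carleman`). It comes from integration by parts against a first order multiplier
(`ibp`). Boundary conditions are only known weakly; `WeakDeriv` records them through the supports of
the test functions that are allowed, and density of restricted test functions
(`exists_ofSmooth_near`) extends the identities to Sobolev functions.

In the remainder, $Q'(p)h+N(h,h)$ is $\Delta h$ up to terms bounded by the weighted gradient of $h$,
which the Carleman estimate absorbs for large $\lambda$. The cross term is delicate, since $Q(p)$
contains $\Delta q$, for which $H^3$ regularity gives only $L^6$ in $x$. Hölder's inequality with
exponents 6, 2, 3, interpolation of $L^3$ between $L^2$ and $L^6$, and the weighted embedding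
$H^1\subset L^6$ (`CarlemanWeight.exists_abs_inner_E_gdot_le`) bound it by $\theta\|E\nabla h\|^2$,
times a constant, plus $\theta^{-1}(\lambda\|E\nabla h\|^2+\lambda^{-1}\|ED^2h\|^2)$. A large
$\theta$ and then a large $\lambda$ finish the argument (`convexity_aux`). The integral in $k$ is
harmless, because the weight does not depend on $k$.

For the convergence, $\lambda(\delta)$ is such that $e^{\lambda t_\nu}=\delta^{-1/2}$, so that data
errors $\delta$ have weighted size $\sqrt\delta$. Comparing $V_\delta$ with $V_*+(Q-Q_*)$ and using
the Carleman estimate gives $\|E\nabla(V_\delta-V_*)\|=O(\sqrt\delta)$ (`exists_tail_bounds`). Hence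
$J(p_*)=O(\sqrt\delta)$ (`CarlemanWeight.exists_lsq_exact_le`), and strict convexity between
$p_{\min}$ and $p_*$ together with the variational inequality at $p_{\min}$ gives
$\|p_*-p_{\min}\|_{H_2}^2=O(\lambda\sqrt\delta)$. The coefficient is Lipschitz in the $H^2$ norm of
$v$. The gradient projection step is a contraction towards $p_{\min}$, because the gradient is
Lipschitz on the ball and the term $\rho\|p\|^2$ makes it strongly monotone in $H_3$
(`IsProj.norm_sub_sq_le`). -/

/-- Lower end of the `i`-th side of the box. -/
def Box.lo (B : Box) (i : Fin 3) : ℝ := if i = 2 then -B.ξ else -B.b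

/-- Upper end of the `i`-th side of the box. -/
def Box.hi (B : Box) (i : Fin 3) : ℝ := if i = 2 then B.d else B.b

lemma Box.lo_lt_hi (B : Box) (i : Fin 3) : B.lo i < B.hi i := by
  have := B.b_pos; have := B.d_pos; have := B.ξ_pos
  unfold Box.lo Box.hi; split_ifs <;> linarith

/-- The slab `lo i < x_i < hi i`. -/
def Box.slab (B : Box) (i : Fin 3) : Set E3 := {x | B.lo i < x i ∧ x i < B.hi i}

lemma Box.mem_domain {B : Box} {x : E3} : x ∈ B.domain ↔ ∀ i, x ∈ B.slab i := by
  simp only [Box.domain, Box.slab, Box.lo, Box.hi, mem_ofPred_eq, Fin.forall_fin_succ, abs_lt]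
  simp

lemma Box.isOpen_slab (B : Box) (i : Fin 3) : IsOpen (B.slab i) :=
  (isOpen_lt (f := fun _ => B.lo i) (g := fun x : E3 => x i) continuous_const (by fun_prop)).inter
    (isOpen_lt (f := fun x : E3 => x i) (g := fun _ => B.hi i) (by fun_prop) continuous_const)

lemma Box.domain_eq_iInter (B : Box) : B.domain = ⋂ i, B.slab i := by
  ext x; simp [Box.mem_domain]

lemma Box.isOpen_domain (B : Box) : IsOpen B.domain := by
  rw [B.domain_eq_iInter]; exact isOpen_iInter_of_finite B.isOpen_slab

lemma Box.measurableSet_domain (B : Box) : MeasurableSet B.domain := B.isOpen_domain.measurableSet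

/-- A radius that bounds the box. -/
def Box.rad (B : Box) : ℝ := 2 * (B.b + B.d + B.ξ)

lemma Box.rad_pos (B : Box) : 0 < B.rad := by
  have := B.b_pos; have := B.d_pos; have := B.ξ_pos
  unfold Box.rad; linarith

lemma Box.norm_le_rad {B : Box} {x : E3} (hx : x ∈ B.domain) : ‖x‖ ≤ B.rad := by
  have := B.b_pos; have := B.d_pos; have := B.ξ_pos
  obtain ⟨h0, h1, h2, h3⟩ := hx
  rw [EuclideanSpace.norm_eq, Fin.sum_univ_three]
  refine Real.sqrt_le_iff.2 ⟨B.rad_pos.le, ?_⟩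
  have e0 : ‖x 0‖ ^ 2 ≤ B.b ^ 2 := by
    rw [Real.norm_eq_abs]; exact pow_le_pow_left₀ (abs_nonneg _) h0.le 2
  have e1 : ‖x 1‖ ^ 2 ≤ B.b ^ 2 := by
    rw [Real.norm_eq_abs]; exact pow_le_pow_left₀ (abs_nonneg _) h1.le 2
  have e2 : ‖x 2‖ ^ 2 ≤ (B.d + B.ξ) ^ 2 := by
    rw [Real.norm_eq_abs]
    exact pow_le_pow_left₀ (abs_nonneg _) (abs_le.2 ⟨by linarith, by linarith⟩) 2
  have : (0:ℝ) ≤ B.b * (B.d + B.ξ) := by positivity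
  unfold Box.rad
  nlinarith

lemma Box.domain_subset_closedBall (B : Box) : B.domain ⊆ Metric.closedBall 0 B.rad := fun x hx => by
  simpa using Box.norm_le_rad hx

instance (B : Box) : IsFiniteMeasure B.vol := by
  refine ⟨?_⟩
  rw [Box.vol, Measure.restrict_apply_univ]
  exact (measure_mono B.domain_subset_closedBall).trans_lt measure_closedBall_lt_top

lemma Box.ae_vol {B : Box} {p : E3 → Prop} (h : ∀ x ∈ B.domain, p x) : ∀ᵐ x ∂B.vol, p x :=
  (ae_restrict_mem B.measurableSet_domain).mono h

lemma exists_bound_of_continuous (B : Box) {E : Type*} [NormedAddCommGroup E] {g : E3 → E}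
    (hg : Continuous g) : ∃ C, 0 ≤ C ∧ ∀ x ∈ B.domain, ‖g x‖ ≤ C := by
  obtain ⟨C, hC⟩ := (isCompact_closedBall (0 : E3) B.rad).exists_bound_of_continuousOn
    hg.continuousOn
  exact ⟨max C 0, le_max_right _ _,
    fun x hx => (hC x (B.domain_subset_closedBall hx)).trans (le_max_left _ _)⟩

lemma memLp_of_continuous (B : Box) {E : Type*} [NormedAddCommGroup E] {g : E3 → E}
    (hg : Continuous g) (p : ENNReal) : MemLp g p B.vol := by
  obtain ⟨C, -, hC⟩ := exists_bound_of_continuous B hg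
  exact MemLp.of_bound hg.aestronglyMeasurable C (Box.ae_vol hC)

/-! ### Multiplication operators and pairings -/

/-- Multiplication by an essentially bounded function (zero if `g` is not one). -/
def mulC (B : Box) (g : E3 → ℂ) : L2 B →L[ℝ] L2 B :=
  open Classical in
  if h : MemLp g ⊤ B.vol then (ContinuousLinearMap.mul ℝ ℂ).holderL B.vol ⊤ 2 2 (h.toLp g) else 0

lemma coeFn_mulC {B : Box} {g : E3 → ℂ} (h : MemLp g ⊤ B.vol) (f : L2 B) :
    mulC B g f =ᵐ[B.vol] fun x => g x * f x := by
  rw [mulC, dif_pos h, ContinuousLinearMap.holderL_apply_apply]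
  filter_upwards [ContinuousLinearMap.coeFn_holder (ContinuousLinearMap.mul ℝ ℂ) (r := 2)
    (h.toLp g) f, h.coeFn_toLp] with x hx hx'
  rw [hx, hx', ContinuousLinearMap.mul_apply']

/-- Multiplication by a continuous real function (zero if `g` is not continuous). -/
def mulL (B : Box) (g : E3 → ℝ) : L2 B →L[ℝ] L2 B := mulC B (fun x => (g x : ℂ))

lemma coeFn_mulL {B : Box} {g : E3 → ℝ} (h : Continuous g) (f : L2 B) :
    mulL B g f =ᵐ[B.vol] fun x => (g x : ℂ) * f x :=
  coeFn_mulC (memLp_of_continuous B (by fun_prop) ⊤) f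

/-- The real `L²` product with weight `g`. -/
def wip {B : Box} (g : E3 → ℝ) (f h : L2 B) : ℝ := inner ℝ f (mulL B g h)

lemma inner_eq_integral {B : Box} (f h : L2 B) :
    inner ℝ f h = ∫ x, ((starRingEnd ℂ) (f x) * h x).re ∂B.vol := by
  rw [L2.inner_def]
  refine integral_congr_ae (Filter.Eventually.of_forall fun x => ?_)
  show inner ℝ (f x) (h x) = _
  rw [Complex.inner, mul_comm]

lemma integrable_inner_re {B : Box} (f h : L2 B) :
    Integrable (fun x => ((starRingEnd ℂ) (f x) * h x).re) B.vol := by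
  have := L2.integrable_inner (𝕜 := ℝ) f h
  refine this.congr (Filter.Eventually.of_forall fun x => ?_)
  show inner ℝ (f x) (h x) = _
  rw [Complex.inner, mul_comm]

lemma wip_eq_integral {B : Box} {g : E3 → ℝ} (hg : Continuous g) (f h : L2 B) :
    wip g f h = ∫ x, g x * ((starRingEnd ℂ) (f x) * h x).re ∂B.vol := by
  rw [wip, inner_eq_integral]
  refine integral_congr_ae ?_
  filter_upwards [coeFn_mulL hg h] with x hx
  rw [hx]
  simp; ring

lemma integrable_wip {B : Box} {g : E3 → ℝ} (hg : Continuous g) (f h : L2 B) :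
    Integrable (fun x => g x * ((starRingEnd ℂ) (f x) * h x).re) B.vol := by
  refine (integrable_inner_re f (mulL B g h)).congr ?_
  filter_upwards [coeFn_mulL hg h] with x hx
  rw [hx]
  simp; ring

lemma wip_comm {B : Box} {g : E3 → ℝ} (hg : Continuous g) (f h : L2 B) :
    wip g f h = wip g h f := by
  rw [wip_eq_integral hg, wip_eq_integral hg]
  congr 1; ext x; congr 1; simp; ring

lemma mulL_mulL {B : Box} {g g' : E3 → ℝ} (hg : Continuous g) (hg' : Continuous g') (f : L2 B) :
    mulL B g (mulL B g' f) = mulL B (fun x => g x * g' x) f := by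
  refine Lp.ext ?_
  filter_upwards [coeFn_mulL hg (mulL B g' f), coeFn_mulL hg' f,
    coeFn_mulL (g := fun x => g x * g' x) (hg.mul hg') f] with x h1 h2 h3
  rw [h1, h2, h3]; push_cast; ring

lemma mulL_add_weight {B : Box} {g g' : E3 → ℝ} (hg : Continuous g) (hg' : Continuous g')
    (f : L2 B) : mulL B (fun x => g x + g' x) f = mulL B g f + mulL B g' f := by
  refine Lp.ext ?_
  filter_upwards [coeFn_mulL hg f, coeFn_mulL hg' f, coeFn_mulL (g := fun x => g x + g' x) (hg.add hg') f,
    Lp.coeFn_add (mulL B g f) (mulL B g' f)] with x h1 h2 h3 h4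
  rw [h3, h4, Pi.add_apply, h1, h2]; push_cast; ring

lemma mulL_one {B : Box} (f : L2 B) : mulL B (fun _ => 1) f = f := by
  refine Lp.ext ?_
  filter_upwards [coeFn_mulL (B := B) (g := fun _ => 1) continuous_const f] with x h1
  rw [h1]; simp

lemma inner_mulL {B : Box} {g : E3 → ℝ} (hg : Continuous g) (f h : L2 B) :
    inner ℝ (mulL B g f) h = wip g f h := by
  rw [wip_comm hg, wip, real_inner_comm]

/-- A continuous function times a constant, as an element of `L²`. -/
def tst (B : Box) (φ : E3 → ℝ) (c : ℂ) : L2 B :=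
  open Classical in
  if h : Continuous φ then
    (memLp_of_continuous B (g := fun x => (φ x : ℂ) * c) (by fun_prop) 2).toLp _ else 0

lemma coeFn_tst {B : Box} {φ : E3 → ℝ} (h : Continuous φ) (c : ℂ) :
    tst B φ c =ᵐ[B.vol] fun x => (φ x : ℂ) * c := by
  rw [tst, dif_pos h]; exact MemLp.coeFn_toLp _

lemma integrable_pair {B : Box} {φ : E3 → ℝ} (h : Continuous φ) (u : L2 B) :
    Integrable (fun x => (φ x : ℂ) * u x) B.vol := by
  have h1 : MemLp (fun x => (φ x : ℂ)) 2 B.vol := memLp_of_continuous B (by fun_prop) 2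
  exact h1.integrable_mul (Lp.memLp u)

lemma inner_tst {B : Box} {φ : E3 → ℝ} (h : Continuous φ) (c : ℂ) (u : L2 B) :
    inner ℝ (tst B φ c) u = ((starRingEnd ℂ) c * pair φ u).re := by
  rw [inner_eq_integral, pair, ← integral_const_mul]
  have : Integrable (fun x => (starRingEnd ℂ) c * ((φ x : ℂ) * u x)) B.vol :=
    (integrable_pair h u).const_mul _
  rw [← RCLike.re_eq_complex_re, ← integral_re this]
  refine integral_congr_ae ?_
  filter_upwards [coeFn_tst (B := B) h c] with x hx
  rw [hx]
  simp; ring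

/-! ### Classical partial derivatives of smooth functions -/

/-- Infinitely differentiable real functions. -/
abbrev Smooth (φ : E3 → ℝ) : Prop := ContDiff ℝ (⊤ : ℕ∞) φ

lemma Smooth.differentiableAt {φ : E3 → ℝ} (h : Smooth φ) (x : E3) : DifferentiableAt ℝ φ x :=
  h.differentiable (by simp) x

lemma Smooth.pd {φ : E3 → ℝ} (h : Smooth φ) (i : Fin 3) : Smooth (pd i φ) :=
  (h.fderiv_right (m := (⊤ : ℕ∞)) (by simp)).clm_apply contDiff_const

lemma IsTest.smooth {φ : E3 → ℝ} (h : IsTest φ) : Smooth φ := h.1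

lemma IsTest.continuous {φ : E3 → ℝ} (h : IsTest φ) : Continuous φ := h.1.continuous

lemma IsTest.mul_left {w φ : E3 → ℝ} (hφ : IsTest φ) (hw : Smooth w) :
    IsTest (fun x => w x * φ x) := ⟨hw.mul hφ.1, hφ.2.mul_left⟩

lemma pd_mul {w φ : E3 → ℝ} (hw : Smooth w) (hφ : Smooth φ) (i : Fin 3) :
    pd i (fun x => w x * φ x) = fun x => w x * pd i φ x + pd i w x * φ x := by
  ext x
  simp only [pd]
  rw [fderiv_fun_mul (hw.differentiableAt x) (hφ.differentiableAt x)]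
  simp; ring

lemma pd_comm {φ : E3 → ℝ} (h : Smooth φ) (i j : Fin 3) : pd i (pd j φ) = pd j (pd i φ) := by
  have key : ∀ (a b : E3) (x : E3), fderiv ℝ (fun y => fderiv ℝ φ y a) x b =
      fderiv ℝ (fderiv ℝ φ) x b a := by
    intro a b x
    have hd : DifferentiableAt ℝ (fderiv ℝ φ) x :=
      (h.fderiv_right (m := (⊤ : ℕ∞)) (by simp)).differentiable (by simp) x
    rw [fderiv_clm_apply hd (differentiableAt_const a)]
    simp
  ext x
  unfold Convexification.pd
  rw [key, key]
  have hs : IsSymmSndFDerivAt ℝ φ x := by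
    apply ContDiffAt.isSymmSndFDerivAt (n := (⊤ : ℕ∞)) h.contDiffAt
    rw [minSmoothness_of_isRCLikeNormedField]
    exact WithTop.coe_le_coe.2 (le_top : (2 : ℕ∞) ≤ ⊤)
  exact hs _ _

lemma pd_coord {ω : ℝ → ℝ} (hω : Differentiable ℝ ω) (i j : Fin 3) :
    pd i (fun x : E3 => ω (x j)) = fun x => if i = j then deriv ω (x j) else 0 := by
  ext x
  have h1 : HasFDerivAt (fun x : E3 => x j) (EuclideanSpace.proj j : E3 →L[ℝ] ℝ) x :=
    (EuclideanSpace.proj j : E3 →L[ℝ] ℝ).hasFDerivAt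
  have := ((hω (x j)).hasDerivAt.comp_hasFDerivAt x h1).fderiv
  unfold Convexification.pd
  simp only [Function.comp_def] at this
  rw [this]
  by_cases hij : i = j
  · subst hij; simp
  · simp [hij, Ne.symm hij]

lemma smooth_coord {ω : ℝ → ℝ} (hω : ContDiff ℝ (⊤ : ℕ∞) ω) (j : Fin 3) :
    Smooth (fun x : E3 => ω (x j)) :=
  hω.comp (EuclideanSpace.proj j : E3 →L[ℝ] ℝ).contDiff

lemma tsupport_pd_subset (i : Fin 3) (φ : E3 → ℝ) : tsupport (pd i φ) ⊆ tsupport φ :=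
  tsupport_fderiv_apply_subset ℝ _

lemma Smooth.pdMulti {φ : E3 → ℝ} (h : Smooth φ) (α : Fin 3 → ℕ) : Smooth (pdMulti α φ) := by
  have it : ∀ (i : Fin 3) (n : ℕ) {φ : E3 → ℝ}, Smooth φ →
      Smooth ((Convexification.pd i)^[n] φ) := by
    intro i n
    induction n with
    | zero => exact fun h => h
    | succ n ih => intro φ h; rw [Function.iterate_succ_apply]; exact ih (h.pd i)
  exact it 0 _ (it 1 _ (it 2 _ h))

lemma pd_iterate_comm {φ : E3 → ℝ} (h : Smooth φ) (i j : Fin 3) (n : ℕ) :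
    pd i ((pd j)^[n] φ) = (pd j)^[n] (pd i φ) := by
  induction n generalizing φ with
  | zero => rfl
  | succ n ih => rw [Function.iterate_succ_apply, ih (h.pd j), Function.iterate_succ_apply,
      pd_comm h]

lemma pdMulti_zero (φ : E3 → ℝ) : pdMulti 0 φ = φ := rfl

lemma smooth_iterate {φ : E3 → ℝ} (h : Smooth φ) (j : Fin 3) (n : ℕ) :
    Smooth ((pd j)^[n] φ) := by
  induction n generalizing φ with
  | zero => exact h
  | succ n ih => rw [Function.iterate_succ_apply]; exact ih (h.pd j)

lemma pdMulti_pd {φ : E3 → ℝ} (h : Smooth φ) (α : Fin 3 → ℕ) (i : Fin 3) :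
    pdMulti α (pd i φ) = pd i (pdMulti α φ) := by
  unfold pdMulti
  rw [pd_iterate_comm (smooth_iterate (smooth_iterate h 2 _) 1 _),
    pd_iterate_comm (smooth_iterate h 2 _), pd_iterate_comm h]

/-- `pdMulti` differentiates in the fixed order $z,y,x$, so the additional derivative has to be
commuted past the others. -/
lemma pdMulti_add_unitIdx {φ : E3 → ℝ} (h : Smooth φ) (α : Fin 3 → ℕ) (i : Fin 3) :
    pdMulti (α + unitIdx i) φ = pdMulti α (pd i φ) := by
  unfold pdMulti unitIdx
  fin_cases i
  · simp only [Pi.add_apply]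
    simp [Function.iterate_succ_apply]
    rw [pd_iterate_comm (smooth_iterate h 2 _), pd_iterate_comm h]
  · simp only [Pi.add_apply]
    simp [Function.iterate_succ_apply]
    rw [pd_iterate_comm h]
  · simp only [Pi.add_apply]
    simp [Function.iterate_succ_apply]

/-- Every multi-index is reached from zero by unit steps, so identities for $D^\alpha$ can be proved
one derivative at a time. -/
lemma multiIdx_induction {p : (Fin 3 → ℕ) → Prop} (h0 : p 0)
    (h1 : ∀ α i, p α → p (α + unitIdx i)) (α : Fin 3 → ℕ) : p α := by
  induction hn : ∑ i, α i generalizing α with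
  | zero =>
    have : α = 0 := by
      ext i
      have := Finset.single_le_sum (f := α) (fun _ _ => Nat.zero_le _) (Finset.mem_univ i)
      simp only [Pi.zero_apply]; omega
    rw [this]; exact h0
  | succ n ih =>
    obtain ⟨i, hi⟩ : ∃ i, 0 < α i := by
      by_contra! hc
      have : ∑ i, α i = 0 := Finset.sum_eq_zero fun i _ => by have := hc i; omega
      omega
    have hle : unitIdx i ≤ α := by
      intro j
      unfold unitIdx
      by_cases hj : j = i
      · subst hj; simp; omega
      · simp [hj]
    have e : α - unitIdx i + unitIdx i = α := by
      ext j; have h : unitIdx i j ≤ α j := hle j; simp only [Pi.add_apply, Pi.sub_apply]; omega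
    rw [← e]
    refine h1 _ _ (ih _ ?_)
    have hs : ∑ j, (α - unitIdx i + unitIdx i) j = n + 1 := by rw [e]; exact hn
    simp only [Pi.add_apply, Finset.sum_add_distrib] at hs
    have : ∑ j, unitIdx i j = 1 := by unfold unitIdx; simp
    omega

lemma sum_unitIdx (i : Fin 3) : ∑ j, unitIdx i j = 1 := by unfold unitIdx; simp

lemma pdMulti_add {φ : E3 → ℝ} (h : Smooth φ) (α β : Fin 3 → ℕ) :
    pdMulti (α + β) φ = pdMulti α (pdMulti β φ) := by
  induction β using multiIdx_induction generalizing φ with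
  | h0 => rfl
  | h1 β i ih =>
    rw [← add_assoc, pdMulti_add_unitIdx h, ih (h.pd i), pdMulti_add_unitIdx h]

lemma pdMulti_unitIdx {φ : E3 → ℝ} (h : Smooth φ) (i : Fin 3) : pdMulti (unitIdx i) φ = pd i φ := by
  have := pdMulti_add_unitIdx h 0 i
  rwa [zero_add] at this

lemma tsupport_pdMulti_subset (α : Fin 3 → ℕ) (φ : E3 → ℝ) :
    tsupport (pdMulti α φ) ⊆ tsupport φ := by
  have it : ∀ (i : Fin 3) (n : ℕ) (φ : E3 → ℝ), tsupport ((pd i)^[n] φ) ⊆ tsupport φ := by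
    intro i n
    induction n with
    | zero => exact fun _ => subset_rfl
    | succ n ih =>
      intro φ; rw [Function.iterate_succ_apply]
      exact (ih _).trans (tsupport_pd_subset i φ)
  exact (it 0 _ _).trans ((it 1 _ _).trans (it 2 _ _))

end

section

/-! ### Weak partial derivatives with prescribed supports of the test functions -/

/-- `f'` is the weak derivative of `f` in direction `i`, tested with functions that are supported
in `S`; these need not vanish near the boundary of the box. -/
def WeakDeriv {B : Box} (i : Fin 3) (S : Set E3) (f f' : L2 B) : Prop :=
  ∀ φ, IsTest φ → tsupport φ ⊆ S → pair (pd i φ) f + pair φ f' = 0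

lemma WeakDeriv.mono {B : Box} {i : Fin 3} {S T : Set E3} {f f' : L2 B} (h : WeakDeriv i T f f')
    (hST : S ⊆ T) : WeakDeriv i S f f' := fun φ hφ hs => h φ hφ (hs.trans hST)

-- Dominated convergence. This is how cutoffs are removed: they are bounded by 1 and tend to 1
-- inside the box, and nothing is asked of them on its boundary.
open Filter Topology in
lemma tendsto_pair {B : Box} {φ : E3 → ℝ} (hφ : Continuous φ) {θ : ℕ → E3 → ℝ}
    (hθ : ∀ n, Continuous (θ n)) (h1 : ∀ n x, |θ n x| ≤ 1)
    (hlim : ∀ x ∈ B.domain, Tendsto (fun n => θ n x) atTop (𝓝 1)) (u : L2 B) :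
    Tendsto (fun n => pair (fun x => θ n x * φ x) u) atTop (𝓝 (pair φ u)) := by
  refine tendsto_integral_of_dominated_convergence (fun x => ‖(φ x : ℂ) * u x‖) (fun n => ?_)
    (integrable_pair hφ u).norm (fun n => ?_) ?_
  · exact (integrable_pair ((hθ n).mul hφ) u).aestronglyMeasurable
  · refine Eventually.of_forall fun x => ?_
    simp only [Complex.ofReal_mul, norm_mul, Complex.norm_real, Real.norm_eq_abs]
    rw [mul_assoc]
    exact mul_le_of_le_one_left (by positivity) (h1 n x)
  · refine Box.ae_vol fun x hx => ?_
    have h2 : Tendsto (fun n => ((θ n x : ℝ) : ℂ) * ((φ x : ℂ) * u x)) atTop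
        (𝓝 (((1 : ℝ) : ℂ) * ((φ x : ℂ) * u x))) :=
      (((Complex.continuous_ofReal.tendsto _).comp (hlim x hx))).mul_const _
    simpa [mul_assoc] using h2

open Filter Topology in
lemma tendsto_wip {B : Box} {g : E3 → ℝ} (hg : Continuous g) {θ : ℕ → E3 → ℝ}
    (hθ : ∀ n, Continuous (θ n)) (h1 : ∀ n x, |θ n x| ≤ 1)
    (hlim : ∀ x ∈ B.domain, Tendsto (fun n => θ n x) atTop (𝓝 1)) (f h : L2 B) :
    Tendsto (fun n => wip (fun x => θ n x * g x) f h) atTop (𝓝 (wip g f h)) := by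
  have e : ∀ n, wip (fun x => θ n x * g x) f h =
      ∫ x, θ n x * g x * ((starRingEnd ℂ) (f x) * h x).re ∂B.vol := fun n =>
    wip_eq_integral ((hθ n).mul hg) f h
  simp only [e, wip_eq_integral hg]
  refine tendsto_integral_of_dominated_convergence
    (fun x => ‖g x * ((starRingEnd ℂ) (f x) * h x).re‖) (fun n => ?_)
    (integrable_wip hg f h).norm (fun n => ?_) ?_
  · exact (integrable_wip ((hθ n).mul hg) f h).aestronglyMeasurable
  · refine Eventually.of_forall fun x => ?_
    rw [mul_assoc, norm_mul (θ n x), Real.norm_eq_abs (θ n x)]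
    exact mul_le_of_le_one_left (by positivity) (h1 n x)
  · refine Box.ae_vol fun x hx => ?_
    have h2 := (hlim x hx).mul_const (g x * ((starRingEnd ℂ) (f x) * h x).re)
    simpa [mul_assoc] using h2

/-- Smooth cutoffs that vanish for `t ≥ c - 1/n`. -/
def cutHi (c : ℝ) (n : ℕ) (t : ℝ) : ℝ := Real.smoothTransition (n * (c - t) - 1)

/-- Smooth cutoffs that vanish for `t ≤ c + 1/n`. -/
def cutLo (c : ℝ) (n : ℕ) (t : ℝ) : ℝ := Real.smoothTransition (n * (t - c) - 1)

lemma cutHi_contDiff (c : ℝ) (n : ℕ) : ContDiff ℝ (⊤ : ℕ∞) (cutHi c n) :=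
  Real.smoothTransition.contDiff.comp (by fun_prop)

lemma cutLo_contDiff (c : ℝ) (n : ℕ) : ContDiff ℝ (⊤ : ℕ∞) (cutLo c n) :=
  Real.smoothTransition.contDiff.comp (by fun_prop)

lemma cutHi_nonneg (c : ℝ) (n : ℕ) (t : ℝ) : 0 ≤ cutHi c n t := Real.smoothTransition.nonneg _
lemma cutLo_nonneg (c : ℝ) (n : ℕ) (t : ℝ) : 0 ≤ cutLo c n t := Real.smoothTransition.nonneg _
lemma cutHi_le_one (c : ℝ) (n : ℕ) (t : ℝ) : cutHi c n t ≤ 1 := Real.smoothTransition.le_one _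
lemma cutLo_le_one (c : ℝ) (n : ℕ) (t : ℝ) : cutLo c n t ≤ 1 := Real.smoothTransition.le_one _

lemma cutHi_antitone (c : ℝ) (n : ℕ) : Antitone (cutHi c n) := fun x y h =>
  Real.smoothTransition.monotone (by gcongr)

open Filter Topology in
lemma tendsto_cutHi {c t : ℝ} (h : t < c) : Tendsto (fun n => cutHi c n t) atTop (𝓝 1) := by
  refine tendsto_const_nhds.congr' ?_
  filter_upwards [eventually_ge_atTop ⌈2 / (c - t)⌉₊] with n hn
  have h1 : 2 / (c - t) ≤ n := (Nat.le_ceil _).trans (by exact_mod_cast hn)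
  rw [div_le_iff₀ (by linarith)] at h1
  exact (Real.smoothTransition.one_of_one_le (by linarith)).symm

open Filter Topology in
lemma tendsto_cutLo {c t : ℝ} (h : c < t) : Tendsto (fun n => cutLo c n t) atTop (𝓝 1) := by
  have := tendsto_cutHi (neg_lt_neg h)
  simpa [cutHi, cutLo, add_comm, sub_eq_add_neg] using this

lemma tsupport_cutHi (c : ℝ) (n : ℕ) (j : Fin 3) :
    tsupport (fun x : E3 => cutHi c n (x j)) ⊆ {x | x j < c} := by
  -- For $n=0$ the cutoff vanishes identically, and the bound $c-1/n$ is meaningless.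
  rcases Nat.eq_zero_or_pos n with rfl | hn
  · have : (fun x : E3 => cutHi c 0 (x j)) = 0 := by
      ext x; simp [cutHi, Real.smoothTransition.zero_of_nonpos]
    rw [this]; simp
  have hn' : (0 : ℝ) < n := by exact_mod_cast hn
  refine (closure_minimal (t := {x : E3 | x j ≤ c - 1 / n}) ?_ ?_).trans ?_
  · intro x hx
    by_contra hc
    refine hx (Real.smoothTransition.zero_of_nonpos ?_)
    simp only [mem_ofPred_eq, not_le] at hc
    have : n * (c - x j) < n * (1 / n) := by gcongr; linarith
    rw [mul_one_div_cancel hn'.ne'] at this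
    linarith
  · exact isClosed_le (by fun_prop) continuous_const
  · intro x hx
    have : 0 < 1 / (n : ℝ) := by positivity
    simp only [mem_ofPred_eq] at *
    linarith

lemma tsupport_cutLo (c : ℝ) (n : ℕ) (j : Fin 3) :
    tsupport (fun x : E3 => cutLo c n (x j)) ⊆ {x | c < x j} := by
  rcases Nat.eq_zero_or_pos n with rfl | hn
  · have : (fun x : E3 => cutLo c 0 (x j)) = 0 := by
      ext x; simp [cutLo, Real.smoothTransition.zero_of_nonpos]
    rw [this]; simp
  have hn' : (0 : ℝ) < n := by exact_mod_cast hn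
  refine (closure_minimal (t := {x : E3 | c + 1 / n ≤ x j}) ?_ ?_).trans ?_
  · intro x hx
    by_contra hc
    refine hx (Real.smoothTransition.zero_of_nonpos ?_)
    simp only [mem_ofPred_eq, not_le] at hc
    have : n * (x j - c) < n * (1 / n) := by gcongr; linarith
    rw [mul_one_div_cancel hn'.ne'] at this
    linarith
  · exact isClosed_le continuous_const (by fun_prop)
  · intro x hx
    have : 0 < 1 / (n : ℝ) := by positivity
    simp only [mem_ofPred_eq] at *
    linarith

open Filter Topology in
/-- Restrictions on the supports in directions transversal to the derivative are immaterial. -/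
lemma WeakDeriv.of_inter_slab {B : Box} {i j : Fin 3} (hij : i ≠ j) {S : Set E3} {f f' : L2 B}
    (h : WeakDeriv i (S ∩ B.slab j) f f') : WeakDeriv i S f f' := by
  intro φ hφ hs
  set ω : ℕ → ℝ → ℝ := fun n t => cutLo (B.lo j) n t * cutHi (B.hi j) n t with hω
  have hsm : ∀ n, ContDiff ℝ (⊤ : ℕ∞) (ω n) := fun n =>
    (cutLo_contDiff _ n).mul (cutHi_contDiff _ n)
  have hθ : ∀ n, Smooth (fun x : E3 => ω n (x j)) := fun n => smooth_coord (hsm n) j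
  have hb : ∀ n (x : E3), |ω n (x j)| ≤ 1 := fun n x => by
    rw [abs_of_nonneg (mul_nonneg (cutLo_nonneg _ _ _) (cutHi_nonneg _ _ _))]
    exact mul_le_one₀ (cutLo_le_one _ _ _) (cutHi_nonneg _ _ _) (cutHi_le_one _ _ _)
  have hlim : ∀ x ∈ B.domain, Tendsto (fun n => ω n (x j)) atTop (𝓝 1) := fun x hx => by
    have hx := Box.mem_domain.1 hx j
    simpa using (tendsto_cutLo hx.1).mul (tendsto_cutHi hx.2)
  -- The cutoff depends on $x_j$ alone with $j\ne i$, so $\partial_i$ does not see it and no error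
  -- term appears.
  have key : ∀ n, pair (fun x => ω n (x j) * pd i φ x) f +
      pair (fun x => ω n (x j) * φ x) f' = 0 := fun n => by
    have := h _ (hφ.mul_left (hθ n)) ?_
    · rw [pd_mul (hθ n) hφ.1, pd_coord ((hsm n).differentiable (by simp)) i j] at this
      simpa [hij] using this
    · refine subset_inter ((tsupport_mul_subset_right).trans hs) ?_
      refine tsupport_mul_subset_left.trans ?_
      refine subset_inter (tsupport_mul_subset_left.trans (tsupport_cutLo _ n j))
        (tsupport_mul_subset_right.trans (tsupport_cutHi _ n j))
  have l1 := tendsto_pair (hφ.pd i).continuous (fun n => (hθ n).continuous) hb hlim f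
  have l2 := tendsto_pair hφ.continuous (fun n => (hθ n).continuous) hb hlim f'
  have l3 := l1.add l2
  simp only [key] at l3
  exact (tendsto_nhds_unique l3 tendsto_const_nhds)

lemma neg_one_pow_cancel {n : ℕ} {a b : ℂ} (h : (-1 : ℂ) ^ n * a = (-1) ^ (n + 1) * b) :
    a + b = 0 := by
  have h0 : ((-1 : ℂ)) ^ n ≠ 0 := by simp
  have : (-1 : ℂ) ^ n * (a + b) = 0 := by rw [mul_add, h, pow_succ]; ring
  exact (mul_eq_zero.1 this).resolve_left h0

lemma pair_pdMulti {B : Box} {m : ℕ} (u : Hm B m) {α : Fin 3 → ℕ} (hα : α ∈ multiIdx m)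
    {φ : E3 → ℝ} (hφ : IsTest φ) (hs : tsupport φ ⊆ B.domain) :
    pair (pdMulti α φ) (D 0 u) = (-1) ^ (∑ i, α i) * pair φ (D α u) := u.2 α hα φ hφ hs

lemma weakDeriv_domain {B : Box} {m : ℕ} (u : Hm B m) {α : Fin 3 → ℕ} {i : Fin 3}
    (h : α + unitIdx i ∈ multiIdx m) :
    WeakDeriv i B.domain (D α u) (D (α + unitIdx i) u) := by
  intro φ hφ hs
  have hsum : ∑ j, (α + unitIdx i) j = (∑ j, α j) + 1 := by
    simp only [Pi.add_apply, Finset.sum_add_distrib, sum_unitIdx]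
  have hα : α ∈ multiIdx m := by
    rw [mem_multiIdx] at *; omega
  have h1 := pair_pdMulti u hα (hφ.pd i) ((tsupport_pd_subset i φ).trans hs)
  have h2 := pair_pdMulti u h hφ hs
  rw [pdMulti_add_unitIdx hφ.1, h1, hsum] at h2
  exact neg_one_pow_cancel h2

/-- The definition of weak derivatives needs test functions that vanish near all six faces. Two uses
of `WeakDeriv.of_inter_slab` dispose of the four faces parallel to the direction of differentiation.
-/
lemma weakDeriv_slab {B : Box} {m : ℕ} (u : Hm B m) {α : Fin 3 → ℕ} {i : Fin 3}
    (h : α + unitIdx i ∈ multiIdx m) :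
    WeakDeriv i (B.slab i) (D α u) (D (α + unitIdx i) u) := by
  have hd := weakDeriv_domain u h
  have hsub : ∀ j k : Fin 3, i ≠ j → i ≠ k → j ≠ k → B.slab i ∩ B.slab j ∩ B.slab k ⊆ B.domain := by
    intro j k hij hik hjk x hx
    rw [Box.mem_domain]
    intro l
    have : l = i ∨ l = j ∨ l = k := by omega
    rcases this with rfl | rfl | rfl
    · exact hx.1.1
    · exact hx.1.2
    · exact hx.2
  obtain ⟨j, k, hij, hik, hjk⟩ : ∃ j k : Fin 3, i ≠ j ∧ i ≠ k ∧ j ≠ k := by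
    clear hd hsub h; revert i; decide
  exact ((hd.mono (hsub j k hij hik hjk)).of_inter_slab hik).of_inter_slab hij

/-- Tangential derivatives inherit vanishing boundary values. -/
lemma WeakDeriv.tangential {B : Box} {i j : Fin 3} (hij : i ≠ j) {f fi fj fij : L2 B}
    (h : WeakDeriv j univ f fj) (hi : WeakDeriv i (B.slab i) f fi)
    (hji : WeakDeriv i (B.slab i) fj fij) : WeakDeriv j univ fi fij := by
  -- A test function supported in the slab of direction $i$ may take over the derivative
  -- $\partial_i$ without boundary terms; the boundary condition of $f$ is then tested with
  -- $\partial_i\varphi$.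
  refine WeakDeriv.of_inter_slab hij.symm (S := univ) (B := B) (j := i) ?_
  intro φ hφ hs
  have hs : tsupport φ ⊆ B.slab i := hs.trans inter_subset_right
  have h1 := hji φ hφ hs
  have h2 := h (pd i φ) (hφ.pd i) (subset_univ _)
  have h3 := hi (pd j φ) (hφ.pd j) ((tsupport_pd_subset j φ).trans hs)
  rw [pd_comm hφ.1 j i] at h2
  linear_combination h1 + h3 - h2

/-- Boundary conditions of `u ∈ H₀^m`. -/
lemma weakDeriv_zeroData {B : Box} {m : ℕ} {u : Hm B m} (hu : u ∈ zeroData B m) (i : Fin 3) :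
    WeakDeriv i univ (D 0 u) (D (unitIdx i) u) := fun φ hφ _ =>
  ((hasBoundaryData_zero_iff u).1 hu).1 φ hφ i

/-- Only $u=0$ on $\partial\Omega$ enters. When $\alpha_j=0$, the operator $D^\alpha$ is tangential
to the two faces orthogonal to $e_j$, so $D^\alpha u$ vanishes there and test functions need not. -/
lemma weakDeriv_zeroData_tangential {B : Box} {m : ℕ} {u : Hm B m} (hu : u ∈ zeroData B m)
    (j : Fin 3) (α : Fin 3 → ℕ) (hα : α j = 0) (hm : α + unitIdx j ∈ multiIdx m) :
    WeakDeriv j univ (D α u) (D (α + unitIdx j) u) := by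
  induction α using multiIdx_induction with
  | h0 => rw [zero_add]; exact weakDeriv_zeroData hu j
  | h1 α i ih =>
    have hij : i ≠ j := by
      rintro rfl
      simp [unitIdx] at hα
    have hsum : ∀ (β : Fin 3 → ℕ) l, ∑ k, (β + unitIdx l) k = (∑ k, β k) + 1 := fun β l => by
      simp only [Pi.add_apply, Finset.sum_add_distrib, sum_unitIdx]
    have e : α + unitIdx i + unitIdx j = α + unitIdx j + unitIdx i := by
      rw [add_assoc, add_comm (unitIdx i), ← add_assoc]
    rw [mem_multiIdx, hsum, hsum] at hm
    have h1 : α + unitIdx j ∈ multiIdx m := by rw [mem_multiIdx, hsum]; omega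
    have h2 : α + unitIdx i ∈ multiIdx m := by rw [mem_multiIdx, hsum]; omega
    have h3 : α + unitIdx j + unitIdx i ∈ multiIdx m := by rw [mem_multiIdx, hsum, hsum]; omega
    have hα' : α j = 0 := by
      simp only [Pi.add_apply] at hα; omega
    rw [e]
    exact (ih hα' h1).tangential hij (weakDeriv_slab u h2) (weakDeriv_slab u h3)

/-- This encodes $u_z=0$ on $\Gamma$. Nothing is known about $u_z$ on the face $z=d$, which test
functions must therefore avoid; the conditions at the lateral faces are removed by
`WeakDeriv.of_inter_slab`. -/
lemma weakDeriv_zeroData_normal {B : Box} {m : ℕ} {u : Hm B m} (hu : u ∈ zeroData B m) :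
    WeakDeriv 2 {x | x 2 < B.d} (D (unitIdx 2) u) (D (2 • unitIdx 2) u) := by
  have h : WeakDeriv 2 ({x | x 2 < B.d} ∩ B.slab 0 ∩ B.slab 1) (D (unitIdx 2) u)
      (D (2 • unitIdx 2) u) := by
    intro φ hφ hs
    refine ((hasBoundaryData_zero_iff u).1 hu).2 φ hφ ?_
    -- A point of $\partial\Omega$ with $|x|,|y|<b$ and $z<d$ lies on $\Gamma$, since otherwise it
    -- would be interior.
    refine (disjoint_left.2 fun x hx hx' => ?_ : Disjoint _ _)
    obtain ⟨⟨hd, h0⟩, h1⟩ := hs hx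
    obtain ⟨hf, hn⟩ := hx'
    have hcl : x 2 ∈ Icc (-B.ξ) B.d := by
      have : closure B.domain ⊆ {x | x 2 ∈ Icc (-B.ξ) B.d} := by
        refine closure_minimal (fun y hy => ⟨hy.2.2.1.le, hy.2.2.2.le⟩) ?_
        exact isClosed_Icc.preimage (f := fun x : E3 => x 2) (by fun_prop)
      exact this hf.1
    simp only [Box.slab, Box.lo, Box.hi] at h0 h1
    have a0 : |x 0| < B.b := by rw [abs_lt]; simpa using h0
    have a1 : |x 1| < B.b := by rw [abs_lt]; simpa using h1
    rcases hcl.1.eq_or_lt with he | hl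
    · exact hn ⟨a0, a1, he.symm⟩
    · rw [B.isOpen_domain.frontier_eq] at hf
      exact hf.2 ⟨a0, a1, hl, hd⟩
  exact (h.of_inter_slab (by decide)).of_inter_slab (by decide)

end

section

/-! ### Mollification with a simultaneous dilation -/

lemma map_affine (t : ℝ) (ht : t ≠ 0) (b : E3) :
    (volume : Measure E3).map (fun x => t • x + b) = ENNReal.ofReal |(t ^ 3)⁻¹| • volume := by
  have e : (fun x : E3 => t • x + b) = (fun x => x + b) ∘ (fun x => t • x) := rfl
  rw [e, ← Measure.map_map (by fun_prop) (by fun_prop)]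
  have := Measure.map_addHaar_smul (volume : Measure E3) ht
  rw [finrank_euclideanSpace_fin] at this
  change Measure.map (fun x => x + b) (Measure.map (t • ·) volume) = _
  rw [this, Measure.map_smul, map_add_right_eq_self]

/-- The substitution costs $t^{-3/2}$ in the $L^2$ norm, and $8^{1/2}\le3$ for $t\ge1/2$. -/
lemma eLpNorm_comp_affine_le {F : Type*} [NormedAddCommGroup F] {f : E3 → F}
    (hf : AEStronglyMeasurable f volume) {t : ℝ} (ht : 1 / 2 ≤ t) (b : E3) :
    eLpNorm (fun x => f (t • x + b)) 2 volume ≤ 3 * eLpNorm f 2 volume := by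
  have ht0 : t ≠ 0 := by linarith
  have hm := map_affine t ht0 b
  have hne : ENNReal.ofReal |(t ^ 3)⁻¹| ≠ ⊤ := ENNReal.ofReal_ne_top
  have h1 : eLpNorm (fun x => f (t • x + b)) 2 volume =
      eLpNorm f 2 (ENNReal.ofReal |(t ^ 3)⁻¹| • volume) := by
    rw [← hm, eLpNorm_map_measure _ (by fun_prop)]
    · rfl
    · rw [hm]; exact hf.smul_measure _
  rw [h1, eLpNorm_smul_measure_of_ne_top (by norm_num), smul_eq_mul]
  gcongr
  have h8 : |(t ^ 3)⁻¹| ≤ 9 := by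
    rw [abs_of_nonneg (by positivity)]
    have : (1 / 2 : ℝ) ^ 3 ≤ t ^ 3 := by gcongr
    calc (t ^ 3)⁻¹ ≤ ((1 / 2 : ℝ) ^ 3)⁻¹ := by gcongr
      _ ≤ 9 := by norm_num
  calc ENNReal.ofReal |(t ^ 3)⁻¹| ^ (1 / (2 : ENNReal)).toReal
      ≤ (9 : ENNReal) ^ (1 / (2 : ENNReal)).toReal := by
        gcongr
        calc ENNReal.ofReal |(t ^ 3)⁻¹| ≤ ENNReal.ofReal 9 := ENNReal.ofReal_le_ofReal h8
          _ = 9 := by simp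
    _ = 3 := by
        have : (9 : ENNReal) = 3 ^ (2 : ℝ) := by
          rw [show (2 : ℝ) = ((2 : ℕ) : ℝ) by norm_num, ENNReal.rpow_natCast]; norm_num
        rw [this, ← ENNReal.rpow_mul]; simp

/-- Dilations and translations act continuously on `L²`. -/
lemma exists_eLpNorm_affine_sub_le {w : E3 → ℝ} (hw : MemLp w 2 volume) (c : E3) {ε : ENNReal}
    (hε : ε ≠ 0) : ∃ η : ℝ, 0 < η ∧ η ≤ 1 / 2 ∧ ∀ t y, 1 - η ≤ t → t ≤ 1 → ‖y‖ ≤ η →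
      eLpNorm (fun x : E3 => w (t • x + ((1 - t) • c - y)) - w x) 2 volume ≤ ε := by
  -- Reducing to small $\varepsilon$ makes it finite, so that real constants can be formed from it.
  wlog hε1 : ε ≤ 1 generalizing ε
  · obtain ⟨η, h1, h2, h3⟩ := this one_ne_zero le_rfl
    exact ⟨η, h1, h2, fun t y a b d => (h3 t y a b d).trans (le_of_not_ge hε1)⟩
  have hεt : ε ≠ ⊤ := (hε1.trans_lt ENNReal.one_lt_top).ne
  have h8 : ε / 8 ≠ 0 := (ENNReal.div_pos hε (by norm_num)).ne'
  obtain ⟨g, hgs, hg, hgc, hgm⟩ := hw.exists_hasCompactSupport_eLpNorm_sub_le (by norm_num) h8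
  obtain ⟨R₀, hR₀⟩ := hgs.isCompact.isBounded.subset_closedBall (0 : E3)
  -- Outside the ball of radius $R$ both $g(x)$ and $g(tx+b)$ vanish, because
  -- $|tx+b|\ge|x|/2-\|c\|-1>|R_0|$.
  set R : ℝ := 2 * (|R₀| + ‖c‖ + 1) with hR
  have hRc : 0 < R := by positivity
  set S : Set E3 := Metric.closedBall 0 R with hS
  have hSfin : volume S ≠ ⊤ := measure_closedBall_lt_top.ne
  have hr1 : volume S ^ (1 / (2 : ENNReal).toReal) ≠ ⊤ := by
    refine ENNReal.rpow_ne_top_of_nonneg (by positivity) hSfin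
  -- A uniform error $\kappa$ on the ball $S$ contributes $\kappa|S|^{1/2}\le\varepsilon/8$ to the
  -- $L^2$ norm.
  set κ : ℝ := (ε / 8).toReal / ((volume S ^ (1 / (2 : ENNReal).toReal)).toReal + 1) with hκ
  have hε8 : 0 < (ε / 8).toReal := ENNReal.toReal_pos h8 (ENNReal.div_ne_top hεt (by norm_num))
  have hκ0 : 0 < κ := by positivity
  have huc := hgs.uniformContinuous_of_continuous hgc
  rw [Metric.uniformContinuous_iff] at huc
  obtain ⟨η₁, hη₁, hu⟩ := huc κ hκ0
  refine ⟨min (1 / 2) (η₁ / (2 * (R + ‖c‖ + 1))), by positivity, min_le_left _ _, ?_⟩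
  intro t y ht ht1 hy
  have hη2 := min_le_left (1 / 2) (η₁ / (2 * (R + ‖c‖ + 1)))
  have hη3 := min_le_right (1 / 2) (η₁ / (2 * (R + ‖c‖ + 1)))
  set η := min (1 / 2) (η₁ / (2 * (R + ‖c‖ + 1)))
  have ht2 : 1 / 2 ≤ t := by linarith
  set b : E3 := (1 - t) • c - y with hb
  have hbn : ‖b‖ ≤ ‖c‖ + 1 := by
    calc ‖b‖ ≤ ‖(1 - t) • c‖ + ‖y‖ := norm_sub_le _ _
      _ ≤ 1 * ‖c‖ + 1 := by
        rw [norm_smul, Real.norm_eq_abs, abs_of_nonneg (by linarith)]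
        gcongr <;> linarith
      _ = _ := by ring
  have hmove : ∀ x ∈ S, dist (t • x + b) x < η₁ := by
    intro x hx
    have hx : ‖x‖ ≤ R := by simpa [hS] using hx
    have e : t • x + b - x = (1 - t) • (c - x) - y := by rw [hb]; module
    rw [dist_eq_norm, e]
    calc ‖(1 - t) • (c - x) - y‖ ≤ (1 - t) * ‖c - x‖ + ‖y‖ := by
          refine (norm_sub_le _ _).trans ?_
          rw [norm_smul, Real.norm_eq_abs, abs_of_nonneg (by linarith)]
      _ ≤ η * (‖c‖ + R) + η := by
          have : ‖c - x‖ ≤ ‖c‖ + R := (norm_sub_le _ _).trans (by gcongr)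
          gcongr; linarith
      _ = η * (R + ‖c‖ + 1) := by ring
      _ ≤ η₁ / (2 * (R + ‖c‖ + 1)) * (R + ‖c‖ + 1) := by gcongr
      _ = η₁ / 2 := by field_simp
      _ < η₁ := by linarith
  have hout : ∀ x ∉ S, g x = 0 ∧ g (t • x + b) = 0 := by
    intro x hx
    have hx : R < ‖x‖ := by simpa [hS] using hx
    have hz : ∀ z, |R₀| < ‖z‖ → g z = 0 := fun z hz => by
      by_contra hne
      have := hR₀ (subset_tsupport g hne)
      rw [mem_closedBall_zero_iff] at this
      exact absurd (this.trans (le_abs_self _)) (not_le.2 hz)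
    refine ⟨hz _ ?_, hz _ ?_⟩
    · have := norm_nonneg c; have := abs_nonneg R₀; linarith
    · have h1 : ‖t • x‖ - ‖b‖ ≤ ‖t • x + b‖ := by
        have := norm_sub_norm_le (t • x) (-b)
        simpa using this
      have h2 : 1 / 2 * ‖x‖ ≤ ‖t • x‖ := by
        rw [norm_smul, Real.norm_eq_abs, abs_of_nonneg (by linarith)]; gcongr
      linarith
  have hd : ∀ x, dist (g (t • x + b)) (g x) ≤ κ := by
    intro x
    by_cases hx : x ∈ S
    · exact (hu (hmove x hx)).le
    · rw [(hout x hx).1, (hout x hx).2, dist_self]; exact hκ0.le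
  have hgA : AEStronglyMeasurable (fun x : E3 => g (t • x + b)) volume :=
    (hgc.comp (by fun_prop : Continuous fun x : E3 => t • x + b)).aestronglyMeasurable
  have hwg := hw.1.sub hgc.aestronglyMeasurable (μ := (volume : Measure E3))
  have hqmp : Measure.QuasiMeasurePreserving (fun x : E3 => t • x + b) volume volume := by
    refine ⟨by fun_prop, ?_⟩
    rw [map_affine t (by linarith) b]
    exact Measure.smul_absolutelyContinuous
  have hA : AEStronglyMeasurable (fun x : E3 => (w - g) (t • x + b)) volume :=
    hwg.comp_quasiMeasurePreserving hqmp
  have hmid : eLpNorm ((fun x : E3 => g (t • x + b)) - g) 2 volume ≤ ε / 8 := by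
    refine (eLpNorm_sub_le_of_dist_bdd volume (by norm_num) (s := S)
      Metric.isClosed_closedBall.measurableSet hκ0.le hd ?_ ?_).trans ?_
    · intro x hx; by_contra hxS; exact hx (hout x hxS).2
    · intro x hx; by_contra hxS; exact hx (hout x hxS).1
    · rw [← ENNReal.ofReal_toReal hr1, ← ENNReal.ofReal_mul hκ0.le,
        ← ENNReal.ofReal_toReal (ENNReal.div_ne_top hεt (by norm_num : (8 : ENNReal) ≠ 0))]
      refine ENNReal.ofReal_le_ofReal ?_
      rw [hκ, div_mul_eq_mul_div, div_le_iff₀ (by positivity)]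
      gcongr; linarith
  have hsum : (fun x : E3 => w (t • x + b) - w x) =
      (fun x => (w - g) (t • x + b)) + (((fun x => g (t • x + b)) - g) + (g - w)) := by
    ext x; simp
  rw [hsum]
  -- The moved error $w-g$ costs $3\varepsilon/8$; the displacement of $g$ and the error at rest
  -- cost $\varepsilon/8$ each.
  calc _ ≤ eLpNorm (fun x => (w - g) (t • x + b)) 2 volume
        + (eLpNorm ((fun x => g (t • x + b)) - g) 2 volume + eLpNorm (g - w) 2 volume) := by
        refine (eLpNorm_add_le hA ((hgA.sub hgc.aestronglyMeasurable).add
          (hgc.aestronglyMeasurable.sub hw.1)) (by norm_num)).trans ?_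
        gcongr
        exact eLpNorm_add_le (hgA.sub hgc.aestronglyMeasurable)
          (hgc.aestronglyMeasurable.sub hw.1) (by norm_num)
    _ ≤ 3 * (ε / 8) + (ε / 8 + ε / 8) := by
        rw [eLpNorm_sub_comm g w]
        gcongr
        exact (eLpNorm_comp_affine_le hwg ht2 b).trans (by gcongr)
    _ = 5 * (ε / 8) := by ring
    _ ≤ 8 * (ε / 8) := by gcongr; norm_num
    _ = ε := ENNReal.mul_div_cancel (by norm_num) (by norm_num)

end

/-! ### Mollification, and smooth functions as elements of the Sobolev spaces. -/

section

lemma sq_lintegral_le {ν : Measure E3} [IsProbabilityMeasure ν] {g : E3 → ENNReal}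
    (hg : Measurable g) : (∫⁻ y, g y ∂ν) ^ 2 ≤ ∫⁻ y, g y ^ 2 ∂ν := by
  have h := ENNReal.lintegral_mul_le_Lp_mul_Lq ν Real.HolderConjugate.two_two hg.aemeasurable
    (aemeasurable_const (b := (1 : ENNReal)))
  simp only [Pi.mul_apply, mul_one, ENNReal.one_rpow, lintegral_one, measure_univ] at h
  calc (∫⁻ y, g y ∂ν) ^ 2 ≤ ((∫⁻ y, g y ^ (2 : ℝ) ∂ν) ^ (1 / (2 : ℝ))) ^ 2 := by gcongr
    _ = ∫⁻ y, g y ^ 2 ∂ν := by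
      rw [← ENNReal.rpow_natCast, ← ENNReal.rpow_mul]
      norm_num

/-- Cauchy–Schwarz with respect to the probability measure, then Tonelli: the square of an average
is at most the average of the squares. -/
lemma lintegral_enorm_integral_sq_le {ν μ : Measure E3} [IsProbabilityMeasure ν] [SFinite μ]
    {f : E3 → E3 → ℝ} (hf : Measurable (Function.uncurry f)) :
    ∫⁻ x, ‖∫ y, f x y ∂ν‖ₑ ^ 2 ∂μ ≤ ∫⁻ y, ∫⁻ x, ‖f x y‖ₑ ^ 2 ∂μ ∂ν := by
  rw [lintegral_lintegral_swap (by fun_prop)]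
  refine lintegral_mono fun x => ?_
  calc ‖∫ y, f x y ∂ν‖ₑ ^ 2 ≤ (∫⁻ y, ‖f x y‖ₑ ∂ν) ^ 2 := by
        gcongr; exact enorm_integral_le_lintegral_enorm _
    _ ≤ _ := sq_lintegral_le (by
        have : Measurable (f x) := hf.comp measurable_prodMk_left
        fun_prop)

lemma eLpNorm_two_sq {F : Type*} [NormedAddCommGroup F] {α : Type*} [MeasurableSpace α]
    {μ : Measure α} (f : α → F) : eLpNorm f 2 μ ^ 2 = ∫⁻ x, ‖f x‖ₑ ^ 2 ∂μ := by
  have := eLpNorm_nnreal_pow_eq_lintegral (μ := μ) (f := f) (p := 2) two_ne_zero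
  simpa using this

/-- Mollification of `w` with kernel `η`. -/
def moll (w η : E3 → ℝ) : E3 → ℝ := convolution w η (ContinuousLinearMap.mul ℝ ℝ) volume

lemma moll_apply (w η : E3 → ℝ) (p : E3) : moll w η p = ∫ y, w y * η (p - y) := rfl

lemma moll_apply' (w η : E3 → ℝ) (p : E3) : moll w η p = ∫ y, η y * w (p - y) := by
  rw [moll_apply, ← integral_sub_left_eq_self _ _ p]
  simp [mul_comm]

/-- A mollification is an average of translates with respect to the probability measure $\eta\,dy$,
so its error does not exceed the largest error of the translates involved. -/
lemma eLpNorm_moll_sub_le {w η : E3 → ℝ} (hw : Measurable w) (hwi : LocallyIntegrable w volume)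
    (hη : Continuous η) (hc : HasCompactSupport η)
    (hη0 : ∀ y, 0 ≤ η y) (hη1 : ∫ y, η y = 1) {t : ℝ} {b : E3} {ε : ENNReal}
    (h : ∀ y, η y ≠ 0 → eLpNorm (fun x : E3 => w (t • x + b - y) - w x) 2 volume ≤ ε) :
    eLpNorm (fun x => moll w η (t • x + b) - w x) 2 volume ≤ ε := by
  set ν : Measure E3 := volume.withDensity fun y => ENNReal.ofReal (η y) with hν
  have hηi : Integrable η volume := hη.integrable_of_hasCompactSupport hc
  have hνp : IsProbabilityMeasure ν := by
    refine ⟨?_⟩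
    rw [hν, withDensity_apply _ MeasurableSet.univ, Measure.restrict_univ,
      ← ofReal_integral_eq_lintegral_ofReal hηi (Filter.Eventually.of_forall hη0), hη1]
    simp
  have hmeas : Measurable fun y => ENNReal.ofReal (η y) := by fun_prop
  have hint : ∀ f : E3 → ℝ, ∫ y, f y ∂ν = ∫ y, η y * f y := by
    intro f
    rw [hν, integral_withDensity_eq_integral_toReal_smul hmeas (by simp)]
    simp [hη0]
  have e : ∀ x : E3, moll w η (t • x + b) - w x = ∫ y, (w (t • x + b - y) - w x) ∂ν := by
    intro x
    have i1 : Integrable (fun y => η y * w (t • x + b - y)) volume := by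
      have h1 := hc.convolutionExists_right (ContinuousLinearMap.mul ℝ ℝ) hwi hη (t • x + b)
      have h2 := (Integrable.comp_sub_left h1 (t • x + b))
      simpa [mul_comm] using h2
    rw [hint, moll_apply']
    simp_rw [mul_sub]
    rw [integral_sub i1 (hηi.mul_const _), integral_mul_const, hη1, one_mul]
  simp_rw [e]
  rw [← ENNReal.pow_le_pow_left_iff two_ne_zero, eLpNorm_two_sq]
  refine (lintegral_enorm_integral_sq_le (by
    unfold Function.uncurry; fun_prop)).trans ?_
  calc ∫⁻ y, ∫⁻ x, ‖w (t • x + b - y) - w x‖ₑ ^ 2 ∂volume ∂ν ≤ ∫⁻ y, ε ^ 2 ∂ν := by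
        refine lintegral_mono_ae ?_
        have : ∀ᵐ y ∂ν, ENNReal.ofReal (η y) ≠ 0 := by
          rw [hν, ae_withDensity_iff hmeas]
          exact Filter.Eventually.of_forall fun _ h => h
        filter_upwards [this] with y hy
        rw [← eLpNorm_two_sq (μ := volume) (fun x : E3 => w (t • x + b - y) - w x)]
        gcongr
        refine h y fun h0 => hy (by simp [h0])
    _ = ε ^ 2 := by simp

lemma smooth_moll {w η : E3 → ℝ} (hwi : LocallyIntegrable w volume) (hη : IsTest η) :
    Smooth (moll w η) :=
  hη.2.contDiff_convolution_right (ContinuousLinearMap.mul ℝ ℝ) hwi hη.1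

lemma pd_moll {w η : E3 → ℝ} (hwi : LocallyIntegrable w volume) (hη : IsTest η) (i : Fin 3) :
    pd i (moll w η) = moll w (pd i η) := by
  ext x
  have h := (hη.2.hasFDerivAt_convolution_right (ContinuousLinearMap.mul ℝ ℝ) hwi
    (hη.1.of_le (by exact_mod_cast le_top)) x).fderiv
  unfold pd moll
  rw [h]
  exact convolution_precompR_apply _ hwi (hη.2.fderiv (𝕜 := ℝ))
    (hη.1.continuous_fderiv (by simp)) _ _

lemma pdMulti_moll {w η : E3 → ℝ} (hwi : LocallyIntegrable w volume) (hη : IsTest η)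
    (α : Fin 3 → ℕ) : pdMulti α (moll w η) = moll w (pdMulti α η) := by
  induction α using multiIdx_induction with
  | h0 => rfl
  | h1 α i ih =>
    rw [pdMulti_add_unitIdx (smooth_moll hwi hη), pdMulti_pd (smooth_moll hwi hη), ih,
      pd_moll hwi (hη.pdMulti α), pdMulti_add_unitIdx hη.1, pdMulti_pd hη.1]

lemma smooth_affine {f : E3 → ℝ} (hf : Smooth f) (t : ℝ) (b : E3) :
    Smooth (fun x => f (t • x + b)) := hf.comp (by fun_prop)

lemma pd_affine {f : E3 → ℝ} (hf : Smooth f) (t : ℝ) (b : E3) (i : Fin 3) :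
    pd i (fun x => f (t • x + b)) = fun x => t * pd i f (t • x + b) := by
  ext x
  have h1 : HasFDerivAt (fun x : E3 => t • x + b) (t • ContinuousLinearMap.id ℝ E3) x :=
    ((hasFDerivAt_id x).const_smul t).add_const b
  have := ((hf.differentiableAt (t • x + b)).hasFDerivAt.comp x h1).fderiv
  simp only [Function.comp_def] at this
  unfold pd
  rw [this]
  simp

lemma pd_const_mul {f : E3 → ℝ} (hf : Smooth f) (t : ℝ) (i : Fin 3) :
    pd i (fun x => t * f x) = fun x => t * pd i f x := by
  ext x
  unfold pd
  rw [fderiv_const_mul (hf.differentiableAt x)]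
  simp

lemma pdMulti_affine {f : E3 → ℝ} (hf : Smooth f) (t : ℝ) (b : E3) (α : Fin 3 → ℕ) :
    pdMulti α (fun x => f (t • x + b)) =
      fun x => t ^ (∑ i, α i) * pdMulti α f (t • x + b) := by
  induction α using multiIdx_induction with
  | h0 => simp [pdMulti_zero]
  | h1 α i ih =>
    rw [pdMulti_add_unitIdx (smooth_affine hf t b), pdMulti_pd (smooth_affine hf t b), ih,
      pd_const_mul (smooth_affine (hf.pdMulti α) t b), pd_affine (hf.pdMulti α),
      pdMulti_add_unitIdx hf, pdMulti_pd hf]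
    have : ∑ k, (α + unitIdx i) k = (∑ k, α k) + 1 := by
      simp only [Pi.add_apply, Finset.sum_add_distrib, sum_unitIdx]
    rw [this]
    ext x; ring

/-! ### Test functions as elements of the Sobolev spaces -/

lemma integral_pd_eq_zero {F : E3 → ℝ} (hF : IsTest F) (i : Fin 3) : ∫ x, pd i F x = 0 := by
  have h := integral_mul_fderiv_eq_neg_fderiv_mul_of_integrable (𝕜 := ℝ) (f := fun _ : E3 => (1 : ℝ))
    (g := F) (v := EuclideanSpace.single i (1 : ℝ)) (μ := (volume : Measure E3)) (by simp)
    (by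
      simp only [one_mul]
      exact (hF.pd i).continuous.integrable_of_hasCompactSupport (hF.pd i).2)
    (by simpa using hF.continuous.integrable_of_hasCompactSupport hF.2)
    (fun x _ => by fun_prop) (fun x _ => hF.smooth.differentiableAt x)
  simpa [pd] using h

lemma pair_tst {B : Box} {ψ φ : E3 → ℝ} (hφ : Continuous φ) (hs : tsupport ψ ⊆ B.domain) (c : ℂ) :
    pair ψ (tst B φ c) = ((∫ x, ψ x * φ x : ℝ) : ℂ) * c := by
  have h1 : pair ψ (tst B φ c) = ∫ x, (((ψ x * φ x : ℝ) : ℂ)) * c ∂B.vol := by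
    refine integral_congr_ae ?_
    filter_upwards [coeFn_tst (B := B) hφ c] with x hx
    rw [hx]; push_cast; ring
  rw [h1, integral_mul_const, integral_complex_ofReal, Box.vol, setIntegral_eq_integral_of_forall_compl_eq_zero]
  intro x hx
  have : ψ x = 0 := by
    by_contra h0; exact hx (hs (subset_tsupport ψ h0))
  simp [this]

lemma integral_pdMulti_mul {ψ φ : E3 → ℝ} (hψ : IsTest ψ) (hφ : Smooth φ) (α : Fin 3 → ℕ) :
    ∫ x, pdMulti α ψ x * φ x = (-1) ^ (∑ i, α i) * ∫ x, ψ x * pdMulti α φ x := by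
  induction α using multiIdx_induction generalizing ψ with
  | h0 => simp [pdMulti_zero]
  | h1 α i ih =>
    have hα := hφ.pdMulti α
    rw [pdMulti_add_unitIdx hψ.1, ih (hψ.pd i), pdMulti_add_unitIdx hφ, pdMulti_pd hφ]
    have : ∑ k, (α + unitIdx i) k = (∑ k, α k) + 1 := by
      simp only [Pi.add_apply, Finset.sum_add_distrib, sum_unitIdx]
    have ht : IsTest (fun x => pdMulti α φ x * ψ x) := hψ.mul_left hα
    have h0 := integral_pd_eq_zero ht i
    rw [pd_mul hα hψ.1] at h0
    have i1 : Integrable (fun x => pdMulti α φ x * pd i ψ x) volume :=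
      (hα.continuous.mul (hψ.pd i).continuous).integrable_of_hasCompactSupport (hψ.pd i).2.mul_left
    have i2 : Integrable (fun x => pd i (pdMulti α φ) x * ψ x) volume :=
      ((hα.pd i).continuous.mul hψ.continuous).integrable_of_hasCompactSupport hψ.2.mul_left
    rw [integral_add i1 i2] at h0
    simp_rw [mul_comm (ψ _), mul_comm (pd i ψ _)]
    rw [this, pow_succ]
    linear_combination (-1) ^ (∑ i, α i) * h0

lemma entry_toLp {B : Box} {m : ℕ} (f : (Fin 3 → ℕ) → L2 B) {α : Fin 3 → ℕ}
    (hα : α ∈ multiIdx m) :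
    Jet.entry α (WithLp.toLp 2 fun β : multiIdx m => f β.1) = f α := by
  rw [Jet.entry, dif_pos hα]; rfl

lemma zero_mem_multiIdx (m : ℕ) : (0 : Fin 3 → ℕ) ∈ multiIdx m := by simp [mem_multiIdx]

/-- An element of `H^m` from the family of its derivatives. -/
def Hm.mk' {B : Box} {m : ℕ} (f : (Fin 3 → ℕ) → L2 B)
    (hf : ∀ α ∈ multiIdx m, ∀ φ, IsTest φ → tsupport φ ⊆ B.domain →
      pair (pdMulti α φ) (f 0) = (-1) ^ (∑ i, α i) * pair φ (f α)) : Hm B m :=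
  ⟨WithLp.toLp 2 fun β => f β.1, fun α hα φ hφ hs => by
    rw [entry_toLp f hα, entry_toLp f (zero_mem_multiIdx m)]
    exact hf α hα φ hφ hs⟩

lemma D_mk' {B : Box} {m : ℕ} (f : (Fin 3 → ℕ) → L2 B)
    (hf : ∀ α ∈ multiIdx m, ∀ φ, IsTest φ → tsupport φ ⊆ B.domain →
      pair (pdMulti α φ) (f 0) = (-1) ^ (∑ i, α i) * pair φ (f α)) {α : Fin 3 → ℕ}
    (hα : α ∈ multiIdx m) : D α (Hm.mk' (m := m) f hf) = f α := entry_toLp f hα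

/-- The function `c φ` in `H^m`, for smooth `φ`. -/
def ofSmooth (B : Box) (m : ℕ) {φ : E3 → ℝ} (hφ : Smooth φ) (c : ℂ) : Hm B m :=
  Hm.mk' (fun α => tst B (pdMulti α φ) c) fun α _ ψ hψ hs => by
    rw [pair_tst (hφ.pdMulti α).continuous hs,
      pair_tst (hφ.pdMulti 0).continuous ((tsupport_pdMulti_subset α ψ).trans hs), pdMulti_zero,
      integral_pdMulti_mul hψ hφ]
    push_cast; ring

lemma D_ofSmooth {B : Box} {m : ℕ} {φ : E3 → ℝ} (hφ : Smooth φ) (c : ℂ) {α : Fin 3 → ℕ}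
    (hα : α ∈ multiIdx m) : D α (ofSmooth B m hφ c) = tst B (pdMulti α φ) c := D_mk' _ _ hα

lemma norm_sq_Hm {B : Box} {m : ℕ} (u : Hm B m) :
    ‖u‖ ^ 2 = ∑ α ∈ multiIdx m, ‖D α u‖ ^ 2 := by
  have h : ‖u‖ ^ 2 = ‖(u.1 : Jet B m)‖ ^ 2 := rfl
  rw [h, PiLp.norm_sq_eq_of_L2, ← Finset.sum_coe_sort (multiIdx m) fun α => ‖D α u‖ ^ 2]
  refine Finset.sum_congr rfl fun α _ => ?_
  have : D α.1 u = (u.1 : Jet B m) α := by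
    show Jet.entry α.1 (u.1 : Jet B m) = _
    rw [Jet.entry, dif_pos α.2]; rfl
  rw [this]

lemma norm_D_le {B : Box} {m : ℕ} (α : Fin 3 → ℕ) (u : Hm B m) : ‖D α u‖ ≤ ‖u‖ := by
  by_cases hα : α ∈ multiIdx m
  · refine le_of_sq_le_sq ?_ (norm_nonneg _)
    rw [norm_sq_Hm]
    exact Finset.single_le_sum (f := fun α => ‖D α u‖ ^ 2) (fun _ _ => by positivity) hα
  · have : D α u = 0 := by
      show Jet.entry α (u.1 : Jet B m) = 0
      rw [Jet.entry, dif_neg hα]; rfl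
    rw [this, norm_zero]; exact norm_nonneg _

lemma norm_Hm_le_sum {B : Box} {m : ℕ} (u : Hm B m) : ‖u‖ ≤ ∑ α ∈ multiIdx m, ‖D α u‖ := by
  refine le_of_sq_le_sq ?_ (Finset.sum_nonneg fun _ _ => norm_nonneg _)
  rw [norm_sq_Hm]
  exact Finset.sum_sq_le_sq_sum_of_nonneg fun _ _ => norm_nonneg _

lemma Hm.ext_D {B : Box} {m : ℕ} {u v : Hm B m} (h : ∀ α ∈ multiIdx m, D α u = D α v) : u = v := by
  rw [← sub_eq_zero, ← norm_le_zero_iff]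
  refine (norm_Hm_le_sum _).trans (Finset.sum_nonpos fun α hα => ?_)
  rw [map_sub, h α hα, sub_self, norm_zero]

end

section

/-! ### Density of test functions -/

/-- Extension by zero of a real component of an `L²` function. -/
def extZero {B : Box} (l : ℂ →L[ℝ] ℝ) (f : L2 B) : E3 → ℝ :=
  B.domain.indicator fun x => l (f x)

lemma measurable_extZero {B : Box} (l : ℂ →L[ℝ] ℝ) (f : L2 B) : Measurable (extZero l f) :=
  (l.continuous.measurable.comp (Lp.stronglyMeasurable f).measurable).indicator
    B.measurableSet_domain

lemma memLp_extZero {B : Box} (l : ℂ →L[ℝ] ℝ) (f : L2 B) : MemLp (extZero l f) 2 volume := by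
  rw [extZero, memLp_indicator_iff_restrict B.measurableSet_domain]
  exact l.comp_memLp' (Lp.memLp f)

lemma hasCompactSupport_extZero {B : Box} (l : ℂ →L[ℝ] ℝ) (f : L2 B) :
    HasCompactSupport (extZero l f) :=
  HasCompactSupport.intro (isCompact_closedBall 0 B.rad) fun _ hx =>
    indicator_of_notMem (fun h => hx (B.domain_subset_closedBall h)) _

/-- The real linear map `l` stands for the real or the imaginary part, so that the approximation can
be carried out with real functions on the whole space. -/
lemma apply_pair {B : Box} (l : ℂ →L[ℝ] ℝ) (f : L2 B) {χ : E3 → ℝ} (hχ : Continuous χ) :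
    l (pair χ f) = ∫ y, extZero l f y * χ y := by
  have h1 : ∀ y, extZero l f y * χ y = B.domain.indicator (fun x => l ((χ x : ℂ) * f x)) y := by
    intro y
    by_cases hy : y ∈ B.domain
    · simp only [extZero, indicator_of_mem hy]
      rw [← Complex.real_smul, map_smul, smul_eq_mul, mul_comm]
    · simp [extZero, indicator_of_notMem hy]
  simp_rw [h1]
  rw [integral_indicator B.measurableSet_domain, pair]
  exact (l.integral_comp_comm (integrable_pair hχ f)).symm

/-- The kernel $y\mapsto\eta(p-y)$ is an admissible test function once its support lies in the box.
The sign in the definition of the weak derivative cancels the one from the reflection $y\mapsto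
p-y$. -/
lemma moll_extZero {B : Box} {m : ℕ} (l : ℂ →L[ℝ] ℝ) (u : Hm B m) {α : Fin 3 → ℕ}
    (hα : α ∈ multiIdx m) {η : E3 → ℝ} (hη : IsTest η) {p : E3}
    (hs : tsupport (fun y => η ((-1 : ℝ) • y + p)) ⊆ B.domain) :
    moll (extZero l (D 0 u)) (pdMulti α η) p = moll (extZero l (D α u)) η p := by
  have hψ : IsTest (fun y => η ((-1 : ℝ) • y + p)) := by
    refine ⟨smooth_affine hη.1 _ _, ?_⟩
    exact hη.2.comp_homeomorph
      ((Homeomorph.smulOfNeZero (-1 : ℝ) (by norm_num)).trans (Homeomorph.addRight p))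
  have h := congrArg l (pair_pdMulti u hα hψ hs)
  have e1 : ((-1 : ℂ) ^ (∑ i, α i)) * pair (fun y => η ((-1 : ℝ) • y + p)) (D α u) =
      ((-1 : ℝ) ^ (∑ i, α i)) • pair (fun y => η ((-1 : ℝ) • y + p)) (D α u) := by
    rw [Complex.real_smul]; push_cast; rfl
  rw [e1, map_smul, apply_pair l _ (hψ.pdMulti α).continuous, apply_pair l _ hψ.continuous,
    pdMulti_affine hη.1] at h
  have e2 : ∀ y : E3, (-1 : ℝ) • y + p = p - y := fun y => by module
  simp only [e2, smul_eq_mul] at h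
  have e3 : ∀ y, extZero l (D 0 u) y * ((-1) ^ (∑ i, α i) * pdMulti α η (p - y)) =
      (-1) ^ (∑ i, α i) * (extZero l (D 0 u) y * pdMulti α η (p - y)) := fun y => by ring
  simp_rw [e3] at h
  rw [integral_const_mul] at h
  exact mul_left_cancel₀ (by simp : ((-1 : ℝ)) ^ (∑ i, α i) ≠ 0) h

/-- The centre of the box. -/
def Box.center (B : Box) : E3 := !₂[0, 0, (B.d - B.ξ) / 2]

lemma Box.center_apply (B : Box) (i : Fin 3) : B.center i = (B.lo i + B.hi i) / 2 := by
  fin_cases i <;> simp [Box.center, Box.lo, Box.hi]; ring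

/-- The inner radius of the box. -/
def Box.inrad (B : Box) : ℝ := min B.b ((B.d + B.ξ) / 2)

lemma Box.inrad_pos (B : Box) : 0 < B.inrad := by
  have := B.b_pos; have := B.d_pos; have := B.ξ_pos
  unfold Box.inrad; positivity

lemma Box.inrad_le (B : Box) (i : Fin 3) : B.inrad ≤ (B.hi i - B.lo i) / 2 := by
  have h1 := min_le_left B.b ((B.d + B.ξ) / 2)
  have h2 := min_le_right B.b ((B.d + B.ξ) / 2)
  unfold Box.inrad Box.hi Box.lo
  split_ifs <;> linarith

/-- Contracting towards the centre by the factor $1-h$ moves every point of the box at least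
`B.inrad * h` away from each face. This leaves room for mollification with that radius. -/
lemma Box.mem_domain_of_near {B : Box} {x y : E3} (hx : x ∈ B.domain) {h : ℝ} (h0 : 0 < h)
    (h1 : h ≤ 1 / 2) (hy : ‖y - ((1 - h) • x + h • B.center)‖ ≤ B.inrad * h) :
    y ∈ B.domain := by
  rw [Box.mem_domain] at *
  intro i
  have hi := (PiLp.norm_apply_le (y - ((1 - h) • x + h • B.center)) i).trans hy
  obtain ⟨a1, a2⟩ := hx i
  have hc := B.inrad_le i
  simp only [PiLp.sub_apply, PiLp.add_apply, PiLp.smul_apply, smul_eq_mul, Real.norm_eq_abs,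
    abs_le, Box.center_apply] at hi
  have m1 : B.inrad * h ≤ (B.hi i - B.lo i) / 2 * h := by gcongr
  have m2 : (1 - h) * B.lo i < (1 - h) * x i := by gcongr; linarith
  have m3 : (1 - h) * x i < (1 - h) * B.hi i := by gcongr; linarith
  constructor <;> nlinarith

-- The zero extension of $u$ is mollified and then evaluated at contracted points. The contraction
-- keeps the support of the kernel inside the box, so that no Sobolev extension is needed; its price
-- is a factor $(1-h)^{|\alpha|}$ that tends to 1.
open Filter Topology in
lemma exists_test_near {B : Box} {m : ℕ} (l : ℂ →L[ℝ] ℝ) (u : Hm B m) {ε : ENNReal}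
    (hε : ε ≠ 0) : ∃ φ, IsTest φ ∧ ∀ α ∈ multiIdx m,
      eLpNorm (fun x => pdMulti α φ x - l (D α u x)) 2 B.vol ≤ ε := by
  have hε2 : ε / 2 ≠ 0 := (ENNReal.div_pos hε (by norm_num)).ne'
  -- There are finitely many $\alpha$, so a single small $h$ serves all of them.
  have hev : ∀ α ∈ multiIdx m, ∀ᶠ h in 𝓝[>] (0 : ℝ),
      (∀ y, ‖y‖ ≤ B.inrad * h → eLpNorm (fun x : E3 => extZero l (D α u)
        ((1 - h) • x + (h • B.center - y)) - extZero l (D α u) x) 2 volume ≤ ε / 2) ∧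
      ENNReal.ofReal (1 - (1 - h) ^ (∑ i, α i)) * eLpNorm (extZero l (D α u)) 2 volume
        ≤ ε / 2 := by
    intro α _
    refine Filter.Eventually.and ?_ ?_
    · obtain ⟨κ, h1, h2, h3⟩ := exists_eLpNorm_affine_sub_le (memLp_extZero l (D α u)) B.center hε2
      have hpos : 0 < κ / (B.inrad + 1) := div_pos h1 (by linarith [B.inrad_pos])
      filter_upwards [Ioo_mem_nhdsGT hpos] with h hh y hy
      have hk : h * (B.inrad + 1) < κ := (lt_div_iff₀ (by linarith [B.inrad_pos])).1 hh.2
      have hin : 0 < B.inrad * h := mul_pos B.inrad_pos hh.1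
      have := h3 (1 - h) y (by nlinarith) (by linarith [hh.1]) (by nlinarith [hh.1])
      simpa using this
    · have ht : Tendsto (fun h : ℝ => ENNReal.ofReal (1 - (1 - h) ^ (∑ i, α i)) *
          eLpNorm (extZero l (D α u)) 2 volume) (𝓝 0) (𝓝 (0 * eLpNorm (extZero l (D α u)) 2 volume)) := by
        refine ENNReal.Tendsto.mul_const ?_ (Or.inr (memLp_extZero l (D α u)).eLpNorm_ne_top)
        have : Tendsto (fun h : ℝ => 1 - (1 - h) ^ (∑ i, α i)) (𝓝 0) (𝓝 0) := by
          have hc : Continuous (fun h : ℝ => 1 - (1 - h) ^ (∑ i, α i)) := by fun_prop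
          have := hc.tendsto 0
          simpa using this
        have := (ENNReal.continuous_ofReal.tendsto 0).comp this
        simpa [Function.comp_def] using this
      rw [zero_mul] at ht
      have := ht.eventually (eventually_lt_nhds (pos_iff_ne_zero.2 hε2))
      exact (this.filter_mono nhdsWithin_le_nhds).mono fun _ h => h.le
  have hall := (Filter.eventually_all_finset (multiIdx m)).2 hev
  obtain ⟨h, hP, hh⟩ := (hall.and (Ioo_mem_nhdsGT (by norm_num : (0 : ℝ) < 1 / 2))).exists
  have hr : 0 < B.inrad * h := mul_pos B.inrad_pos hh.1
  let f : ContDiffBump (0 : E3) := ⟨B.inrad * h / 2, B.inrad * h, by linarith, by linarith⟩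
  set η : E3 → ℝ := f.normed volume with hηd
  have hη : IsTest η := ⟨f.contDiff_normed, f.hasCompactSupport_normed⟩
  have hηs : ∀ y, η y ≠ 0 → ‖y‖ ≤ B.inrad * h := fun y hy => by
    have : y ∈ Function.support η := hy
    rw [hηd, f.support_normed_eq] at this
    exact (mem_ball_zero_iff.1 this).le
  have hwi : LocallyIntegrable (extZero l (D 0 u)) volume :=
    (memLp_extZero l (D 0 u)).locallyIntegrable (by norm_num)
  have ht0 : (1 - h) ≠ 0 := by linarith [hh.2]
  refine ⟨fun x => moll (extZero l (D 0 u)) η ((1 - h) • x + h • B.center), ⟨?_, ?_⟩, ?_⟩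
  · exact smooth_affine (smooth_moll hwi hη) _ _
  · have hcs : HasCompactSupport (moll (extZero l (D 0 u)) η) :=
      (hasCompactSupport_extZero l _).convolution _ hη.2
    exact hcs.comp_homeomorph ((Homeomorph.smulOfNeZero (1 - h) ht0).trans
      (Homeomorph.addRight (h • B.center)))
  intro α hα
  obtain ⟨hP1, hP2⟩ := hP α hα
  set t := 1 - h with ht
  set w := extZero l (D α u) with hw
  set n := ∑ i, α i with hn
  have hwl : LocallyIntegrable w volume :=
    (memLp_extZero l (D α u)).locallyIntegrable (by norm_num)
  -- The error splits into that of the mollification of $D^\alpha u$ and that of the chain rule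
  -- factor $t^n$.
  have e1 : ∀ x ∈ B.domain, pdMulti α (fun x => moll (extZero l (D 0 u)) η (t • x + h • B.center)) x
      - l (D α u x) = t ^ n * (moll w η (t • x + h • B.center) - w x) + (t ^ n - 1) * w x := by
    intro x hx
    have : w x = l (D α u x) := indicator_of_mem hx _
    rw [pdMulti_affine (smooth_moll hwi hη), pdMulti_moll hwi hη]
    beta_reduce
    rw [moll_extZero l u hα hη, ← this]
    · ring
    · refine (closure_minimal (t := Metric.closedBall (t • x + h • B.center) (B.inrad * h)) ?_
        Metric.isClosed_closedBall).trans ?_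
      · intro y hy
        have := hηs _ hy
        rw [Metric.mem_closedBall, dist_comm, dist_eq_norm]
        refine le_of_eq_of_le ?_ this
        congr 1; module
      · intro y hy
        rw [Metric.mem_closedBall, dist_eq_norm] at hy
        exact Box.mem_domain_of_near hx hh.1 hh.2.le hy
  rw [eLpNorm_congr_ae (Box.ae_vol e1)]
  have hm1 : AEStronglyMeasurable (fun x : E3 => moll w η (t • x + h • B.center)) volume :=
    (smooth_affine (smooth_moll hwl hη) _ _).continuous.aestronglyMeasurable
  have hm2 : AEStronglyMeasurable w volume := (memLp_extZero l (D α u)).1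
  have ht1 : 0 ≤ t ∧ t ≤ 1 := ⟨by linarith [hh.2], by linarith [hh.1]⟩
  have htn : t ^ n ≤ 1 := pow_le_one₀ ht1.1 ht1.2
  have key : eLpNorm (fun x : E3 => moll w η (t • x + h • B.center) - w x) 2 volume ≤ ε / 2 := by
    refine eLpNorm_moll_sub_le (measurable_extZero l _) hwl hη.continuous hη.2
      (fun y => f.nonneg_normed y) f.integral_normed fun y hy => ?_
    have := hP1 y (hηs y hy)
    simpa [add_sub_assoc] using this
  calc _ ≤ eLpNorm (fun x : E3 => t ^ n * (moll w η (t • x + h • B.center) - w x)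
        + (t ^ n - 1) * w x) 2 volume := eLpNorm_mono_measure _ Measure.restrict_le_self
    _ ≤ eLpNorm (fun x : E3 => t ^ n * (moll w η (t • x + h • B.center) - w x)) 2 volume
        + eLpNorm (fun x : E3 => (t ^ n - 1) * w x) 2 volume :=
        eLpNorm_add_le ((hm1.sub hm2).const_mul _) (hm2.const_mul _) (by norm_num)
    _ ≤ ε / 2 + ε / 2 := by
        gcongr
        · refine (eLpNorm_mono fun x => ?_).trans key
          rw [norm_mul]
          refine mul_le_of_le_one_left (norm_nonneg _) ?_
          rwa [Real.norm_eq_abs, abs_of_nonneg (pow_nonneg ht1.1 _)]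
        · refine le_of_eq_of_le ?_ hP2
          have : (fun x : E3 => (t ^ n - 1) * w x) = (t ^ n - 1) • w := rfl
          rw [this, eLpNorm_const_smul]
          congr 1
          rw [← ofReal_norm, Real.norm_eq_abs, abs_sub_comm,
            abs_of_nonneg (by linarith)]
    _ = ε := ENNReal.add_halves ε

lemma norm_sub_tst_le {B : Box} (f : L2 B) {φ₁ φ₂ : E3 → ℝ} (h₁ : Continuous φ₁)
    (h₂ : Continuous φ₂) {ε : ℝ} (hε : 0 ≤ ε)
    (e₁ : eLpNorm (fun x => φ₁ x - Complex.reCLM (f x)) 2 B.vol ≤ ENNReal.ofReal ε)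
    (e₂ : eLpNorm (fun x => φ₂ x - Complex.imCLM (f x)) 2 B.vol ≤ ENNReal.ofReal ε) :
    ‖f - (tst B φ₁ 1 + tst B φ₂ Complex.I)‖ ≤ 2 * ε := by
  rw [Lp.norm_def]
  refine ENNReal.toReal_le_of_le_ofReal (by positivity) ?_
  have hre : AEStronglyMeasurable (fun x => φ₁ x - Complex.reCLM (f x)) B.vol :=
    h₁.aestronglyMeasurable.sub (Complex.reCLM.continuous.comp_aestronglyMeasurable
      (Lp.aestronglyMeasurable f))
  have him : AEStronglyMeasurable (fun x => φ₂ x - Complex.imCLM (f x)) B.vol :=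
    h₂.aestronglyMeasurable.sub (Complex.imCLM.continuous.comp_aestronglyMeasurable
      (Lp.aestronglyMeasurable f))
  have e : (f - (tst B φ₁ 1 + tst B φ₂ Complex.I) : L2 B) =ᵐ[B.vol]
      fun x => -((φ₁ x - Complex.reCLM (f x) : ℝ) : ℂ)
        + -(((φ₂ x - Complex.imCLM (f x) : ℝ) : ℂ) * Complex.I) := by
    filter_upwards [Lp.coeFn_sub f (tst B φ₁ 1 + tst B φ₂ Complex.I),
      Lp.coeFn_add (tst B φ₁ 1) (tst B φ₂ Complex.I), coeFn_tst (B := B) h₁ 1,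
      coeFn_tst (B := B) h₂ Complex.I] with x a1 a2 a3 a4
    rw [a1, Pi.sub_apply, a2, Pi.add_apply, a3, a4]
    apply Complex.ext <;> simp
  rw [eLpNorm_congr_ae e]
  refine (eLpNorm_add_le (by fun_prop) (by fun_prop) (by norm_num)).trans ?_
  rw [two_mul, ENNReal.ofReal_add hε hε]
  gcongr
  · refine le_of_eq_of_le (eLpNorm_congr_norm_ae ?_) e₁
    exact Filter.Eventually.of_forall fun x => by
      rw [norm_neg, Complex.norm_real]
  · refine le_of_eq_of_le (eLpNorm_congr_norm_ae ?_) e₂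
    exact Filter.Eventually.of_forall fun x => by
      rw [norm_neg, norm_mul, Complex.norm_real, Complex.norm_I, mul_one]

/-- Restrictions of smooth functions are dense in `H^m`. -/
theorem exists_ofSmooth_near {B : Box} {m : ℕ} (u : Hm B m) {ε : ℝ} (hε : 0 < ε) :
    ∃ (φ₁ φ₂ : E3 → ℝ) (h₁ : IsTest φ₁) (h₂ : IsTest φ₂),
      ‖u - (ofSmooth B m h₁.1 1 + ofSmooth B m h₂.1 Complex.I)‖ < ε := by
  set κ : ℝ := ε / (2 * ((multiIdx m).card + 1)) with hκ
  have hκ0 : 0 < κ := by positivity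
  have hκe : ENNReal.ofReal κ ≠ 0 := (ENNReal.ofReal_pos.2 hκ0).ne'
  obtain ⟨φ₁, h₁, a₁⟩ := exists_test_near Complex.reCLM u hκe
  obtain ⟨φ₂, h₂, a₂⟩ := exists_test_near Complex.imCLM u hκe
  refine ⟨φ₁, φ₂, h₁, h₂, ?_⟩
  calc _ ≤ ∑ α ∈ multiIdx m, ‖D α (u - (ofSmooth B m h₁.1 1 + ofSmooth B m h₂.1 Complex.I))‖ :=
        norm_Hm_le_sum _
    _ ≤ ∑ α ∈ multiIdx m, 2 * κ := by
        refine Finset.sum_le_sum fun α hα => ?_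
        rw [map_sub, map_add, D_ofSmooth _ _ hα, D_ofSmooth _ _ hα]
        exact norm_sub_tst_le _ (h₁.pdMulti α).continuous (h₂.pdMulti α).continuous hκ0.le
          (a₁ α hα) (a₂ α hα)
    _ = (multiIdx m).card * (2 * κ) := by simp
    _ < ((multiIdx m).card + 1) * (2 * κ) := by gcongr; linarith
    _ = ε := by rw [hκ]; field_simp

end

section

/-! ### Integration by parts -/

/-- The derivative `D^β u` as an element of a Sobolev space of lower order. -/
def shift {B : Box} {n : ℕ} (k : ℕ) (β : Fin 3 → ℕ) (h : ∑ i, β i + k ≤ n) (u : Hm B n) :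
    Hm B k :=
  Hm.mk' (fun α => D (β + α) u) fun α hα φ hφ hs => by
    rw [mem_multiIdx] at hα
    have hsum : ∑ i, (β + α) i = ∑ i, β i + ∑ i, α i := by
      simp only [Pi.add_apply, Finset.sum_add_distrib]
    have hβ : β ∈ multiIdx n := by rw [mem_multiIdx]; omega
    have hβα : β + α ∈ multiIdx n := by rw [mem_multiIdx, hsum]; omega
    have h1 := pair_pdMulti u hβ (hφ.pdMulti α) ((tsupport_pdMulti_subset α φ).trans hs)
    have h2 := pair_pdMulti u hβα hφ hs
    rw [pdMulti_add hφ.1, h1, hsum, pow_add, mul_assoc] at h2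
    rw [add_zero]
    exact mul_left_cancel₀ (by simp : ((-1 : ℂ)) ^ (∑ i, β i) ≠ 0) h2

lemma D_shift {B : Box} {n k : ℕ} {β : Fin 3 → ℕ} (h : ∑ i, β i + k ≤ n) (u : Hm B n)
    {α : Fin 3 → ℕ} (hα : α ∈ multiIdx k) : D α (shift k β h u) = D (β + α) u := D_mk' _ _ hα

lemma unitIdx_mem_multiIdx {m : ℕ} (hm : 1 ≤ m) (i : Fin 3) : unitIdx i ∈ multiIdx m := by
  rw [mem_multiIdx, sum_unitIdx]; exact hm

lemma sum_add_unitIdx (β : Fin 3 → ℕ) (l : Fin 3) :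
    ∑ k, (β + unitIdx l) k = (∑ k, β k) + 1 := by
  simp only [Pi.add_apply, Finset.sum_add_distrib, sum_unitIdx]

lemma continuous_mul_apply {w φ : E3 → ℝ} (hw : Continuous w) (hφ : Continuous φ) :
    Continuous fun x => w x * φ x := hw.mul hφ

lemma wip_tst {B : Box} {w φ : E3 → ℝ} (hw : Continuous w) (hφ : Continuous φ) (f : L2 B) (c : ℂ) :
    wip w f (tst B φ c) = ((starRingEnd ℂ) c * pair (fun x => w x * φ x) f).re := by
  rw [← inner_tst (continuous_mul_apply hw hφ), wip, real_inner_comm]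
  congr 1
  refine Lp.ext ?_
  filter_upwards [coeFn_mulL hw (tst B φ c), coeFn_tst (B := B) hφ c,
    coeFn_tst (B := B) (continuous_mul_apply hw hφ) c] with x h1 h2 h3
  rw [h1, h2, h3]; push_cast; ring

lemma wip_add_right {B : Box} (w : E3 → ℝ) (f g h : L2 B) :
    wip w f (g + h) = wip w f g + wip w f h := by
  rw [wip, map_add, inner_add_right]; rfl

lemma wip_add_left {B : Box} (w : E3 → ℝ) (f g h : L2 B) :
    wip w (f + g) h = wip w f h + wip w g h := by
  rw [wip, inner_add_left]; rfl

lemma wip_neg_right {B : Box} (w : E3 → ℝ) (f g : L2 B) : wip w f (-g) = -wip w f g := by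
  rw [wip, map_neg, inner_neg_right]; rfl

lemma wip_neg_left {B : Box} (w : E3 → ℝ) (f g : L2 B) : wip w (-f) g = -wip w f g := by
  rw [wip, inner_neg_left]; rfl

/-- For a test function $g$ the identity is the hypothesis applied to the test function $wg$. It is
linear and continuous in $g$, hence passes to $H^m$ by density. -/
lemma ibp_aux {B : Box} {i : Fin 3} {S : Set E3} {f f' : L2 B} (h : WeakDeriv i S f f') {m : ℕ}
    (hm : 1 ≤ m) (g : Hm B m) {w : E3 → ℝ} (hw : Smooth w) (hs : tsupport w ⊆ S) :
    wip w f (D (unitIdx i) g) + wip w f' (D 0 g) + wip (pd i w) f (D 0 g) = 0 := by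
  set T : Hm B m →L[ℝ] ℝ :=
    (innerSL ℝ f).comp ((mulL B w).comp (D (unitIdx i))) +
      (innerSL ℝ f').comp ((mulL B w).comp (D 0)) +
      (innerSL ℝ f).comp ((mulL B (pd i w)).comp (D 0)) with hT
  have hTg : ∀ g, T g = wip w f (D (unitIdx i) g) + wip w f' (D 0 g) + wip (pd i w) f (D 0 g) :=
    fun g => rfl
  rw [← hTg]
  have hgen : ∀ {φ : E3 → ℝ} (hφ : IsTest φ) (c : ℂ), T (ofSmooth B m hφ.1 c) = 0 := by
    intro φ hφ c
    rw [hTg, D_ofSmooth _ _ (unitIdx_mem_multiIdx hm i), D_ofSmooth _ _ (zero_mem_multiIdx m),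
      pdMulti_unitIdx hφ.1, pdMulti_zero, wip_tst hw.continuous (hφ.pd i).continuous,
      wip_tst hw.continuous hφ.continuous, wip_tst (hw.pd i).continuous hφ.continuous]
    have h1 := h _ (hφ.mul_left hw) (tsupport_mul_subset_left.trans hs)
    rw [pd_mul hw hφ.1] at h1
    have h2 : pair (fun x => w x * pd i φ x + pd i w x * φ x) f =
        pair (fun x => w x * pd i φ x) f + pair (fun x => pd i w x * φ x) f := by
      rw [pair, pair, pair, ← integral_add
        (integrable_pair (continuous_mul_apply hw.continuous (hφ.pd i).continuous) f)
        (integrable_pair (continuous_mul_apply (hw.pd i).continuous hφ.continuous) f)]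
      congr 1; ext x; push_cast; ring
    rw [h2] at h1
    rw [← Complex.add_re, ← Complex.add_re, ← mul_add, ← mul_add, ← add_right_comm, h1]
    simp
  -- If $Tg\ne0$, a combination of test functions closer to $g$ than $|Tg|/\|T\|$ contradicts that
  -- $T$ vanishes on it.
  by_contra hne
  have hT0 : T ≠ 0 := fun h0 => hne (by rw [h0]; rfl)
  obtain ⟨φ₁, φ₂, h₁, h₂, hn⟩ := exists_ofSmooth_near g
    (ε := |T g| / ‖T‖) (div_pos (abs_pos.2 hne) (norm_pos_iff.2 hT0))
  have := T.le_opNorm (g - (ofSmooth B m h₁.1 1 + ofSmooth B m h₂.1 Complex.I))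
  rw [map_sub, map_add, hgen h₁, hgen h₂, add_zero, sub_zero, Real.norm_eq_abs] at this
  rw [lt_div_iff₀ (norm_pos_iff.2 hT0), mul_comm] at hn
  exact absurd this (not_le.2 hn)

/-- Integration by parts against a derivative of a Sobolev function, with a smooth weight. -/
theorem ibp {B : Box} {i : Fin 3} {S : Set E3} {f f' : L2 B} (h : WeakDeriv i S f f') {n : ℕ}
    (u : Hm B n) {β : Fin 3 → ℕ} (hβ : ∑ k, β k + 1 ≤ n) {w : E3 → ℝ} (hw : Smooth w)
    (hs : tsupport w ⊆ S) :
    wip w f (D (β + unitIdx i) u) + wip w f' (D β u) + wip (pd i w) f (D β u) = 0 := by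
  have := ibp_aux h le_rfl (shift 1 β hβ u) hw hs
  rwa [D_shift _ _ (unitIdx_mem_multiIdx le_rfl i), D_shift _ _ (zero_mem_multiIdx 1),
    add_zero] at this

/-! ### Weights that depend on `z` -/

/-- A function of `z` as a function on the space. -/
def ofZ (ω : ℝ → ℝ) : E3 → ℝ := fun x => ω (x 2)

lemma smooth_ofZ {ω : ℝ → ℝ} (h : ContDiff ℝ (⊤ : ℕ∞) ω) : Smooth (ofZ ω) := smooth_coord h 2

lemma pd_ofZ {ω : ℝ → ℝ} (h : ContDiff ℝ (⊤ : ℕ∞) ω) : pd 2 (ofZ ω) = ofZ (deriv ω) := by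
  unfold ofZ; rw [pd_coord (h.differentiable (by simp))]; simp

lemma pd_ofZ_of_ne {ω : ℝ → ℝ} (h : ContDiff ℝ (⊤ : ℕ∞) ω) {i : Fin 3} (hi : i ≠ 2) :
    pd i (ofZ ω) = 0 := by
  unfold ofZ; rw [pd_coord (h.differentiable (by simp))]; ext x; simp [hi]

lemma wip_zero_weight {B : Box} (f h : L2 B) : wip 0 f h = 0 := by
  rw [wip_eq_integral (g := 0) continuous_const]; simp

lemma contDiff_deriv {ω : ℝ → ℝ} (h : ContDiff ℝ (⊤ : ℕ∞) ω) : ContDiff ℝ (⊤ : ℕ∞) (deriv ω) := by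
  have h1 : ContDiff ℝ ((⊤ : ℕ∞) + 1 : WithTop ℕ∞) ω := by simpa using h
  exact (contDiff_succ_iff_deriv.1 h1).2.2

/-- Weighted products. -/
abbrev wz {B : Box} (ω : ℝ → ℝ) (f h : L2 B) : ℝ := wip (ofZ ω) f h

section identities

variable {B : Box} {u : Hm B 3} {ω : ℝ → ℝ}

lemma unitIdx_ne {i j : Fin 3} (h : i ≠ j) : unitIdx i j = 0 := by
  unfold unitIdx; rw [Pi.single_apply, if_neg h.symm]

/-- Formally $2\int\omega u_zu_{ii}=-2\int\omega u_{iz}u_i=\int\omega' u_i^2$. No boundary terms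
arise, because $u_z$ vanishes on the faces orthogonal to $e_i$ and $u_i$ on those orthogonal to
$e_2$. -/
lemma wz_tangential_normal (hu : u ∈ zeroData B 3) (hω : ContDiff ℝ (⊤ : ℕ∞) ω) {i : Fin 3}
    (hi : i ≠ 2) : 2 * wz ω (D (unitIdx 2) u) (D (unitIdx i + unitIdx i) u) =
      wz (deriv ω) (D (unitIdx i) u) (D (unitIdx i) u) := by
  have hm : ∀ a b : Fin 3, unitIdx a + unitIdx b ∈ multiIdx 3 := fun a b => by
    rw [mem_multiIdx, sum_add_unitIdx, sum_unitIdx]; norm_num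
  have h1 := ibp (weakDeriv_zeroData_tangential hu i (unitIdx 2) (unitIdx_ne hi.symm) (hm _ _)) u
    (β := unitIdx i) (by rw [sum_unitIdx]; norm_num) (smooth_ofZ hω) (subset_univ _)
  have h2 := ibp (weakDeriv_zeroData_tangential hu 2 (unitIdx i) (unitIdx_ne hi) (hm _ _)) u
    (β := unitIdx i) (by rw [sum_unitIdx]; norm_num) (smooth_ofZ hω) (subset_univ _)
  rw [pd_ofZ_of_ne hω hi, wip_zero_weight, add_comm (unitIdx 2) (unitIdx i)] at h1
  rw [pd_ofZ hω, wip_comm (smooth_ofZ hω).continuous (D (unitIdx i) u)] at h2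
  linear_combination 2 * h1 - h2

lemma wz_zero_normal (hu : u ∈ zeroData B 3) (hω : ContDiff ℝ (⊤ : ℕ∞) ω) :
    2 * wz ω (D 0 u) (D (unitIdx 2) u) = -wz (deriv ω) (D 0 u) (D 0 u) := by
  have h1 := ibp (weakDeriv_zeroData hu 2) u
    (β := 0) (by simp) (smooth_ofZ hω) (subset_univ _)
  rw [pd_ofZ hω, zero_add, wip_comm (smooth_ofZ hω).continuous (D (unitIdx 2) u)] at h1
  linear_combination h1

lemma wz_zero_tangential (hu : u ∈ zeroData B 3) (hω : ContDiff ℝ (⊤ : ℕ∞) ω) {i : Fin 3}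
    (hi : i ≠ 2) : wz ω (D 0 u) (D (unitIdx i + unitIdx i) u) =
      -wz ω (D (unitIdx i) u) (D (unitIdx i) u) := by
  have h1 := ibp (weakDeriv_zeroData hu i) u
    (β := unitIdx i) (by rw [sum_unitIdx]; norm_num) (smooth_ofZ hω) (subset_univ _)
  rw [pd_ofZ_of_ne hω hi, wip_zero_weight] at h1
  linear_combination h1

lemma wz_zero_normal_two (hu : u ∈ zeroData B 3) (hω : ContDiff ℝ (⊤ : ℕ∞) ω) :
    wz ω (D 0 u) (D (unitIdx 2 + unitIdx 2) u) =
      -wz ω (D (unitIdx 2) u) (D (unitIdx 2) u) - wz (deriv ω) (D 0 u) (D (unitIdx 2) u) := by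
  have h1 := ibp (weakDeriv_zeroData hu 2) u
    (β := unitIdx 2) (by rw [sum_unitIdx]; norm_num) (smooth_ofZ hω) (subset_univ _)
  rw [pd_ofZ hω] at h1
  linear_combination h1

/-- Both derivatives are moved in turn: $u_{ii}$ vanishes on the faces orthogonal to $e_j$ and $u_j$
on those orthogonal to $e_i$. A third derivative occurs on the way, which is where $u\in H^3$
matters. The weight depends on $z$ only, so with $i\ne2$ it is differentiated at most in direction
$j$. -/
lemma wip_mixed (hu : u ∈ zeroData B 3) (hω : ContDiff ℝ (⊤ : ℕ∞) ω) {i j : Fin 3}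
    (hij : i ≠ j) (hi : i ≠ 2) :
    wz ω (D (unitIdx i + unitIdx i) u) (D (unitIdx j + unitIdx j) u) =
      wz ω (D (unitIdx i + unitIdx j) u) (D (unitIdx i + unitIdx j) u)
        - wip (pd j (ofZ ω)) (D (unitIdx i + unitIdx i) u) (D (unitIdx j) u) := by
  have hm : ∀ a b : Fin 3, unitIdx a + unitIdx b ∈ multiIdx 3 := fun a b => by
    rw [mem_multiIdx, sum_add_unitIdx, sum_unitIdx]; norm_num
  have hm3 : ∀ a b c : Fin 3, unitIdx a + unitIdx b + unitIdx c ∈ multiIdx 3 := fun a b c => by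
    rw [mem_multiIdx, sum_add_unitIdx, sum_add_unitIdx, sum_unitIdx]
  have h1 := ibp (weakDeriv_zeroData_tangential hu j (unitIdx i + unitIdx i)
    (by simp [unitIdx_ne hij]) (hm3 _ _ _)) u
    (β := unitIdx j) (by rw [sum_unitIdx]; norm_num) (smooth_ofZ hω) (subset_univ _)
  have h2 := ibp (weakDeriv_zeroData_tangential hu i (unitIdx j) (unitIdx_ne hij.symm) (hm _ _)) u
    (β := unitIdx i + unitIdx j) (by rw [sum_add_unitIdx, sum_unitIdx]) (smooth_ofZ hω)
    (subset_univ _)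
  rw [pd_ofZ_of_ne hω hi, wip_zero_weight, add_comm (unitIdx j) (unitIdx i),
    add_right_comm (unitIdx i) (unitIdx j), wip_comm (smooth_ofZ hω).continuous (D (unitIdx j) u)] at h2
  linear_combination h1 - h2

lemma wip_self_nonneg {w : E3 → ℝ} (hw : Continuous w) (h : ∀ x ∈ B.domain, 0 ≤ w x) (f : L2 B) :
    0 ≤ wip w f f := by
  rw [wip_eq_integral hw]
  refine integral_nonneg_of_ae (Box.ae_vol fun x hx => ?_)
  refine mul_nonneg (h x hx) ?_
  rw [← Complex.normSq_eq_conj_mul_self, Complex.ofReal_re]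
  exact Complex.normSq_nonneg _

lemma wip_add_weight {w w' : E3 → ℝ} (hw : Continuous w) (hw' : Continuous w') (f h : L2 B) :
    wip (fun x => w x + w' x) f h = wip w f h + wip w' f h := by
  rw [wip, mulL_add_weight hw hw', inner_add_right]; rfl

-- Integration by parts of $2\omega u_zu_{zz}$ leaves $\int\omega u_z^2$ over the face $z=d$, where
-- $u_z$ is unknown. This term is nonnegative because $\omega\ge0$, so it can be dropped. The
-- decreasing cutoffs realize this: their derivative times $\omega$ has a sign.
open Filter Topology in
lemma wz_normal_normal (hu : u ∈ zeroData B 3) (hω : ContDiff ℝ (⊤ : ℕ∞) ω)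
    (h0 : ∀ t ∈ Ioo (-B.ξ) B.d, 0 ≤ ω t) : -wz (deriv ω) (D (unitIdx 2) u) (D (unitIdx 2) u) ≤
      2 * wz ω (D (unitIdx 2) u) (D (unitIdx 2 + unitIdx 2) u) := by
  have hW := weakDeriv_zeroData_normal hu
  rw [two_smul] at hW
  set f := D (unitIdx 2) u
  set f' := D (unitIdx 2 + unitIdx 2) u
  set χ : ℕ → ℝ → ℝ := fun n => cutHi B.d n with hχ
  have hχs : ∀ n, ContDiff ℝ (⊤ : ℕ∞) (χ n) := fun n => cutHi_contDiff _ n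
  have key : ∀ n, -wip (fun x => ofZ (χ n) x * ofZ (deriv ω) x) f f ≤
      2 * wip (fun x => ofZ (χ n) x * ofZ ω x) f f' := by
    intro n
    have hsm := (smooth_ofZ (hχs n)).mul (smooth_ofZ hω)
    have h1 := ibp hW u (β := unitIdx 2) (by rw [sum_unitIdx]; norm_num)
      (w := fun x => ofZ (χ n) x * ofZ ω x) hsm
      (tsupport_mul_subset_left.trans (tsupport_cutHi _ n 2))
    rw [pd_mul (smooth_ofZ (hχs n)) (smooth_ofZ hω), pd_ofZ hω, pd_ofZ (hχs n),
      wip_add_weight (continuous_mul_apply (smooth_ofZ (hχs n)).continuous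
        (smooth_ofZ (contDiff_deriv hω)).continuous)
      (continuous_mul_apply (smooth_ofZ (contDiff_deriv (hχs n))).continuous
        (smooth_ofZ hω).continuous),
      wip_comm hsm.continuous f' (D (unitIdx 2) u)] at h1
    have h2 : 0 ≤ wip (fun x => -(ofZ (deriv (χ n)) x * ofZ ω x)) f f := by
      refine wip_self_nonneg ?_ (fun x hx => ?_) f
      · exact (((smooth_ofZ (contDiff_deriv (hχs n))).continuous).mul
          (smooth_ofZ hω).continuous).neg
      · rw [neg_nonneg]
        exact mul_nonpos_of_nonpos_of_nonneg ((cutHi_antitone B.d n).deriv_nonpos)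
          (h0 _ ⟨hx.2.2.1, hx.2.2.2⟩)
    have h3 : wip (fun x => -(ofZ (deriv (χ n)) x * ofZ ω x)) f f =
        -wip (fun x => ofZ (deriv (χ n)) x * ofZ ω x) f f := by
      have hc := ((smooth_ofZ (contDiff_deriv (hχs n))).continuous).mul (smooth_ofZ hω).continuous
      have e1 := wip_eq_integral (g := fun x => -(ofZ (deriv (χ n)) x * ofZ ω x)) hc.neg f f
      have e2 := wip_eq_integral (g := fun x => (ofZ (deriv (χ n)) x * ofZ ω x)) hc f f
      rw [e1, e2, ← integral_neg]
      congr 1; ext x; ring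
    linarith
  have hb : ∀ n (x : E3), |ofZ (χ n) x| ≤ 1 := fun n x => by
    rw [ofZ, abs_of_nonneg (cutHi_nonneg _ _ _)]; exact cutHi_le_one _ _ _
  have hlim : ∀ x ∈ B.domain, Tendsto (fun n => ofZ (χ n) x) atTop (𝓝 1) := fun x hx =>
    tendsto_cutHi hx.2.2.2
  have hc := fun n => (smooth_ofZ (hχs n)).continuous
  exact le_of_tendsto_of_tendsto'
    (tendsto_wip (smooth_ofZ (contDiff_deriv hω)).continuous hc hb hlim f f).neg
    ((tendsto_wip (smooth_ofZ hω).continuous hc hb hlim f f').const_mul 2) key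

end identities

end

section

/-! ### The Carleman estimate -/

/-- An admissible exponent of the weight: decreasing and strictly convex along the box. -/
structure CarlemanWeight (B : Box) where
  (ψ ψ₁ ψ₂ ψ₃ ψ₄ : ℝ → ℝ)
  smooth : ContDiff ℝ (⊤ : ℕ∞) ψ
  deriv₁ : ∀ z, HasDerivAt ψ (ψ₁ z) z
  deriv₂ : ∀ z, HasDerivAt ψ₁ (ψ₂ z) z
  deriv₃ : ∀ z, HasDerivAt ψ₂ (ψ₃ z) z
  deriv₄ : ∀ z, HasDerivAt ψ₃ (ψ₄ z) z
  (κ M : ℝ)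
  κ_pos : 0 < κ
  le₁ : ∀ z ∈ Ioo (-B.ξ) B.d, κ ≤ -ψ₁ z
  le₂ : ∀ z ∈ Ioo (-B.ξ) B.d, κ ≤ ψ₂ z
  abs₁ : ∀ z ∈ Ioo (-B.ξ) B.d, |ψ₁ z| ≤ M
  abs₂ : ∀ z ∈ Ioo (-B.ξ) B.d, |ψ₂ z| ≤ M
  abs₃ : ∀ z ∈ Ioo (-B.ξ) B.d, |ψ₃ z| ≤ M
  abs₄ : ∀ z ∈ Ioo (-B.ξ) B.d, |ψ₄ z| ≤ M

namespace CarlemanWeight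

variable {B : Box} (w : CarlemanWeight B)

lemma smooth₁ : ContDiff ℝ (⊤ : ℕ∞) w.ψ₁ := by
  rw [← funext fun z => (w.deriv₁ z).deriv]; exact contDiff_deriv w.smooth

lemma smooth₂ : ContDiff ℝ (⊤ : ℕ∞) w.ψ₂ := by
  rw [← funext fun z => (w.deriv₂ z).deriv]; exact contDiff_deriv w.smooth₁

lemma smooth₃ : ContDiff ℝ (⊤ : ℕ∞) w.ψ₃ := by
  rw [← funext fun z => (w.deriv₃ z).deriv]; exact contDiff_deriv w.smooth₂

lemma smooth₄ : ContDiff ℝ (⊤ : ℕ∞) w.ψ₄ := by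
  rw [← funext fun z => (w.deriv₄ z).deriv]; exact contDiff_deriv w.smooth₃

/-- The weight `exp (2 λ ψ)`. -/
def φ (lam : ℝ) : ℝ → ℝ := fun z => Real.exp (2 * lam * w.ψ z)

/-- The square root of the weight, `exp (λ ψ)`. -/
def e (lam : ℝ) : ℝ → ℝ := fun z => Real.exp (lam * w.ψ z)

lemma smooth_e (lam : ℝ) : ContDiff ℝ (⊤ : ℕ∞) (w.e lam) :=
  (contDiff_const.mul w.smooth).exp

/-- Multiplication by `exp (λ ψ)`. -/
def E (lam : ℝ) : L2 B →L[ℝ] L2 B := mulL B (ofZ (w.e lam))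

lemma smooth_φ (lam : ℝ) : ContDiff ℝ (⊤ : ℕ∞) (w.φ lam) :=
  (contDiff_const.mul w.smooth).exp

lemma φ_pos (lam z : ℝ) : 0 < w.φ lam z := Real.exp_pos _

lemma hasDerivAt_φ (lam z : ℝ) : HasDerivAt (w.φ lam) (w.φ lam z * (2 * lam * w.ψ₁ z)) z :=
  ((w.deriv₁ z).const_mul (2 * lam)).exp

lemma hasDerivAt_φ_mul (lam : ℝ) {g : ℝ → ℝ} {g' z : ℝ} (hg : HasDerivAt g g' z) :
    HasDerivAt (fun z => w.φ lam z * g z) (w.φ lam z * (g' + 2 * lam * w.ψ₁ z * g z)) z := by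
  have := (w.hasDerivAt_φ lam z).mul hg
  convert! this using 1; ring

/-- Products with the weight `exp (2 λ ψ) g`. -/
def q (lam : ℝ) (g : ℝ → ℝ) (f h : L2 B) : ℝ := wz (fun z => w.φ lam z * g z) f h

lemma norm_E_sq (lam : ℝ) (f : L2 B) : ‖w.E lam f‖ ^ 2 = w.q lam (fun _ => 1) f f := by
  have hc := (smooth_ofZ (w.smooth_e lam)).continuous
  rw [← real_inner_self_eq_norm_sq, E, inner_mulL hc, wip, mulL_mulL hc hc]
  show wip _ f f = wip _ f f
  congr 1
  ext x
  simp only [ofZ, CarlemanWeight.e, φ, mul_one, ← Real.exp_add]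
  congr 1; ring

variable {w}

lemma q_add {lam : ℝ} {g g' : ℝ → ℝ} (hg : Continuous g) (hg' : Continuous g') (f h : L2 B) :
    w.q lam (fun z => g z + g' z) f h = w.q lam g f h + w.q lam g' f h := by
  have hc := (w.smooth_φ lam).continuous
  have hz : Continuous fun x : E3 => x 2 := by fun_prop
  have := wip_add_weight (B := B) (w := ofZ fun z => w.φ lam z * g z)
    (w' := ofZ fun z => w.φ lam z * g' z) ((continuous_mul_apply (hc.comp hz) (hg.comp hz)))
    ((continuous_mul_apply (hc.comp hz) (hg'.comp hz))) f h
  rw [q, q, q, wz, wz, wz, ← this]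
  congr 1; ext x; simp only [ofZ]; ring

lemma q_const_mul {lam : ℝ} {g : ℝ → ℝ} (hg : Continuous g) (c : ℝ) (f h : L2 B) :
    w.q lam (fun z => c * g z) f h = c * w.q lam g f h := by
  have hc := (w.smooth_φ lam).continuous
  have hz : Continuous fun x : E3 => x 2 := by fun_prop
  have h1 : Continuous (ofZ fun z => w.φ lam z * g z) :=
    continuous_mul_apply (hc.comp hz) (hg.comp hz)
  have h2 : Continuous (ofZ fun z => w.φ lam z * (c * g z)) :=
    continuous_mul_apply (hc.comp hz) ((continuous_const.mul hg).comp hz)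
  rw [q, q, wz, wz, wip_eq_integral h1, wip_eq_integral h2, ← integral_const_mul]
  congr 1; ext x; simp only [ofZ]; ring

/-- Pointwise positivity of the real form is applied to the real and the imaginary parts separately.
-/
lemma q_quadForm_nonneg {lam : ℝ} {g₀ g₁ g₂ : ℝ → ℝ} (h₀ : Continuous g₀) (h₁ : Continuous g₁)
    (h₂ : Continuous g₂)
    (H : ∀ z ∈ Ioo (-B.ξ) B.d, ∀ s t : ℝ, 0 ≤ g₂ z * s ^ 2 + g₁ z * (t * s) + g₀ z * t ^ 2)
    (f h : L2 B) : 0 ≤ w.q lam g₂ f f + w.q lam g₁ h f + w.q lam g₀ h h := by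
  have hc := (w.smooth_φ lam).continuous
  have hz : Continuous fun x : E3 => x 2 := by fun_prop
  have hh : ∀ {g : ℝ → ℝ}, Continuous g → Continuous (ofZ fun z => w.φ lam z * g z) := fun hg =>
    continuous_mul_apply (hc.comp hz) (hg.comp hz)
  rw [q, q, q, wz, wz, wz, wip_eq_integral (hh h₀), wip_eq_integral (hh h₁),
    wip_eq_integral (hh h₂), ← integral_add (integrable_wip (hh h₂) _ _)
      (integrable_wip (hh h₁) _ _)]
  have i₂₁ : Integrable (fun x => ofZ (fun z => w.φ lam z * g₂ z) x *
      ((starRingEnd ℂ) (f x) * f x).re + ofZ (fun z => w.φ lam z * g₁ z) x *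
      ((starRingEnd ℂ) (h x) * f x).re) B.vol :=
    (integrable_wip (hh h₂) f f).add (integrable_wip (hh h₁) h f)
  rw [← integral_add i₂₁ (integrable_wip (hh h₀) _ _)]
  refine integral_nonneg_of_ae (Box.ae_vol fun x hx => ?_)
  have hp := w.φ_pos lam (x 2)
  have H1 := H (x 2) ⟨hx.2.2.1, hx.2.2.2⟩ (f x).re (h x).re
  have H2 := H (x 2) ⟨hx.2.2.1, hx.2.2.2⟩ (f x).im (h x).im
  have := mul_nonneg hp.le (add_nonneg H1 H2)
  simp only [ofZ, Pi.zero_apply, Complex.mul_re, Complex.conj_re, Complex.conj_im]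
  refine this.trans (le_of_eq ?_)
  ring

lemma wip_mulL_left {g v : E3 → ℝ} (hg : Continuous g) (hv : Continuous v) (f h : L2 B) :
    wip v (mulL B g f) h = wip (fun x => v x * g x) f h := by
  rw [wip, inner_mulL hg, wip, mulL_mulL hg hv, wip]
  simp_rw [mul_comm]

lemma q_mulL_left {lam : ℝ} {g v : ℝ → ℝ} (hg : Continuous g) (hv : Continuous v) (f h : L2 B) :
    w.q lam v (mulL B (ofZ g) f) h = w.q lam (fun z => v z * g z) f h := by
  have hc := (w.smooth_φ lam).continuous
  have hz : Continuous fun x : E3 => x 2 := by fun_prop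
  have hg' : Continuous (ofZ g) := hg.comp hz
  have hv' : Continuous (ofZ fun z => w.φ lam z * v z) :=
    continuous_mul_apply (hc.comp hz) (hv.comp hz)
  rw [q, wz, wip_mulL_left hg' hv', q, wz]
  congr 1; ext x; simp only [ofZ]; ring

lemma q_add_left {lam : ℝ} (g : ℝ → ℝ) (f f' h : L2 B) :
    w.q lam g (f + f') h = w.q lam g f h + w.q lam g f' h := wip_add_left _ _ _ _

lemma q_add_right {lam : ℝ} (g : ℝ → ℝ) (f f' h : L2 B) :
    w.q lam g h (f + f') = w.q lam g h f + w.q lam g h f' := wip_add_right _ _ _ _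

lemma q_comm {lam : ℝ} {g : ℝ → ℝ} (hg : Continuous g) (f h : L2 B) :
    w.q lam g f h = w.q lam g h f :=
  wip_comm (continuous_mul_apply ((w.smooth_φ lam).continuous.comp (by fun_prop))
    (hg.comp (by fun_prop))) _ _

/-- This is $0\le\|E(f-h)\|^2$. With $f=\Delta u$ and $h$ a first order multiplier, only explicit
quadratic forms in $u$ and its derivatives remain to be computed. -/
lemma two_inner_le (lam : ℝ) (f h : L2 B) :
    2 * w.q lam (fun _ => 1) h f - w.q lam (fun _ => 1) h h ≤ w.q lam (fun _ => 1) f f := by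
  have h1 : 0 ≤ w.q lam (fun _ => 1) (f + -h) (f + -h) := by
    rw [← norm_E_sq]; positivity
  have hn1 : ∀ a b : L2 B, w.q lam (fun _ => 1) (-a) b = -w.q lam (fun _ => 1) a b :=
    fun a b => wip_neg_left _ _ _
  have hn2 : ∀ a b : L2 B, w.q lam (fun _ => 1) a (-b) = -w.q lam (fun _ => 1) a b :=
    fun a b => wip_neg_right _ _ _
  rw [q_add_left, q_add_right, q_add_right, hn1, hn2, hn1, hn2,
    q_comm continuous_const f h] at h1
  linarith

lemma lap_eq {m : ℕ} (u : Hm B m) : lap u = D (unitIdx 0 + unitIdx 0) u +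
    D (unitIdx 1 + unitIdx 1) u + D (unitIdx 2 + unitIdx 2) u := by
  simp only [lap, Fin.sum_univ_three, two_smul]


lemma q_tangential_normal {u : Hm B 3} (hu : u ∈ zeroData B 3) (lam : ℝ) {g g' : ℝ → ℝ} (hs : ContDiff ℝ (⊤ : ℕ∞) g)
    (hg : ∀ z, HasDerivAt g (g' z) z) {i : Fin 3} (hi : i ≠ 2) :
    2 * w.q lam g (D (unitIdx 2) u) (D (unitIdx i + unitIdx i) u) =
      w.q lam (fun z => g' z + 2 * lam * w.ψ₁ z * g z) (D (unitIdx i) u) (D (unitIdx i) u) := by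
  have := wz_tangential_normal hu ((w.smooth_φ lam).mul hs) hi
  rw [funext fun z => (w.hasDerivAt_φ_mul lam (hg z)).deriv] at this
  exact this


lemma q_zero_normal {u : Hm B 3} (hu : u ∈ zeroData B 3) (lam : ℝ) {g g' : ℝ → ℝ} (hs : ContDiff ℝ (⊤ : ℕ∞) g)
    (hg : ∀ z, HasDerivAt g (g' z) z) :
    2 * w.q lam g (D 0 u) (D (unitIdx 2) u) =
      -w.q lam (fun z => g' z + 2 * lam * w.ψ₁ z * g z) (D 0 u) (D 0 u) := by
  have := wz_zero_normal hu ((w.smooth_φ lam).mul hs)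
  rw [funext fun z => (w.hasDerivAt_φ_mul lam (hg z)).deriv] at this
  exact this

lemma q_zero_tangential {u : Hm B 3} (hu : u ∈ zeroData B 3) (lam : ℝ) {g : ℝ → ℝ} (hs : ContDiff ℝ (⊤ : ℕ∞) g) {i : Fin 3} (hi : i ≠ 2) :
    w.q lam g (D 0 u) (D (unitIdx i + unitIdx i) u) =
      -w.q lam g (D (unitIdx i) u) (D (unitIdx i) u) :=
  wz_zero_tangential hu ((w.smooth_φ lam).mul hs) hi

lemma q_zero_normal_two {u : Hm B 3} (hu : u ∈ zeroData B 3) (lam : ℝ) {g g' : ℝ → ℝ} (hs : ContDiff ℝ (⊤ : ℕ∞) g)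
    (hg : ∀ z, HasDerivAt g (g' z) z) :
    w.q lam g (D 0 u) (D (unitIdx 2 + unitIdx 2) u) =
      -w.q lam g (D (unitIdx 2) u) (D (unitIdx 2) u) -
        w.q lam (fun z => g' z + 2 * lam * w.ψ₁ z * g z) (D 0 u) (D (unitIdx 2) u) := by
  have := wz_zero_normal_two hu ((w.smooth_φ lam).mul hs)
  rw [funext fun z => (w.hasDerivAt_φ_mul lam (hg z)).deriv] at this
  exact this

lemma q_normal_normal {u : Hm B 3} (hu : u ∈ zeroData B 3) (lam : ℝ) {g g' : ℝ → ℝ} (hs : ContDiff ℝ (⊤ : ℕ∞) g)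
    (hg : ∀ z, HasDerivAt g (g' z) z) (h0 : ∀ z ∈ Ioo (-B.ξ) B.d, 0 ≤ g z) :
    -w.q lam (fun z => g' z + 2 * lam * w.ψ₁ z * g z) (D (unitIdx 2) u) (D (unitIdx 2) u) ≤
      2 * w.q lam g (D (unitIdx 2) u) (D (unitIdx 2 + unitIdx 2) u) := by
  have := wz_normal_normal hu ((w.smooth_φ lam).mul hs)
    fun z hz => mul_nonneg (w.φ_pos lam z).le (h0 z hz)
  rw [funext fun z => (w.hasDerivAt_φ_mul lam (hg z)).deriv] at this
  exact this

lemma q_mixed_tangential {u : Hm B 3} (hu : u ∈ zeroData B 3) (lam : ℝ) {i j : Fin 3} (hij : i ≠ j) (hi : i ≠ 2) (hj : j ≠ 2) :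
    w.q lam (fun _ => 1) (D (unitIdx i + unitIdx i) u) (D (unitIdx j + unitIdx j) u) =
      w.q lam (fun _ => 1) (D (unitIdx i + unitIdx j) u) (D (unitIdx i + unitIdx j) u) := by
  have hs := (w.smooth_φ lam).mul (contDiff_const (c := (1 : ℝ)))
  have := wip_mixed hu hs hij hi
  rw [pd_ofZ_of_ne hs hj, wip_zero_weight, sub_zero] at this
  exact this

/-- Moving $\partial_z$ hits the weight and leaves a product $u_{ii}u_z$; by `q_tangential_normal`
it is a quadratic form in the tangential derivative $u_i$ alone. -/
lemma q_mixed_normal {u : Hm B 3} (hu : u ∈ zeroData B 3) (lam : ℝ) {i : Fin 3} (hi : i ≠ 2) :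
    w.q lam (fun _ => 1) (D (unitIdx i + unitIdx i) u) (D (unitIdx 2 + unitIdx 2) u) =
      w.q lam (fun _ => 1) (D (unitIdx i + unitIdx 2) u) (D (unitIdx i + unitIdx 2) u)
      - w.q lam (fun z => 2 * lam * w.ψ₂ z + 2 * lam * w.ψ₁ z * (2 * lam * w.ψ₁ z))
          (D (unitIdx i) u) (D (unitIdx i) u) / 2 := by
  have hs := (w.smooth_φ lam).mul (contDiff_const (c := (1 : ℝ)))
  have h1 := wip_mixed hu hs hi hi
  have hd : deriv (fun z => w.φ lam z * 1) = fun z => w.φ lam z * (2 * lam * w.ψ₁ z) := by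
    ext z
    simpa using (w.hasDerivAt_φ lam z).deriv
  rw [pd_ofZ hs, hd] at h1
  have h2 := q_tangential_normal (w := w) hu lam (g := fun z => 2 * lam * w.ψ₁ z)
    (contDiff_const.mul w.smooth₁) (fun z => (w.deriv₂ z).const_mul (2 * lam)) hi
  have h3 := q_comm (w := w) (lam := lam) (g := fun z => 2 * lam * w.ψ₁ z)
    (continuous_const.mul w.smooth₁.continuous) (D (unitIdx 2) u) (D (unitIdx i + unitIdx i) u)
  have h4 : wip (ofZ fun z => w.φ lam z * (2 * lam * w.ψ₁ z)) (D (unitIdx i + unitIdx i) u)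
      (D (unitIdx 2) u) = w.q lam (fun z => 2 * lam * w.ψ₁ z) (D (unitIdx i + unitIdx i) u)
      (D (unitIdx 2) u) := rfl
  rw [h4] at h1
  have h5 : ∀ a b : L2 B, wip (ofZ fun z => w.φ lam z * 1) a b = w.q lam (fun _ => 1) a b :=
    fun _ _ => rfl
  rw [← h5, ← h5]
  linarith

lemma q_lin (lam : ℝ) {g₁ g₂ g₃ g₄ : ℝ → ℝ} (h₁ : Continuous g₁) (h₂ : Continuous g₂) (h₃ : Continuous g₃)
    (h₄ : Continuous g₄) (c₁ c₂ c₃ c₄ : ℝ) (f h : L2 B) :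
    w.q lam (fun z => c₁ * g₁ z + c₂ * g₂ z + c₃ * g₃ z + c₄ * g₄ z) f h =
      c₁ * w.q lam g₁ f h + c₂ * w.q lam g₂ f h + c₃ * w.q lam g₃ f h + c₄ * w.q lam g₄ f h := by
  rw [q_add (by fun_prop) (by fun_prop), q_add (by fun_prop) (by fun_prop),
    q_add (by fun_prop) (by fun_prop), q_const_mul h₁, q_const_mul h₂, q_const_mul h₃,
    q_const_mul h₄]



end CarlemanWeight

end

/-! ### Proof of the Carleman estimate: first order terms, then the Hessian. -/

section

namespace CarlemanWeight

variable {B : Box} {w : CarlemanWeight B}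

/-- Here $s,t$ stand for $u_z,u$, and $a_j$ for $\psi^{(j)}$. The form is a sum of two squares and a
multiple of $t^2$ with leading part $2l^3a_1^2a_2$, positive by convexity of $\psi$. The square with
the factor $cl$ cancels the mixed term that the correction $-2cl$ creates in the first one. -/
lemma quadForm_nonneg_aux {κ M c l a₁ a₂ a₃ a₄ : ℝ} (hκ : 0 < κ) (hc0 : 0 < c) (hc1 : c ≤ κ)
    (hc2 : c * (1 + 2 * M ^ 2) ≤ κ ^ 3) (hl1 : 1 ≤ l) (hl2 : 4 * M ^ 2 + 2 * M ≤ l * κ ^ 3)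
    (b₁ : κ ≤ -a₁) (b₂ : κ ≤ a₂) (h₁ : |a₁| ≤ M) (h₂ : |a₂| ≤ M) (h₃ : |a₃| ≤ M) (h₄ : |a₄| ≤ M)
    (s t : ℝ) :
    0 ≤ (4 * l ^ 2 * a₁ ^ 2 + 6 * l * a₂ - 2 * (c * l)) * (s - -(l * a₁) * t) ^ 2
      + c * l * (s - 2 * (-(l * a₁) * t)) ^ 2
      + l * (2 * l ^ 2 * (a₁ ^ 2 * a₂) - 2 * l * (a₁ * a₃ + a₂ ^ 2) - 2 * a₄
        - c * l ^ 2 * (1 + 2 * a₁ ^ 2)) * t ^ 2 := by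
  have hl0 : 0 < l := by linarith
  have hM : 0 ≤ M := (abs_nonneg _).trans h₁
  have q1 : a₁ ^ 2 ≤ M ^ 2 := sq_le_sq' (abs_le.1 h₁).1 (abs_le.1 h₁).2
  have q2 : a₂ ^ 2 ≤ M ^ 2 := sq_le_sq' (abs_le.1 h₂).1 (abs_le.1 h₂).2
  have q3 : a₁ * a₃ ≤ M ^ 2 := by
    have := sq_le_sq' (abs_le.1 h₃).1 (abs_le.1 h₃).2
    linarith [sq_nonneg (a₁ - a₃), sub_sq a₁ a₃]
  have q4 : κ ^ 3 ≤ a₁ ^ 2 * a₂ := by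
    have : κ ^ 2 ≤ a₁ ^ 2 := sq_le_sq.2 (by rw [abs_of_pos hκ]; exact b₁.trans (neg_le_abs _))
    calc κ ^ 3 = κ ^ 2 * κ := by ring
      _ ≤ _ := by gcongr
  have q5 : c * (1 + 2 * a₁ ^ 2) ≤ κ ^ 3 := le_trans (by gcongr) hc2
  have q6 : a₄ ≤ M := (le_abs_self _).trans h₄
  have p1 : 0 ≤ 4 * l ^ 2 * a₁ ^ 2 + 6 * l * a₂ - 2 * (c * l) := by
    have : 0 ≤ l * (6 * a₂ - 2 * c) := mul_nonneg hl0.le (by linarith)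
    nlinarith [sq_nonneg (l * a₁)]
  have p2 : 0 ≤ 2 * l ^ 2 * (a₁ ^ 2 * a₂) - 2 * l * (a₁ * a₃ + a₂ ^ 2) - 2 * a₄
      - c * l ^ 2 * (1 + 2 * a₁ ^ 2) := by
    have r1 : l ^ 2 * κ ^ 3 ≤ l ^ 2 * (a₁ ^ 2 * a₂) := by gcongr
    have r2 : l ^ 2 * (c * (1 + 2 * a₁ ^ 2)) ≤ l ^ 2 * κ ^ 3 := by gcongr
    have r3 : l * (a₁ * a₃ + a₂ ^ 2) ≤ l * (M ^ 2 + M ^ 2) := by gcongr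
    have r4 : l * (4 * M ^ 2 + 2 * M) ≤ l * (l * κ ^ 3) := by gcongr
    have r5 : 2 * M ≤ l * (2 * M) := le_mul_of_one_le_left (by linarith) hl1
    nlinarith
  positivity

/-- The part of the Carleman estimate that concerns derivatives of order at most one. -/
lemma carleman_first_order (w : CarlemanWeight B) : ∃ c lam₀ : ℝ, 0 < c ∧ 1 ≤ lam₀ ∧
    ∀ lam, lam₀ ≤ lam → ∀ u : Hm B 3, u ∈ zeroData B 3 →
      c * (lam * ∑ i, ‖w.E lam (D (unitIdx i) u)‖ ^ 2 + lam ^ 3 * ‖w.E lam (D 0 u)‖ ^ 2) ≤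
        ‖w.E lam (lap u)‖ ^ 2 := by
  have hκ := w.κ_pos
  -- The first entry keeps the coefficients of the squares nonnegative; the second lets the losses
  -- proportional to $c$ use up at most half of the leading term $2\lambda^3\psi'^2\psi''$.
  set c : ℝ := min w.κ (w.κ ^ 3 / (1 + 2 * w.M ^ 2)) with hc
  have hc0 : 0 < c := by positivity
  have hc1 : c ≤ w.κ := min_le_left _ _
  have hc2 : c * (1 + 2 * w.M ^ 2) ≤ w.κ ^ 3 := by
    rw [← le_div_iff₀ (by positivity)]; exact min_le_right _ _
  refine ⟨c, max 1 ((4 * w.M ^ 2 + 2 * w.M) / w.κ ^ 3), hc0, le_max_left _ _, ?_⟩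
  intro lam hlam u hu
  have hl1 : 1 ≤ lam := (le_max_left _ _).trans hlam
  have hl0 : 0 < lam := by linarith
  have hl2 : 4 * w.M ^ 2 + 2 * w.M ≤ lam * w.κ ^ 3 := by
    rw [← div_le_iff₀ (by positivity)]; exact (le_max_right _ _).trans hlam
  have s1 := w.smooth₁
  have s2 := w.smooth₂
  have s3 := w.smooth₃
  have s4 := w.smooth₄
  have k1 := s1.continuous
  have k2 := s2.continuous
  have k3 := s3.continuous
  have k4 := s4.continuous
  -- the multiplier and the derivatives of its coefficients
  set α : ℝ → ℝ := fun z => -(2 * lam) * w.ψ₁ z with hα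
  set α' : ℝ → ℝ := fun z => -(2 * lam) * w.ψ₂ z with hα'
  -- The antisymmetric part of the Laplacian conjugated with $e^{\lambda\psi}$ would have
  -- $-\lambda\psi''$ as its last term. The second copy of it yields
  -- $T\alpha-2\beta=2\lambda\psi''>0$, which controls the tangential derivatives.
  set β : ℝ → ℝ := fun z => -(2 * lam ^ 2) * w.ψ₁ z ^ 2 - 2 * lam * w.ψ₂ z with hβ
  set β' : ℝ → ℝ := fun z => -(4 * lam ^ 2) * (w.ψ₁ z * w.ψ₂ z) - 2 * lam * w.ψ₃ z with hβ'
  -- For zero data $2\int\phi\,k\,uu_z+\int(\phi k)'u^2=0$. Adding this vanishing quantity with the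
  -- present $k$ turns the form in $(u_z,u)$ into the one of `quadForm_nonneg_aux`.
  set k : ℝ → ℝ := fun z => 4 * lam ^ 3 * w.ψ₁ z ^ 3 + 2 * lam ^ 2 * (w.ψ₁ z * w.ψ₂ z)
    - 2 * lam * w.ψ₃ z with hk
  set k' : ℝ → ℝ := fun z => 12 * lam ^ 3 * (w.ψ₁ z ^ 2 * w.ψ₂ z)
    + 2 * lam ^ 2 * (w.ψ₂ z ^ 2 + w.ψ₁ z * w.ψ₃ z) - 2 * lam * w.ψ₄ z with hk'
  have sα : ContDiff ℝ (⊤ : ℕ∞) α := by fun_prop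
  have sβ : ContDiff ℝ (⊤ : ℕ∞) β := by fun_prop
  have sk : ContDiff ℝ (⊤ : ℕ∞) k := by fun_prop
  have dα : ∀ z, HasDerivAt α (α' z) z := fun z => (w.deriv₂ z).const_mul _
  have dβ : ∀ z, HasDerivAt β (β' z) z := fun z => by
    have := (((w.deriv₂ z).pow 2).const_mul (-(2 * lam ^ 2))).sub ((w.deriv₃ z).const_mul (2 * lam))
    convert! this using 1
    simp only [hβ']; push_cast; ring
  have dk : ∀ z, HasDerivAt k (k' z) z := fun z => by
    have := ((((w.deriv₂ z).pow 3).const_mul (4 * lam ^ 3)).add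
      (((w.deriv₂ z).mul (w.deriv₃ z)).const_mul (2 * lam ^ 2))).sub
      ((w.deriv₄ z).const_mul (2 * lam))
    convert! this using 1
    simp only [hk']; push_cast; ring
  -- In general $Tg=g'+2\lambda\psi'g$, which is the derivative of $e^{2\lambda\psi}g$ divided by
  -- the weight.
  set Tα : ℝ → ℝ := fun z => α' z + 2 * lam * w.ψ₁ z * α z with hTα
  set Tβ : ℝ → ℝ := fun z => β' z + 2 * lam * w.ψ₁ z * β z with hTβ
  set Tk : ℝ → ℝ := fun z => k' z + 2 * lam * w.ψ₁ z * k z with hTk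
  have cα : Continuous α := sα.continuous
  have cβ : Continuous β := sβ.continuous
  have ck : Continuous k := sk.continuous
  have cTα : Continuous Tα := by fun_prop
  have cTβ : Continuous Tβ := by fun_prop
  have cTk : Continuous Tk := by fun_prop
  have cαα : Continuous fun z => α z * α z := cα.mul cα
  have cαβ : Continuous fun z => α z * β z := cα.mul cβ
  have cβα : Continuous fun z => β z * α z := cβ.mul cα
  have cββ : Continuous fun z => β z * β z := cβ.mul cβ
  have c1 : Continuous (fun _ : ℝ => (1 : ℝ)) := continuous_const
  have h2 : ∀ i : Fin 3, i ≠ 2 → 0 ≤ w.q lam Tα (D (unitIdx i) u) (D (unitIdx i) u)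
      - 2 * w.q lam β (D (unitIdx i) u) (D (unitIdx i) u)
      - c * lam * w.q lam (fun _ => 1) (D (unitIdx i) u) (D (unitIdx i) u) := by
    intro i _
    have h := q_quadForm_nonneg (w := w) (lam := lam) (g₀ := fun _ => 0) (g₁ := fun _ => 0)
      (g₂ := fun z => 1 * Tα z + (-2) * β z + (-(c * lam)) * 1 + 0 * 1)
      (by fun_prop) (by fun_prop) (by fun_prop) ?_ (D (unitIdx i) u) 0
    · rw [q_lin lam cTα cβ c1 c1] at h
      have z0 : ∀ g (a : L2 B), w.q lam g 0 a = 0 := fun g a => by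
        simp [q, wip]
      rw [z0, z0] at h
      linarith
    · intro z hz s t
      have e1 : 1 * Tα z + (-2) * β z + (-(c * lam)) * 1 + 0 * 1 = lam * (2 * w.ψ₂ z - c) := by
        simp only [hTα, hα', hα, hβ]; ring
      rw [e1]
      have := w.le₂ z hz
      have : 0 ≤ lam * (2 * w.ψ₂ z - c) := mul_nonneg hl0.le (by linarith)
      nlinarith [mul_nonneg this (sq_nonneg s)]
  have h3 : 0 ≤ (-w.q lam Tα (D (unitIdx 2) u) (D (unitIdx 2) u)
      - 2 * w.q lam β (D (unitIdx 2) u) (D (unitIdx 2) u)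
      - w.q lam (fun z => α z * α z) (D (unitIdx 2) u) (D (unitIdx 2) u)
      - c * lam * w.q lam (fun _ => 1) (D (unitIdx 2) u) (D (unitIdx 2) u))
      + (-2 * w.q lam Tβ (D 0 u) (D (unitIdx 2) u)
        - 2 * w.q lam (fun z => α z * β z) (D 0 u) (D (unitIdx 2) u)
        + 2 * w.q lam k (D 0 u) (D (unitIdx 2) u))
      + (-w.q lam (fun z => β z * β z) (D 0 u) (D 0 u) + w.q lam Tk (D 0 u) (D 0 u)
        - c * lam ^ 3 * w.q lam (fun _ => 1) (D 0 u) (D 0 u)) := by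
    have h := q_quadForm_nonneg (w := w) (lam := lam)
      (g₂ := fun z => (-1) * Tα z + (-2) * β z + (-1) * (α z * α z) + (-(c * lam)) * 1)
      (g₁ := fun z => (-2) * Tβ z + (-2) * (α z * β z) + 2 * k z + 0 * 1)
      (g₀ := fun z => (-1) * (β z * β z) + 1 * Tk z + (-(c * lam ^ 3)) * 1 + 0 * 1)
      (by fun_prop) (by fun_prop) (by fun_prop) ?_ (D (unitIdx 2) u) (D 0 u)
    · rw [q_lin lam cTα cβ cαα c1, q_lin lam cTβ cαβ ck c1, q_lin lam cββ cTk c1 c1] at h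
      refine h.trans (le_of_eq ?_)
      ring
    · intro z hz s t
      have key := quadForm_nonneg_aux hκ hc0 hc1 hc2 hl1 hl2 (w.le₁ z hz) (w.le₂ z hz)
        (w.abs₁ z hz) (w.abs₂ z hz) (w.abs₃ z hz) (w.abs₄ z hz) s t
      refine key.trans (le_of_eq ?_)
      simp only [hTα, hα', hα, hβ, hTβ, hβ', hk, hTk, hk']; ring
  set U := D 0 u
  set Ux := D (unitIdx 0) u
  set Uy := D (unitIdx 1) u
  set Uz := D (unitIdx 2) u
  have h1 := two_inner_le (w := w) lam (lap u) (mulL B (ofZ α) Uz + mulL B (ofZ β) U)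
  have hone : ∀ g : ℝ → ℝ, (fun z => (1 : ℝ) * g z) = g := fun g => by simp
  rw [q_add_left, q_mulL_left cα c1, q_mulL_left cβ c1, hone, hone, q_add_left, q_add_right,
    q_add_right, q_mulL_left cα c1, q_mulL_left cβ c1, q_mulL_left cα c1, q_mulL_left cβ c1,
    hone, hone, q_comm cα Uz (mulL B (ofZ α) Uz), q_comm cα Uz (mulL B (ofZ β) U),
    q_comm cβ U (mulL B (ofZ α) Uz), q_comm cβ U (mulL B (ofZ β) U), q_mulL_left cα cα,
    q_mulL_left cβ cα, q_mulL_left cα cβ, q_mulL_left cβ cβ, lap_eq, q_add_right, q_add_right,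
    q_add_right, q_add_right, ← lap_eq] at h1
  have i1 := q_tangential_normal (w := w) hu lam sα dα (i := 0) (by decide)
  have i2 := q_tangential_normal (w := w) hu lam sα dα (i := 1) (by decide)
  -- The boundary term at $z=d$ has the good sign because $\alpha=-2\lambda\psi'\ge0$: this is why
  -- the weight must decrease away from $\Gamma$.
  have i3 := q_normal_normal (w := w) hu lam sα dα
    (fun z hz => by have := w.le₁ z hz; simp only [hα]; nlinarith)
  have i4 := q_zero_tangential (w := w) hu lam sβ (i := 0) (by decide)
  have i5 := q_zero_tangential (w := w) hu lam sβ (i := 1) (by decide)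
  have i6 := q_zero_normal_two (w := w) hu lam sβ dβ
  have i7 := q_zero_normal (w := w) hu lam sk dk
  have hx := h2 0 (by decide)
  have hy := h2 1 (by decide)
  have hcomm : w.q lam (fun z => β z * α z) Uz U = w.q lam (fun z => α z * β z) U Uz := by
    rw [q_comm cβα]
    simp_rw [mul_comm (β _)]
  simp only [norm_E_sq, Fin.sum_univ_three]
  linarith

/-- The Hessian is controlled by the Laplacian up to terms of first order. -/
lemma hessian_le {lam : ℝ} (hl : 1 ≤ lam) {u : Hm B 3} (hu : u ∈ zeroData B 3) :
    ∑ i, ∑ j, ‖w.E lam (D (unitIdx i + unitIdx j) u)‖ ^ 2 ≤ ‖w.E lam (lap u)‖ ^ 2 +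
      (2 * w.M + 4 * w.M ^ 2) * lam ^ 2 * ∑ i, ‖w.E lam (D (unitIdx i) u)‖ ^ 2 := by
  have c1 : Continuous (fun _ : ℝ => (1 : ℝ)) := continuous_const
  -- Expanding the square of the Laplacian, each product $u_{ii}u_{jj}$ becomes $|u_{ij}|^2$ up to a
  -- term in tangential first derivatives whose weight is of order $\lambda^2$.
  have m1 := q_mixed_tangential (w := w) hu lam (i := 0) (j := 1) (by decide) (by decide)
    (by decide)
  have m2 := q_mixed_normal (w := w) hu lam (i := 0) (by decide)
  have m3 := q_mixed_normal (w := w) hu lam (i := 1) (by decide)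
  have k1 := w.smooth₁.continuous
  have k2 := w.smooth₂.continuous
  have h2 : ∀ f : L2 B,
      w.q lam (fun z => 2 * lam * w.ψ₂ z + 2 * lam * w.ψ₁ z * (2 * lam * w.ψ₁ z)) f f ≤
        (2 * w.M + 4 * w.M ^ 2) * lam ^ 2 * w.q lam (fun _ => 1) f f := by
    intro f
    have cG : Continuous
        fun z => 2 * lam * w.ψ₂ z + 2 * lam * w.ψ₁ z * (2 * lam * w.ψ₁ z) := by fun_prop
    have h := q_quadForm_nonneg (w := w) (lam := lam) (g₀ := fun _ => 0) (g₁ := fun _ => 0)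
      (g₂ := fun z => (-1) * (2 * lam * w.ψ₂ z + 2 * lam * w.ψ₁ z * (2 * lam * w.ψ₁ z))
        + ((2 * w.M + 4 * w.M ^ 2) * lam ^ 2) * 1 + 0 * 1 + 0 * 1)
      (by fun_prop) (by fun_prop) (by fun_prop) ?_ f 0
    · rw [q_lin lam cG c1 c1 c1] at h
      have z0 : ∀ g (a : L2 B), w.q lam g 0 a = 0 := fun g a => by simp [q, wip]
      rw [z0, z0] at h
      linarith
    · intro z hz s t
      have hM : 0 ≤ w.M := (abs_nonneg _).trans (w.abs₁ z hz)
      have a2 := (abs_le.1 (w.abs₂ z hz)).2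
      have a1 : w.ψ₁ z ^ 2 ≤ w.M ^ 2 :=
        sq_le_sq' (abs_le.1 (w.abs₁ z hz)).1 (abs_le.1 (w.abs₁ z hz)).2
      have t1 : lam * w.ψ₂ z ≤ lam ^ 2 * w.M := by
        have := mul_le_mul_of_nonneg_left a2 (by linarith : 0 ≤ lam)
        nlinarith [mul_nonneg (by linarith : 0 ≤ lam) hM]
      have t2 : lam ^ 2 * w.ψ₁ z ^ 2 ≤ lam ^ 2 * w.M ^ 2 := by gcongr
      have t3 : 0 ≤ (-1) * (2 * lam * w.ψ₂ z + 2 * lam * w.ψ₁ z * (2 * lam * w.ψ₁ z))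
        + ((2 * w.M + 4 * w.M ^ 2) * lam ^ 2) * 1 + 0 * 1 + 0 * 1 := by
        linarith [show 2 * lam * w.ψ₁ z * (2 * lam * w.ψ₁ z) = 4 * (lam ^ 2 * w.ψ₁ z ^ 2) by ring,
          show (2 * w.M + 4 * w.M ^ 2) * lam ^ 2 = 2 * (lam ^ 2 * w.M) + 4 * (lam ^ 2 * w.M ^ 2)
            by ring]
      have := mul_nonneg t3 (sq_nonneg s)
      linarith
  have hx := h2 (D (unitIdx 0) u)
  have hy := h2 (D (unitIdx 1) u)
  have hz : 0 ≤ (2 * w.M + 4 * w.M ^ 2) * lam ^ 2 *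
      w.q lam (fun _ => 1) (D (unitIdx 2) u) (D (unitIdx 2) u) := by
    have hn : (0 : ℝ) ≤ w.M := by
      have h0 : (0 : ℝ) ∈ Ioo (-B.ξ) B.d := ⟨by linarith [B.ξ_pos], B.d_pos⟩
      exact (abs_nonneg _).trans (w.abs₁ 0 h0)
    rw [← norm_E_sq]; positivity
  simp only [norm_E_sq, Fin.sum_univ_three]
  rw [lap_eq, q_add_left, q_add_left, q_add_right, q_add_right, q_add_right, q_add_right,
    q_add_right, q_add_right, q_comm c1 (D (unitIdx 1 + unitIdx 1) u) (D (unitIdx 0 + unitIdx 0) u),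
    q_comm c1 (D (unitIdx 2 + unitIdx 2) u) (D (unitIdx 0 + unitIdx 0) u),
    q_comm c1 (D (unitIdx 2 + unitIdx 2) u) (D (unitIdx 1 + unitIdx 1) u),
    add_comm (unitIdx 1) (unitIdx 0), add_comm (unitIdx 2) (unitIdx 0),
    add_comm (unitIdx 2) (unitIdx 1)]
  linarith

/-- The Carleman estimate for the Laplacian. -/
theorem carleman (w : CarlemanWeight B) : ∃ C lam₀ : ℝ, 1 ≤ C ∧ 1 ≤ lam₀ ∧
    ∀ lam, lam₀ ≤ lam → ∀ u : Hm B 3, u ∈ zeroData B 3 →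
      lam ^ 3 * ‖w.E lam (D 0 u)‖ ^ 2 + lam * ∑ i, ‖w.E lam (D (unitIdx i) u)‖ ^ 2 +
        lam⁻¹ * ∑ i, ∑ j, ‖w.E lam (D (unitIdx i + unitIdx j) u)‖ ^ 2 ≤
          C * ‖w.E lam (lap u)‖ ^ 2 := by
  obtain ⟨c, lam₀, hc, hl, h⟩ := carleman_first_order w
  have hM : (0 : ℝ) ≤ w.M := by
    have h0 : (0 : ℝ) ∈ Ioo (-B.ξ) B.d := ⟨by linarith [B.ξ_pos], B.d_pos⟩
    exact (abs_nonneg _).trans (w.abs₁ 0 h0)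
  -- One $c^{-1}$ comes from the first order terms; the Hessian divided by $\lambda$ adds 1 and the
  -- first order loss once more.
  refine ⟨1 + c⁻¹ * (1 + (2 * w.M + 4 * w.M ^ 2)), lam₀, ?_, hl, fun lam hlam u hu => ?_⟩
  · have : 0 ≤ c⁻¹ * (1 + (2 * w.M + 4 * w.M ^ 2)) := by positivity
    linarith
  have hl1 : 1 ≤ lam := hl.trans hlam
  have hl0 : 0 < lam := by linarith
  have h1 := h lam hlam u hu
  have h2 := hessian_le (w := w) hl1 hu
  set S0 := ‖w.E lam (D 0 u)‖ ^ 2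
  set S1 := ∑ i, ‖w.E lam (D (unitIdx i) u)‖ ^ 2
  set S2 := ∑ i, ∑ j, ‖w.E lam (D (unitIdx i + unitIdx j) u)‖ ^ 2
  set N := ‖w.E lam (lap u)‖ ^ 2
  set K := 2 * w.M + 4 * w.M ^ 2
  have hK : 0 ≤ K := by positivity
  have hN : 0 ≤ N := by positivity
  have hS0 : 0 ≤ S0 := by positivity
  have h3 : lam * S1 + lam ^ 3 * S0 ≤ c⁻¹ * N := by
    rw [inv_mul_eq_div, le_div_iff₀ hc]; linarith
  have h4 : lam⁻¹ * S2 ≤ N + K * (lam * S1) := by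
    calc lam⁻¹ * S2 ≤ lam⁻¹ * (N + K * lam ^ 2 * S1) := by gcongr
      _ = lam⁻¹ * N + K * (lam * S1) := by field_simp
      _ ≤ _ := by
        have : lam⁻¹ ≤ 1 := inv_le_one_of_one_le₀ hl1
        have := mul_le_mul_of_nonneg_right this hN
        linarith
  have h5 : 0 ≤ lam ^ 3 * S0 := by positivity
  have h6 : K * (lam * S1) ≤ K * (c⁻¹ * N) := by
    refine mul_le_mul_of_nonneg_left ?_ hK
    linarith
  have : (1 + c⁻¹ * (1 + K)) * N = N + c⁻¹ * N + K * (c⁻¹ * N) := by ring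
  linarith

end CarlemanWeight

end

section

/-! ### The weight of the theorem -/

/-- A smooth extension of `(z + s)^{-ν} - (s + d)^{-ν}` to the real line. -/
def expFn (B : Box) (s ν : ℝ) : ℝ → ℝ := fun z =>
  Real.smoothTransition (2 * (z + s) / (s - B.ξ) - 1) * (z + s) ^ (-ν) - (s + B.d) ^ (-ν)

lemma expFn_of_le {B : Box} {s : ℝ} (hs : B.ξ < s) (ν : ℝ) {z : ℝ} (hz : -B.ξ ≤ z) :
    expFn B s ν z = (z + s) ^ (-ν) - (s + B.d) ^ (-ν) := by
  have h : 0 < s - B.ξ := by linarith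
  rw [expFn, Real.smoothTransition.one_of_one_le, one_mul]
  rw [le_sub_iff_add_le, le_div_iff₀ h]
  linarith

lemma contDiff_expFn {B : Box} {s : ℝ} (hs : B.ξ < s) (ν : ℝ) :
    ContDiff ℝ (⊤ : ℕ∞) (expFn B s ν) := by
  have h : 0 < s - B.ξ := by linarith
  refine ContDiff.sub ?_ contDiff_const
  rw [contDiff_iff_contDiffAt]
  intro z
  -- The transition factor vanishes for $z+s\le(s-\xi)/2$, hence near every point where the power
  -- could be singular.
  rcases le_or_gt (z + s) 0 with hz | hz
  · refine (contDiffAt_const (c := (0 : ℝ))).congr_of_eventuallyEq ?_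
    have : ∀ᶠ y in nhds z, y + s < (s - B.ξ) / 2 :=
      (isOpen_lt (by fun_prop) continuous_const).mem_nhds (by simp only [mem_ofPred_eq]; linarith)
    filter_upwards [this] with y hy
    rw [Real.smoothTransition.zero_of_nonpos, zero_mul]
    rw [sub_nonpos, div_le_one h]
    linarith
  · refine ContDiffAt.mul ?_ ?_
    · exact Real.smoothTransition.contDiff.contDiffAt.comp z
        ((((contDiff_const.mul (contDiff_id.add contDiff_const)).div_const _).sub
          contDiff_const).contDiffAt)
    · exact (contDiff_id.add contDiff_const).contDiffAt.rpow_const_of_ne hz.ne'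

lemma deriv_expFn_eventuallyEq {B : Box} {s : ℝ} (hs : B.ξ < s) (ν : ℝ) {z : ℝ} (hz : -B.ξ < z) :
    deriv (expFn B s ν) =ᶠ[nhds z] fun y => -ν * (y + s) ^ (-ν - 1) := by
  filter_upwards [Ioi_mem_nhds hz] with y hy
  have h1 : expFn B s ν =ᶠ[nhds y] fun x => (x + s) ^ (-ν) - (s + B.d) ^ (-ν) := by
    filter_upwards [Ioi_mem_nhds hy] with x hx
    exact expFn_of_le hs ν (le_of_lt hx)
  have hy' : -B.ξ < y := hy
  rw [h1.deriv_eq]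
  have := ((hasDerivAt_id y).add_const s).rpow_const (p := -ν) (Or.inl (by simp only [id]; linarith))
  simpa using (this.sub_const ((s + B.d) ^ (-ν))).deriv

lemma deriv_deriv_expFn {B : Box} {s : ℝ} (hs : B.ξ < s) (ν : ℝ) {z : ℝ} (hz : -B.ξ < z) :
    deriv (deriv (expFn B s ν)) z = ν * (ν + 1) * (z + s) ^ (-ν - 2) := by
  rw [(deriv_expFn_eventuallyEq hs ν hz).deriv_eq]
  have := (((hasDerivAt_id z).add_const s).rpow_const (p := -ν - 1)
    (Or.inl (by simp only [id]; linarith))).const_mul (-ν)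
  have h2 := this.deriv
  simp only [id, one_mul] at h2
  rw [h2, show -ν - 1 - 1 = -ν - 2 by ring]
  ring

/-- On the box $\psi'=-\nu(z+s)^{-\nu-1}$ and $\psi''=\nu(\nu+1)(z+s)^{-\nu-2}$. Negative powers are
smallest at $z=d$, and $\nu\ge1$ allows the numerical factors to be dropped from the lower bounds.
The upper bounds are compactness. -/
lemma exists_weight (B : Box) {s ν : ℝ} (hs : B.ξ < s) (hν : 1 ≤ ν) :
    ∃ w : CarlemanWeight B, w.ψ = expFn B s ν := by
  have hsm := contDiff_expFn hs ν
  have h1 := contDiff_deriv hsm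
  have h2 := contDiff_deriv h1
  have h3 := contDiff_deriv h2
  have h4 := contDiff_deriv h3
  have hd : ∀ {g : ℝ → ℝ}, ContDiff ℝ (⊤ : ℕ∞) g → ∀ z, HasDerivAt g (deriv g z) z :=
    fun hg z => (hg.differentiable (by simp) z).hasDerivAt
  have hb : ∀ {g : ℝ → ℝ}, ContDiff ℝ (⊤ : ℕ∞) g → ∃ M, ∀ z ∈ Ioo (-B.ξ) B.d, |g z| ≤ M := by
    intro g hg
    obtain ⟨M, hM⟩ := (isCompact_Icc (a := -B.ξ) (b := B.d)).exists_bound_of_continuousOn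
      hg.continuous.continuousOn
    exact ⟨M, fun z hz => hM z (Ioo_subset_Icc_self hz)⟩
  obtain ⟨M1, hM1⟩ := hb h1
  obtain ⟨M2, hM2⟩ := hb h2
  obtain ⟨M3, hM3⟩ := hb h3
  obtain ⟨M4, hM4⟩ := hb h4
  have hsd : 0 < s + B.d := by linarith [B.ξ_pos, B.d_pos]
  exact ⟨{
    ψ := expFn B s ν
    ψ₁ := _, ψ₂ := _, ψ₃ := _, ψ₄ := _
    smooth := hsm
    deriv₁ := hd hsm, deriv₂ := hd h1, deriv₃ := hd h2, deriv₄ := hd h3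
    κ := min ((s + B.d) ^ (-ν - 1)) ((s + B.d) ^ (-ν - 2))
    M := max (max M1 M2) (max M3 M4)
    κ_pos := by positivity
    le₁ := fun z hz => by
      rw [(deriv_expFn_eventuallyEq hs ν hz.1).eq_of_nhds]
      have h0 : 0 < z + s := by linarith [hz.1]
      have : (s + B.d) ^ (-ν - 1) ≤ (z + s) ^ (-ν - 1) :=
        Real.rpow_le_rpow_of_nonpos h0 (by linarith [hz.2]) (by linarith)
      have h5 : 0 < (z + s) ^ (-ν - 1) := by positivity
      refine (min_le_left _ _).trans ?_
      nlinarith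
    le₂ := fun z hz => by
      rw [deriv_deriv_expFn hs ν hz.1]
      have h0 : 0 < z + s := by linarith [hz.1]
      have : (s + B.d) ^ (-ν - 2) ≤ (z + s) ^ (-ν - 2) :=
        Real.rpow_le_rpow_of_nonpos h0 (by linarith [hz.2]) (by linarith)
      have h5 : 0 < (z + s) ^ (-ν - 2) := by positivity
      refine (min_le_right _ _).trans (this.trans (le_mul_of_one_le_left h5.le ?_))
      nlinarith
    abs₁ := fun z hz => (hM1 z hz).trans ((le_max_left _ _).trans (le_max_left _ _))
    abs₂ := fun z hz => (hM2 z hz).trans ((le_max_right _ _).trans (le_max_left _ _))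
    abs₃ := fun z hz => (hM3 z hz).trans ((le_max_left _ _).trans (le_max_right _ _))
    abs₄ := fun z hz => (hM4 z hz).trans ((le_max_right _ _).trans (le_max_right _ _)) }, rfl⟩

lemma tNu_pos (B : Box) {s ν : ℝ} (hs : B.ξ < s) (hν : 1 ≤ ν) : 0 < tNu B s ν := by
  have := Real.rpow_lt_rpow_of_neg (x := s - B.ξ) (y := s + B.d) (z := -ν) (by linarith)
    (by linarith [B.ξ_pos, B.d_pos]) (by linarith)
  rw [tNu]; linarith

/-- Consequently $1\le e^{\lambda\psi}\le e^{\lambda t_\nu}$ for $\lambda\ge0$. The lower bound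
recovers unweighted norms from weighted ones; the upper bound is the price for errors in the data.
-/
lemma expFn_mem {B : Box} {s ν : ℝ} (hs : B.ξ < s) (hν : 1 ≤ ν) {z : ℝ}
    (hz : z ∈ Ioo (-B.ξ) B.d) : 0 ≤ expFn B s ν z ∧ expFn B s ν z ≤ tNu B s ν := by
  rw [expFn_of_le hs ν hz.1.le, tNu]
  have h1 : (s + B.d) ^ (-ν) ≤ (z + s) ^ (-ν) :=
    Real.rpow_le_rpow_of_nonpos (by linarith [hz.1]) (by linarith [hz.2]) (by linarith)
  have h2 : (z + s) ^ (-ν) ≤ (s - B.ξ) ^ (-ν) :=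
    Real.rpow_le_rpow_of_nonpos (by linarith) (by linarith [hz.1]) (by linarith)
  constructor <;> linarith

/-- The normalized squared weight is the weight of the functionals. -/
lemma exp_mul_cwf {B : Box} {s ν : ℝ} (hs : B.ξ < s) (lam : ℝ) {z : ℝ}
    (hz : z ∈ Ioo (-B.ξ) B.d) :
    Real.exp (-2 * lam * (s + B.d) ^ (-ν)) * cwf s ν lam z =
      Real.exp (lam * expFn B s ν z) ^ 2 := by
  rw [cwf, expFn_of_le hs ν hz.1.le, ← Real.exp_add, sq, ← Real.exp_add]
  congr 1; ring

end

section

/-! ### Sobolev inequalities for smooth functions on the box -/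

/-- $F(x)=F(y)+\int_y^xF'$, averaged over $y$ in the interval. -/
lemma enorm_le_lintegral_Ioo {F F' : ℝ → ℝ} (hF : ∀ t, HasDerivAt F (F' t) t)
    (hF' : Continuous F') {a b x : ℝ} (hx : x ∈ Ioo a b) :
    ‖F x‖ₑ ≤ ∫⁻ t in Ioo a b, ((ENNReal.ofReal (b - a))⁻¹ * ‖F t‖ₑ + ‖F' t‖ₑ) := by
  have hab : a < b := hx.1.trans hx.2
  have hFc : Continuous F := continuous_iff_continuousAt.2 fun t => (hF t).continuousAt
  set K := ∫⁻ t in Ioo a b, ‖F' t‖ₑ with hK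
  set c := (ENNReal.ofReal (b - a))⁻¹ with hc
  have hv : volume (Ioo a b) = ENNReal.ofReal (b - a) := Real.volume_Ioo
  have hcv : c * volume (Ioo a b) = 1 := by
    rw [hv]
    exact ENNReal.inv_mul_cancel (ENNReal.ofReal_pos.2 (by linarith)).ne' ENNReal.ofReal_ne_top
  have h1 : ∀ y ∈ Ioo a b, ‖F x‖ₑ ≤ ‖F y‖ₑ + K := by
    intro y hy
    have e := intervalIntegral.integral_eq_sub_of_hasDerivAt (a := y) (b := x)
      (fun t _ => hF t) (hF'.intervalIntegrable _ _)
    have e2 : F x = F y + ∫ t in y..x, F' t := by rw [e]; ring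
    rw [e2]
    refine (enorm_add_le _ _).trans ?_
    gcongr
    rw [intervalIntegral.intervalIntegral_eq_integral_uIoc]
    have h3 : ‖(if y ≤ x then (1 : ℝ) else -1) • ∫ t in uIoc y x, F' t‖ₑ =
        ‖∫ t in uIoc y x, F' t‖ₑ := by
      split_ifs <;> simp
    rw [h3]
    refine (enorm_integral_le_lintegral_enorm _).trans (lintegral_mono_set ?_)
    intro t ht
    rcases le_total y x with h | h
    · rw [uIoc_of_le h] at ht; exact ⟨hy.1.trans ht.1, ht.2.trans_lt hx.2⟩
    · rw [uIoc_of_ge h] at ht; exact ⟨hx.1.trans ht.1, ht.2.trans_lt hy.2⟩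
  calc ‖F x‖ₑ = c * ∫⁻ _ in Ioo a b, ‖F x‖ₑ := by
        rw [setLIntegral_const, mul_comm ‖F x‖ₑ, ← mul_assoc, hcv, one_mul]
    _ ≤ c * ∫⁻ y in Ioo a b, (‖F y‖ₑ + K) := by
        gcongr c * ?_
        exact setLIntegral_mono (by fun_prop) h1
    _ = _ := by
        rw [lintegral_add_left (by fun_prop), lintegral_add_left (by fun_prop), setLIntegral_const,
          mul_add, mul_comm K, ← mul_assoc, hcv, one_mul, lintegral_const_mul _ (by fun_prop)]

/-- The one-dimensional measures whose product is the volume of the box. -/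
def Box.side (B : Box) (i : Fin 3) : Measure ℝ := volume.restrict (Ioo (B.lo i) (B.hi i))

instance (B : Box) (i : Fin 3) : SigmaFinite (B.side i) := by unfold Box.side; infer_instance

lemma measurePreserving_toLp (B : Box) :
    MeasurePreserving (WithLp.toLp 2 : (Fin 3 → ℝ) → E3) (Measure.pi B.side) B.vol := by
  have h := (PiLp.volume_preserving_toLp (Fin 3)).restrict_preimage B.measurableSet_domain
  have e : (WithLp.toLp 2 : (Fin 3 → ℝ) → E3) ⁻¹' B.domain =
      univ.pi fun i => Ioo (B.lo i) (B.hi i) := by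
    ext y
    simp [Box.mem_domain, Box.slab]
  rw [e, volume_pi, Measure.restrict_pi_pi] at h
  exact h

lemma hasDerivAt_comp_update {φ : E3 → ℝ} (hφ : Smooth φ) (y : Fin 3 → ℝ) (i : Fin 3) (t : ℝ) :
    HasDerivAt (fun t => φ (WithLp.toLp 2 (Function.update y i t)))
      (pd i φ (WithLp.toLp 2 (Function.update y i t))) t := by
  have h1 : HasDerivAt (fun t => WithLp.toLp 2 (Function.update y i t) : ℝ → E3)
      (EuclideanSpace.single i 1) t :=
    (PiLp.continuousLinearEquiv 2 ℝ (fun _ : Fin 3 => ℝ)).symm.hasFDerivAt.comp_hasDerivAt t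
      (hasDerivAt_update y i t)
  exact (hφ.differentiableAt _).hasFDerivAt.comp_hasDerivAt t h1

/-- The Gagliardo–Nirenberg argument. On every line parallel to an axis $|\varphi|^4$ is bounded by
a line integral of the same function `f`. The product of the square roots of the three bounds
dominates $|\varphi|^6$, and `lintegral_prod_lintegral_pow_le` integrates this product. -/
lemma lintegral_pow_six_le {B : Box} {φ : E3 → ℝ} (hφ : Smooth φ) :
    ∫⁻ x, ‖φ x‖ₑ ^ 6 ∂B.vol ≤ (∫⁻ x, ((∑ i, (ENNReal.ofReal (B.hi i - B.lo i))⁻¹) * ‖φ x‖ₑ ^ 4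
      + 4 * ‖φ x‖ₑ ^ 3 * ∑ i, ‖pd i φ x‖ₑ) ∂B.vol) ^ (3 / 2 : ℝ) := by
  set c := ∑ i, (ENNReal.ofReal (B.hi i - B.lo i))⁻¹ with hc
  set f : E3 → ENNReal := fun x => c * ‖φ x‖ₑ ^ 4 + 4 * ‖φ x‖ₑ ^ 3 * ∑ i, ‖pd i φ x‖ₑ with hf
  have hcφ : Continuous φ := hφ.continuous
  have hcp : ∀ i, Continuous (pd i φ) := fun i => (hφ.pd i).continuous
  have hm : Measurable f := by
    have : ∀ i, Measurable (pd i φ) := fun i => (hcp i).measurable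
    fun_prop
  have hmp := measurePreserving_toLp B
  rw [← hmp.lintegral_comp (by fun_prop), ← hmp.lintegral_comp hm]
  have hp : Real.HolderConjugate (Fintype.card (Fin 3)) (3 / 2) := by
    rw [Fintype.card_fin, Real.holderConjugate_iff]; norm_num
  refine le_trans ?_ (lintegral_prod_lintegral_pow_le B.side hp
    (f := fun y => f (WithLp.toLp 2 y)) (hm.comp hmp.measurable))
  have hmem : ∀ᵐ y ∂Measure.pi B.side, WithLp.toLp 2 y ∈ B.domain :=
    hmp.quasiMeasurePreserving.ae (Box.ae_vol fun x hx => hx)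
  refine lintegral_mono_ae ?_
  filter_upwards [hmem] with y hy
  have key : ∀ i, ‖φ (WithLp.toLp 2 y)‖ₑ ^ 4 ≤
      ∫⁻ t, f (WithLp.toLp 2 (Function.update y i t)) ∂B.side i := by
    intro i
    set g : ℝ → ℝ := fun t => φ (WithLp.toLp 2 (Function.update y i t)) with hg
    set g' : ℝ → ℝ := fun t => pd i φ (WithLp.toLp 2 (Function.update y i t)) with hg'
    have hd : ∀ t, HasDerivAt g (g' t) t := hasDerivAt_comp_update hφ y i
    have hd4 : ∀ t, HasDerivAt (fun t => g t ^ 4) (4 * g t ^ 3 * g' t) t := fun t => by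
      simpa using! (hd t).pow 4
    have hcu : Continuous fun t => (WithLp.toLp 2 (Function.update y i t) : E3) :=
      (PiLp.continuous_toLp 2 _).comp (continuous_const.update i continuous_id)
    have hgc : Continuous g := hcφ.comp hcu
    have hgc' : Continuous g' := (hcp i).comp hcu
    have hyi : y i ∈ Ioo (B.lo i) (B.hi i) := Box.mem_domain.1 hy i
    have := enorm_le_lintegral_Ioo hd4 (by fun_prop) hyi
    simp only [hg, Function.update_eq_self] at this
    rw [enorm_pow] at this
    refine this.trans (lintegral_mono fun t => ?_)
    simp only [hf, enorm_pow, enorm_mul]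
    have h4 : ‖(4 : ℝ)‖ₑ = 4 := by simp [Real.enorm_eq_ofReal]
    rw [h4]
    gcongr
    · exact Finset.single_le_sum (f := fun i => (ENNReal.ofReal (B.hi i - B.lo i))⁻¹)
        (fun _ _ => zero_le) (Finset.mem_univ i)
    · exact Finset.single_le_sum
        (f := fun j => ‖pd j φ (WithLp.toLp 2 (Function.update y i t))‖ₑ)
        (fun _ _ => zero_le) (Finset.mem_univ i)
  calc ‖φ (WithLp.toLp 2 y)‖ₑ ^ 6 = ∏ _i : Fin 3, (‖φ (WithLp.toLp 2 y)‖ₑ ^ 4) ^ (1 / 2 : ℝ) := by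
        rw [Finset.prod_const, Finset.card_univ, Fintype.card_fin, ← ENNReal.rpow_natCast,
          ← ENNReal.rpow_natCast, ← ENNReal.rpow_natCast, ← ENNReal.rpow_mul, ← ENNReal.rpow_mul]
        norm_num
    _ ≤ _ := by
        refine Finset.prod_le_prod' fun i _ => ?_
        have : (1 : ℝ) / ((Fintype.card (Fin 3) : ℝ) - 1) = 1 / 2 := by
          rw [Fintype.card_fin]; norm_num
        rw [this]
        exact ENNReal.rpow_le_rpow (key i) (by norm_num)

lemma lintegral_mul_le_sqrt {α : Type*} [MeasurableSpace α] {μ : Measure α} {f g : α → ENNReal}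
    (hf : AEMeasurable f μ) (hg : AEMeasurable g μ) :
    ∫⁻ a, f a * g a ∂μ ≤
      (∫⁻ a, f a ^ 2 ∂μ) ^ (1 / 2 : ℝ) * (∫⁻ a, g a ^ 2 ∂μ) ^ (1 / 2 : ℝ) := by
  have := ENNReal.lintegral_mul_le_Lp_mul_Lq μ (p := 2) (q := 2)
    (by rw [Real.holderConjugate_iff]; norm_num) hf hg
  simpa using this

lemma eLpNorm_nat {α F : Type*} [MeasurableSpace α] [NormedAddCommGroup F] {μ : Measure α}
    (f : α → F) (n : ℕ) (hn : n ≠ 0) :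
    eLpNorm f n μ = (∫⁻ a, ‖f a‖ₑ ^ n ∂μ) ^ (1 / (n : ℝ)) := by
  rw [eLpNorm_eq_lintegral_rpow_enorm_toReal (by exact_mod_cast hn) (by simp)]
  simp

/-- The embedding of `H¹` into `L⁶`, for smooth functions. -/
lemma exists_eLpNorm_six_le (B : Box) : ∃ C : NNReal, ∀ φ : E3 → ℝ, Smooth φ →
    eLpNorm φ 6 B.vol ≤ C * (eLpNorm φ 2 B.vol + ∑ i, eLpNorm (pd i φ) 2 B.vol) := by
  set c := ∑ i, (ENNReal.ofReal (B.hi i - B.lo i))⁻¹ with hc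
  have hct : c ≠ ⊤ := by
    rw [hc]
    refine (ENNReal.sum_lt_top.2 fun i _ => ?_).ne
    rw [ENNReal.inv_lt_top]
    exact ENNReal.ofReal_pos.2 (by linarith [B.lo_lt_hi i])
  refine ⟨(c + 4).toNNReal, fun φ hφ => ?_⟩
  rw [ENNReal.coe_toNNReal (by simp [hct])]
  have hcφ : Continuous φ := hφ.continuous
  have hcp : ∀ i, Continuous (pd i φ) := fun i => (hφ.pd i).continuous
  have hmp : ∀ i, Measurable (pd i φ) := fun i => (hcp i).measurable
  have h2 : ∀ ψ : E3 → ℝ, eLpNorm ψ 2 B.vol = (∫⁻ a, ‖ψ a‖ₑ ^ 2 ∂B.vol) ^ (1 / 2 : ℝ) :=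
    fun ψ => by simpa using eLpNorm_nat (μ := B.vol) ψ 2 (by norm_num)
  have h6 : eLpNorm φ 6 B.vol = (∫⁻ a, ‖φ a‖ₑ ^ 6 ∂B.vol) ^ (1 / 6 : ℝ) := by
    simpa using eLpNorm_nat (μ := B.vol) φ 6 (by norm_num)
  set a := eLpNorm φ 6 B.vol with ha
  have hat : a ≠ ⊤ := (memLp_of_continuous B hcφ 6).eLpNorm_lt_top.ne
  set G := c * eLpNorm φ 2 B.vol + 4 * ∑ i, eLpNorm (pd i φ) 2 B.vol with hG
  have ha6 : ∫⁻ x, ‖φ x‖ₑ ^ 6 ∂B.vol = a ^ 6 := by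
    rw [h6, ← ENNReal.rpow_natCast, ← ENNReal.rpow_mul]; norm_num
  have hhold : ∀ ψ : E3 → ℝ, Continuous ψ → ∫⁻ x, ‖φ x‖ₑ ^ 3 * ‖ψ x‖ₑ ∂B.vol ≤
      a ^ 3 * eLpNorm ψ 2 B.vol := by
    intro ψ hψ
    refine (lintegral_mul_le_sqrt (by fun_prop) (by fun_prop)).trans (le_of_eq ?_)
    rw [h2]
    congr 1
    simp_rw [← pow_mul]
    rw [ha6, ← ENNReal.rpow_natCast, ← ENNReal.rpow_mul, ← ENNReal.rpow_natCast]
    norm_num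
  have hint : ∫⁻ x, (c * ‖φ x‖ₑ ^ 4 + 4 * ‖φ x‖ₑ ^ 3 * ∑ i, ‖pd i φ x‖ₑ) ∂B.vol ≤ a ^ 3 * G := by
    rw [lintegral_add_left (by fun_prop), lintegral_const_mul _ (by fun_prop)]
    have e1 : ∀ x, 4 * ‖φ x‖ₑ ^ 3 * ∑ i, ‖pd i φ x‖ₑ = 4 * ∑ i, ‖φ x‖ₑ ^ 3 * ‖pd i φ x‖ₑ := by
      intro x; rw [mul_assoc, Finset.mul_sum]
    simp_rw [e1]
    rw [lintegral_const_mul _ (by fun_prop), lintegral_finsetSum _ (fun i _ => by fun_prop), hG,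
      mul_add]
    refine add_le_add ?_ ?_
    · rw [mul_left_comm]
      gcongr
      simp_rw [pow_succ _ 3]
      exact hhold φ hcφ
    · rw [mul_left_comm (a ^ 3), Finset.mul_sum _ _ (a ^ 3)]
      refine mul_le_mul' le_rfl (Finset.sum_le_sum fun i _ => ?_)
      exact hhold _ (hcp i)
  -- This amounts to $a^4\le a^3G$, and $a^3$ cancels because the $L^6$ norm of a continuous
  -- function on the box is finite.
  have hmain : a ^ 6 ≤ (a ^ 3 * G) ^ (3 / 2 : ℝ) := by
    rw [← ha6]
    exact (lintegral_pow_six_le hφ).trans (ENNReal.rpow_le_rpow hint (by norm_num))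
  have haG : a ≤ G := by
    rcases eq_or_ne a 0 with h0 | h0
    · rw [h0]; exact zero_le
    have h12 : a ^ 12 ≤ (a ^ 3 * G) ^ 3 := by
      calc a ^ 12 = (a ^ 6) ^ 2 := by ring
        _ ≤ ((a ^ 3 * G) ^ (3 / 2 : ℝ)) ^ 2 := by gcongr
        _ = (a ^ 3 * G) ^ 3 := by
          rw [← ENNReal.rpow_natCast, ← ENNReal.rpow_mul, ← ENNReal.rpow_natCast]; norm_num
    have h3 : a ^ 4 ≤ a ^ 3 * G := by
      rw [show a ^ 12 = (a ^ 4) ^ 3 by ring] at h12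
      exact (ENNReal.pow_le_pow_left_iff (by norm_num)).1 h12
    rw [pow_succ] at h3
    exact (ENNReal.mul_le_mul_iff_right (pow_ne_zero _ h0) (ENNReal.pow_ne_top hat)).1 h3
  refine haG.trans ?_
  rw [hG, mul_add]
  gcongr
  · exact le_self_add
  · exact le_add_self

end

section

/-! ### The embedding of `H²` into `L^∞` for smooth functions -/

lemma hasDerivAt_comp_line {φ : E3 → ℝ} (hφ : Smooth φ) (x h : E3) (t : ℝ) :
    HasDerivAt (fun t : ℝ => φ (x + t • h)) (∑ i, h i * pd i φ (x + t • h)) t := by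
  have h1 : HasDerivAt (fun t : ℝ => x + t • h) h t := by
    simpa using ((hasDerivAt_id t).smul_const h).const_add x
  have h2 := (hφ.differentiableAt (x + t • h)).hasFDerivAt.comp_hasDerivAt t h1
  convert! h2 using 1
  have e : h = ∑ i, h i • (EuclideanSpace.single i (1 : ℝ) : E3) := by
    ext j; fin_cases j <;> simp [Fin.sum_univ_three]
  have e3 := congrArg (fderiv ℝ φ (x + t • h)) e
  rw [e3, map_sum]
  simp [pd]

/-- Taylor's formula along a segment, in the form used to estimate a function by its averages. -/
lemma enorm_le_taylor {φ : E3 → ℝ} (hφ : Smooth φ) {x h : E3} {r : ENNReal} (hrt : r ≠ ⊤)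
    (hr : ∀ i, ‖h i‖ₑ ≤ r) :
    ‖φ x‖ₑ ≤ ‖φ (x + h)‖ₑ + r * ∑ i, ‖pd i φ (x + h)‖ₑ +
      r ^ 2 * ∫⁻ t in Ioo (0 : ℝ) 1, ENNReal.ofReal t *
        ∑ i, ∑ j, ‖pd j (pd i φ) (x + t • h)‖ₑ := by
  set f : ℝ → ℝ := fun t => φ (x + t • h) with hf
  set f' : ℝ → ℝ := fun t => ∑ i, h i * pd i φ (x + t • h) with hf'
  set f'' : ℝ → ℝ := fun t => ∑ i, h i * ∑ j, h j * pd j (pd i φ) (x + t • h) with hf''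
  have d1 : ∀ t, HasDerivAt f (f' t) t := hasDerivAt_comp_line hφ x h
  have d2 : ∀ t, HasDerivAt f' (f'' t) t := fun t =>
    HasDerivAt.fun_sum fun i _ => (hasDerivAt_comp_line (hφ.pd i) x h t).const_mul (h i)
  -- $tf'-f$ is a primitive of $tf''$. Integrating it expands $\varphi(x)$ around the far end $x+h$,
  -- and the factor $t$ in the remainder will tame a singularity.
  have d3 : ∀ t, HasDerivAt (fun t => t * f' t - f t) (t * f'' t) t := fun t => by
    have := ((hasDerivAt_id t).mul (d2 t)).sub (d1 t)
    convert! this using 1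
    simp
  have hc : ∀ i j, Continuous (pd j (pd i φ)) := fun i j => ((hφ.pd i).pd j).continuous
  have c3 : Continuous fun t => t * f'' t := by fun_prop
  have e := intervalIntegral.integral_eq_sub_of_hasDerivAt (a := 0) (b := 1) (fun t _ => d3 t)
    (c3.intervalIntegrable _ _)
  have e2 : φ x = φ (x + h) - f' 1 + ∫ t in (0 : ℝ)..1, t * f'' t := by
    rw [e]; simp [hf]; ring
  have s1 : ∀ (v : Fin 3 → ℝ), ‖∑ i, h i * v i‖ₑ ≤ r * ∑ i, ‖v i‖ₑ := fun v => by
    rw [Finset.mul_sum]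
    refine (enorm_sum_le _ _).trans (Finset.sum_le_sum fun i _ => ?_)
    rw [enorm_mul]; gcongr; exact hr i
  rw [e2]
  refine (enorm_add_le _ _).trans (add_le_add ((enorm_sub_le).trans
    (add_le_add le_rfl ?_)) ?_)
  · simp only [hf', one_smul]
    exact s1 _
  · rw [intervalIntegral.integral_of_le zero_le_one, integral_Ioc_eq_integral_Ioo,
      ← lintegral_const_mul' _ _ (ENNReal.pow_ne_top hrt)]
    refine (enorm_integral_le_lintegral_enorm _).trans (setLIntegral_mono_ae' measurableSet_Ioo
      (Filter.Eventually.of_forall fun t ht => ?_))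
    rw [enorm_mul, mul_left_comm, Real.enorm_eq_ofReal ht.1.le]
    gcongr
    simp only [hf'']
    refine (s1 _).trans ?_
    rw [sq, mul_assoc]
    gcongr
    rw [Finset.mul_sum]
    exact Finset.sum_le_sum fun i _ => s1 _

lemma Box.convex_mem {B : Box} {x y : E3} (hx : x ∈ B.domain) (hy : y ∈ B.domain) {t : ℝ}
    (h0 : 0 < t) (h1 : t ≤ 1) : x + t • (y - x) ∈ B.domain := by
  rw [Box.mem_domain] at *
  intro i
  have a := hx i
  have b := hy i
  simp only [Box.slab, mem_ofPred_eq, PiLp.add_apply, PiLp.smul_apply, PiLp.sub_apply,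
    smul_eq_mul] at *
  have h2 : 0 ≤ 1 - t := by linarith
  constructor
  · have := mul_pos h0 (sub_pos.2 b.1)
    have := mul_nonneg h2 (sub_pos.2 a.1).le
    linarith
  · have := mul_pos h0 (sub_pos.2 b.2)
    have := mul_nonneg h2 (sub_pos.2 a.2).le
    linarith

/-- The dilation $y\mapsto x+t(y-x)$ keeps the box in itself by convexity, and its Jacobian costs
$t^{-3/2}$ after Cauchy–Schwarz. The factor $t$ of the Taylor remainder reduces this to the
integrable $t^{-1/2}$. -/
lemma lintegral_segment_le {B : Box} {H : E3 → ENNReal} (hH : Measurable H) {x : E3}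
    (hx : x ∈ B.domain) {t : ℝ} (ht : t ∈ Ioo (0 : ℝ) 1) :
    ∫⁻ y, H (x + t • (y - x)) ∂B.vol ≤ B.vol univ ^ (1 / 2 : ℝ) *
      (ENNReal.ofReal |(t ^ 3)⁻¹| ^ (1 / 2 : ℝ) * (∫⁻ y, H y ^ 2 ∂B.vol) ^ (1 / 2 : ℝ)) := by
  have h1 := lintegral_mul_le_sqrt (μ := B.vol) (f := fun _ => 1)
    (g := fun y => H (x + t • (y - x))) aemeasurable_const
    (hH.comp (by fun_prop)).aemeasurable
  simp only [one_mul, one_pow, lintegral_one] at h1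
  refine h1.trans ?_
  gcongr
  rw [← ENNReal.mul_rpow_of_nonneg _ _ (by norm_num)]
  gcongr
  have h2 : ∫⁻ y, H (x + t • (y - x)) ^ 2 ∂B.vol ≤
      ∫⁻ y, B.domain.indicator (fun y => H y ^ 2) (t • y + (1 - t) • x) := by
    rw [Box.vol, ← lintegral_indicator B.measurableSet_domain]
    refine lintegral_mono fun y => ?_
    by_cases hy : y ∈ B.domain
    swap
    · rw [indicator_of_notMem hy]; exact zero_le
    rw [indicator_of_mem hy]
    have e : t • y + (1 - t) • x = x + t • (y - x) := by module
    rw [e, indicator_of_mem (Box.convex_mem hx hy ht.1 ht.2.le)]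
  refine h2.trans (le_of_eq ?_)
  have hm : Measurable (B.domain.indicator fun y => H y ^ 2) :=
    (hH.pow_const 2).indicator B.measurableSet_domain
  rw [← lintegral_map hm (g := fun y : E3 => t • y + (1 - t) • x) (by fun_prop),
    map_affine t ht.1.ne', lintegral_smul_measure, lintegral_indicator B.measurableSet_domain,
    smul_eq_mul, Box.vol]

lemma lintegral_kernel_lt_top :
    ∫⁻ t in Ioo (0 : ℝ) 1, ENNReal.ofReal t * ENNReal.ofReal |(t ^ 3)⁻¹| ^ (1 / 2 : ℝ) < ⊤ := by
  have h : IntegrableOn (fun t : ℝ => t ^ (-1 / 2 : ℝ)) (Ioo 0 1) :=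
    ((intervalIntegral.intervalIntegrable_rpow' (a := 0) (b := 1) (r := -1 / 2)
      (by norm_num)).1).mono_set Ioo_subset_Ioc_self
  refine lt_of_le_of_lt (setLIntegral_mono_ae' measurableSet_Ioo
    (Filter.Eventually.of_forall fun t ht => ?_)) h.lintegral_lt_top
  have h0 : 0 < t := ht.1
  rw [abs_of_nonneg (by positivity), ENNReal.ofReal_rpow_of_nonneg (by positivity) (by norm_num),
    ← ENNReal.ofReal_mul h0.le]
  refine ENNReal.ofReal_le_ofReal (le_of_eq ?_)
  rw [← Real.rpow_natCast, ← Real.rpow_neg h0.le, ← Real.rpow_mul h0.le]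
  nth_rewrite 1 [← Real.rpow_one t]
  rw [← Real.rpow_add h0]
  norm_num

/-- The embedding of `H²` into `L^∞`, for smooth functions. -/
lemma exists_enorm_le (B : Box) : ∃ C : NNReal, ∀ φ : E3 → ℝ, Smooth φ → ∀ x ∈ B.domain,
    ‖φ x‖ₑ ≤ C * (eLpNorm φ 2 B.vol + ∑ i, eLpNorm (pd i φ) 2 B.vol +
      ∑ i, ∑ j, eLpNorm (pd j (pd i φ)) 2 B.vol) := by
  set κ := ∫⁻ t in Ioo (0 : ℝ) 1, ENNReal.ofReal t * ENNReal.ofReal |(t ^ 3)⁻¹| ^ (1 / 2 : ℝ)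
    with hκ
  have hκt : κ ≠ ⊤ := lintegral_kernel_lt_top.ne
  set m := B.vol univ with hm
  have hmt : m ≠ ⊤ := measure_ne_top _ _
  have hm0 : m ≠ 0 := by
    rw [hm, Box.vol, Measure.restrict_apply_univ]
    refine (B.isOpen_domain.measure_pos volume ⟨B.center, ?_⟩).ne'
    rw [Box.mem_domain]
    intro i
    have := B.lo_lt_hi i
    simp only [Box.slab, mem_ofPred_eq, Box.center_apply]
    constructor <;> linarith
  set r := ENNReal.ofReal (2 * B.rad) with hr
  set s := m ^ (1 / 2 : ℝ) with hs
  have hst : s ≠ ⊤ := ENNReal.rpow_ne_top_of_nonneg (by norm_num) hmt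
  set C := m⁻¹ * (s * (1 + r + r ^ 2 * κ)) with hC
  have hCt : C ≠ ⊤ := by
    refine ENNReal.mul_ne_top (ENNReal.inv_ne_top.2 hm0) (ENNReal.mul_ne_top hst ?_)
    simp [hr, hκt, ENNReal.mul_eq_top]
  refine ⟨C.toNNReal, fun φ hφ x hx => ?_⟩
  rw [ENNReal.coe_toNNReal hCt]
  have hc0 : Continuous φ := hφ.continuous
  have hc1 : ∀ i, Continuous (pd i φ) := fun i => (hφ.pd i).continuous
  have hc2 : ∀ i j, Continuous (pd j (pd i φ)) := fun i j => ((hφ.pd i).pd j).continuous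
  have hm0' : Measurable φ := hc0.measurable
  have hm1 : ∀ i, Measurable (pd i φ) := fun i => (hc1 i).measurable
  have hm2 : ∀ i j, Measurable (pd j (pd i φ)) := fun i j => (hc2 i j).measurable
  have h2 : ∀ ψ : E3 → ℝ, eLpNorm ψ 2 B.vol = (∫⁻ a, ‖ψ a‖ₑ ^ 2 ∂B.vol) ^ (1 / 2 : ℝ) :=
    fun ψ => by simpa using eLpNorm_nat (μ := B.vol) ψ 2 (by norm_num)
  have hone : ∀ ψ : E3 → ℝ, Measurable ψ → ∫⁻ y, ‖ψ y‖ₑ ∂B.vol ≤ s * eLpNorm ψ 2 B.vol := by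
    intro ψ hψ
    have := lintegral_mul_le_sqrt (μ := B.vol) (f := fun _ => 1) (g := fun y => ‖ψ y‖ₑ)
      aemeasurable_const (by fun_prop)
    simpa [h2, hs, hm] using this
  set S2 : E3 → ENNReal := fun z => ∑ i, ∑ j, ‖pd j (pd i φ) z‖ₑ with hS2
  have mS2 : Measurable S2 := by fun_prop
  have hpt : ∀ y ∈ B.domain, ‖φ x‖ₑ ≤ ‖φ y‖ₑ + r * ∑ i, ‖pd i φ y‖ₑ +
      r ^ 2 * ∫⁻ t in Ioo (0 : ℝ) 1, ENNReal.ofReal t * S2 (x + t • (y - x)) := by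
    intro y hy
    have := enorm_le_taylor hφ (x := x) (h := y - x) (r := r) (by rw [hr]; exact ENNReal.ofReal_ne_top) fun i => by
      rw [hr, ← ofReal_norm]
      refine ENNReal.ofReal_le_ofReal ((PiLp.norm_apply_le _ i).trans ((norm_sub_le _ _).trans ?_))
      linarith [Box.norm_le_rad hx, Box.norm_le_rad hy]
    simpa using this
  have hseg : ∫⁻ y, (∫⁻ t in Ioo (0 : ℝ) 1, ENNReal.ofReal t * S2 (x + t • (y - x))) ∂B.vol ≤
      s * (κ * ∑ i, ∑ j, eLpNorm (pd j (pd i φ)) 2 B.vol) := by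
    rw [lintegral_lintegral_swap (by
      refine Measurable.aemeasurable ?_
      refine Measurable.mul (by fun_prop) (mS2.comp ?_)
      exact Continuous.measurable (by fun_prop))]
    have hn : (∫⁻ y, S2 y ^ 2 ∂B.vol) ^ (1 / 2 : ℝ) ≤
        ∑ i, ∑ j, eLpNorm (pd j (pd i φ)) 2 B.vol := by
      have e : (∫⁻ y, S2 y ^ 2 ∂B.vol) ^ (1 / 2 : ℝ) = eLpNorm S2 2 B.vol := by
        rw [eLpNorm_eq_lintegral_rpow_enorm_toReal (by norm_num) (by norm_num)]
        simp
      rw [e]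
      have e2 : S2 = ∑ i, ∑ j, fun z => ‖pd j (pd i φ) z‖ₑ := by
        ext z; simp [hS2, Finset.sum_apply]
      rw [e2]
      refine (eLpNorm_sum_le (fun i _ => ?_) (by norm_num)).trans (Finset.sum_le_sum fun i _ => ?_)
      · fun_prop
      · refine (eLpNorm_sum_le (fun j _ => by fun_prop) (by norm_num)).trans
          (Finset.sum_le_sum fun j _ => ?_)
        rw [eLpNorm_enorm]
    calc _ ≤ ∫⁻ t in Ioo (0 : ℝ) 1, s * ((ENNReal.ofReal t *
          ENNReal.ofReal |(t ^ 3)⁻¹| ^ (1 / 2 : ℝ)) *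
            ∑ i, ∑ j, eLpNorm (pd j (pd i φ)) 2 B.vol) := by
          refine setLIntegral_mono_ae' measurableSet_Ioo
            (Filter.Eventually.of_forall fun t ht => ?_)
          rw [lintegral_const_mul' _ _ ENNReal.ofReal_ne_top, mul_assoc, mul_left_comm s]
          gcongr
          refine (lintegral_segment_le mS2 hx ht).trans ?_
          gcongr
      _ = _ := by
          rw [lintegral_const_mul' _ _ hst, lintegral_mul_const _ (by fun_prop)]
  have hmm : m⁻¹ * m = 1 := ENNReal.inv_mul_cancel hm0 hmt
  -- The Taylor bound is averaged over the end point $y$, so that only $L^2$ norms over the box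
  -- remain.
  calc ‖φ x‖ₑ = m⁻¹ * ∫⁻ _, ‖φ x‖ₑ ∂B.vol := by
        rw [lintegral_const, mul_comm ‖φ x‖ₑ, ← mul_assoc, ← hm, hmm, one_mul]
    _ ≤ m⁻¹ * ∫⁻ y, (‖φ y‖ₑ + r * ∑ i, ‖pd i φ y‖ₑ +
        r ^ 2 * ∫⁻ t in Ioo (0 : ℝ) 1, ENNReal.ofReal t * S2 (x + t • (y - x))) ∂B.vol := by
        gcongr m⁻¹ * ?_
        exact lintegral_mono_ae (Box.ae_vol hpt)
    _ ≤ m⁻¹ * (s * eLpNorm φ 2 B.vol + r * ∑ i, s * eLpNorm (pd i φ) 2 B.vol +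
        r ^ 2 * (s * (κ * ∑ i, ∑ j, eLpNorm (pd j (pd i φ)) 2 B.vol))) := by
        gcongr m⁻¹ * ?_
        rw [lintegral_add_left (by fun_prop), lintegral_add_left (by fun_prop),
          lintegral_const_mul _ (by fun_prop), lintegral_finsetSum _ (fun i _ => by fun_prop),
          lintegral_const_mul' _ _ (ENNReal.pow_ne_top ENNReal.ofReal_ne_top)]
        gcongr with i
        · exact hone φ hm0'
        · exact hone _ (hm1 i)
    _ ≤ _ := by
        rw [← Finset.mul_sum, hC, mul_assoc]
        gcongr m⁻¹ * ?_
        set a := eLpNorm φ 2 B.vol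
        set b := ∑ i, eLpNorm (pd i φ) 2 B.vol
        set d := ∑ i, ∑ j, eLpNorm (pd j (pd i φ)) 2 B.vol
        calc s * a + r * (s * b) + r ^ 2 * (s * (κ * d)) = s * (1 * a + r * b + r ^ 2 * κ * d) := by
              ring
          _ ≤ s * ((1 + r + r ^ 2 * κ) * a + (1 + r + r ^ 2 * κ) * b
              + (1 + r + r ^ 2 * κ) * d) := by
              gcongr
              · rw [add_assoc]; exact le_self_add
              · rw [add_right_comm]; exact le_add_self
              · exact le_add_self
          _ = _ := by ring

end

section

/-! ### Sobolev inequalities in `H^m` -/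

/-- Convergence in $L^2$ gives an almost everywhere convergent subsequence, and Fatou's lemma does
the rest. The $L^6$ and $L^\infty$ bounds of smooth functions pass to Sobolev functions without
convergence in those norms. -/
lemma eLpNorm_le_of_tendsto {B : Box} {f : ℕ → L2 B} {g : L2 B} (h : Tendsto f atTop (𝓝 g))
    {p : ENNReal} {b : ℕ → ENNReal} {c : ENNReal} (hb : ∀ n, eLpNorm (f n) p B.vol ≤ b n)
    (hbc : Tendsto b atTop (𝓝 c)) : eLpNorm g p B.vol ≤ c := by
  have h1 : TendstoInMeasure B.vol (fun n => (f n : E3 → ℂ)) atTop g :=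
    tendstoInMeasure_of_tendsto_Lp h
  obtain ⟨ns, hns, hae⟩ := h1.exists_seq_tendsto_ae
  refine (Lp.eLpNorm_lim_le_liminf_eLpNorm (fun n => Lp.aestronglyMeasurable (f (ns n))) g
    hae).trans ?_
  rw [← (hbc.comp hns.tendsto_atTop).liminf_eq]
  exact liminf_le_liminf (Eventually.of_forall fun n => hb (ns n))

lemma eLpNorm_left_le {B : Box} {f : L2 B} {a b : E3 → ℝ}
    (hf : f =ᵐ[B.vol] fun x => (a x : ℂ) + (b x : ℂ) * Complex.I) (p : ENNReal) :
    eLpNorm a p B.vol ≤ eLpNorm f p B.vol := by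
  refine eLpNorm_mono_ae ?_
  filter_upwards [hf] with x hx
  rw [hx]
  simpa using Complex.abs_re_le_norm ((a x : ℂ) + (b x : ℂ) * Complex.I)

lemma eLpNorm_right_le {B : Box} {f : L2 B} {a b : E3 → ℝ}
    (hf : f =ᵐ[B.vol] fun x => (a x : ℂ) + (b x : ℂ) * Complex.I) (p : ENNReal) :
    eLpNorm b p B.vol ≤ eLpNorm f p B.vol := by
  refine eLpNorm_mono_ae ?_
  filter_upwards [hf] with x hx
  rw [hx]
  simpa using Complex.abs_im_le_norm ((a x : ℂ) + (b x : ℂ) * Complex.I)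

lemma eLpNorm_le_add {B : Box} {f : L2 B} {a b : E3 → ℝ} (ha : Continuous a) (hb : Continuous b)
    (hf : f =ᵐ[B.vol] fun x => (a x : ℂ) + (b x : ℂ) * Complex.I) {p : ENNReal} (hp : 1 ≤ p) :
    eLpNorm f p B.vol ≤ eLpNorm a p B.vol + eLpNorm b p B.vol := by
  rw [eLpNorm_congr_ae hf]
  refine (eLpNorm_add_le (by fun_prop) (by fun_prop) hp).trans (le_of_eq ?_)
  congr 1
  · exact eLpNorm_congr_norm_ae (Eventually.of_forall fun x => by simp)
  · exact eLpNorm_congr_norm_ae (Eventually.of_forall fun x => by simp)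

/-- A sequence of smooth functions that converges in `H^m`. -/
lemma exists_smooth_seq {B : Box} {m : ℕ} (u : Hm B m) :
    ∃ (v : ℕ → Hm B m) (a b : ℕ → E3 → ℝ), Tendsto v atTop (𝓝 u) ∧ (∀ n, Smooth (a n)) ∧
      (∀ n, Smooth (b n)) ∧ ∀ n, ∀ α ∈ multiIdx m, D α (v n) =ᵐ[B.vol]
        fun x => (pdMulti α (a n) x : ℂ) + (pdMulti α (b n) x : ℂ) * Complex.I := by
  have h : ∀ n : ℕ, (0 : ℝ) < 1 / ((n : ℝ) + 1) := fun n => by positivity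
  choose a b ha hb hv using fun n => exists_ofSmooth_near u (h n)
  refine ⟨fun n => ofSmooth B m (ha n).1 1 + ofSmooth B m (hb n).1 Complex.I, a, b, ?_,
    fun n => (ha n).1, fun n => (hb n).1, fun n α hα => ?_⟩
  · rw [tendsto_iff_norm_sub_tendsto_zero]
    refine squeeze_zero (fun _ => norm_nonneg _) (fun n => ?_)
      tendsto_one_div_add_atTop_nhds_zero_nat
    rw [norm_sub_rev]
    exact (hv n).le
  · rw [map_add, D_ofSmooth _ _ hα, D_ofSmooth _ _ hα]
    filter_upwards [Lp.coeFn_add (tst B (pdMulti α (a n)) 1) (tst B (pdMulti α (b n)) Complex.I),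
      coeFn_tst (B := B) ((ha n).pdMulti α).continuous 1,
      coeFn_tst (B := B) ((hb n).pdMulti α).continuous Complex.I] with x h1 h2 h3
    rw [h1, Pi.add_apply, h2, h3, mul_one]

lemma unitIdx_add_mem (i j : Fin 3) : unitIdx i + unitIdx j ∈ multiIdx 2 := by
  rw [mem_multiIdx, sum_add_unitIdx, sum_unitIdx]

lemma eLpNorm_D {B : Box} {m : ℕ} (α : Fin 3 → ℕ) (u : Hm B m) :
    eLpNorm (D α u) 2 B.vol ≤ ENNReal.ofReal ‖u‖ := by
  rw [← ENNReal.ofReal_toReal (Lp.eLpNorm_ne_top (D α u)), ← Lp.norm_def]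
  exact ENNReal.ofReal_le_ofReal (norm_D_le α u)

/-- The embedding of `H²` into `L^∞`. -/
theorem exists_eLpNorm_top_le (B : Box) : ∃ C : ℝ, 0 ≤ C ∧ ∀ u : Hm B 2,
    eLpNorm (D 0 u) ⊤ B.vol ≤ ENNReal.ofReal (C * ‖u‖) := by
  obtain ⟨C, hC⟩ := exists_enorm_le B
  -- $13=1+3+9$ counts the derivatives of order 0, 1, 2, and the factor 2 the real and imaginary
  -- parts.
  refine ⟨2 * C * 13, by positivity, fun u => ?_⟩
  obtain ⟨v, a, b, hv, ha, hb, hD⟩ := exists_smooth_seq u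
  have key : ∀ (φ : E3 → ℝ), Smooth φ → ∀ N : ENNReal,
      (∀ α ∈ multiIdx 2, eLpNorm (pdMulti α φ) 2 B.vol ≤ N) →
      eLpNorm φ ⊤ B.vol ≤ C * (13 * N) := by
    intro φ hφ N hN
    rw [eLpNorm_exponent_top]
    refine essSup_le_of_ae_le _ (Box.ae_vol fun x hx => (hC φ hφ x hx).trans ?_)
    refine mul_le_mul' le_rfl ?_
    have h0 : eLpNorm φ 2 B.vol ≤ N := hN 0 (zero_mem_multiIdx 2)
    have h1 : ∀ i, eLpNorm (pd i φ) 2 B.vol ≤ N := fun i => by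
      have := hN (unitIdx i) (unitIdx_mem_multiIdx (by norm_num) i)
      rwa [pdMulti_unitIdx hφ] at this
    have h2 : ∀ i j, eLpNorm (pd j (pd i φ)) 2 B.vol ≤ N := fun i j => by
      have := hN (unitIdx j + unitIdx i) (unitIdx_add_mem j i)
      rwa [pdMulti_add hφ, pdMulti_unitIdx hφ, pdMulti_unitIdx (hφ.pd i)] at this
    calc _ ≤ N + ∑ _i : Fin 3, N + ∑ _i : Fin 3, ∑ _j : Fin 3, N := by
          gcongr with i _ i _ j
          · exact h1 i
          · exact h2 i j
      _ = 13 * N := by simp; ring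
  refine eLpNorm_le_of_tendsto (f := fun n => D 0 (v n)) ((D 0).continuous.tendsto u |>.comp hv)
    (b := fun n => ENNReal.ofReal (2 * C * 13 * ‖v n‖)) (fun n => ?_)
    ((ENNReal.continuous_ofReal.comp (by fun_prop : Continuous fun v : Hm B 2 =>
      2 * C * 13 * ‖v‖)).tendsto u |>.comp hv)
  have h0 := hD n 0 (zero_mem_multiIdx 2)
  refine (eLpNorm_le_add (ha n).continuous (hb n).continuous h0 le_top).trans ?_
  have k1 := key (a n) (ha n) (ENNReal.ofReal ‖v n‖) fun α hα =>
    (eLpNorm_left_le (hD n α hα) 2).trans (eLpNorm_D α _)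
  have k2 := key (b n) (hb n) (ENNReal.ofReal ‖v n‖) fun α hα =>
    (eLpNorm_right_le (hD n α hα) 2).trans (eLpNorm_D α _)
  refine (add_le_add k1 k2).trans (le_of_eq ?_)
  rw [ENNReal.ofReal_mul (by positivity), ENNReal.ofReal_mul (by positivity),
    ENNReal.ofReal_mul (by positivity), ENNReal.ofReal_coe_nnreal]
  norm_num
  ring

/-- The embedding of `H¹` into `L⁶`, with a smooth weight. -/
theorem exists_eLpNorm_six_le_norm (B : Box) : ∃ C : ℝ, 0 ≤ C ∧ ∀ w : E3 → ℝ, Smooth w →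
    ∀ u : Hm B 1, eLpNorm (mulL B w (D 0 u)) 6 B.vol ≤ ENNReal.ofReal (C * (‖mulL B w (D 0 u)‖ +
      ∑ i, ‖mulL B w (D (unitIdx i) u) + mulL B (pd i w) (D 0 u)‖)) := by
  obtain ⟨C, hC⟩ := exists_eLpNorm_six_le B
  refine ⟨2 * C, by positivity, fun w hw u => ?_⟩
  obtain ⟨v, a, b, hv, ha, hb, hD⟩ := exists_smooth_seq u
  have hcw : Continuous w := hw.continuous
  have hcpw : ∀ i, Continuous (pd i w) := fun i => (hw.pd i).continuous
  set N : Hm B 1 → ℝ := fun u => ‖mulL B w (D 0 u)‖ +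
      ∑ i, ‖mulL B w (D (unitIdx i) u) + mulL B (pd i w) (D 0 u)‖ with hN
  have hNc : Continuous fun u => 2 * C * N u := by fun_prop
  have hNn : ∀ u, 0 ≤ N u := fun u => by positivity
  refine eLpNorm_le_of_tendsto (f := fun n => mulL B w (D 0 (v n)))
    (((mulL B w).comp (D 0)).continuous.tendsto u |>.comp hv)
    (b := fun n => ENNReal.ofReal (2 * C * N (v n))) (fun n => ?_)
    ((ENNReal.continuous_ofReal.comp hNc).tendsto u |>.comp hv)
  have h0 := hD n 0 (zero_mem_multiIdx 1)
  have e0 : mulL B w (D 0 (v n)) =ᵐ[B.vol]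
      fun x => ((w x * a n x : ℝ) : ℂ) + ((w x * b n x : ℝ) : ℂ) * Complex.I := by
    filter_upwards [h0, coeFn_mulL hcw (D 0 (v n))] with x h1 h2
    rw [h2, h1, pdMulti_zero, pdMulti_zero]; push_cast; ring
  -- This is $\partial_i(wv)$: the embedding is applied to the product $wv$, so its constant does
  -- not depend on the weight.
  have e1 : ∀ i, (mulL B w (D (unitIdx i) (v n)) + mulL B (pd i w) (D 0 (v n)) : L2 B) =ᵐ[B.vol]
      fun x => ((pd i (fun x => w x * a n x) x : ℝ) : ℂ) +
        ((pd i (fun x => w x * b n x) x : ℝ) : ℂ) * Complex.I := by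
    intro i
    filter_upwards [h0, hD n (unitIdx i) (unitIdx_mem_multiIdx le_rfl i),
      coeFn_mulL hcw (D (unitIdx i) (v n)), coeFn_mulL (hcpw i) (D 0 (v n)),
      Lp.coeFn_add (mulL B w (D (unitIdx i) (v n))) (mulL B (pd i w) (D 0 (v n)))]
      with x h1 h2 h3 h4 h5
    rw [h5, Pi.add_apply, h4, h3, h2, h1, pdMulti_zero, pdMulti_zero, pdMulti_unitIdx (ha n),
      pdMulti_unitIdx (hb n), pd_mul hw (ha n), pd_mul hw (hb n)]
    push_cast; ring
  have hL : ∀ f : L2 B, eLpNorm f 2 B.vol = ENNReal.ofReal ‖f‖ := fun f => by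
    rw [Lp.norm_def, ENNReal.ofReal_toReal (Lp.eLpNorm_ne_top f)]
  have key : ∀ φ : E3 → ℝ, Smooth φ →
      eLpNorm φ 2 B.vol ≤ ENNReal.ofReal ‖mulL B w (D 0 (v n))‖ →
      (∀ i, eLpNorm (pd i φ) 2 B.vol ≤
        ENNReal.ofReal ‖mulL B w (D (unitIdx i) (v n)) + mulL B (pd i w) (D 0 (v n))‖) →
      eLpNorm φ 6 B.vol ≤ C * ENNReal.ofReal (N (v n)) := by
    intro φ hφ k0 k1
    refine (hC φ hφ).trans ?_
    rw [hN, ENNReal.ofReal_add (by positivity) (by positivity),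
      ENNReal.ofReal_sum_of_nonneg fun _ _ => norm_nonneg _]
    gcongr with i
    exact k1 i
  refine (eLpNorm_le_add (hcw.mul (ha n).continuous) (hcw.mul (hb n).continuous) e0
    (by norm_num)).trans ?_
  have k1 := key _ (hw.mul (ha n)) ((eLpNorm_left_le e0 2).trans (hL _).le) fun i =>
    (eLpNorm_left_le (e1 i) 2).trans (hL _).le
  have k2 := key _ (hw.mul (hb n)) ((eLpNorm_right_le e0 2).trans (hL _).le) fun i =>
    (eLpNorm_right_le (e1 i) 2).trans (hL _).le
  refine (add_le_add k1 k2).trans (le_of_eq ?_)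
  rw [ENNReal.ofReal_mul (by positivity), ENNReal.ofReal_mul (by positivity),
    ENNReal.ofReal_coe_nnreal]
  norm_num
  ring

end

section

/-! ### Products of gradients -/

lemma exists_shift_norm_le (B : Box) {n k : ℕ} {β : Fin 3 → ℕ} (h : ∑ i, β i + k ≤ n) (u : Hm B n) :
    ‖shift k β h u‖ ≤ (multiIdx k).card * ‖u‖ := by
  refine (norm_Hm_le_sum _).trans ?_
  rw [← nsmul_eq_mul]
  refine Finset.sum_le_card_nsmul _ _ _ fun α hα => ?_
  rw [D_shift h u hα]
  exact norm_D_le _ u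

lemma sum_unitIdx_add_le (i : Fin 3) {k n : ℕ} (h : 1 + k ≤ n) : ∑ j, unitIdx i j + k ≤ n := by
  rw [sum_unitIdx]; exact h

lemma exists_eLpNorm_gradient_le (B : Box) : ∃ C : ℝ, 0 ≤ C ∧ ∀ (u : Hm B 3) (i : Fin 3),
    eLpNorm (D (unitIdx i) u) ⊤ B.vol ≤ ENNReal.ofReal (C * ‖u‖) := by
  obtain ⟨C, hC0, hC⟩ := exists_eLpNorm_top_le B
  refine ⟨C * (multiIdx 2).card, by positivity, fun u i => ?_⟩
  have h := sum_unitIdx_add_le i (k := 2) (n := 3) (by norm_num)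
  have h1 := hC (shift 2 (unitIdx i) h u)
  rw [D_shift h u (zero_mem_multiIdx 2), add_zero] at h1
  refine h1.trans (ENNReal.ofReal_le_ofReal ?_)
  rw [mul_assoc]
  gcongr
  exact exists_shift_norm_le B h u

lemma memLp_top_gradient {B : Box} (u : Hm B 3) (i : Fin 3) :
    MemLp (D (unitIdx i) u) ⊤ B.vol := by
  obtain ⟨C, -, hC⟩ := exists_eLpNorm_gradient_le B
  exact ⟨Lp.aestronglyMeasurable _, (hC u i).trans_lt ENNReal.ofReal_lt_top⟩

/-- The partial derivative of `u ∈ H³` as an element of `L^∞`. -/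
def gradTop (B : Box) (i : Fin 3) : Hm B 3 →L[ℝ] Lp ℂ ⊤ B.vol :=
  LinearMap.mkContinuous
    { toFun := fun u => (memLp_top_gradient u i).toLp _
      map_add' := fun u v => by
        rw [← MemLp.toLp_add]
        refine MemLp.toLp_congr _ _ ?_
        rw [map_add]
        exact Lp.coeFn_add _ _
      map_smul' := fun c u => by
        rw [RingHom.id_apply, ← MemLp.toLp_const_smul]
        refine MemLp.toLp_congr _ _ ?_
        rw [map_smul]
        exact Lp.coeFn_smul _ _ } (exists_eLpNorm_gradient_le B).choose fun u => by
    have h := (exists_eLpNorm_gradient_le B).choose_spec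
    refine (Lp.norm_toLp _ (memLp_top_gradient u i)).le.trans ?_
    exact ENNReal.toReal_le_of_le_ofReal (mul_nonneg h.1 (norm_nonneg _)) (h.2 u i)

lemma coeFn_gradTop {B : Box} (i : Fin 3) (u : Hm B 3) :
    gradTop B i u =ᵐ[B.vol] D (unitIdx i) u := MemLp.coeFn_toLp (memLp_top_gradient u i)

/-- The product `∇u · ∇v`. -/
def gdot (B : Box) : Hm B 3 →L[ℝ] Hm B 3 →L[ℝ] L2 B :=
  ∑ i, ((ContinuousLinearMap.mul ℝ ℂ).holderL B.vol ⊤ 2 2).bilinearComp (gradTop B i)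
    (D (unitIdx i))

lemma gdot_apply {B : Box} (u v : Hm B 3) : gdot B u v =
    ∑ i, (ContinuousLinearMap.mul ℝ ℂ).holderL B.vol ⊤ 2 2 (gradTop B i u) (D (unitIdx i) v) := by
  simp [gdot]

lemma coeFn_mul_gradient {B : Box} (i : Fin 3) (u : Hm B 3) (f : L2 B) :
    (ContinuousLinearMap.mul ℝ ℂ).holderL B.vol ⊤ 2 2 (gradTop B i u) f =ᵐ[B.vol]
      fun x => D (unitIdx i) u x * f x := by
  rw [ContinuousLinearMap.holderL_apply_apply]
  filter_upwards [ContinuousLinearMap.coeFn_holder (ContinuousLinearMap.mul ℝ ℂ) (r := 2)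
    (gradTop B i u) f, coeFn_gradTop i u] with x hx hx'
  rw [hx, hx', ContinuousLinearMap.mul_apply']

lemma coeFn_gdot {B : Box} (u v : Hm B 3) : gdot B u v =ᵐ[B.vol]
    fun x => ∑ i, D (unitIdx i) u x * D (unitIdx i) v x := by
  rw [gdot_apply, Fin.sum_univ_three]
  filter_upwards [coeFn_mul_gradient 0 u (D (unitIdx 0) v),
    coeFn_mul_gradient 1 u (D (unitIdx 1) v), coeFn_mul_gradient 2 u (D (unitIdx 2) v),
    Lp.coeFn_add ((ContinuousLinearMap.mul ℝ ℂ).holderL B.vol ⊤ 2 2 (gradTop B 0 u)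
      (D (unitIdx 0) v) + (ContinuousLinearMap.mul ℝ ℂ).holderL B.vol ⊤ 2 2 (gradTop B 1 u)
      (D (unitIdx 1) v)) ((ContinuousLinearMap.mul ℝ ℂ).holderL B.vol ⊤ 2 2 (gradTop B 2 u)
      (D (unitIdx 2) v)),
    Lp.coeFn_add ((ContinuousLinearMap.mul ℝ ℂ).holderL B.vol ⊤ 2 2 (gradTop B 0 u)
      (D (unitIdx 0) v)) ((ContinuousLinearMap.mul ℝ ℂ).holderL B.vol ⊤ 2 2 (gradTop B 1 u)
      (D (unitIdx 1) v))] with x h0 h1 h2 h3 h4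
  rw [h3, Pi.add_apply, h4, Pi.add_apply, h0, h1, h2, Fin.sum_univ_three]

lemma gdot_comm {B : Box} (u v : Hm B 3) : gdot B u v = gdot B v u := by
  refine Lp.ext ?_
  filter_upwards [coeFn_gdot u v, coeFn_gdot v u] with x h1 h2
  rw [h1, h2]
  simp_rw [mul_comm]

namespace CarlemanWeight

variable {B : Box} (w : CarlemanWeight B)

lemma continuous_ofZ_e (lam : ℝ) : Continuous (ofZ (w.e lam)) :=
  (smooth_ofZ (w.smooth_e lam)).continuous

lemma coeFn_E (lam : ℝ) (f : L2 B) :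
    w.E lam f =ᵐ[B.vol] fun x => ((w.e lam (x 2) : ℝ) : ℂ) * f x :=
  coeFn_mulL (w.continuous_ofZ_e lam) f

lemma e_pos (lam z : ℝ) : 0 < w.e lam z := Real.exp_pos _

/-- The weighted gradient. -/
def gradE (lam : ℝ) : Hm B 3 →L[ℝ] PiLp 2 fun _ : Fin 3 => L2 B :=
  ((PiLp.continuousLinearEquiv 2 ℝ fun _ : Fin 3 => L2 B).symm : _ →L[ℝ] _).comp
    (ContinuousLinearMap.pi fun i => (w.E lam).comp (D (unitIdx i)))

/-- The weighted Hessian. -/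
def hessE (lam : ℝ) : Hm B 3 →L[ℝ] PiLp 2 fun _ : Fin 3 × Fin 3 => L2 B :=
  ((PiLp.continuousLinearEquiv 2 ℝ fun _ : Fin 3 × Fin 3 => L2 B).symm : _ →L[ℝ] _).comp
    (ContinuousLinearMap.pi fun p : Fin 3 × Fin 3 => (w.E lam).comp (D (unitIdx p.1 + unitIdx p.2)))

lemma norm_gradE_sq (lam : ℝ) (u : Hm B 3) :
    ‖w.gradE lam u‖ ^ 2 = ∑ i, ‖w.E lam (D (unitIdx i) u)‖ ^ 2 := by
  rw [PiLp.norm_sq_eq_of_L2]; rfl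

lemma norm_hessE_sq (lam : ℝ) (u : Hm B 3) :
    ‖w.hessE lam u‖ ^ 2 = ∑ i, ∑ j, ‖w.E lam (D (unitIdx i + unitIdx j) u)‖ ^ 2 := by
  rw [PiLp.norm_sq_eq_of_L2, Fintype.sum_prod_type]; rfl

lemma norm_E_le_gradE (lam : ℝ) (u : Hm B 3) (i : Fin 3) :
    ‖w.E lam (D (unitIdx i) u)‖ ≤ ‖w.gradE lam u‖ := PiLp.norm_apply_le (w.gradE lam u) i

lemma norm_E_le_hessE (lam : ℝ) (u : Hm B 3) (i j : Fin 3) :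
    ‖w.E lam (D (unitIdx i + unitIdx j) u)‖ ≤ ‖w.hessE lam u‖ :=
  PiLp.norm_apply_le (w.hessE lam u) (i, j)

lemma M_nonneg : 0 ≤ w.M :=
  (abs_nonneg _).trans (w.abs₁ 0 ⟨by linarith [B.ξ_pos], B.d_pos⟩)

/-- $\partial_ze^{\lambda\psi}=\lambda\psi'e^{\lambda\psi}$ with $|\psi'|\le M$; the other partial
derivatives of the weight vanish. -/
lemma norm_mulL_pd_e_le (lam : ℝ) (j : Fin 3) (f : L2 B) :
    ‖mulL B (pd j (ofZ (w.e lam))) f‖ ≤ |lam| * w.M * ‖w.E lam f‖ := by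
  have hs := smooth_ofZ (w.smooth_e lam)
  have hM := w.M_nonneg
  have hb : ∀ x ∈ B.domain, |pd j (ofZ (w.e lam)) x| ≤ |lam| * w.M * w.e lam (x 2) := by
    intro x hx
    have he := w.e_pos lam (x 2)
    by_cases hj : j = 2
    · subst hj
      rw [pd_ofZ (w.smooth_e lam), ofZ,
        show deriv (w.e lam) (x 2) = w.e lam (x 2) * (lam * w.ψ₁ (x 2)) from
          (((w.deriv₁ (x 2)).const_mul lam).exp).deriv, abs_mul, abs_mul, abs_of_pos he, mul_comm]
      gcongr
      exact w.abs₁ _ ⟨hx.2.2.1, hx.2.2.2⟩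
    · rw [pd_ofZ_of_ne (w.smooth_e lam) hj]
      simp only [Pi.zero_apply, abs_zero]
      positivity
  refine Lp.norm_le_mul_norm_of_ae_le_mul ?_
  filter_upwards [coeFn_mulL (hs.pd j).continuous f, w.coeFn_E lam f, Box.ae_vol hb]
    with x h1 h2 h3
  rw [h1, h2, norm_mul, norm_mul, Complex.norm_real, Complex.norm_real, Real.norm_eq_abs,
    Real.norm_eq_abs, abs_of_pos (w.e_pos lam _), ← mul_assoc]
  gcongr

/-- The weighted embedding of `H¹` into `L⁶`, for gradients. -/
lemma exists_eLpNorm_six_E_le : ∃ C : ℝ, 0 ≤ C ∧ ∀ lam : ℝ, 1 ≤ lam → ∀ (u : Hm B 3) (i : Fin 3),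
    eLpNorm (w.E lam (D (unitIdx i) u)) 6 B.vol ≤
      ENNReal.ofReal (C * (‖w.hessE lam u‖ + lam * ‖w.gradE lam u‖)) := by
  obtain ⟨C, hC0, hC⟩ := exists_eLpNorm_six_le_norm B
  have hM := w.M_nonneg
  refine ⟨C * (4 + 3 * w.M), by positivity, fun lam hl u i => ?_⟩
  have hl0 : 0 ≤ lam := by linarith
  have h := sum_unitIdx_add_le i (k := 1) (n := 3) (by norm_num)
  have h1 := hC (ofZ (w.e lam)) (smooth_ofZ (w.smooth_e lam)) (shift 1 (unitIdx i) h u)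
  rw [D_shift h u (zero_mem_multiIdx 1), add_zero] at h1
  refine h1.trans (ENNReal.ofReal_le_ofReal ?_)
  rw [mul_assoc]
  gcongr
  have e0 : ∀ f, mulL B (ofZ (w.e lam)) f = w.E lam f := fun _ => rfl
  have k1 := w.norm_E_le_gradE lam u i
  have k2 : ∀ j, ‖mulL B (ofZ (w.e lam)) (D (unitIdx j) (shift 1 (unitIdx i) h u)) +
      mulL B (pd j (ofZ (w.e lam))) (D (unitIdx i) u)‖ ≤
      ‖w.hessE lam u‖ + lam * w.M * ‖w.gradE lam u‖ := by
    intro j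
    rw [D_shift h u (unitIdx_mem_multiIdx le_rfl j), e0]
    refine (norm_add_le _ _).trans (add_le_add (w.norm_E_le_hessE lam u i j) ?_)
    refine (w.norm_mulL_pd_e_le lam j _).trans ?_
    rw [abs_of_nonneg hl0]
    gcongr
  have k3 := Finset.sum_le_sum fun j (_ : j ∈ Finset.univ) => k2 j
  rw [Finset.sum_const, Finset.card_univ, Fintype.card_fin, nsmul_eq_mul] at k3
  rw [e0]
  have n1 := norm_nonneg (w.hessE lam u)
  have n2 := norm_nonneg (w.gradE lam u)
  push_cast at k3
  have : ‖w.gradE lam u‖ ≤ lam * ‖w.gradE lam u‖ := le_mul_of_one_le_left n2 hl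
  have : 0 ≤ w.M * ‖w.hessE lam u‖ := by positivity
  nlinarith

/-- The weight can be placed entirely on $\nabla v$, while $\nabla u$ is bounded by $H^2\subset
L^\infty$. -/
lemma exists_norm_E_gdot_le : ∃ C : ℝ, 0 ≤ C ∧ ∀ (lam : ℝ) (u v : Hm B 3),
    ‖w.E lam (gdot B u v)‖ ≤ C * ‖u‖ * ‖w.gradE lam v‖ := by
  refine ⟨∑ i, ‖gradTop B i‖, by positivity, fun lam u v => ?_⟩
  rw [gdot_apply, map_sum, Finset.sum_mul, Finset.sum_mul]
  refine (norm_sum_le _ _).trans (Finset.sum_le_sum fun i _ => ?_)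
  have e : w.E lam ((ContinuousLinearMap.mul ℝ ℂ).holderL B.vol ⊤ 2 2 (gradTop B i u)
      (D (unitIdx i) v)) = (ContinuousLinearMap.mul ℝ ℂ).holderL B.vol ⊤ 2 2 (gradTop B i u)
      (w.E lam (D (unitIdx i) v)) := by
    refine Lp.ext ?_
    filter_upwards [w.coeFn_E lam ((ContinuousLinearMap.mul ℝ ℂ).holderL B.vol ⊤ 2 2
      (gradTop B i u) (D (unitIdx i) v)), coeFn_mul_gradient i u (D (unitIdx i) v),
      coeFn_mul_gradient i u (w.E lam (D (unitIdx i) v)), w.coeFn_E lam (D (unitIdx i) v)]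
      with x h1 h2 h3 h4
    rw [h1, h2, h3, h4]; ring
  rw [e, ContinuousLinearMap.holderL_apply_apply]
  refine (ContinuousLinearMap.norm_holder_apply_apply_le _ _ _).trans ?_
  have := (gradTop B i).le_opNorm u
  have := w.norm_E_le_gradE lam v i
  have h1 : ‖ContinuousLinearMap.mul ℝ ℂ‖ ≤ 1 := ContinuousLinearMap.opNorm_mul_le ℝ ℂ
  calc _ ≤ 1 * (‖gradTop B i‖ * ‖u‖) * ‖w.gradE lam v‖ := by gcongr
    _ = _ := by ring

end CarlemanWeight

/-! ### A trilinear estimate -/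

/-- Hölder's inequality with exponents 2, 6, 3, where the $L^3$ norm of $c$ is at most the geometric
mean of its $L^2$ and $L^6$ norms. -/
lemma lintegral_trilinear_le {α : Type*} [MeasurableSpace α] {μ : Measure α} {a b c : α → ENNReal}
    (ha : AEMeasurable a μ) (hb : AEMeasurable b μ) (hc : AEMeasurable c μ) :
    ∫⁻ x, b x * (a x * c x) ∂μ ≤ (∫⁻ x, b x ^ 2 ∂μ) ^ (1 / 2 : ℝ) *
      ((∫⁻ x, a x ^ 6 ∂μ) ^ (1 / 6 : ℝ) * ((∫⁻ x, c x ^ 2 ∂μ) ^ (1 / 2 : ℝ) *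
        (∫⁻ x, c x ^ 6 ∂μ) ^ (1 / 6 : ℝ)) ^ (1 / 2 : ℝ)) := by
  refine (lintegral_mul_le_sqrt hb (ha.mul hc)).trans (mul_le_mul' le_rfl ?_)
  have h1 : ∫⁻ x, (a x * c x) ^ 2 ∂μ ≤ (∫⁻ x, (a x ^ 2 * c x) ^ 2 ∂μ) ^ (1 / 2 : ℝ) *
      (∫⁻ x, c x ^ 2 ∂μ) ^ (1 / 2 : ℝ) := by
    refine le_trans (le_of_eq ?_) (lintegral_mul_le_sqrt ((ha.pow_const 2).mul hc) hc)
    exact lintegral_congr fun x => by ring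
  have h2 : ∫⁻ x, (a x ^ 2 * c x) ^ 2 ∂μ ≤ (∫⁻ x, a x ^ 6 ∂μ) ^ (2 / 3 : ℝ) *
      (∫⁻ x, c x ^ 6 ∂μ) ^ (1 / 3 : ℝ) := by
    have := ENNReal.lintegral_mul_le_Lp_mul_Lq μ (p := 3 / 2) (q := 3)
      (by rw [Real.holderConjugate_iff]; norm_num) (ha.pow_const 4) (hc.pow_const 2)
    have e1 : ∀ x, (a x ^ 4) ^ (3 / 2 : ℝ) = a x ^ 6 := fun x => by
      rw [← ENNReal.rpow_natCast, ← ENNReal.rpow_mul, ← ENNReal.rpow_natCast]; norm_num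
    have e2 : ∀ x, (c x ^ 2) ^ (3 : ℝ) = c x ^ 6 := fun x => by
      rw [← ENNReal.rpow_natCast, ← ENNReal.rpow_mul, ← ENNReal.rpow_natCast]; norm_num
    simp_rw [e1, e2] at this
    refine le_trans (le_of_eq ?_) (this.trans (le_of_eq ?_))
    · exact lintegral_congr fun x => by simp only [Pi.mul_apply]; ring
    · norm_num
  calc (∫⁻ x, (a x * c x) ^ 2 ∂μ) ^ (1 / 2 : ℝ)
      ≤ (((∫⁻ x, a x ^ 6 ∂μ) ^ (2 / 3 : ℝ) * (∫⁻ x, c x ^ 6 ∂μ) ^ (1 / 3 : ℝ)) ^ (1 / 2 : ℝ) *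
        (∫⁻ x, c x ^ 2 ∂μ) ^ (1 / 2 : ℝ)) ^ (1 / 2 : ℝ) := by
        refine ENNReal.rpow_le_rpow (h1.trans ?_) (by norm_num)
        gcongr
    _ = _ := by
        have hh : (0 : ℝ) ≤ 1 / 2 := by norm_num
        simp only [ENNReal.mul_rpow_of_nonneg _ _ hh, ← ENNReal.rpow_mul]
        norm_num
        ring

lemma abs_inner_le_lintegral {B : Box} (f h : L2 B) :
    ENNReal.ofReal |inner ℝ f h| ≤ ∫⁻ x, ‖f x‖ₑ * ‖h x‖ₑ ∂B.vol := by
  rw [L2.inner_def, ← Real.enorm_eq_ofReal_abs]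
  refine (enorm_integral_le_lintegral_enorm _).trans (lintegral_mono fun x => ?_)
  rw [← ofReal_norm, ← ofReal_norm, ← ofReal_norm, ← ENNReal.ofReal_mul (norm_nonneg _)]
  exact ENNReal.ofReal_le_ofReal (norm_inner_le_norm _ _)

/-- The two copies of the weight are moved to $b$ and $c$. The factor $a$, in applications the value
of the operator at a given point, stays unweighted and thus has a bound independent of $\lambda$. -/
lemma CarlemanWeight.abs_inner_E_mul_le {B : Box} (w : CarlemanWeight B) (lam : ℝ)
    {a b c f : L2 B} (hf : f =ᵐ[B.vol] fun x => b x * c x) {A G : ℝ} (hA : 0 ≤ A) (hG : 0 ≤ G)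
    (ha : eLpNorm a 6 B.vol ≤ ENNReal.ofReal A)
    (hc : eLpNorm (w.E lam c) 6 B.vol ≤ ENNReal.ofReal G) :
    |inner ℝ (w.E lam a) (w.E lam f)| ≤ A * (‖w.E lam b‖ * √(‖w.E lam c‖ * G)) := by
  rw [← ENNReal.ofReal_le_ofReal_iff (by positivity)]
  refine (abs_inner_le_lintegral _ _).trans ?_
  have e : ∫⁻ x, ‖w.E lam a x‖ₑ * ‖w.E lam f x‖ₑ ∂B.vol =
      ∫⁻ x, ‖w.E lam b x‖ₑ * (‖a x‖ₑ * ‖w.E lam c x‖ₑ) ∂B.vol := by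
    refine lintegral_congr_ae ?_
    filter_upwards [hf, w.coeFn_E lam a, w.coeFn_E lam b, w.coeFn_E lam c, w.coeFn_E lam f]
      with x h1 h2 h3 h4 h5
    rw [h2, h3, h4, h5, h1]
    simp only [enorm_mul]; ring
  rw [e]
  refine (lintegral_trilinear_le (Lp.aestronglyMeasurable a).enorm
    (Lp.aestronglyMeasurable _).enorm (Lp.aestronglyMeasurable _).enorm).trans ?_
  have h2 : ∀ f : L2 B, (∫⁻ x, ‖f x‖ₑ ^ 2 ∂B.vol) ^ (1 / 2 : ℝ) = ENNReal.ofReal ‖f‖ := fun f => by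
    rw [Lp.norm_def, ENNReal.ofReal_toReal (Lp.eLpNorm_ne_top f)]
    simpa using (eLpNorm_nat (μ := B.vol) f 2 (by norm_num)).symm
  have h6 : ∀ f : L2 B, (∫⁻ x, ‖f x‖ₑ ^ 6 ∂B.vol) ^ (1 / 6 : ℝ) = eLpNorm f 6 B.vol := fun f => by
    simpa using (eLpNorm_nat (μ := B.vol) f 6 (by norm_num)).symm
  rw [h2, h2, h6, h6, ENNReal.ofReal_mul hA, ENNReal.ofReal_mul (norm_nonneg _), Real.sqrt_eq_rpow,
    ← ENNReal.ofReal_rpow_of_nonneg (by positivity) (by norm_num),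
    ENNReal.ofReal_mul (norm_nonneg _), mul_left_comm]
  gcongr

/-- The trilinear estimate for products of gradients. -/
lemma CarlemanWeight.exists_abs_inner_E_gdot_le {B : Box} (w : CarlemanWeight B) :
    ∃ C : ℝ, 0 ≤ C ∧ ∀ lam : ℝ, 1 ≤ lam → ∀ (a : L2 B) (A : ℝ), 0 ≤ A →
      eLpNorm a 6 B.vol ≤ ENNReal.ofReal A → ∀ u v : Hm B 3,
      |inner ℝ (w.E lam a) (w.E lam (gdot B u v))| ≤ C * A * (‖w.gradE lam u‖ *
        √(‖w.gradE lam v‖ * (‖w.hessE lam v‖ + lam * ‖w.gradE lam v‖))) := by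
  obtain ⟨C, hC0, hC⟩ := w.exists_eLpNorm_six_E_le
  refine ⟨3 * √C, by positivity, fun lam hl a A hA ha u v => ?_⟩
  set G := ‖w.hessE lam v‖ + lam * ‖w.gradE lam v‖ with hGd
  have hG : 0 ≤ G := by positivity
  rw [gdot_apply, map_sum, inner_sum]
  refine (Finset.abs_sum_le_sum_abs _ _).trans ?_
  have key : ∀ i : Fin 3, |inner ℝ (w.E lam a) (w.E lam ((ContinuousLinearMap.mul ℝ ℂ).holderL
      B.vol ⊤ 2 2 (gradTop B i u) (D (unitIdx i) v)))| ≤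
      √C * A * (‖w.gradE lam u‖ * √(‖w.gradE lam v‖ * G)) := by
    intro i
    refine (w.abs_inner_E_mul_le lam (coeFn_mul_gradient i u (D (unitIdx i) v)) hA
      (by positivity) ha (hC lam hl v i)).trans ?_
    have h1 := w.norm_E_le_gradE lam u i
    have h2 := w.norm_E_le_gradE lam v i
    have h3 : ‖w.gradE lam v‖ * (C * G) = C * (‖w.gradE lam v‖ * G) := by ring
    have h4 : √C * A * (‖w.gradE lam u‖ * √(‖w.gradE lam v‖ * G)) =
        A * (‖w.gradE lam u‖ * √(‖w.gradE lam v‖ * (C * G))) := by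
      rw [h3, Real.sqrt_mul hC0]; ring
    rw [h4]
    refine mul_le_mul_of_nonneg_left (mul_le_mul h1 (Real.sqrt_le_sqrt ?_) (Real.sqrt_nonneg _)
      (norm_nonneg _)) hA
    exact mul_le_mul_of_nonneg_right h2 (by positivity)
  refine (Finset.sum_le_sum fun i _ => key i).trans (le_of_eq ?_)
  generalize ‖w.gradE lam u‖ * √(‖w.gradE lam v‖ * G) = K
  rw [Finset.sum_const, Finset.card_univ, Fintype.card_fin, nsmul_eq_mul]
  push_cast; ring

/-! ### Bounds in `L⁶` -/

lemma exists_eLpNorm_six_D_le (B : Box) : ∃ C : ℝ, 0 ≤ C ∧ ∀ (u : Hm B 3) (β : Fin 3 → ℕ),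
    ∑ i, β i ≤ 2 → eLpNorm (D β u) 6 B.vol ≤ ENNReal.ofReal (C * ‖u‖) := by
  obtain ⟨C, hC0, hC⟩ := exists_eLpNorm_six_le_norm B
  refine ⟨C * 4, by positivity, fun u β hβ => ?_⟩
  have h : ∑ i, β i + 1 ≤ 3 := by omega
  have h1 := hC (fun _ => 1) contDiff_const (shift 1 β h u)
  have e1 : ∀ i, pd i (fun _ : E3 => (1 : ℝ)) = fun _ => 0 := fun i => by
    ext x; simp [pd]
  have e2 : ∀ f : L2 B, mulL B (fun _ => 0) f = 0 := fun f => by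
    refine Lp.ext ?_
    filter_upwards [coeFn_mulL (B := B) (g := fun _ => 0) continuous_const f,
      Lp.coeFn_zero ℂ 2 B.vol] with x h1 h2
    rw [h1, h2]; simp
  simp only [e1, e2, mulL_one, add_zero] at h1
  rw [D_shift h u (zero_mem_multiIdx 1), add_zero] at h1
  refine h1.trans (ENNReal.ofReal_le_ofReal ?_)
  rw [mul_assoc]
  gcongr
  have k1 := norm_D_le β u
  have k2 : ∑ i, ‖D (unitIdx i) (shift 1 β h u)‖ ≤ ∑ _i : Fin 3, ‖u‖ :=
    Finset.sum_le_sum fun i _ => by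
      rw [D_shift h u (unitIdx_mem_multiIdx le_rfl i)]; exact norm_D_le _ u
  rw [Finset.sum_const, Finset.card_univ, Fintype.card_fin, nsmul_eq_mul] at k2
  push_cast at k2
  linarith

lemma exists_eLpNorm_six_gdot_le (B : Box) : ∃ C : ℝ, 0 ≤ C ∧ ∀ u v : Hm B 3,
    eLpNorm (gdot B u v) 6 B.vol ≤ ENNReal.ofReal (C * (‖u‖ * ‖v‖)) := by
  obtain ⟨C₁, h₁0, h₁⟩ := exists_eLpNorm_gradient_le B
  obtain ⟨C₂, h₂0, h₂⟩ := exists_eLpNorm_six_D_le B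
  refine ⟨3 * (C₁ * C₂), by positivity, fun u v => ?_⟩
  rw [eLpNorm_congr_ae (coeFn_gdot u v)]
  have e : (fun x => ∑ i, D (unitIdx i) u x * D (unitIdx i) v x) =
      ∑ i, fun x => D (unitIdx i) u x * D (unitIdx i) v x := by
    ext x; simp [Finset.sum_apply]
  rw [e]
  have hm : ∀ i (z : Hm B 3), AEStronglyMeasurable (D (unitIdx i) z) B.vol :=
    fun i z => Lp.aestronglyMeasurable _
  refine (eLpNorm_sum_le (fun i _ => (hm i u).mul (hm i v)) (by norm_num)).trans ?_
  have key : ∀ i : Fin 3, eLpNorm (fun x => D (unitIdx i) u x * D (unitIdx i) v x) 6 B.vol ≤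
      ENNReal.ofReal (C₁ * ‖u‖ * (C₂ * ‖v‖)) := by
    intro i
    have := eLpNorm_le_eLpNorm_mul_eLpNorm_of_nnnorm (p := ⊤) (q := 6) (r := 6) (hm i u) (hm i v)
      (fun a b => a * b) 1 (Eventually.of_forall fun x => by simp)
    refine this.trans ?_
    rw [ENNReal.ofReal_mul (by positivity), ENNReal.coe_one, one_mul]
    exact mul_le_mul' (h₁ u i) (h₂ v _ (by rw [sum_unitIdx]; norm_num))
  refine (Finset.sum_le_sum fun i _ => key i).trans (le_of_eq ?_)
  rw [← ENNReal.ofReal_sum_of_nonneg fun _ _ => by positivity]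
  congr 1
  simp; ring

end

section

/-! ### Minimization over convex sets -/

section Hilbert

variable {H : Type*} [NormedAddCommGroup H] [InnerProductSpace ℝ H] [CompleteSpace H]

/-- A continuous nonnegative function that is uniformly convex at midpoints has exactly one
minimizer on a closed convex set. -/
lemma existsUnique_isMinimizer {K : Set H} (hK : IsClosed K) (hne : K.Nonempty)
    (hconv : Convex ℝ K) {f : H → ℝ} (hf : Continuous f) (h0 : ∀ x, 0 ≤ f x) {c : ℝ} (hc : 0 < c)
    (hm : ∀ x ∈ K, ∀ y ∈ K, f ((1 / 2 : ℝ) • x + (1 / 2 : ℝ) • y) + c * ‖x - y‖ ^ 2 ≤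
      (f x + f y) / 2) : ∃! x, IsMinimizer f K x := by
  have hmid : ∀ x ∈ K, ∀ y ∈ K, (1 / 2 : ℝ) • x + (1 / 2 : ℝ) • y ∈ K := fun x hx y hy =>
    hconv hx hy (by norm_num) (by norm_num) (by norm_num)
  set I := sInf (f '' K) with hI
  have hbdd : BddBelow (f '' K) := ⟨0, by rintro _ ⟨x, -, rfl⟩; exact h0 x⟩
  have hle : ∀ x ∈ K, I ≤ f x := fun x hx => csInf_le hbdd (mem_image_of_mem f hx)
  have hex : ∀ n : ℕ, ∃ x ∈ K, f x < I + 1 / ((n : ℝ) + 1) := fun n => by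
    have h : (0 : ℝ) < 1 / ((n : ℝ) + 1) := by positivity
    obtain ⟨_, ⟨x, hx, rfl⟩, hlt⟩ := exists_lt_of_csInf_lt (hne.image f)
      (show sInf (f '' K) < I + 1 / ((n : ℝ) + 1) by rw [← hI]; linarith)
    exact ⟨x, hx, hlt⟩
  choose u huK hu using hex
  -- The value at the midpoint is at least the infimum, so two points that almost minimize are close
  -- to each other. This gives both the Cauchy property and uniqueness.
  have hdist : ∀ x ∈ K, ∀ y ∈ K, ∀ ε : ℝ, f x ≤ I + ε → f y ≤ I + ε → ‖x - y‖ ^ 2 ≤ ε / c := by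
    intro x hx y hy ε h1 h2
    have := hm x hx y hy
    have := hle _ (hmid x hx y hy)
    rw [le_div_iff₀ hc]
    linarith
  have hcauchy : CauchySeq u := by
    rw [Metric.cauchySeq_iff']
    intro ε hε
    obtain ⟨N, hN⟩ := exists_nat_one_div_lt (show 0 < c * ε ^ 2 by positivity)
    refine ⟨N, fun n hn => ?_⟩
    have hnN : 1 / ((n : ℝ) + 1) ≤ 1 / ((N : ℝ) + 1) := by gcongr
    have h1 := hdist _ (huK n) _ (huK N) (1 / ((N : ℝ) + 1)) ((hu n).le.trans (by gcongr)) (hu N).le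
    rw [dist_eq_norm]
    refine lt_of_pow_lt_pow_left₀ 2 hε.le (h1.trans_lt ?_)
    rw [div_lt_iff₀ hc]
    linarith
  obtain ⟨x, hx⟩ := cauchySeq_tendsto_of_complete hcauchy
  have hxK : x ∈ K := hK.mem_of_tendsto hx (Eventually.of_forall huK)
  have hfx : f x ≤ I := by
    have h1 : Tendsto (fun n => f (u n)) atTop (𝓝 (f x)) := (hf.tendsto x).comp hx
    have h2 : Tendsto (fun n : ℕ => I + 1 / ((n : ℝ) + 1)) atTop (𝓝 (I + 0)) :=
      tendsto_const_nhds.add tendsto_one_div_add_atTop_nhds_zero_nat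
    rw [add_zero] at h2
    exact le_of_tendsto_of_tendsto' h1 h2 fun n => (hu n).le
  refine ⟨x, ⟨hxK, fun y hy => hfx.trans (hle y hy)⟩, fun y hy => ?_⟩
  have hfy : f y ≤ I := (hy.2 hxK).trans hfx
  have h1 := hdist y hy.1 x hxK 0 (by linarith) (by linarith)
  rw [zero_div] at h1
  have : ‖y - x‖ = 0 := by nlinarith [norm_nonneg (y - x)]
  exact sub_eq_zero.1 (norm_eq_zero.1 this)

lemma inner_gradient_eq {f : H → ℝ} {x : H} {f' : H →L[ℝ] ℝ} (h : HasFDerivAt f f' x) (y : H) :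
    inner ℝ (∇ f x) y = f' y := by
  rw [h.hasGradientAt.gradient, InnerProductSpace.toDual_symm_apply]

/-- Variational inequality for a minimizer on a convex set. -/
lemma IsMinimizer.inner_gradient_nonneg {K : Set H} (hconv : Convex ℝ K) {f : H → ℝ} {x y : H}
    (hx : IsMinimizer f K x) (hf : DifferentiableAt ℝ f x) (hy : y ∈ K) :
    0 ≤ inner ℝ (∇ f x) (y - x) := by
  rw [inner_gradient_eq hf.hasFDerivAt]
  exact hx.2.localize.hasFDerivWithinAt_nonneg hf.hasFDerivAt.hasFDerivWithinAt
    (sub_mem_posTangentConeAt_of_segment_subset (hconv.segment_subset hx.1 hy))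

lemma IsProj.inner_le_zero {K : Set H} (hconv : Convex ℝ K) {x y z : H} (h : IsProj K x y)
    (hz : z ∈ K) : inner ℝ (x - y) (z - y) ≤ 0 := by
  refine (norm_eq_iInf_iff_real_inner_le_zero hconv h.1).1 ?_ z hz
  have : Nonempty K := ⟨⟨y, h.1⟩⟩
  refine le_antisymm (le_ciInf fun w => ?_) (ciInf_le ⟨0, ?_⟩ (⟨y, h.1⟩ : K))
  · rw [← dist_eq_norm, ← dist_eq_norm]; exact h.2 w w.2
  · rintro _ ⟨w, rfl⟩; exact norm_nonneg _

/-- One step of the gradient projection method. -/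
lemma IsProj.norm_sub_sq_le {K : Set H} (hconv : Convex ℝ K) {f : H → ℝ} {m p y : H}
    (hm : IsMinimizer f K m) (hd : DifferentiableAt ℝ f m) {ω ρ L : ℝ} (hω : 0 < ω)
    (hmono : 2 * ρ * ‖p - m‖ ^ 2 ≤ inner ℝ (∇ f p - ∇ f m) (p - m))
    (hlip : ‖∇ f p - ∇ f m‖ ≤ L * ‖p - m‖) (hωL : ω * L ^ 2 ≤ 2 * ρ)
    (hy : IsProj K (p - ω • ∇ f p) y) : ‖y - m‖ ^ 2 ≤ (1 - 2 * ω * ρ) * ‖p - m‖ ^ 2 := by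
  have h1 := hy.inner_le_zero hconv hm.1
  have h2 := hm.inner_gradient_nonneg hconv hd hy.1
  set g := ∇ f p - ∇ f m with hg
  set z := p - m - ω • g with hz
  -- The characterization of the projection, tested with the minimizer, is added to the variational
  -- inequality at the minimizer, tested with the projection.
  have h3 : ‖y - m‖ ^ 2 ≤ inner ℝ z (y - m) := by
    have e : inner ℝ (p - ω • ∇ f p - y) (m - y) =
        ‖y - m‖ ^ 2 - inner ℝ z (y - m) + ω * inner ℝ (∇ f m) (y - m) := by
      rw [← real_inner_self_eq_norm_sq, ← inner_sub_left, ← real_inner_smul_left, ← inner_add_left,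
        ← inner_neg_neg]
      congr 1
      · rw [hz, hg]; module
      · abel
    have := mul_nonneg hω.le h2
    linarith
  have h4 : ‖y - m‖ ^ 2 ≤ ‖z‖ ^ 2 := by
    have h5 := real_inner_le_norm z (y - m)
    have h6 : ‖y - m‖ ≤ ‖z‖ := by
      rcases (norm_nonneg (y - m)).eq_or_lt with h | h
      · rw [← h]; exact norm_nonneg _
      · have : ‖y - m‖ * ‖y - m‖ ≤ ‖z‖ * ‖y - m‖ := by nlinarith
        exact le_of_mul_le_mul_right this h
    gcongr
  have h5 : ‖z‖ ^ 2 = ‖p - m‖ ^ 2 - 2 * ω * inner ℝ g (p - m) + ω ^ 2 * ‖g‖ ^ 2 := by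
    rw [hz, norm_sub_sq_real, real_inner_smul_right, norm_smul, Real.norm_eq_abs, mul_pow, sq_abs,
      real_inner_comm]
    ring
  have h6 : ‖g‖ ^ 2 ≤ L ^ 2 * ‖p - m‖ ^ 2 := by
    rw [← mul_pow]; gcongr
  -- Monotonicity gains $4\omega\rho$ and the bound on the step lets the quadratic term take back at
  -- most $2\omega\rho$.
  have h7 : ω ^ 2 * ‖g‖ ^ 2 ≤ ω * (2 * ρ) * ‖p - m‖ ^ 2 := by
    calc ω ^ 2 * ‖g‖ ^ 2 ≤ ω ^ 2 * (L ^ 2 * ‖p - m‖ ^ 2) := by gcongr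
      _ = ω * (ω * L ^ 2) * ‖p - m‖ ^ 2 := by ring
      _ ≤ _ := by gcongr
  have h8 := mul_le_mul_of_nonneg_left hmono hω.le
  nlinarith

end Hilbert

/-! ### Least squares functionals of quadratic maps -/

/-- A quadratic map `p ↦ c + A p + N p p` between normed spaces. -/
structure QuadMap (X Y : Type*) [NormedAddCommGroup X] [NormedSpace ℝ X]
    [NormedAddCommGroup Y] [NormedSpace ℝ Y] where
  c : Y
  A : X →L[ℝ] Y
  N : X →L[ℝ] X →L[ℝ] Y

namespace QuadMap

section

variable {X Y : Type*} [NormedAddCommGroup X] [NormedSpace ℝ X] [NormedAddCommGroup Y]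
  [NormedSpace ℝ Y] (Q : QuadMap X Y)

/-- The value of a quadratic map. -/
def val (p : X) : Y := Q.c + Q.A p + Q.N p p

/-- The derivative of a quadratic map. -/
def der (p : X) : X →L[ℝ] Y := Q.A + Q.N p + Q.N.flip p

lemma val_add (p h : X) : Q.val (p + h) = Q.val p + Q.der p h + Q.N h h := by
  simp only [val, der, map_add, add_apply, ContinuousLinearMap.flip_apply]
  abel

lemma hasFDerivAt_val (p : X) : HasFDerivAt Q.val (Q.der p) p := by
  have h1 : HasFDerivAt (fun p => Q.N p p) (Q.N p + Q.N.flip p) p := by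
    have := (Q.N.hasFDerivAt (x := p)).clm_apply (hasFDerivAt_id p)
    convert! this using 1
  have := ((Q.A.hasFDerivAt (x := p)).const_add Q.c).add h1
  rw [← add_assoc] at this
  exact this

lemma norm_der_le {a R : ℝ} (hA : ‖Q.A‖ ≤ a) (hN : ‖Q.N‖ ≤ a) {p : X} (hp : ‖p‖ ≤ R) (h : X) :
    ‖Q.der p h‖ ≤ a * (1 + 2 * R) * ‖h‖ := by
  have ha : 0 ≤ a := (norm_nonneg _).trans hA
  have h1 : ‖Q.A h‖ ≤ a * ‖h‖ := Q.A.le_of_opNorm_le hA h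
  have h2 : ‖Q.N p h‖ ≤ a * R * ‖h‖ := (Q.N.le_opNorm₂ p h).trans (by gcongr)
  have h3 : ‖Q.N h p‖ ≤ a * ‖h‖ * R := (Q.N.le_opNorm₂ h p).trans (by gcongr)
  have : Q.der p h = Q.A h + Q.N p h + Q.N h p := rfl
  rw [this]
  refine (norm_add₃_le).trans ?_
  linarith

/-- Translation of a quadratic map, composed with linear maps. -/
def pull {X' Y' : Type*} [NormedAddCommGroup X'] [NormedSpace ℝ X'] [NormedAddCommGroup Y']
    [NormedSpace ℝ Y'] (S : Y →L[ℝ] Y') (T : X' →L[ℝ] X) (z : X) : QuadMap X' Y' where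
  c := S (Q.val z)
  A := S.comp ((Q.der z).comp T)
  N := (ContinuousLinearMap.compL ℝ X' Y Y' S).comp (Q.N.bilinearComp T T)

lemma val_pull {X' Y' : Type*} [NormedAddCommGroup X'] [NormedSpace ℝ X']
    [NormedAddCommGroup Y'] [NormedSpace ℝ Y'] (S : Y →L[ℝ] Y') (T : X' →L[ℝ] X) (z : X)
    (p : X') : (Q.pull S T z).val p = S (Q.val (T p + z)) := by
  rw [add_comm, val_add, map_add, map_add]; rfl

lemma der_pull {X' Y' : Type*} [NormedAddCommGroup X'] [NormedSpace ℝ X']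
    [NormedAddCommGroup Y'] [NormedSpace ℝ Y'] (S : Y →L[ℝ] Y') (T : X' →L[ℝ] X) (z : X)
    (p h : X') : (Q.pull S T z).der p h = S (Q.der (T p + z) (T h)) := by
  have e1 : (Q.pull S T z).der p h = S (Q.A (T h) + Q.N z (T h) + Q.N (T h) z) +
    S (Q.N (T p) (T h)) + S (Q.N (T h) (T p)) := rfl
  have e2 : Q.der (T p + z) (T h) = Q.A (T h) + Q.N (T p + z) (T h) + Q.N (T h) (T p + z) := rfl
  rw [e1, e2, ← map_add, ← map_add]
  congr 1
  simp only [map_add, add_apply]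
  abel

end

section

variable {X Y : Type*} [NormedAddCommGroup X] [InnerProductSpace ℝ X] [NormedAddCommGroup Y]
  [InnerProductSpace ℝ Y] (Q : QuadMap X Y)

/-- The regularized least squares functional. -/
def lsq (ρ : ℝ) (p : X) : ℝ := ‖Q.val p‖ ^ 2 + ρ * ‖p‖ ^ 2

/-- The derivative of the regularized least squares functional. -/
def lsqDer (ρ : ℝ) (p : X) : X →L[ℝ] ℝ :=
  (2 : ℝ) • (innerSL ℝ (Q.val p)).comp (Q.der p) + (2 * ρ) • innerSL ℝ p

lemma lsqDer_apply (ρ : ℝ) (p h : X) :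
    Q.lsqDer ρ p h = 2 * inner ℝ (Q.val p) (Q.der p h) + 2 * ρ * inner ℝ p h := by
  simp [lsqDer]

/-- The expansion is exact, since the map is quadratic. The linear and quadratic parts of its
increment are kept in one square, because only their sum has to be bounded from below. -/
lemma lsq_add (ρ : ℝ) (p h : X) : Q.lsq ρ (p + h) - Q.lsq ρ p - Q.lsqDer ρ p h =
    ‖Q.der p h + Q.N h h‖ ^ 2 + 2 * inner ℝ (Q.val p) (Q.N h h) + ρ * ‖h‖ ^ 2 := by
  rw [lsq, lsq, lsqDer_apply, val_add, add_assoc, norm_add_sq_real, norm_add_sq_real p h,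
    inner_add_right]
  ring

lemma hasFDerivAt_lsq (ρ : ℝ) (p : X) : HasFDerivAt (Q.lsq ρ) (Q.lsqDer ρ p) p := by
  have h := (Q.hasFDerivAt_val p).norm_sq.add (((hasFDerivAt_id p).norm_sq).const_mul ρ)
  convert! h using 1
  ext z
  simp [lsqDer]
  ring

/-- The derivative of the least squares functional is Lipschitz continuous on balls. -/
lemma abs_lsqDer_sub_le {a R ρ : ℝ} (hρ : 0 ≤ ρ) (hc : ‖Q.c‖ ≤ a) (hA : ‖Q.A‖ ≤ a) (hN : ‖Q.N‖ ≤ a)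
    {p q : X} (hp : ‖p‖ ≤ R) (hq : ‖q‖ ≤ R) (h : X) :
    |Q.lsqDer ρ p h - Q.lsqDer ρ q h| ≤
      (2 * (a * (1 + 2 * R)) ^ 2 + 4 * a ^ 2 * (1 + R + R ^ 2) + 2 * ρ) * ‖p - q‖ * ‖h‖ := by
  have ha : 0 ≤ a := (norm_nonneg _).trans hA
  have hR : 0 ≤ R := (norm_nonneg _).trans hp
  have e1 : Q.val p - Q.val q = Q.A (p - q) + Q.N p (p - q) + Q.N (p - q) q := by
    simp only [val, map_sub, sub_apply]; abel
  have e2 : Q.der p h - Q.der q h = Q.N (p - q) h + Q.N h (p - q) := by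
    have : ∀ r, Q.der r h = Q.A h + Q.N r h + Q.N h r := fun r => rfl
    simp only [this, map_sub, sub_apply]; abel
  have e3 : Q.lsqDer ρ p h - Q.lsqDer ρ q h = 2 * inner ℝ (Q.val p - Q.val q) (Q.der p h)
      + 2 * inner ℝ (Q.val q) (Q.der p h - Q.der q h) + 2 * ρ * inner ℝ (p - q) h := by
    rw [lsqDer_apply, lsqDer_apply, inner_sub_left, inner_sub_left, inner_sub_right]; ring
  have b1 : ‖Q.val p - Q.val q‖ ≤ a * (1 + 2 * R) * ‖p - q‖ := by
    rw [e1]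
    have h1 : ‖Q.A (p - q)‖ ≤ a * ‖p - q‖ := Q.A.le_of_opNorm_le hA _
    have h2 : ‖Q.N p (p - q)‖ ≤ a * R * ‖p - q‖ := (Q.N.le_opNorm₂ _ _).trans (by gcongr)
    have h3 : ‖Q.N (p - q) q‖ ≤ a * ‖p - q‖ * R := (Q.N.le_opNorm₂ _ _).trans (by gcongr)
    refine (norm_add₃_le).trans ?_
    linarith
  have b2 : ‖Q.der p h - Q.der q h‖ ≤ 2 * a * ‖p - q‖ * ‖h‖ := by
    rw [e2]
    have h2 : ‖Q.N (p - q) h‖ ≤ a * ‖p - q‖ * ‖h‖ := (Q.N.le_opNorm₂ _ _).trans (by gcongr)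
    have h3 : ‖Q.N h (p - q)‖ ≤ a * ‖h‖ * ‖p - q‖ := (Q.N.le_opNorm₂ _ _).trans (by gcongr)
    refine (norm_add_le _ _).trans ?_
    linarith
  have b3 : ‖Q.val q‖ ≤ a * (1 + R + R ^ 2) := by
    have h1 : ‖Q.A q‖ ≤ a * R := (Q.A.le_of_opNorm_le hA _).trans (by gcongr)
    have h2 : ‖Q.N q q‖ ≤ a * R * R := (Q.N.le_opNorm₂ _ _).trans (by gcongr)
    refine (norm_add₃_le).trans ?_
    linarith
  have b4 := Q.norm_der_le hA hN hp h
  rw [e3]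
  have c1 := (abs_real_inner_le_norm (Q.val p - Q.val q) (Q.der p h)).trans
    (mul_le_mul b1 b4 (norm_nonneg _) (by positivity))
  have c2 := (abs_real_inner_le_norm (Q.val q) (Q.der p h - Q.der q h)).trans
    (mul_le_mul b3 b2 (norm_nonneg _) (by positivity))
  have c3 := mul_le_mul_of_nonneg_left (abs_real_inner_le_norm (p - q) h) hρ
  refine (abs_add_three _ _ _).trans ?_
  rw [abs_mul, abs_mul, abs_mul, abs_mul, abs_of_nonneg hρ, abs_two]
  nlinarith

end

end QuadMap

end

section

/-! ### Operations on functions of the wavenumber -/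

section Wavenumber

variable {E E' : Type*} [NormedAddCommGroup E] [NormedSpace ℝ E] [CompleteSpace E]
  [NormedAddCommGroup E'] [NormedSpace ℝ E'] [CompleteSpace E'] {k₁ k₂ : ℝ}

instance (k₁ k₂ : ℝ) : IsFiniteMeasure (kVol k₁ k₂) :=
  ⟨by rw [kVol, Measure.restrict_apply_univ]; exact isCompact_Icc.measure_lt_top⟩

lemma kVol_univ (k₁ k₂ : ℝ) : kVol k₁ k₂ univ = ENNReal.ofReal (k₂ - k₁) := by
  rw [kVol, Measure.restrict_apply_univ, Real.volume_Icc]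

lemma ae_kVol (k₁ k₂ : ℝ) : ∀ᵐ k ∂kVol k₁ k₂, k ∈ Icc k₁ k₂ :=
  ae_restrict_mem measurableSet_Icc

lemma integrable_kVol (f : Lp E 2 (kVol k₁ k₂)) : Integrable f (kVol k₁ k₂) :=
  (Lp.memLp f).integrable one_le_two

lemma intervalIntegrable_kVol (f : Lp E 2 (kVol k₁ k₂)) {k : ℝ} (hk : k ∈ Icc k₁ k₂) :
    IntervalIntegrable f volume k k₂ := by
  rw [intervalIntegrable_iff_integrableOn_Icc_of_le hk.2]
  exact IntegrableOn.mono_set (integrable_kVol f) (Icc_subset_Icc_left hk.1)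

lemma intervalIntegral_eq_kVol (f : ℝ → E) {k : ℝ} (hk : k ∈ Icc k₁ k₂) :
    ∫ κ in k..k₂, f κ = ∫ κ in Ioc k k₂, f κ ∂kVol k₁ k₂ := by
  rw [intervalIntegral.integral_of_le hk.2, kVol, Measure.restrict_restrict measurableSet_Ioc,
    inter_eq_left.2 (Ioc_subset_Icc_self.trans (Icc_subset_Icc_left hk.1))]

lemma tail_congr {f g : ℝ → E} (h : f =ᵐ[kVol k₁ k₂] g) {k : ℝ} (hk : k ∈ Icc k₁ k₂) :
    ∫ κ in k..k₂, f κ = ∫ κ in k..k₂, g κ := by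
  rw [intervalIntegral_eq_kVol f hk, intervalIntegral_eq_kVol g hk]
  exact integral_congr_ae (ae_restrict_of_ae h)

/-- Cauchy–Schwarz. The bound is uniform in $k$: $v$ is bounded in $k$ although $q$ is only square
integrable, so that products of their gradients are square integrable in $k$. -/
lemma norm_tail_le (f : Lp E 2 (kVol k₁ k₂)) {k : ℝ} (hk : k ∈ Icc k₁ k₂) :
    ‖∫ κ in k..k₂, f κ‖ ≤ √(k₂ - k₁) * ‖f‖ := by
  rw [intervalIntegral_eq_kVol f hk]
  have h12 : k₁ ≤ k₂ := hk.1.trans hk.2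
  have h1 : eLpNorm f 1 (kVol k₁ k₂) ≤ ENNReal.ofReal (√(k₂ - k₁) * ‖f‖) := by
    refine (eLpNorm_le_eLpNorm_mul_rpow_measure_univ one_le_two (Lp.aestronglyMeasurable f)).trans ?_
    rw [kVol_univ, ENNReal.ofReal_mul (Real.sqrt_nonneg _),
      mul_comm, Lp.norm_def, ENNReal.ofReal_toReal (Lp.eLpNorm_ne_top f), Real.sqrt_eq_rpow,
      ← ENNReal.ofReal_rpow_of_nonneg (sub_nonneg.2 h12) (by norm_num)]
    refine mul_le_mul' (le_of_eq ?_) le_rfl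
    congr 1
    norm_num
  have h2 : ‖∫ κ in Ioc k k₂, f κ ∂kVol k₁ k₂‖ₑ ≤ eLpNorm f 1 (kVol k₁ k₂) := by
    refine (enorm_integral_le_lintegral_enorm _).trans ?_
    rw [eLpNorm_one_eq_lintegral_enorm]
    exact lintegral_mono' Measure.restrict_le_self le_rfl
  have h3 := h2.trans h1
  rw [← ofReal_norm] at h3
  exact (ENNReal.ofReal_le_ofReal_iff (by positivity)).1 h3

lemma tail_add (f g : Lp E 2 (kVol k₁ k₂)) {k : ℝ} (hk : k ∈ Icc k₁ k₂) :
    ∫ κ in k..k₂, (f + g : Lp E 2 (kVol k₁ k₂)) κ =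
      (∫ κ in k..k₂, f κ) + ∫ κ in k..k₂, g κ := by
  rw [tail_congr (Lp.coeFn_add f g) hk, ← intervalIntegral.integral_add
    (intervalIntegrable_kVol f hk) (intervalIntegrable_kVol g hk)]
  rfl

lemma tail_smul (c : ℝ) (f : Lp E 2 (kVol k₁ k₂)) {k : ℝ} (hk : k ∈ Icc k₁ k₂) :
    ∫ κ in k..k₂, (c • f : Lp E 2 (kVol k₁ k₂)) κ = c • ∫ κ in k..k₂, f κ := by
  rw [tail_congr (Lp.coeFn_smul c f) hk, ← intervalIntegral.integral_smul]
  rfl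

lemma tail_sub (f g : Lp E 2 (kVol k₁ k₂)) {k : ℝ} (hk : k ∈ Icc k₁ k₂) :
    ∫ κ in k..k₂, (f - g : Lp E 2 (kVol k₁ k₂)) κ =
      (∫ κ in k..k₂, f κ) - ∫ κ in k..k₂, g κ := by
  rw [tail_congr (Lp.coeFn_sub f g) hk, ← intervalIntegral.integral_sub
    (intervalIntegrable_kVol f hk) (intervalIntegrable_kVol g hk)]
  rfl

lemma tail_comp (P : E →L[ℝ] E') (f : Lp E 2 (kVol k₁ k₂)) {k : ℝ} (hk : k ∈ Icc k₁ k₂) :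
    ∫ κ in k..k₂, P (f κ) = P (∫ κ in k..k₂, f κ) :=
  P.intervalIntegral_comp_comm (intervalIntegrable_kVol f hk)

lemma ae_kVol_of_lt {k₁ k₂ : ℝ} (h : k₂ < k₁) (P : ℝ → Prop) : ∀ᵐ k ∂kVol k₁ k₂, P k := by
  rw [kVol, Icc_eq_empty (not_le.2 h), Measure.restrict_empty, ae_zero]
  trivial

lemma memLp_tail (f : Lp E 2 (kVol k₁ k₂)) :
    MemLp (fun k => ∫ κ in k..k₂, f κ) ⊤ (kVol k₁ k₂) := by
  -- For $k_2<k_1$ the interval of wavenumbers is empty and the measure is zero.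
  rcases lt_or_ge k₂ k₁ with h | h
  · exact (memLp_congr_ae (ae_kVol_of_lt h _)).2 (MemLp.zero (ε := E))
  refine MemLp.of_bound ?_ (√(k₂ - k₁) * ‖f‖) ?_
  · have h1 : IntegrableOn f (uIcc k₁ k₂) volume := by
      rw [uIcc_of_le h]; exact integrable_kVol f
    have h2 := intervalIntegral.continuousOn_primitive_interval_left h1
    rw [uIcc_of_le h] at h2
    exact h2.aestronglyMeasurable measurableSet_Icc
  · filter_upwards [ae_kVol k₁ k₂] with k hk
    exact norm_tail_le f hk

/-- The operator `f ↦ ∫_k^{k₂} f dκ`. -/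
def volterra (E : Type*) [NormedAddCommGroup E] [NormedSpace ℝ E] [CompleteSpace E] (k₁ k₂ : ℝ) :
    Lp E 2 (kVol k₁ k₂) →L[ℝ] Lp E ⊤ (kVol k₁ k₂) :=
  LinearMap.mkContinuous
    { toFun := fun f => (memLp_tail f).toLp _
      map_add' := fun f g => by
        rw [← MemLp.toLp_add]
        refine MemLp.toLp_congr _ _ ?_
        filter_upwards [ae_kVol k₁ k₂] with k hk
        exact tail_add f g hk
      map_smul' := fun c f => by
        rw [RingHom.id_apply, ← MemLp.toLp_const_smul]
        refine MemLp.toLp_congr _ _ ?_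
        filter_upwards [ae_kVol k₁ k₂] with k hk
        exact tail_smul c f hk } (√(k₂ - k₁)) fun f => by
    refine (Lp.norm_le_of_ae_bound (C := √(k₂ - k₁) * ‖f‖) (by positivity) ?_).trans (by simp)
    filter_upwards [ae_kVol k₁ k₂, (memLp_tail f).coeFn_toLp] with k hk hk'
    exact (congrArg norm hk').trans_le (norm_tail_le f hk)

lemma coeFn_volterra (f : Lp E 2 (kVol k₁ k₂)) :
    volterra E k₁ k₂ f =ᵐ[kVol k₁ k₂] fun k => ∫ κ in k..k₂, f κ :=
  (memLp_tail f).coeFn_toLp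

lemma memLp_wavenumber (k₁ k₂ : ℝ) : MemLp (fun k : ℝ => k) ⊤ (kVol k₁ k₂) := by
  refine MemLp.of_bound continuous_id.aestronglyMeasurable (max |k₁| |k₂|) ?_
  filter_upwards [ae_kVol k₁ k₂] with k hk
  exact abs_le_max_abs_abs hk.1 hk.2

/-- Multiplication by the wavenumber. -/
def mulK (E : Type*) [NormedAddCommGroup E] [NormedSpace ℝ E] (k₁ k₂ : ℝ) (p : ENNReal)
    [Fact (1 ≤ p)] : Lp E p (kVol k₁ k₂) →L[ℝ] Lp E p (kVol k₁ k₂) :=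
  (ContinuousLinearMap.lsmul ℝ ℝ).holderL (kVol k₁ k₂) ⊤ p p ((memLp_wavenumber k₁ k₂).toLp _)

lemma coeFn_mulK (p : ENNReal) [Fact (1 ≤ p)] (f : Lp E p (kVol k₁ k₂)) :
    mulK E k₁ k₂ p f =ᵐ[kVol k₁ k₂] fun k => k • f k := by
  rw [mulK, ContinuousLinearMap.holderL_apply_apply]
  filter_upwards [ContinuousLinearMap.coeFn_holder (ContinuousLinearMap.lsmul ℝ ℝ) (r := p)
    ((memLp_wavenumber k₁ k₂).toLp _) f, (memLp_wavenumber k₁ k₂).coeFn_toLp] with k h1 h2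
  rw [h1, h2]
  rfl

/-- The inclusion of bounded functions in the square integrable ones. -/
def topToTwo (E : Type*) [NormedAddCommGroup E] [NormedSpace ℝ E] (k₁ k₂ : ℝ) :
    Lp E ⊤ (kVol k₁ k₂) →L[ℝ] Lp E 2 (kVol k₁ k₂) :=
  (ContinuousLinearMap.lsmul ℝ ℝ).holderL (kVol k₁ k₂) 2 ⊤ 2 (Lp.const 2 (kVol k₁ k₂) 1)

lemma coeFn_topToTwo (f : Lp E ⊤ (kVol k₁ k₂)) : topToTwo E k₁ k₂ f =ᵐ[kVol k₁ k₂] f := by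
  rw [topToTwo, ContinuousLinearMap.holderL_apply_apply]
  filter_upwards [ContinuousLinearMap.coeFn_holder (ContinuousLinearMap.lsmul ℝ ℝ) (r := 2)
    (Lp.const 2 (kVol k₁ k₂) (1 : ℝ)) f, Lp.coeFn_const 2 (kVol k₁ k₂) (1 : ℝ)] with k h1 h2
  rw [h1, h2]
  simp

/-- The function `v(k) = V - ∫_k^{k₂} q dκ` as a bounded function of `k`. -/
def vTop (E : Type*) [NormedAddCommGroup E] [NormedSpace ℝ E] [CompleteSpace E] (k₁ k₂ : ℝ) :
    Lp E 2 (kVol k₁ k₂) × E →L[ℝ] Lp E ⊤ (kVol k₁ k₂) :=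
  (-volterra E k₁ k₂).coprod (Lp.constL ⊤ (kVol k₁ k₂) ℝ)

lemma coeFn_vTop (z : Lp E 2 (kVol k₁ k₂) × E) :
    vTop E k₁ k₂ z =ᵐ[kVol k₁ k₂] fun k => z.2 - ∫ κ in k..k₂, z.1 κ := by
  have e : vTop E k₁ k₂ z = Lp.const ⊤ (kVol k₁ k₂) z.2 - volterra E k₁ k₂ z.1 := by
    rw [vTop, ContinuousLinearMap.coprod_apply, neg_apply, sub_eq_neg_add]
    rfl
  rw [e]
  filter_upwards [Lp.coeFn_sub (Lp.const ⊤ (kVol k₁ k₂) z.2) (volterra E k₁ k₂ z.1),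
    coeFn_volterra z.1, Lp.coeFn_const ⊤ (kVol k₁ k₂) z.2] with k h1 h2 h3
  rw [h1, Pi.sub_apply, h2, h3]
  rfl

/-- The function `k v(k)`. -/
def kvTop (E : Type*) [NormedAddCommGroup E] [NormedSpace ℝ E] [CompleteSpace E] (k₁ k₂ : ℝ) :
    Lp E 2 (kVol k₁ k₂) × E →L[ℝ] Lp E ⊤ (kVol k₁ k₂) :=
  (mulK E k₁ k₂ ⊤).comp (vTop E k₁ k₂)

lemma coeFn_kvTop (z : Lp E 2 (kVol k₁ k₂) × E) :
    kvTop E k₁ k₂ z =ᵐ[kVol k₁ k₂] fun k => k • (z.2 - ∫ κ in k..k₂, z.1 κ) := by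
  filter_upwards [coeFn_mulK ⊤ (vTop E k₁ k₂ z), coeFn_vTop z] with k h1 h2
  rw [kvTop, ContinuousLinearMap.comp_apply, h1, h2]

/-- The function `k q(k) + v(k)`. -/
def kqv (E : Type*) [NormedAddCommGroup E] [NormedSpace ℝ E] [CompleteSpace E] (k₁ k₂ : ℝ) :
    Lp E 2 (kVol k₁ k₂) × E →L[ℝ] Lp E 2 (kVol k₁ k₂) :=
  (mulK E k₁ k₂ 2).comp (ContinuousLinearMap.fst ℝ _ _) + (topToTwo E k₁ k₂).comp (vTop E k₁ k₂)

lemma coeFn_kqv (z : Lp E 2 (kVol k₁ k₂) × E) : kqv E k₁ k₂ z =ᵐ[kVol k₁ k₂]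
    fun k => k • z.1 k + (z.2 - ∫ κ in k..k₂, z.1 κ) := by
  filter_upwards [coeFn_mulK 2 z.1, coeFn_vTop z, coeFn_topToTwo (vTop E k₁ k₂ z),
    Lp.coeFn_add (mulK E k₁ k₂ 2 z.1) (topToTwo E k₁ k₂ (vTop E k₁ k₂ z))] with k h1 h2 h3 h4
  rw [← h1, ← h2, ← h3]
  exact h4

/-- Application of a linear map to the values of a pair. -/
def compPair (k₁ k₂ : ℝ) (P : E →L[ℝ] E') :
    Lp E 2 (kVol k₁ k₂) × E →L[ℝ] Lp E' 2 (kVol k₁ k₂) × E' :=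
  (P.compLpL 2 (kVol k₁ k₂)).prodMap P

lemma compPair_apply (P : E →L[ℝ] E') (z : Lp E 2 (kVol k₁ k₂) × E) :
    compPair k₁ k₂ P z = (P.compLpL 2 (kVol k₁ k₂) z.1, P z.2) := rfl

lemma norm_compPair_zero (P : E →L[ℝ] E') (f : Lp E 2 (kVol k₁ k₂)) :
    ‖compPair k₁ k₂ P (f, 0)‖ = ‖P.compLpL 2 (kVol k₁ k₂) f‖ := by
  rw [compPair_apply, Prod.norm_def, map_zero, norm_zero]
  exact max_eq_left (norm_nonneg _)

lemma comp_tail (P : E →L[ℝ] E') (f : Lp E 2 (kVol k₁ k₂)) {k : ℝ} (hk : k ∈ Icc k₁ k₂) :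
    ∫ κ in k..k₂, P.compLpL 2 (kVol k₁ k₂) f κ = P (∫ κ in k..k₂, f κ) :=
  (tail_congr (P.coeFn_compLpL f) hk).trans (tail_comp P f hk)

/-- Integration acts in $k$ and `P` on the values, so they commute. With a weighted gradient for
`P`, this moves the weight inside the integral. -/
lemma comp_kvTop (P : E →L[ℝ] E') (z : Lp E 2 (kVol k₁ k₂) × E) :
    P.compLpL ⊤ (kVol k₁ k₂) (kvTop E k₁ k₂ z) = kvTop E' k₁ k₂ (compPair k₁ k₂ P z) := by
  refine Lp.ext ?_
  filter_upwards [ae_kVol k₁ k₂, coeFn_kvTop z, coeFn_kvTop (compPair k₁ k₂ P z),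
    P.coeFn_compLpL (kvTop E k₁ k₂ z)] with k hk h1 h2 h3
  rw [h3, h1, h2, map_smul, map_sub, ← comp_tail P z.1 hk]
  rfl

lemma comp_kqv (P : E →L[ℝ] E') (z : Lp E 2 (kVol k₁ k₂) × E) :
    P.compLpL 2 (kVol k₁ k₂) (kqv E k₁ k₂ z) = kqv E' k₁ k₂ (compPair k₁ k₂ P z) := by
  refine Lp.ext ?_
  filter_upwards [ae_kVol k₁ k₂, coeFn_kqv z, coeFn_kqv (compPair k₁ k₂ P z),
    P.coeFn_compLpL (kqv E k₁ k₂ z), P.coeFn_compLpL z.1] with k hk h1 h2 h3 h4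
  rw [h3, h1, h2, map_add, map_smul, map_sub, ← comp_tail P z.1 hk, ← h4]
  rfl

attribute [irreducible] volterra mulK topToTwo vTop kvTop kqv compPair

end Wavenumber

end

section

/-! ### The quadratic map behind the weighted functional -/

lemma D_restr {B : Box} {m n : ℕ} (h : m ≤ n) (u : Hm B n) {α : Fin 3 → ℕ} (hα : α ∈ multiIdx m) :
    D α (restr h u) = D α u := by
  change Jet.entry α (WithLp.toLp 2 fun β : multiIdx m => D β.1 u) = _
  rw [Jet.entry, dif_pos hα]
  rfl

lemma norm_restr_le {B : Box} {m n : ℕ} (h : m ≤ n) (u : Hm B n) : ‖restr h u‖ ≤ ‖u‖ := by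
  refine le_of_sq_le_sq ?_ (norm_nonneg _)
  rw [norm_sq_Hm, norm_sq_Hm]
  calc ∑ α ∈ multiIdx m, ‖D α (restr h u)‖ ^ 2 = ∑ α ∈ multiIdx m, ‖D α u‖ ^ 2 :=
        Finset.sum_congr rfl fun α hα => by rw [D_restr h u hα]
    _ ≤ _ := Finset.sum_le_sum_of_subset_of_nonneg (fun α hα => multiIdx_mono h hα)
        fun _ _ _ => by positivity

/-- The inclusion `H^n(Ω) ⊆ H^m(Ω)` as a continuous linear map. -/
def restrL (B : Box) {m n : ℕ} (h : m ≤ n) : Hm B n →L[ℝ] Hm B m :=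
  LinearMap.mkContinuous
    { toFun := restr h
      map_add' := fun u v => Hm.ext_D fun α hα => by
        rw [map_add, D_restr h _ hα, D_restr h _ hα, D_restr h _ hα, map_add]
      map_smul' := fun c u => Hm.ext_D fun α hα => by
        rw [RingHom.id_apply, map_smul, D_restr h _ hα, D_restr h _ hα, map_smul] } 1
    fun u => by rw [one_mul]; exact norm_restr_le h u

/-- The Laplacian as a continuous linear map. -/
def lapL (B : Box) (m : ℕ) : Hm B m →L[ℝ] L2 B := ∑ i, D (2 • unitIdx i)

lemma lapL_apply {B : Box} {m : ℕ} (u : Hm B m) : lapL B m u = lap u := by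
  simp [lapL, lap]

/-- The operator `2 i ∂_z`. -/
def dzI (B : Box) : Hm B 3 →L[ℝ] L2 B := (2 * Complex.I) • D (unitIdx 2)

lemma coeFn_dzI {B : Box} (u : Hm B 3) :
    dzI B u =ᵐ[B.vol] fun x => 2 * Complex.I * D (unitIdx 2) u x := by
  have e : dzI B u = (2 * Complex.I) • D (unitIdx 2) u := rfl
  rw [e]
  filter_upwards [Lp.coeFn_smul (2 * Complex.I) (D (unitIdx 2) u)] with x hx
  rw [hx]
  rfl

/-- Pointwise products `∇u(k) · ∇v(k)`. -/
def gdotK (B : Box) (k₁ k₂ : ℝ) : Lp (Hm B 3) ⊤ (kVol k₁ k₂) →L[ℝ] Lp (Hm B 3) 2 (kVol k₁ k₂) →L[ℝ]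
    Lp (L2 B) 2 (kVol k₁ k₂) :=
  (gdot B).holderL (kVol k₁ k₂) ⊤ 2 2

lemma coeFn_gdotK {B : Box} {k₁ k₂ : ℝ} (u : Lp (Hm B 3) ⊤ (kVol k₁ k₂))
    (v : Lp (Hm B 3) 2 (kVol k₁ k₂)) :
    gdotK B k₁ k₂ u v =ᵐ[kVol k₁ k₂] fun k => gdot B (u k) (v k) := by
  rw [gdotK, ContinuousLinearMap.holderL_apply_apply]
  exact ContinuousLinearMap.coeFn_holder (gdot B) u v

/-- A quadratic map without constant term. -/
def QuadMap.ofForms {X Y : Type*} [NormedAddCommGroup X] [NormedSpace ℝ X] [NormedAddCommGroup Y]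
    [NormedSpace ℝ Y] (A : X →L[ℝ] Y) (N : X →L[ℝ] X →L[ℝ] Y) : QuadMap X Y := ⟨0, A, N⟩

lemma QuadMap.val_ofForms {X Y : Type*} [NormedAddCommGroup X] [NormedSpace ℝ X]
    [NormedAddCommGroup Y] [NormedSpace ℝ Y] (A : X →L[ℝ] Y) (N : X →L[ℝ] X →L[ℝ] Y) (z : X) :
    (QuadMap.ofForms A N).val z = A z + N z z := by
  rw [QuadMap.val, QuadMap.ofForms, zero_add]

/-- The operator `(q, V) ↦ L(q; V)`. -/
def opQ (B : Box) (k₁ k₂ : ℝ) :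
    QuadMap (HK B 3 k₁ k₂ × Hm B 3) (Lp (L2 B) 2 (kVol k₁ k₂)) :=
  QuadMap.ofForms (((lapL B 3).compLpL 2 (kVol k₁ k₂)).comp (ContinuousLinearMap.fst ℝ _ _) +
      ((dzI B).compLpL 2 (kVol k₁ k₂)).comp (kqv (Hm B 3) k₁ k₂))
    ((2 : ℝ) • (gdotK B k₁ k₂).bilinearComp (kvTop (Hm B 3) k₁ k₂) (kqv (Hm B 3) k₁ k₂))

lemma opQ_A {B : Box} {k₁ k₂ : ℝ} (z : HK B 3 k₁ k₂ × Hm B 3) :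
    (opQ B k₁ k₂).A z = (lapL B 3).compLpL 2 (kVol k₁ k₂) z.1 +
      (dzI B).compLpL 2 (kVol k₁ k₂) (kqv (Hm B 3) k₁ k₂ z) := rfl

lemma opQ_N {B : Box} {k₁ k₂ : ℝ} (z z' : HK B 3 k₁ k₂ × Hm B 3) :
    (opQ B k₁ k₂).N z z' = (2 : ℝ) • gdotK B k₁ k₂ (kvTop (Hm B 3) k₁ k₂ z)
      (kqv (Hm B 3) k₁ k₂ z') := rfl

/-- The operator is regrouped as $\Delta q+2i\partial_z(kq+v)+2\nabla(kv)\cdot\nabla(kq+v)$. The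
tail $V$ is a variable on the same footing as $q$, so that exact and noisy problems are values of
one map at two points. -/
lemma opQ_val {B : Box} {k₁ k₂ : ℝ} (z : HK B 3 k₁ k₂ × Hm B 3) :
    (opQ B k₁ k₂).val z = (lapL B 3).compLpL 2 (kVol k₁ k₂) z.1 +
      (dzI B).compLpL 2 (kVol k₁ k₂) (kqv (Hm B 3) k₁ k₂ z) +
      (2 : ℝ) • gdotK B k₁ k₂ (kvTop (Hm B 3) k₁ k₂ z) (kqv (Hm B 3) k₁ k₂ z) := by
  rw [← opQ_N, ← opQ_A]
  exact QuadMap.val_ofForms _ _ z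

lemma coeFn_opQ_val {B : Box} {k₁ k₂ : ℝ} (z : HK B 3 k₁ k₂ × Hm B 3) :
    ∀ᵐ k ∂kVol k₁ k₂, (opQ B k₁ k₂).val z k = lap (z.1 k) +
      dzI B (kqv (Hm B 3) k₁ k₂ z k) +
      (2 : ℝ) • gdot B (kvTop (Hm B 3) k₁ k₂ z k) (kqv (Hm B 3) k₁ k₂ z k) := by
  rw [opQ_val]
  set a := (lapL B 3).compLpL 2 (kVol k₁ k₂) z.1 with ha
  set b := (dzI B).compLpL 2 (kVol k₁ k₂) (kqv (Hm B 3) k₁ k₂ z) with hb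
  set c := gdotK B k₁ k₂ (kvTop (Hm B 3) k₁ k₂ z) (kqv (Hm B 3) k₁ k₂ z) with hc
  filter_upwards [Lp.coeFn_add (a + b) ((2 : ℝ) • c), Lp.coeFn_add a b, Lp.coeFn_smul (2 : ℝ) c,
    (lapL B 3).coeFn_compLpL z.1, (dzI B).coeFn_compLpL (kqv (Hm B 3) k₁ k₂ z),
    coeFn_gdotK (kvTop (Hm B 3) k₁ k₂ z) (kqv (Hm B 3) k₁ k₂ z)] with k h1 h2 h3 h4 h5 h6
  rw [h1, Pi.add_apply, h2, Pi.add_apply, h3, Pi.smul_apply, ha, h4, hb, h5, hc, h6, lapL_apply]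

/-- The pair `(p + F, V)`. -/
def dataPt {B : Box} {k₁ k₂ : ℝ} (F : HK B 4 k₁ k₂) (V : Hm B 3) : HK B 3 k₁ k₂ × Hm B 3 :=
  ((restrL B (by norm_num)).compLpL 2 (kVol k₁ k₂) F, V)

/-- The inclusion of the increments `p` in the pairs `(q, V)`. -/
def incr (B : Box) (k₁ k₂ : ℝ) : HK0 B 3 k₁ k₂ →L[ℝ] HK B 3 k₁ k₂ × Hm B 3 :=
  (ContinuousLinearMap.inl ℝ _ _).comp ((Hm0.incl (B := B) (m := 3)).compLpL 2 (kVol k₁ k₂))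

lemma addF_ae {B : Box} {k₁ k₂ : ℝ} (p : HK0 B 3 k₁ k₂) (F : HK B 4 k₁ k₂) (V : Hm B 3) :
    addF p F =ᵐ[kVol k₁ k₂] (incr B k₁ k₂ p + dataPt F V).1 := by
  have e : (incr B k₁ k₂ p + dataPt F V).1 = (Hm0.incl (B := B) (m := 3)).compLpL 2 (kVol k₁ k₂) p +
    (restrL B (by norm_num)).compLpL 2 (kVol k₁ k₂) F := rfl
  rw [e]
  filter_upwards [Lp.coeFn_add ((Hm0.incl (B := B) (m := 3)).compLpL 2 (kVol k₁ k₂) p)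
    ((restrL B (by norm_num)).compLpL 2 (kVol k₁ k₂) F),
    (Hm0.incl (B := B) (m := 3)).coeFn_compLpL p,
    (restrL B (show 3 ≤ 4 by norm_num)).coeFn_compLpL F] with k h1 h2 h3
  rw [h1, Pi.add_apply, h2, h3]
  rfl

lemma Dv_eq {B : Box} {k₁ k₂ : ℝ} {q : ℝ → Hm B 3} {f : HK B 3 k₁ k₂} (h : q =ᵐ[kVol k₁ k₂] f)
    (V : Hm B 3) (α : Fin 3 → ℕ) {k : ℝ} (hk : k ∈ Icc k₁ k₂) :
    Dv k₂ V q α k = D α (V - ∫ κ in k..k₂, f κ) := by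
  rw [Dv, map_sub, ← tail_comp (D α) f hk]
  congr 1
  refine tail_congr ?_ hk
  filter_upwards [h] with κ hκ
  rw [hκ]

lemma opL_ae {B : Box} {k₁ k₂ : ℝ} {q : ℝ → Hm B 3} (z : HK B 3 k₁ k₂ × Hm B 3)
    (h : q =ᵐ[kVol k₁ k₂] z.1) : ∀ᵐ k ∂kVol k₁ k₂,
      (opQ B k₁ k₂).val z k =ᵐ[B.vol] opL k₂ z.2 q k := by
  filter_upwards [coeFn_opQ_val z, ae_kVol k₁ k₂, h, coeFn_kvTop z, coeFn_kqv z]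
    with k h1 hk hq h2 h3
  rw [h1, h2, h3]
  set v := z.2 - ∫ κ in k..k₂, z.1 κ with hv
  have hm : ∀ i, D (unitIdx i) (k • z.1 k + v) =ᵐ[B.vol]
      fun x => (k : ℂ) * D (unitIdx i) (z.1 k) x + D (unitIdx i) v x := fun i => by
    rw [map_add, map_smul]
    filter_upwards [Lp.coeFn_add (k • D (unitIdx i) (z.1 k)) (D (unitIdx i) v),
      Lp.coeFn_smul k (D (unitIdx i) (z.1 k))] with x h1 h2
    rw [h1, Pi.add_apply, h2, Pi.smul_apply, Complex.real_smul]
  have hu : ∀ i, D (unitIdx i) (k • v) =ᵐ[B.vol] fun x => (k : ℂ) * D (unitIdx i) v x := fun i => by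
    rw [map_smul]
    filter_upwards [Lp.coeFn_smul k (D (unitIdx i) v)] with x h1
    rw [h1, Pi.smul_apply, Complex.real_smul]
  filter_upwards [Lp.coeFn_add (lap (z.1 k) + dzI B (k • z.1 k + v))
      ((2 : ℝ) • gdot B (k • v) (k • z.1 k + v)),
    Lp.coeFn_add (lap (z.1 k)) (dzI B (k • z.1 k + v)),
    Lp.coeFn_smul (2 : ℝ) (gdot B (k • v) (k • z.1 k + v)),
    coeFn_gdot (k • v) (k • z.1 k + v), coeFn_dzI (k • z.1 k + v), hm 0, hm 1, hm 2, hu 0, hu 1,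
    hu 2] with x a1 a2 a3 a4 a5 m0 m1 m2 u0 u1 u2
  rw [a1, Pi.add_apply, a2, Pi.add_apply, a3, Pi.smul_apply, a4, a5, opL]
  simp only [Fin.sum_univ_three, Dv_eq h z.2 _ hk, ← hv, m0, m1, m2, u0, u1, u2, hq,
    Complex.real_smul]
  push_cast
  ring

lemma opQ_der {B : Box} {k₁ k₂ : ℝ} (z h : HK B 3 k₁ k₂ × Hm B 3) :
    (opQ B k₁ k₂).der z h = (lapL B 3).compLpL 2 (kVol k₁ k₂) h.1 +
      (dzI B).compLpL 2 (kVol k₁ k₂) (kqv (Hm B 3) k₁ k₂ h) + (opQ B k₁ k₂).N z h +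
      (opQ B k₁ k₂).N h z := rfl

attribute [irreducible] opQ gdotK

lemma norm_sq_eq_integral {α G : Type*} [MeasurableSpace α] {μ : Measure α} [NormedAddCommGroup G]
    [InnerProductSpace ℝ G] (f : Lp G 2 μ) : ‖f‖ ^ 2 = ∫ x, ‖f x‖ ^ 2 ∂μ := by
  rw [← real_inner_self_eq_norm_sq, L2.inner_def]
  simp_rw [real_inner_self_eq_norm_sq]

/-- The quadratic map whose least squares functional is `J`. -/
def weightedQ {B : Box} (w : CarlemanWeight B) (k₁ k₂ lam : ℝ) (V : Hm B 3) (F : HK B 4 k₁ k₂) :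
    QuadMap (HK0 B 3 k₁ k₂) (Lp (L2 B) 2 (kVol k₁ k₂)) :=
  (opQ B k₁ k₂).pull ((w.E lam).compLpL 2 (kVol k₁ k₂)) (incr B k₁ k₂) (dataPt F V)

/-- The normalizing factor and the Carleman weight combine to $e^{2\lambda\psi}$. All properties of
the functional thereby reduce to those of least squares for a quadratic map. -/
lemma J_eq_lsq {B : Box} {s ν : ℝ} (hs : B.ξ < s) {w : CarlemanWeight B}
    (hw : w.ψ = expFn B s ν) (k₁ k₂ lam ρ : ℝ) (V : Hm B 3) (F : HK B 4 k₁ k₂) :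
    J B s ν k₁ k₂ lam ρ V F = (weightedQ w k₁ k₂ lam V F).lsq ρ := by
  ext p
  rw [J, QuadMap.lsq, weightedQ, QuadMap.val_pull,
    norm_sq_eq_integral ((w.E lam).compLpL 2 (kVol k₁ k₂) _), ← integral_const_mul]
  congr 1
  refine integral_congr_ae ?_
  filter_upwards [(w.E lam).coeFn_compLpL
    ((opQ B k₁ k₂).val (incr B k₁ k₂ p + dataPt F V)), opL_ae _ (addF_ae p F V)] with k h1 h2
  rw [h1, norm_sq_eq_integral, ← integral_const_mul]
  refine integral_congr_ae ?_
  filter_upwards [h2, w.coeFn_E lam ((opQ B k₁ k₂).val (incr B k₁ k₂ p + dataPt F V) k),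
    Box.ae_vol (p := fun x => x 2 ∈ Ioo (-B.ξ) B.d) fun x hx => hx.2.2] with x h3 h4 h5
  have e2 : (incr B k₁ k₂ p + dataPt F V).2 = V := zero_add V
  rw [h4, h3, e2, norm_mul, mul_pow, mul_left_comm, exp_mul_cwf hs lam h5, ← hw,
    Complex.norm_real, Real.norm_of_nonneg (w.e_pos lam _).le, mul_comm]
  rfl

end

section

/-! ### Weighted estimates of the quadratic map -/

lemma Lp.ae_norm_le_top {α G : Type*} [MeasurableSpace α] {μ : Measure α} [NormedAddCommGroup G]
    (f : Lp G ⊤ μ) : ∀ᵐ x ∂μ, ‖f x‖ ≤ ‖f‖ := by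
  filter_upwards [ae_le_eLpNormEssSup (f := f) (μ := μ)] with x hx
  rw [← eLpNorm_exponent_top, ← ENNReal.ofReal_toReal (Lp.eLpNorm_ne_top f), ← Lp.norm_def,
    ← ofReal_norm] at hx
  exact (ENNReal.ofReal_le_ofReal_iff (norm_nonneg _)).1 hx

lemma Lp.integrable_norm_sq {α G : Type*} [MeasurableSpace α] {μ : Measure α}
    [NormedAddCommGroup G] (f : Lp G 2 μ) : Integrable (fun x => ‖f x‖ ^ 2) μ :=
  MemLp.integrable_norm_pow (p := 2) (Lp.memLp f) two_ne_zero

lemma exists_bound {X Y : Type*} [NormedAddCommGroup X] [NormedSpace ℝ X] [NormedAddCommGroup Y]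
    [NormedSpace ℝ Y] (T : X →L[ℝ] Y) : ∃ a : ℝ, 0 ≤ a ∧ ∀ x, ‖T x‖ ≤ a * ‖x‖ :=
  ⟨‖T‖, norm_nonneg _, T.le_opNorm⟩

lemma norm_map_two_smul {X Y : Type*} [NormedAddCommGroup X] [NormedSpace ℝ X]
    [NormedAddCommGroup Y] [NormedSpace ℝ Y] (T : X →L[ℝ] Y) (x : X) :
    ‖T ((2 : ℝ) • x)‖ = 2 * ‖T x‖ := by
  rw [map_smul, norm_smul, Real.norm_two]

lemma map_add₄ {X Y : Type*} [NormedAddCommGroup X] [NormedSpace ℝ X] [NormedAddCommGroup Y]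
    [NormedSpace ℝ Y] (T : X →L[ℝ] Y) (a b c d : X) :
    T (a + b + c + d) = T a + T b + T c + T d := by
  simp only [map_add]

lemma norm_add_sub_le {X : Type*} [NormedAddCommGroup X] (l a b c d : X) :
    ‖l + a + b + c + d - l‖ ≤ ‖a‖ + ‖b‖ + ‖c‖ + ‖d‖ := by
  have e : l + a + b + c + d - l = a + b + c + d := by abel
  rw [e]
  exact (norm_add_le (a + b + c) d).trans (by gcongr; exact norm_add₃_le)

namespace CarlemanWeight

variable {B : Box} (w : CarlemanWeight B)

/-- The weighted norm of the gradient of a pair `(q, V)`. -/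
def gradN (k₁ k₂ lam : ℝ) (z : HK B 3 k₁ k₂ × Hm B 3) : ℝ := ‖compPair k₁ k₂ (w.gradE lam) z‖

/-- The weighted norm of the Hessian of a pair `(q, V)`. -/
def hessN (k₁ k₂ lam : ℝ) (z : HK B 3 k₁ k₂ × Hm B 3) : ℝ := ‖compPair k₁ k₂ (w.hessE lam) z‖

lemma gradN_nonneg (k₁ k₂ lam : ℝ) (z : HK B 3 k₁ k₂ × Hm B 3) : 0 ≤ w.gradN k₁ k₂ lam z :=
  norm_nonneg _

/-- The weighted operator norm on functions of the wavenumber. -/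
def EK (k₁ k₂ lam : ℝ) : Lp (L2 B) 2 (kVol k₁ k₂) →L[ℝ] Lp (L2 B) 2 (kVol k₁ k₂) :=
  (w.E lam).compLpL 2 (kVol k₁ k₂)

lemma coeFn_EK {k₁ k₂ : ℝ} (lam : ℝ) (f : Lp (L2 B) 2 (kVol k₁ k₂)) :
    w.EK k₁ k₂ lam f =ᵐ[kVol k₁ k₂] fun k => w.E lam (f k) :=
  (w.E lam).coeFn_compLpL f

lemma norm_E_dzI_le (lam : ℝ) (u : Hm B 3) : ‖w.E lam (dzI B u)‖ ≤ 2 * ‖w.gradE lam u‖ := by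
  refine le_trans ?_ (mul_le_mul_of_nonneg_left (w.norm_E_le_gradE lam u 2) zero_le_two)
  refine Lp.norm_le_mul_norm_of_ae_le_mul ?_
  filter_upwards [w.coeFn_E lam (dzI B u), w.coeFn_E lam (D (unitIdx 2) u), coeFn_dzI u]
    with x h1 h2 h3
  rw [h1, h2, h3]
  simp only [norm_mul, Complex.norm_I, Complex.norm_two]
  linarith

/-- The constant does not depend on $\lambda$: the weight commutes with the operations in $k$, so
the unweighted operator bounds are applied to functions with values in the weighted gradients and
Hessians. -/
lemma exists_norm_kqv_le (k₁ k₂ : ℝ) : ∃ K : ℝ, 0 ≤ K ∧ ∀ z : HK B 3 k₁ k₂ × Hm B 3,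
    ‖kvTop (Hm B 3) k₁ k₂ z‖ ≤ K * ‖z‖ ∧ ‖kqv (Hm B 3) k₁ k₂ z‖ ≤ K * ‖z‖ ∧
    ∀ lam : ℝ,
      ‖(w.gradE lam).compLpL ⊤ (kVol k₁ k₂) (kvTop (Hm B 3) k₁ k₂ z)‖ ≤ K * w.gradN k₁ k₂ lam z ∧
      ‖(w.gradE lam).compLpL 2 (kVol k₁ k₂) (kqv (Hm B 3) k₁ k₂ z)‖ ≤ K * w.gradN k₁ k₂ lam z ∧
      ‖(w.hessE lam).compLpL 2 (kVol k₁ k₂) (kqv (Hm B 3) k₁ k₂ z)‖ ≤ K * w.hessN k₁ k₂ lam z := by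
  obtain ⟨a₁, h1, H1⟩ := exists_bound (kvTop (Hm B 3) k₁ k₂)
  obtain ⟨a₂, h2, H2⟩ := exists_bound (kqv (Hm B 3) k₁ k₂)
  obtain ⟨a₃, h3, H3⟩ := exists_bound (kvTop (PiLp 2 fun _ : Fin 3 => L2 B) k₁ k₂)
  obtain ⟨a₄, h4, H4⟩ := exists_bound (kqv (PiLp 2 fun _ : Fin 3 => L2 B) k₁ k₂)
  obtain ⟨a₅, h5, H5⟩ := exists_bound (kqv (PiLp 2 fun _ : Fin 3 × Fin 3 => L2 B) k₁ k₂)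
  refine ⟨a₁ + a₂ + a₃ + a₄ + a₅, by positivity, fun z => ⟨?_, ?_, fun lam => ⟨?_, ?_, ?_⟩⟩⟩
  · exact (H1 z).trans
      (mul_le_mul_of_nonneg_right (by linarith) (norm_nonneg _))
  · exact (H2 z).trans
      (mul_le_mul_of_nonneg_right (by linarith) (norm_nonneg _))
  · rw [comp_kvTop]
    exact (H3 _).trans
      (mul_le_mul_of_nonneg_right (by linarith) (norm_nonneg _))
  · rw [comp_kqv]
    exact (H4 _).trans
      (mul_le_mul_of_nonneg_right (by linarith) (norm_nonneg _))
  · rw [comp_kqv]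
    exact (H5 _).trans
      (mul_le_mul_of_nonneg_right (by linarith) (norm_nonneg _))

lemma norm_EK_dzI_le {k₁ k₂ : ℝ} (lam : ℝ) (m : HK B 3 k₁ k₂) :
    ‖w.EK k₁ k₂ lam ((dzI B).compLpL 2 (kVol k₁ k₂) m)‖ ≤
      2 * ‖(w.gradE lam).compLpL 2 (kVol k₁ k₂) m‖ := by
  refine Lp.norm_le_mul_norm_of_ae_le_mul ?_
  filter_upwards [w.coeFn_EK lam ((dzI B).compLpL 2 (kVol k₁ k₂) m), (dzI B).coeFn_compLpL m,
    (w.gradE lam).coeFn_compLpL m] with k h1 h2 h3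
  rw [h1, h2, h3]
  exact w.norm_E_dzI_le lam _

/-- By symmetry of the product of gradients, the weight may be placed on either factor; both forms
are needed for the derivative of the quadratic term. -/
lemma exists_norm_EK_gdotK_le (k₁ k₂ : ℝ) : ∃ C : ℝ, 0 ≤ C ∧ ∀ (lam : ℝ)
    (u : Lp (Hm B 3) ⊤ (kVol k₁ k₂)) (m : HK B 3 k₁ k₂),
    ‖w.EK k₁ k₂ lam (gdotK B k₁ k₂ u m)‖ ≤
      C * ‖u‖ * ‖(w.gradE lam).compLpL 2 (kVol k₁ k₂) m‖ ∧
    ‖w.EK k₁ k₂ lam (gdotK B k₁ k₂ u m)‖ ≤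
      C * ‖(w.gradE lam).compLpL ⊤ (kVol k₁ k₂) u‖ * ‖m‖ := by
  obtain ⟨C, hC0, hC⟩ := w.exists_norm_E_gdot_le
  refine ⟨C, hC0, fun lam u m => ⟨?_, ?_⟩⟩
  · refine Lp.norm_le_mul_norm_of_ae_le_mul ?_
    filter_upwards [w.coeFn_EK lam (gdotK B k₁ k₂ u m), coeFn_gdotK u m,
      (w.gradE lam).coeFn_compLpL m, Lp.ae_norm_le_top u] with k h1 h2 h3 h4
    rw [h1, h2, h3]
    refine (hC lam (u k) (m k)).trans ?_
    gcongr
  · refine Lp.norm_le_mul_norm_of_ae_le_mul ?_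
    filter_upwards [w.coeFn_EK lam (gdotK B k₁ k₂ u m), coeFn_gdotK u m,
      (w.gradE lam).coeFn_compLpL u,
      Lp.ae_norm_le_top ((w.gradE lam).compLpL ⊤ (kVol k₁ k₂) u)] with k h1 h2 h3 h4
    rw [h1, h2, gdot_comm]
    rw [h3] at h4
    refine (hC lam (m k) (u k)).trans ?_
    rw [mul_right_comm]
    gcongr

lemma two_mul_le_aux {M N x y : ℝ} (hN : 0 ≤ N) (hy : 0 ≤ y) (h : x ≤ M * y) :
    2 * x ≤ (2 * M + N) * y := by nlinarith

lemma two_mul_mul_le_aux {C M x a b y z : ℝ} (hC : 0 ≤ C) (hM : 0 ≤ M) (hb : 0 ≤ b)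
    (hy : 0 ≤ y) (hz : 0 ≤ z) (h : x ≤ C * a * b) (h1 : a ≤ M * y) (h2 : b ≤ M * z) :
    2 * x ≤ (2 * M + 2 * (C * M * M)) * y * z := by
  have h3 : C * a * b ≤ C * (M * y) * (M * z) := by gcongr
  have h4 : 0 ≤ M * y * z := by positivity
  nlinarith

lemma sum_le_aux {K g a b x y n : ℝ} (hy : 0 ≤ y) (hK : 0 ≤ K) (hg : 0 ≤ g)
    (h : n ≤ a + b) (ha : a ≤ K * g + K * x * g + K * g * x) (hb : b ≤ K * y * g) :
    n ≤ 2 * K * (1 + x + y) * g := by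
  have : 0 ≤ K * g := by positivity
  have : 0 ≤ K * y * g := by positivity
  nlinarith

/-- The lower order parts of the quadratic map are controlled by the weighted gradient. -/
lemma exists_norm_EK_opQ_le (k₁ k₂ : ℝ) : ∃ K : ℝ, 0 ≤ K ∧ ∀ (lam : ℝ)
    (z z' : HK B 3 k₁ k₂ × Hm B 3),
    ‖w.EK k₁ k₂ lam ((dzI B).compLpL 2 (kVol k₁ k₂) (kqv (Hm B 3) k₁ k₂ z))‖ ≤
      K * w.gradN k₁ k₂ lam z ∧
    ‖w.EK k₁ k₂ lam ((opQ B k₁ k₂).N z z')‖ ≤ K * ‖z‖ * w.gradN k₁ k₂ lam z' ∧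
    ‖w.EK k₁ k₂ lam ((opQ B k₁ k₂).N z z')‖ ≤ K * w.gradN k₁ k₂ lam z * ‖z'‖ := by
  refine (w.exists_norm_kqv_le k₁ k₂).elim fun M hM => ?_
  refine (w.exists_norm_EK_gdotK_le k₁ k₂).elim fun C hC => ?_
  have hM0 := hM.1
  have hC0 := hC.1
  refine ⟨2 * M + 2 * (C * M * M), by positivity, fun lam z z' => ?_⟩
  have hc := hC.2 lam (kvTop (Hm B 3) k₁ k₂ z) (kqv (Hm B 3) k₁ k₂ z')
  have e : ‖w.EK k₁ k₂ lam ((opQ B k₁ k₂).N z z')‖ = 2 * ‖w.EK k₁ k₂ lam (gdotK B k₁ k₂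
      (kvTop (Hm B 3) k₁ k₂ z) (kqv (Hm B 3) k₁ k₂ z'))‖ := by
    rw [opQ_N]
    exact norm_map_two_smul (w.EK k₁ k₂ lam) _
  rw [e]
  refine ⟨(w.norm_EK_dzI_le lam _).trans ?_, ?_, ?_⟩
  · exact two_mul_le_aux (by positivity) (w.gradN_nonneg k₁ k₂ lam z) ((hM.2 z).2.2 lam).2.1
  · exact two_mul_mul_le_aux hC0 hM0 (norm_nonneg _) (norm_nonneg _)
      (w.gradN_nonneg k₁ k₂ lam z') hc.1 (hM.2 z).1 ((hM.2 z').2.2 lam).2.1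
  · exact two_mul_mul_le_aux hC0 hM0 (norm_nonneg _)
      (w.gradN_nonneg k₁ k₂ lam z) (norm_nonneg _) hc.2 ((hM.2 z).2.2 lam).1 (hM.2 z').2.1

/-- The derivative of the quadratic map is the Laplacian up to lower order terms. -/
lemma exists_norm_EK_der_sub_le (k₁ k₂ : ℝ) : ∃ K : ℝ, 0 ≤ K ∧ ∀ (lam : ℝ)
    (z h : HK B 3 k₁ k₂ × Hm B 3),
    ‖w.EK k₁ k₂ lam ((opQ B k₁ k₂).der z h) + w.EK k₁ k₂ lam ((opQ B k₁ k₂).N h h) -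
      w.EK k₁ k₂ lam ((lapL B 3).compLpL 2 (kVol k₁ k₂) h.1)‖ ≤
      K * (1 + ‖z‖ + ‖h‖) * w.gradN k₁ k₂ lam h := by
  refine (w.exists_norm_EK_opQ_le k₁ k₂).elim fun K hK => ?_
  have hK0 := hK.1
  refine ⟨2 * K, by positivity, fun lam z h => ?_⟩
  have e := (congrArg (w.EK k₁ k₂ lam) (opQ_der z h)).trans (map_add₄ (w.EK k₁ k₂ lam) _ _ _ _)
  rw [e]
  refine (norm_add_sub_le _ _ _ _ _).trans ?_
  exact sum_le_aux (norm_nonneg h) hK0 (w.gradN_nonneg k₁ k₂ lam h) le_rfl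
    (add_le_add_three (hK.2 lam h h).1 (hK.2 lam z h).2.1 (hK.2 lam h z).2.2) (hK.2 lam h h).2.1

end CarlemanWeight

end

section

/-! ### The second order term -/

lemma eLpNorm_coe_add_le {B : Box} (f g : L2 B) : eLpNorm (f + g : L2 B) 6 B.vol ≤
    eLpNorm f 6 B.vol + eLpNorm g 6 B.vol := by
  rw [eLpNorm_congr_ae (Lp.coeFn_add f g)]
  exact eLpNorm_add_le (Lp.aestronglyMeasurable f) (Lp.aestronglyMeasurable g) (by norm_num)

/-- $\Delta q$ belongs to $H^1\subset L^6$, the exponent required for the unweighted factor of the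
trilinear estimate. -/
lemma exists_eLpNorm_six_opL_le (B : Box) : ∃ C : ℝ, 0 ≤ C ∧ ∀ q u m : Hm B 3,
    eLpNorm (lap q + dzI B m + (2 : ℝ) • gdot B u m : L2 B) 6 B.vol ≤
      ENNReal.ofReal (C * (‖q‖ + ‖m‖ + ‖u‖ * ‖m‖)) := by
  obtain ⟨C₁, h₁0, h₁⟩ := exists_eLpNorm_six_D_le B
  obtain ⟨C₂, h₂0, h₂⟩ := exists_eLpNorm_six_gdot_le B
  refine ⟨3 * C₁ + 2 * C₂, by positivity, fun q u m => ?_⟩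
  have hl : eLpNorm (lap q) 6 B.vol ≤ ENNReal.ofReal (3 * (C₁ * ‖q‖)) := by
    have e : lap q = D (2 • unitIdx 0) q + D (2 • unitIdx 1) q + D (2 • unitIdx 2) q := by
      rw [lap, Fin.sum_univ_three]
    have hi : ∀ i, ∑ j, (2 • unitIdx i) j ≤ 2 := fun i => by
      simp only [Pi.smul_apply, smul_eq_mul, ← Finset.mul_sum, sum_unitIdx, mul_one, le_refl]
    rw [e, show 3 * (C₁ * ‖q‖) = C₁ * ‖q‖ + C₁ * ‖q‖ + C₁ * ‖q‖ by ring,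
      ENNReal.ofReal_add (by positivity) (by positivity),
      ENNReal.ofReal_add (by positivity) (by positivity)]
    refine (eLpNorm_coe_add_le _ _).trans (add_le_add ?_ (h₁ q _ (hi 2)))
    exact (eLpNorm_coe_add_le _ _).trans (add_le_add (h₁ q _ (hi 0)) (h₁ q _ (hi 1)))
  have hz : eLpNorm (dzI B m) 6 B.vol ≤ ENNReal.ofReal (2 * (C₁ * ‖m‖)) := by
    rw [eLpNorm_congr_ae (coeFn_dzI m)]
    have e : (fun x => 2 * Complex.I * D (unitIdx 2) m x) =
        (2 * Complex.I) • (D (unitIdx 2) m : E3 → ℂ) := rfl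
    have e2 : ‖2 * Complex.I‖ₑ = ENNReal.ofReal 2 := by
      rw [← ofReal_norm]; simp
    rw [e, eLpNorm_const_smul, e2, ENNReal.ofReal_mul zero_le_two]
    exact mul_le_mul' le_rfl (h₁ m _ (by rw [sum_unitIdx]; norm_num))
  have hg : eLpNorm ((2 : ℝ) • gdot B u m : L2 B) 6 B.vol ≤
      ENNReal.ofReal (2 * (C₂ * (‖u‖ * ‖m‖))) := by
    have e2 : ‖(2 : ℝ)‖ₑ = ENNReal.ofReal 2 := by
      rw [← ofReal_norm]; simp
    rw [eLpNorm_congr_ae (Lp.coeFn_smul (2 : ℝ) (gdot B u m)), eLpNorm_const_smul, e2,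
      ENNReal.ofReal_mul zero_le_two]
    exact mul_le_mul' le_rfl (h₂ u m)
  refine (eLpNorm_coe_add_le _ _).trans ((add_le_add ((eLpNorm_coe_add_le _ _).trans
    (add_le_add hl hz)) hg).trans ?_)
  rw [← ENNReal.ofReal_add (by positivity) (by positivity),
    ← ENNReal.ofReal_add (by positivity) (by positivity)]
  refine ENNReal.ofReal_le_ofReal ?_
  have : 0 ≤ C₁ * ‖m‖ := by positivity
  have : 0 ≤ C₂ * ‖m‖ := by positivity
  have : 0 ≤ C₂ * ‖q‖ := by positivity
  have : 0 ≤ C₁ * (‖u‖ * ‖m‖) := by positivity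
  nlinarith

/-- Young's inequality twice: $x(y+\lambda x)\le2(\lambda x^2+\lambda^{-1}y^2)$ is a quantity
controlled by the Carleman estimate, and the free $\theta$ makes its coefficient small at the
expense of a term that a large $\lambda$ absorbs. -/
lemma mul_sqrt_le {lam θ a g x y : ℝ} (hl : 0 < lam) (hθ : 0 < θ) (hx : 0 ≤ x) (hy : 0 ≤ y) :
    a * (g * √(x * (y + lam * x))) ≤
      θ * (a ^ 2 * g ^ 2) + θ⁻¹ * (lam * x ^ 2 + lam⁻¹ * y ^ 2) := by
  have h0 : 0 ≤ x * (y + lam * x) := by positivity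
  have h1 : x * (y + lam * x) ≤ 2 * (lam * x ^ 2 + lam⁻¹ * y ^ 2) := by
    have e : 2 * (lam * x ^ 2 + lam⁻¹ * y ^ 2) - x * (y + lam * x) =
        lam⁻¹ * (y - lam * x / 2) ^ 2 + lam⁻¹ * y ^ 2 + 3 / 4 * (lam * x ^ 2) := by
      field_simp; ring
    have : 0 ≤ lam⁻¹ * (y - lam * x / 2) ^ 2 + lam⁻¹ * y ^ 2 + 3 / 4 * (lam * x ^ 2) := by
      positivity
    linarith
  set r := √(x * (y + lam * x)) with hr
  have h2 : r ^ 2 = x * (y + lam * x) := Real.sq_sqrt h0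
  have e : θ * (a ^ 2 * g ^ 2) + θ⁻¹ * (r ^ 2 / 2) - a * (g * r) =
      θ⁻¹ / 2 * (r - θ * (a * g)) ^ 2 + θ / 2 * (a * g) ^ 2 := by
    field_simp; ring
  have : 0 ≤ θ⁻¹ / 2 * (r - θ * (a * g)) ^ 2 + θ / 2 * (a * g) ^ 2 := by positivity
  have : θ⁻¹ * (r ^ 2 / 2) ≤ θ⁻¹ * (lam * x ^ 2 + lam⁻¹ * y ^ 2) := by
    gcongr; rw [h2]; linarith
  linarith

namespace CarlemanWeight

variable {B : Box} (w : CarlemanWeight B)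

lemma exists_abs_inner_E_opL_le : ∃ C : ℝ, 0 ≤ C ∧ ∀ lam : ℝ, 1 ≤ lam → ∀ θ : ℝ, 0 < θ →
    ∀ q u m u' m' : Hm B 3,
    |inner ℝ (w.E lam (lap q + dzI B m + (2 : ℝ) • gdot B u m))
      (w.E lam ((2 : ℝ) • gdot B u' m'))| ≤
      C * (θ * ((‖q‖ + ‖m‖ + ‖u‖ * ‖m‖) ^ 2 * ‖w.gradE lam u'‖ ^ 2) +
        θ⁻¹ * (lam * ‖w.gradE lam m'‖ ^ 2 + lam⁻¹ * ‖w.hessE lam m'‖ ^ 2)) := by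
  obtain ⟨C₁, h₁0, h₁⟩ := exists_eLpNorm_six_opL_le B
  obtain ⟨C₂, h₂0, h₂⟩ := w.exists_abs_inner_E_gdot_le
  refine ⟨2 * (C₂ * C₁), by positivity, fun lam hl θ hθ q u m u' m' => ?_⟩
  have hA : 0 ≤ ‖q‖ + ‖m‖ + ‖u‖ * ‖m‖ := by positivity
  have h3 := h₂ lam hl _ _ (mul_nonneg h₁0 hA) (h₁ q u m) u' m'
  have h4 := mul_sqrt_le (a := ‖q‖ + ‖m‖ + ‖u‖ * ‖m‖) (g := ‖w.gradE lam u'‖)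
    (x := ‖w.gradE lam m'‖) (y := ‖w.hessE lam m'‖) (zero_lt_one.trans_le hl) hθ (norm_nonneg _)
    (norm_nonneg _)
  rw [map_smul, real_inner_smul_right, abs_mul, abs_two, mul_assoc]
  refine mul_le_mul_of_nonneg_left (h3.trans ?_) zero_le_two
  calc _ = C₂ * C₁ * ((‖q‖ + ‖m‖ + ‖u‖ * ‖m‖) * (‖w.gradE lam u'‖ *
        √(‖w.gradE lam m'‖ * (‖w.hessE lam m'‖ + lam * ‖w.gradE lam m'‖)))) := by ring
    _ ≤ _ := mul_le_mul_of_nonneg_left h4 (by positivity)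

end CarlemanWeight

end

section

/-! ### Integrated estimates -/

lemma abs_integral_le_norm_sq {α G₁ G₂ G₃ G₄ : Type*} [MeasurableSpace α] {μ : Measure α}
    [NormedAddCommGroup G₁] [InnerProductSpace ℝ G₁] [NormedAddCommGroup G₂]
    [InnerProductSpace ℝ G₂] [NormedAddCommGroup G₃] [InnerProductSpace ℝ G₃]
    [NormedAddCommGroup G₄] [InnerProductSpace ℝ G₄] (f₁ : Lp G₁ 2 μ) (f₂ : Lp G₂ 2 μ)
    (f₃ : Lp G₃ 2 μ) (f₄ : Lp G₄ 2 μ) {F : α → ℝ} {a b c d : ℝ}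
    (h : ∀ᵐ x ∂μ, |F x| ≤ a * ‖f₁ x‖ ^ 2 + b * ‖f₂ x‖ ^ 2 + c * ‖f₃ x‖ ^ 2 + d * ‖f₄ x‖ ^ 2) :
    |∫ x, F x ∂μ| ≤ a * ‖f₁‖ ^ 2 + b * ‖f₂‖ ^ 2 + c * ‖f₃‖ ^ 2 + d * ‖f₄‖ ^ 2 := by
  have h1 := (Lp.integrable_norm_sq f₁).const_mul a
  have h2 := (Lp.integrable_norm_sq f₂).const_mul b
  have h3 := (Lp.integrable_norm_sq f₃).const_mul c
  have h4 := (Lp.integrable_norm_sq f₄).const_mul d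
  have h12 : Integrable (fun x => a * ‖f₁ x‖ ^ 2 + b * ‖f₂ x‖ ^ 2) μ := h1.add h2
  have h123 : Integrable (fun x => a * ‖f₁ x‖ ^ 2 + b * ‖f₂ x‖ ^ 2 + c * ‖f₃ x‖ ^ 2) μ :=
    h12.add h3
  rw [norm_sq_eq_integral, norm_sq_eq_integral, norm_sq_eq_integral, norm_sq_eq_integral,
    ← integral_const_mul, ← integral_const_mul, ← integral_const_mul, ← integral_const_mul,
    ← integral_add h1 h2, ← integral_add h12 h3, ← integral_add h123 h4]
  have h1234 : Integrable (fun x => a * ‖f₁ x‖ ^ 2 + b * ‖f₂ x‖ ^ 2 + c * ‖f₃ x‖ ^ 2 +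
      d * ‖f₄ x‖ ^ 2) μ := h123.add h4
  simp only [← Real.norm_eq_abs] at h ⊢
  exact norm_integral_le_of_norm_le h1234 h

/-- An inequality between norms, integrated. -/
lemma norm_sq_le_of_ae {α G₁ G₂ G₃ G₄ : Type*} [MeasurableSpace α] {μ : Measure α}
    [NormedAddCommGroup G₁] [InnerProductSpace ℝ G₁] [NormedAddCommGroup G₂]
    [InnerProductSpace ℝ G₂] [NormedAddCommGroup G₃] [InnerProductSpace ℝ G₃]
    [NormedAddCommGroup G₄] [InnerProductSpace ℝ G₄] (f₁ : Lp G₁ 2 μ) (f₂ : Lp G₂ 2 μ)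
    (f₃ : Lp G₃ 2 μ) (f₄ : Lp G₄ 2 μ) {a b c d : ℝ}
    (h : ∀ᵐ x ∂μ, a * ‖f₁ x‖ ^ 2 + b * ‖f₂ x‖ ^ 2 + c * ‖f₃ x‖ ^ 2 ≤ d * ‖f₄ x‖ ^ 2) :
    a * ‖f₁‖ ^ 2 + b * ‖f₂‖ ^ 2 + c * ‖f₃‖ ^ 2 ≤ d * ‖f₄‖ ^ 2 := by
  have h1 := (Lp.integrable_norm_sq f₁).const_mul a
  have h2 := (Lp.integrable_norm_sq f₂).const_mul b
  have h3 := (Lp.integrable_norm_sq f₃).const_mul c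
  have h4 := (Lp.integrable_norm_sq f₄).const_mul d
  have h12 : Integrable (fun x => a * ‖f₁ x‖ ^ 2 + b * ‖f₂ x‖ ^ 2) μ := h1.add h2
  rw [norm_sq_eq_integral, norm_sq_eq_integral, norm_sq_eq_integral, norm_sq_eq_integral,
    ← integral_const_mul, ← integral_const_mul, ← integral_const_mul, ← integral_const_mul,
    ← integral_add h1 h2, ← integral_add h12 h3]
  exact integral_mono_ae (h12.add h3) h4 h

/-- Preparation for integrating in $k$: factors bounded in $k$ are replaced by their bounds $U$ and
$G$, which leaves a combination of squares of four functions that are square integrable in $k$. -/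
lemma sq_bound_aux {θ q m u g n G U x y lam : ℝ} (hθ : 0 < θ) (hm : 0 ≤ m) (hu0 : 0 ≤ u)
    (hg0 : 0 ≤ g) (hq : 0 ≤ q) (hu : u ≤ U) (hg : g ≤ G) (C : ℝ) (hC : 0 ≤ C)
    (h : n ≤ C * (θ * ((q + m + u * m) ^ 2 * g ^ 2) + θ⁻¹ * (lam * x ^ 2 + lam⁻¹ * y ^ 2))) :
    n ≤ C * θ * G ^ 2 * 2 * q ^ 2 + C * θ * G ^ 2 * 2 * (1 + U) ^ 2 * m ^ 2 +
      C * θ⁻¹ * lam * x ^ 2 + C * θ⁻¹ * lam⁻¹ * y ^ 2 := by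
  have h1 : (q + m + u * m) ^ 2 ≤ 2 * q ^ 2 + 2 * (1 + U) ^ 2 * m ^ 2 := by
    have h2 : (q + m + u * m) ^ 2 ≤ (q + (1 + U) * m) ^ 2 := by
      have : u * m ≤ U * m := by gcongr
      exact pow_le_pow_left₀ (by positivity) (by nlinarith) 2
    nlinarith [sq_nonneg (q - (1 + U) * m)]
  have h3 : (q + m + u * m) ^ 2 * g ^ 2 ≤ (2 * q ^ 2 + 2 * (1 + U) ^ 2 * m ^ 2) * G ^ 2 := by
    gcongr
  calc n ≤ _ := h
    _ ≤ C * (θ * ((2 * q ^ 2 + 2 * (1 + U) ^ 2 * m ^ 2) * G ^ 2) +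
        θ⁻¹ * (lam * x ^ 2 + lam⁻¹ * y ^ 2)) := by gcongr
    _ = _ := by ring

lemma cross_bound_aux {C K θ z q m g x y γ η lam n : ℝ} (hC : 0 ≤ C) (hK : 0 ≤ K) (hθ : 0 < θ)
    (hl : 0 < lam) (hz : 0 ≤ z) (hq : 0 ≤ q) (hqz : q ≤ z) (hm : 0 ≤ m) (hmz : m ≤ K * z)
    (hx : 0 ≤ x) (hxγ : x ≤ K * γ) (hy : 0 ≤ y) (hyη : y ≤ K * η) (hg : g = K * γ)
    (h : n ≤ C * θ * g ^ 2 * 2 * q ^ 2 + C * θ * g ^ 2 * 2 * (1 + K * z) ^ 2 * m ^ 2 +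
      C * θ⁻¹ * lam * x ^ 2 + C * θ⁻¹ * lam⁻¹ * y ^ 2) :
    n ≤ C * K ^ 2 * (3 + 2 * (1 + K) ^ 2 * K ^ 2) *
      (θ * (1 + z) ^ 4 * γ ^ 2 + θ⁻¹ * (lam * γ ^ 2 + lam⁻¹ * η ^ 2)) := by
  subst hg
  have h1 : q ^ 2 ≤ (1 + z) ^ 4 := by
    calc q ^ 2 ≤ z ^ 2 := by gcongr
      _ ≤ (1 + z) ^ 2 := by gcongr; linarith
      _ ≤ (1 + z) ^ 4 := pow_le_pow_right₀ (by linarith) (by norm_num)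
  have h2 : (1 + K * z) ^ 2 * m ^ 2 ≤ (1 + K) ^ 2 * K ^ 2 * (1 + z) ^ 4 := by
    calc (1 + K * z) ^ 2 * m ^ 2 ≤ ((1 + K) * (1 + z)) ^ 2 * (K * (1 + z)) ^ 2 := by
          have : 0 ≤ K * z := by positivity
          gcongr
          · nlinarith
          · exact hmz.trans (by nlinarith)
      _ = _ := by ring
  have h3 : x ^ 2 ≤ K ^ 2 * γ ^ 2 := by rw [← mul_pow]; gcongr
  have h4 : y ^ 2 ≤ K ^ 2 * η ^ 2 := by rw [← mul_pow]; gcongr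
  have hA : 0 ≤ C * θ * (K * γ) ^ 2 * 2 := by positivity
  calc n ≤ _ := h
    _ = C * θ * (K * γ) ^ 2 * 2 * (q ^ 2 + (1 + K * z) ^ 2 * m ^ 2) +
      C * θ⁻¹ * (lam * x ^ 2 + lam⁻¹ * y ^ 2) := by ring
    _ ≤ C * θ * (K * γ) ^ 2 * 2 * ((1 + z) ^ 4 + (1 + K) ^ 2 * K ^ 2 * (1 + z) ^ 4) +
      C * θ⁻¹ * (lam * (K ^ 2 * γ ^ 2) + lam⁻¹ * (K ^ 2 * η ^ 2)) := by
        gcongr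
    _ = C * K ^ 2 * ((2 + 2 * (1 + K) ^ 2 * K ^ 2) * (θ * (1 + z) ^ 4 * γ ^ 2) +
        θ⁻¹ * (lam * γ ^ 2 + lam⁻¹ * η ^ 2)) := by ring
    _ ≤ C * K ^ 2 * ((3 + 2 * (1 + K) ^ 2 * K ^ 2) * (θ * (1 + z) ^ 4 * γ ^ 2) +
        (3 + 2 * (1 + K) ^ 2 * K ^ 2) * (θ⁻¹ * (lam * γ ^ 2 + lam⁻¹ * η ^ 2))) := by
        have h5 : 0 ≤ θ * (1 + z) ^ 4 * γ ^ 2 := by positivity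
        have h6 : 0 ≤ θ⁻¹ * (lam * γ ^ 2 + lam⁻¹ * η ^ 2) := by positivity
        have h7 : 0 ≤ (1 + K) ^ 2 * K ^ 2 := by positivity
        refine mul_le_mul_of_nonneg_left (add_le_add ?_ ?_) (by positivity)
        · nlinarith
        · nlinarith
    _ = _ := by ring

namespace CarlemanWeight

variable {B : Box} (w : CarlemanWeight B)

lemma coeFn_opQ_N {k₁ k₂ : ℝ} (h : HK B 3 k₁ k₂ × Hm B 3) :
    (opQ B k₁ k₂).N h h =ᵐ[kVol k₁ k₂] fun k => (2 : ℝ) •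
      gdot B (kvTop (Hm B 3) k₁ k₂ h k) (kqv (Hm B 3) k₁ k₂ h k) := by
  rw [opQ_N]
  filter_upwards [Lp.coeFn_smul (2 : ℝ) (gdotK B k₁ k₂ (kvTop (Hm B 3) k₁ k₂ h)
    (kqv (Hm B 3) k₁ k₂ h)), coeFn_gdotK (kvTop (Hm B 3) k₁ k₂ h) (kqv (Hm B 3) k₁ k₂ h)]
    with k h1 h2
  rw [h1, Pi.smul_apply, h2]

set_option maxHeartbeats 1000000 in
lemma abs_inner_EK_opQ_ae {k₁ k₂ C K : ℝ} (hC0 : 0 ≤ C) {lam θ : ℝ} (hθ : 0 < θ)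
    (hC : ∀ q u m u' m' : Hm B 3,
      |inner ℝ (w.E lam (lap q + dzI B m + (2 : ℝ) • gdot B u m))
        (w.E lam ((2 : ℝ) • gdot B u' m'))| ≤
        C * (θ * ((‖q‖ + ‖m‖ + ‖u‖ * ‖m‖) ^ 2 * ‖w.gradE lam u'‖ ^ 2) +
          θ⁻¹ * (lam * ‖w.gradE lam m'‖ ^ 2 + lam⁻¹ * ‖w.hessE lam m'‖ ^ 2)))
    (z h : HK B 3 k₁ k₂ × Hm B 3)
    (hz : ‖kvTop (Hm B 3) k₁ k₂ z‖ ≤ K * ‖z‖)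
    (hh : ‖(w.gradE lam).compLpL ⊤ (kVol k₁ k₂) (kvTop (Hm B 3) k₁ k₂ h)‖ ≤
      K * w.gradN k₁ k₂ lam h) :
    ∀ᵐ k ∂kVol k₁ k₂, |inner ℝ (w.EK k₁ k₂ lam ((opQ B k₁ k₂).val z) k)
        (w.EK k₁ k₂ lam ((opQ B k₁ k₂).N h h) k)| ≤
      C * θ * (K * w.gradN k₁ k₂ lam h) ^ 2 * 2 * ‖z.1 k‖ ^ 2 +
      C * θ * (K * w.gradN k₁ k₂ lam h) ^ 2 * 2 * (1 + K * ‖z‖) ^ 2 *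
        ‖kqv (Hm B 3) k₁ k₂ z k‖ ^ 2 +
      C * θ⁻¹ * lam *
        ‖(w.gradE lam).compLpL 2 (kVol k₁ k₂) (kqv (Hm B 3) k₁ k₂ h) k‖ ^ 2 +
      C * θ⁻¹ * lam⁻¹ *
        ‖(w.hessE lam).compLpL 2 (kVol k₁ k₂) (kqv (Hm B 3) k₁ k₂ h) k‖ ^ 2 := by
  filter_upwards [w.coeFn_EK lam ((opQ B k₁ k₂).val z), w.coeFn_EK lam ((opQ B k₁ k₂).N h h),
    coeFn_opQ_val z, coeFn_opQ_N h, (w.gradE lam).coeFn_compLpL (kqv (Hm B 3) k₁ k₂ h),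
    (w.hessE lam).coeFn_compLpL (kqv (Hm B 3) k₁ k₂ h),
    (w.gradE lam).coeFn_compLpL (kvTop (Hm B 3) k₁ k₂ h),
    Lp.ae_norm_le_top (kvTop (Hm B 3) k₁ k₂ z),
    Lp.ae_norm_le_top ((w.gradE lam).compLpL ⊤ (kVol k₁ k₂) (kvTop (Hm B 3) k₁ k₂ h))]
    with k e1 e2 e3 e4 e5 e6 e7 e8 e9
  rw [e1, e2, e3, e4, e5, e6]
  rw [e7] at e9
  exact sq_bound_aux hθ (norm_nonneg _) (norm_nonneg _) (norm_nonneg _) (norm_nonneg _)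
    (e8.trans hz) (e9.trans hh) C hC0 (hC _ _ _ _ _)

/-- The second order term in the expansion of the functional. -/
lemma exists_abs_inner_EK_opQ_le (k₁ k₂ : ℝ) : ∃ K : ℝ, 0 ≤ K ∧ ∀ lam : ℝ, 1 ≤ lam →
    ∀ θ : ℝ, 0 < θ → ∀ z h : HK B 3 k₁ k₂ × Hm B 3,
    |inner ℝ (w.EK k₁ k₂ lam ((opQ B k₁ k₂).val z)) (w.EK k₁ k₂ lam ((opQ B k₁ k₂).N h h))| ≤
      K * (θ * (1 + ‖z‖) ^ 4 * w.gradN k₁ k₂ lam h ^ 2 + θ⁻¹ * (lam * w.gradN k₁ k₂ lam h ^ 2 +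
        lam⁻¹ * w.hessN k₁ k₂ lam h ^ 2)) := by
  refine w.exists_abs_inner_E_opL_le.elim fun C hC => ?_
  refine (w.exists_norm_kqv_le k₁ k₂).elim fun K hK => ?_
  refine ⟨C * K ^ 2 * (3 + 2 * (1 + K) ^ 2 * K ^ 2), mul_nonneg (mul_nonneg hC.1 (sq_nonneg _))
    (by positivity), fun lam hl θ hθ z h => ?_⟩
  refine cross_bound_aux (q := ‖z.1‖) (m := ‖kqv (Hm B 3) k₁ k₂ z‖) (g := K * w.gradN k₁ k₂ lam h)
    hC.1 hK.1 hθ (zero_lt_one.trans_le hl) (norm_nonneg z) (norm_nonneg _) (norm_fst_le z)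
    (norm_nonneg _) (hK.2 z).2.1 (norm_nonneg _) ((hK.2 h).2.2 lam).2.1 (norm_nonneg _)
    ((hK.2 h).2.2 lam).2.2 rfl ?_
  rw [L2.inner_def]
  exact abs_integral_le_norm_sq z.1 (kqv (Hm B 3) k₁ k₂ z)
    ((w.gradE lam).compLpL 2 (kVol k₁ k₂) (kqv (Hm B 3) k₁ k₂ h))
    ((w.hessE lam).compLpL 2 (kVol k₁ k₂) (kqv (Hm B 3) k₁ k₂ h))
    (w.abs_inner_EK_opQ_ae hC.1 hθ (hC.2 lam hl θ hθ) z h (hK.2 z).1 ((hK.2 h).2.2 lam).1)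

lemma gradN_incr (k₁ k₂ lam : ℝ) (p : HK0 B 3 k₁ k₂) : w.gradN k₁ k₂ lam (incr B k₁ k₂ p) =
    ‖(w.gradE lam).compLpL 2 (kVol k₁ k₂) (incr B k₁ k₂ p).1‖ :=
  norm_compPair_zero _ _

lemma hessN_incr (k₁ k₂ lam : ℝ) (p : HK0 B 3 k₁ k₂) : w.hessN k₁ k₂ lam (incr B k₁ k₂ p) =
    ‖(w.hessE lam).compLpL 2 (kVol k₁ k₂) (incr B k₁ k₂ p).1‖ :=
  norm_compPair_zero _ _

lemma coeFn_incr {k₁ k₂ : ℝ} (p : HK0 B 3 k₁ k₂) :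
    (incr B k₁ k₂ p).1 =ᵐ[kVol k₁ k₂] fun k => Hm0.incl (p k) :=
  (Hm0.incl (B := B) (m := 3)).coeFn_compLpL p

lemma incl_mem (u : Hm0 B 3) : Hm0.incl u ∈ zeroData B 3 := u.2

/-- The Carleman estimate, integrated over the wavenumbers. -/
lemma exists_gradN_incr_le (k₁ k₂ : ℝ) : ∃ C lam₀ : ℝ, 1 ≤ C ∧ 1 ≤ lam₀ ∧ ∀ lam : ℝ, lam₀ ≤ lam →
    ∀ p : HK0 B 3 k₁ k₂, lam * w.gradN k₁ k₂ lam (incr B k₁ k₂ p) ^ 2 +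
      lam⁻¹ * w.hessN k₁ k₂ lam (incr B k₁ k₂ p) ^ 2 ≤
      C * ‖w.EK k₁ k₂ lam ((lapL B 3).compLpL 2 (kVol k₁ k₂) (incr B k₁ k₂ p).1)‖ ^ 2 := by
  obtain ⟨C, lam₀, hC1, hl0, hC⟩ := w.carleman
  refine ⟨C, lam₀, hC1, hl0, fun lam hl p => ?_⟩
  rw [gradN_incr, hessN_incr]
  set f := (incr B k₁ k₂ p).1 with hf
  have hl1 : 0 ≤ lam := by linarith
  have key := norm_sq_le_of_ae (a := lam) (b := lam⁻¹) (c := 0) (d := C)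
    ((w.gradE lam).compLpL 2 (kVol k₁ k₂) f) ((w.hessE lam).compLpL 2 (kVol k₁ k₂) f)
    f (w.EK k₁ k₂ lam ((lapL B 3).compLpL 2 (kVol k₁ k₂) f)) ?_
  · rw [zero_mul, add_zero] at key
    exact key
  filter_upwards [coeFn_incr p, (w.gradE lam).coeFn_compLpL f, (w.hessE lam).coeFn_compLpL f,
    w.coeFn_EK lam ((lapL B 3).compLpL 2 (kVol k₁ k₂) f), (lapL B 3).coeFn_compLpL f]
    with k h1 h2 h3 h4 h5
  rw [h2, h3, h4, h5, lapL_apply, norm_gradE_sq, norm_hessE_sq, zero_mul, add_zero]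
  have hz : f k ∈ zeroData B 3 := by rw [hf, h1]; exact incl_mem _
  have h6 := hC lam hl (f k) hz
  have h7 : 0 ≤ lam ^ 3 * ‖w.E lam (D 0 (f k))‖ ^ 2 := by positivity
  linarith

end CarlemanWeight

end

section

/-! ### Strict convexity -/

lemma mem_multiIdx_one {α : Fin 3 → ℕ} (h : α ∈ multiIdx 1) : α = 0 ∨ ∃ i, α = unitIdx i := by
  rw [mem_multiIdx] at h
  by_cases h0 : α = 0
  · exact Or.inl h0
  obtain ⟨i, hi⟩ : ∃ i, α i ≠ 0 := by
    by_contra hc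
    push Not at hc
    exact h0 (funext hc)
  refine Or.inr ⟨i, funext fun j => ?_⟩
  rw [Fin.sum_univ_three] at h
  fin_cases i <;> fin_cases j <;> simp [unitIdx] at hi ⊢ <;> omega

lemma mem_multiIdx_two {α : Fin 3 → ℕ} (h : α ∈ multiIdx 2) :
    α ∈ multiIdx 1 ∨ ∃ i j, α = unitIdx i + unitIdx j := by
  by_cases h0 : ∃ i, α i ≠ 0
  · obtain ⟨i, hi⟩ := h0
    have hα : α = unitIdx i + (α - unitIdx i) := by
      funext j
      by_cases hj : j = i
      · subst hj; simp [unitIdx]; omega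
      · simp [unitIdx, hj]
    have hs : ∑ j, (α - unitIdx i) j ≤ 1 := by
      rw [mem_multiIdx, hα] at h
      simp only [Pi.add_apply, Finset.sum_add_distrib, sum_unitIdx] at h
      omega
    rcases mem_multiIdx_one (mem_multiIdx.2 hs) with h1 | ⟨j, h1⟩
    · left
      rw [hα, h1, add_zero]
      exact unitIdx_mem_multiIdx le_rfl i
    · right
      exact ⟨i, j, by rw [← h1]; exact hα⟩
  · push Not at h0
    left
    rw [funext h0]
    exact zero_mem_multiIdx 1

namespace CarlemanWeight

variable {B : Box} (w : CarlemanWeight B)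

lemma norm_le_norm_E (hψ : ∀ z ∈ Ioo (-B.ξ) B.d, 0 ≤ w.ψ z) {lam : ℝ} (hl : 0 ≤ lam) (f : L2 B) :
    ‖f‖ ≤ ‖w.E lam f‖ := by
  refine Lp.norm_le_norm_of_ae_le ?_
  filter_upwards [w.coeFn_E lam f, Box.ae_vol (p := fun x => x 2 ∈ Ioo (-B.ξ) B.d)
    fun x hx => hx.2.2] with x h1 h2
  rw [h1, norm_mul, Complex.norm_real, Real.norm_of_nonneg (w.e_pos lam _).le]
  exact le_mul_of_one_le_left (norm_nonneg _) (Real.one_le_exp (mul_nonneg hl (hψ _ h2)))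

lemma norm_E_le {T : ℝ} (hψ : ∀ z ∈ Ioo (-B.ξ) B.d, w.ψ z ≤ T) {lam : ℝ} (hl : 0 ≤ lam)
    (f : L2 B) : ‖w.E lam f‖ ≤ Real.exp (lam * T) * ‖f‖ := by
  refine Lp.norm_le_mul_norm_of_ae_le_mul ?_
  filter_upwards [w.coeFn_E lam f, Box.ae_vol (p := fun x => x 2 ∈ Ioo (-B.ξ) B.d)
    fun x hx => hx.2.2] with x h1 h2
  rw [h1, norm_mul, Complex.norm_real, Real.norm_of_nonneg (w.e_pos lam _).le]
  refine mul_le_mul_of_nonneg_right (Real.exp_le_exp.2 ?_) (norm_nonneg _)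
  exact mul_le_mul_of_nonneg_left (hψ _ h2) hl

lemma carleman_aux {lam a b c N : ℝ} (hl : 1 ≤ lam)
    (h : lam ^ 3 * a ^ 2 + lam * b ^ 2 + lam⁻¹ * c ^ 2 ≤ N) :
    a ^ 2 ≤ N ∧ b ^ 2 ≤ N ∧ lam⁻¹ * c ^ 2 ≤ N := by
  have h0 : a ^ 2 ≤ lam ^ 3 * a ^ 2 := le_mul_of_one_le_left (sq_nonneg _) (one_le_pow₀ hl)
  have h1 : b ^ 2 ≤ lam * b ^ 2 := le_mul_of_one_le_left (sq_nonneg _) hl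
  have h2 : 0 ≤ lam⁻¹ * c ^ 2 := by positivity
  refine ⟨?_, ?_, ?_⟩ <;> linarith [sq_nonneg a, sq_nonneg b]

/-- The Carleman estimate in terms of Sobolev norms. -/
lemma exists_norm_restr_le (hψ : ∀ z ∈ Ioo (-B.ξ) B.d, 0 ≤ w.ψ z) : ∃ C lam₀ : ℝ, 1 ≤ C ∧
    1 ≤ lam₀ ∧ ∀ lam : ℝ, lam₀ ≤ lam → ∀ u ∈ zeroData B 3,
      lam⁻¹ * ‖restr (show 2 ≤ 3 by norm_num) u‖ ^ 2 ≤ C * ‖w.E lam (lap u)‖ ^ 2 ∧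
      ‖restr (show 1 ≤ 3 by norm_num) u‖ ^ 2 ≤ C * ‖w.E lam (lap u)‖ ^ 2 := by
  obtain ⟨C, lam₀, hC1, hl0, hC⟩ := w.carleman
  have hcard : ∀ m, (1 : ℝ) ≤ (multiIdx m).card := fun m => by
    exact_mod_cast Finset.card_pos.2 ⟨0, zero_mem_multiIdx m⟩
  refine ⟨((multiIdx 1).card + (multiIdx 2).card) * C, lam₀, ?_, hl0, fun lam hl u hu => ?_⟩
  · nlinarith [hcard 1, hcard 2]
  have hl1 : 1 ≤ lam := hl0.trans hl
  have h := hC lam hl u hu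
  rw [← norm_gradE_sq, ← norm_hessE_sq] at h
  have hE : ∀ f : L2 B, ‖f‖ ^ 2 ≤ ‖w.E lam f‖ ^ 2 := fun f =>
    pow_le_pow_left₀ (norm_nonneg _) (w.norm_le_norm_E hψ (zero_le_one.trans hl1) f) 2
  obtain ⟨h0, h1, h2⟩ := carleman_aux hl1 h
  set N := C * ‖w.E lam (lap u)‖ ^ 2 with hN
  have hN0 : 0 ≤ N := by positivity
  have hone : ∀ α ∈ multiIdx 1, ‖D α u‖ ^ 2 ≤ N := by
    intro α hα
    rcases mem_multiIdx_one hα with rfl | ⟨i, rfl⟩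
    · exact (hE _).trans h0
    · exact (hE _).trans ((pow_le_pow_left₀ (norm_nonneg _) (w.norm_E_le_gradE lam u i) 2).trans h1)
  have htwo : ∀ α ∈ multiIdx 2, lam⁻¹ * ‖D α u‖ ^ 2 ≤ N := by
    intro α hα
    rcases mem_multiIdx_two hα with h3 | ⟨i, j, rfl⟩
    · exact (mul_le_of_le_one_left (by positivity) (inv_le_one_of_one_le₀ hl1)).trans (hone α h3)
    · exact (mul_le_mul_of_nonneg_left ((hE _).trans (pow_le_pow_left₀ (norm_nonneg _)
        (w.norm_E_le_hessE lam u i j) 2)) (by positivity)).trans h2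
  constructor
  · rw [norm_sq_Hm, Finset.mul_sum, add_mul, add_mul, mul_assoc, mul_assoc]
    have : ∑ α ∈ multiIdx 2, lam⁻¹ * ‖D α (restr (show 2 ≤ 3 by norm_num) u)‖ ^ 2 ≤
        (multiIdx 2).card • N := Finset.sum_le_card_nsmul _ _ _ fun α hα => by
      rw [D_restr _ u hα]; exact htwo α hα
    rw [nsmul_eq_mul] at this
    have : 0 ≤ ((multiIdx 1).card : ℝ) * N := by positivity
    linarith
  · rw [norm_sq_Hm, add_mul, add_mul, mul_assoc, mul_assoc]
    have : ∑ α ∈ multiIdx 1, ‖D α (restr (show 1 ≤ 3 by norm_num) u)‖ ^ 2 ≤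
        (multiIdx 1).card • N := Finset.sum_le_card_nsmul _ _ _ fun α hα => by
      rw [D_restr _ u hα]; exact hone α hα
    rw [nsmul_eq_mul] at this
    have : 0 ≤ ((multiIdx 2).card : ℝ) * N := by positivity
    linarith

end CarlemanWeight

lemma normHK_eq {B : Box} {m : ℕ} (h : m ≤ 3) {k₁ k₂ : ℝ} (p : HK0 B 3 k₁ k₂) :
    normHK h p = ‖(restrL B h).compLpL 2 (kVol k₁ k₂) (incr B k₁ k₂ p).1‖ := by
  rw [normHK, ← Real.sqrt_sq (norm_nonneg ((restrL B h).compLpL 2 (kVol k₁ k₂) _)),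
    norm_sq_eq_integral]
  congr 1
  refine integral_congr_ae ?_
  filter_upwards [(restrL B h).coeFn_compLpL (incr B k₁ k₂ p).1,
    CarlemanWeight.coeFn_incr p] with k h1 h2
  rw [h1, h2]
  rfl

namespace CarlemanWeight

variable {B : Box} (w : CarlemanWeight B)

lemma exists_normHK_le (hψ : ∀ z ∈ Ioo (-B.ξ) B.d, 0 ≤ w.ψ z) (k₁ k₂ : ℝ) :
    ∃ C lam₀ : ℝ, 1 ≤ C ∧ 1 ≤ lam₀ ∧ ∀ lam : ℝ, lam₀ ≤ lam → ∀ p : HK0 B 3 k₁ k₂,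
      lam⁻¹ * normHK (show 2 ≤ 3 by norm_num) p ^ 2 ≤
        C * ‖w.EK k₁ k₂ lam ((lapL B 3).compLpL 2 (kVol k₁ k₂) (incr B k₁ k₂ p).1)‖ ^ 2 ∧
      normHK (show 1 ≤ 3 by norm_num) p ^ 2 ≤
        C * ‖w.EK k₁ k₂ lam ((lapL B 3).compLpL 2 (kVol k₁ k₂) (incr B k₁ k₂ p).1)‖ ^ 2 := by
  obtain ⟨C, lam₀, hC1, hl0, hC⟩ := w.exists_norm_restr_le hψ
  refine ⟨C, lam₀, hC1, hl0, fun lam hl p => ?_⟩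
  rw [normHK_eq, normHK_eq]
  set f := (incr B k₁ k₂ p).1 with hf
  constructor
  · have key := norm_sq_le_of_ae (a := lam⁻¹) (b := 0) (c := 0) (d := C)
      ((restrL B (show 2 ≤ 3 by norm_num)).compLpL 2 (kVol k₁ k₂) f) f f
      (w.EK k₁ k₂ lam ((lapL B 3).compLpL 2 (kVol k₁ k₂) f)) ?_
    · simpa only [zero_mul, add_zero] using key
    filter_upwards [coeFn_incr p, (restrL B (show 2 ≤ 3 by norm_num)).coeFn_compLpL f,
      w.coeFn_EK lam ((lapL B 3).compLpL 2 (kVol k₁ k₂) f), (lapL B 3).coeFn_compLpL f]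
      with k h1 h2 h3 h4
    have hz : f k ∈ zeroData B 3 := by rw [hf, h1]; exact incl_mem _
    rw [h2, h3, h4, lapL_apply, zero_mul, add_zero, add_zero]
    exact (hC lam hl (f k) hz).1
  · have key := norm_sq_le_of_ae (a := 1) (b := 0) (c := 0) (d := C)
      ((restrL B (show 1 ≤ 3 by norm_num)).compLpL 2 (kVol k₁ k₂) f) f f
      (w.EK k₁ k₂ lam ((lapL B 3).compLpL 2 (kVol k₁ k₂) f)) ?_
    · simpa only [zero_mul, add_zero, one_mul] using key
    filter_upwards [coeFn_incr p, (restrL B (show 1 ≤ 3 by norm_num)).coeFn_compLpL f,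
      w.coeFn_EK lam ((lapL B 3).compLpL 2 (kVol k₁ k₂) f), (lapL B 3).coeFn_compLpL f]
      with k h1 h2 h3 h4
    have hz : f k ∈ zeroData B 3 := by rw [hf, h1]; exact incl_mem _
    rw [h2, h3, h4, lapL_apply, zero_mul, add_zero, add_zero, one_mul]
    exact (hC lam hl (f k) hz).2

end CarlemanWeight

/-- The absorption argument. Here $n$ is the weighted norm of $\Delta h$, $A$ that of the increment
of the quadratic map, $d$ that of their difference, and $x$ the cross term. Large $\lambda$ gives
$d^2\le n^2/8$, hence $A^2\ge3n^2/8$. The choice $\theta=32K_2C+1$ makes the second part of the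
bound of $x$ at most $n^2/32$, and then large $\lambda$ does so for the first part, hence $2|x|\le
n^2/8$. -/
lemma convexity_aux {C K₁ K₂ S lam γ η n A d x z h : ℝ} (hC : 1 ≤ C) (hK₁ : 0 ≤ K₁) (hK₂ : 0 ≤ K₂)
    (hz0 : 0 ≤ z) (hzS : z ≤ S) (hhS : h ≤ S) (hd0 : 0 ≤ d) (hγ : 0 ≤ γ)
    (hn : 0 ≤ n) (hlam : 1 ≤ lam)
    (hl1 : 8 * K₁ ^ 2 * (1 + 2 * S) ^ 2 * C ≤ lam)
    (hl2 : 32 * K₂ * (32 * K₂ * C + 1) * (1 + S) ^ 4 * C ≤ lam)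
    (hcarl : lam * γ ^ 2 + lam⁻¹ * η ^ 2 ≤ C * n ^ 2)
    (htri : n ≤ A + d) (hd : d ≤ K₁ * (1 + z + h) * γ)
    (hx : |x| ≤ K₂ * ((32 * K₂ * C + 1) * (1 + z) ^ 4 * γ ^ 2 +
      (32 * K₂ * C + 1)⁻¹ * (lam * γ ^ 2 + lam⁻¹ * η ^ 2))) :
    1 / 4 * n ^ 2 ≤ A ^ 2 + 2 * x := by
  have hl0 : 0 < lam := by linarith
  have hS : 0 ≤ S := hz0.trans hzS
  have hγ2 : lam * γ ^ 2 ≤ C * n ^ 2 := by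
    have : 0 ≤ lam⁻¹ * η ^ 2 := by positivity
    linarith
  have hd2 : d ^ 2 ≤ n ^ 2 / 8 := by
    have h1 : d ^ 2 ≤ K₁ ^ 2 * (1 + 2 * S) ^ 2 * γ ^ 2 := by
      calc d ^ 2 ≤ (K₁ * (1 + 2 * S) * γ) ^ 2 := by
            refine pow_le_pow_left₀ hd0 (hd.trans ?_) 2
            exact mul_le_mul_of_nonneg_right (mul_le_mul_of_nonneg_left (by linarith) hK₁) hγ
        _ = _ := by ring
    have h2 : 8 * C * d ^ 2 ≤ C * n ^ 2 := by
      calc 8 * C * d ^ 2 ≤ 8 * C * (K₁ ^ 2 * (1 + 2 * S) ^ 2 * γ ^ 2) := by gcongr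
        _ = 8 * K₁ ^ 2 * (1 + 2 * S) ^ 2 * C * γ ^ 2 := by ring
        _ ≤ lam * γ ^ 2 := by gcongr
        _ ≤ _ := hγ2
    have h3 : 8 * d ^ 2 ≤ n ^ 2 := by
      refine le_of_mul_le_mul_left ?_ (show 0 < C by linarith)
      linarith
    linarith
  set θ := 32 * K₂ * C + 1 with hθ
  have hθ0 : 0 < θ := by positivity
  have hx1 : K₂ * (θ * (1 + z) ^ 4 * γ ^ 2) ≤ n ^ 2 / 32 := by
    have h1 : 32 * C * (K₂ * (θ * (1 + z) ^ 4 * γ ^ 2)) ≤ C * n ^ 2 := by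
      calc 32 * C * (K₂ * (θ * (1 + z) ^ 4 * γ ^ 2)) ≤ 32 * C * (K₂ * (θ * (1 + S) ^ 4 * γ ^ 2)) := by
            gcongr
        _ = 32 * K₂ * θ * (1 + S) ^ 4 * C * γ ^ 2 := by ring
        _ ≤ lam * γ ^ 2 := by gcongr
        _ ≤ _ := hγ2
    have h3 : 32 * (K₂ * (θ * (1 + z) ^ 4 * γ ^ 2)) ≤ n ^ 2 := by
      refine le_of_mul_le_mul_left ?_ (show 0 < C by linarith)
      linarith
    linarith
  have hx2 : K₂ * (θ⁻¹ * (lam * γ ^ 2 + lam⁻¹ * η ^ 2)) ≤ n ^ 2 / 32 := by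
    calc K₂ * (θ⁻¹ * (lam * γ ^ 2 + lam⁻¹ * η ^ 2)) ≤ K₂ * (θ⁻¹ * (C * n ^ 2)) := by gcongr
      _ = (32 * K₂ * C) * θ⁻¹ * (n ^ 2 / 32) := by ring
      _ ≤ 1 * (n ^ 2 / 32) := by
          gcongr
          rw [mul_inv_le_iff₀ hθ0]
          linarith
      _ = _ := one_mul _
  have hx3 := (abs_le.1 hx).1
  have hn2 : n ^ 2 ≤ 2 * A ^ 2 + 2 * d ^ 2 := by
    calc n ^ 2 ≤ (A + d) ^ 2 := by gcongr
      _ ≤ _ := by nlinarith [sq_nonneg (A - d)]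
  rw [mul_add] at hx3
  linarith

lemma lower_aux {C lam a b n X : ℝ} (hC : 0 < C) (h : 1 / 4 * n ≤ X) (h1 : lam⁻¹ * a ≤ C * n)
    (h2 : b ≤ C * n) : 1 / (4 * C) / lam * a ≤ X ∧ 1 / (4 * C) * b ≤ X := by
  constructor
  · calc 1 / (4 * C) / lam * a = 1 / (4 * C) * (lam⁻¹ * a) := by ring
      _ ≤ 1 / (4 * C) * (C * n) := by gcongr
      _ = 1 / 4 * n := by field_simp
      _ ≤ X := h
  · calc 1 / (4 * C) * b ≤ 1 / (4 * C) * (C * n) := by gcongr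
      _ = 1 / 4 * n := by field_simp
      _ ≤ X := h

namespace CarlemanWeight

variable {B : Box} (w : CarlemanWeight B)

/-- The second variation of the functional is bounded from below. -/
lemma exists_convexity (hψ : ∀ z ∈ Ioo (-B.ξ) B.d, 0 ≤ w.ψ z) (k₁ k₂ : ℝ) :
    ∃ (c : ℝ) (lam₁ : ℝ → ℝ), 0 < c ∧ (∀ S, 1 ≤ lam₁ S) ∧ ∀ S lam : ℝ, lam₁ S ≤ lam →
      ∀ z : HK B 3 k₁ k₂ × Hm B 3, ‖z‖ ≤ S → ∀ p : HK0 B 3 k₁ k₂, ‖incr B k₁ k₂ p‖ ≤ S →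
      c / lam * normHK (show 2 ≤ 3 by norm_num) p ^ 2 ≤
        ‖w.EK k₁ k₂ lam ((opQ B k₁ k₂).der z (incr B k₁ k₂ p)) +
          w.EK k₁ k₂ lam ((opQ B k₁ k₂).N (incr B k₁ k₂ p) (incr B k₁ k₂ p))‖ ^ 2 +
        2 * inner ℝ (w.EK k₁ k₂ lam ((opQ B k₁ k₂).val z))
          (w.EK k₁ k₂ lam ((opQ B k₁ k₂).N (incr B k₁ k₂ p) (incr B k₁ k₂ p))) ∧
      c * normHK (show 1 ≤ 3 by norm_num) p ^ 2 ≤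
        ‖w.EK k₁ k₂ lam ((opQ B k₁ k₂).der z (incr B k₁ k₂ p)) +
          w.EK k₁ k₂ lam ((opQ B k₁ k₂).N (incr B k₁ k₂ p) (incr B k₁ k₂ p))‖ ^ 2 +
        2 * inner ℝ (w.EK k₁ k₂ lam ((opQ B k₁ k₂).val z))
          (w.EK k₁ k₂ lam ((opQ B k₁ k₂).N (incr B k₁ k₂ p) (incr B k₁ k₂ p))) := by
  refine (w.exists_norm_EK_der_sub_le k₁ k₂).elim fun K₁ hK₁ => ?_
  refine (w.exists_abs_inner_EK_opQ_le k₁ k₂).elim fun K₂ hK₂ => ?_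
  refine (w.exists_gradN_incr_le k₁ k₂).elim fun C hC' => hC'.elim fun lam₀ hC => ?_
  refine (w.exists_normHK_le hψ k₁ k₂).elim fun C' hC'' => hC''.elim fun lam₀' hC' => ?_
  have hC0 : 0 < C := zero_lt_one.trans_le hC.1
  have hC0' : 0 < C' := zero_lt_one.trans_le hC'.1
  -- The threshold combines those of the two forms of the Carleman estimate and the two absorptions
  -- in `convexity_aux`. It depends on the size $S$ of the points, while the constant of convexity
  -- does not.
  refine ⟨1 / (4 * C'), fun S => max (max lam₀ lam₀') (max (8 * K₁ ^ 2 * (1 + 2 * S) ^ 2 * C)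
    (32 * K₂ * (32 * K₂ * C + 1) * (1 + S) ^ 4 * C)), by positivity,
    fun S => le_max_of_le_left (le_max_of_le_left hC.2.1), fun S lam hlam z hz p hp => ?_⟩
  have hl1 : lam₀ ≤ lam := (le_max_of_le_left (le_max_left _ _)).trans hlam
  have hl2 : lam₀' ≤ lam := (le_max_of_le_left (le_max_right _ _)).trans hlam
  have hl3 := (le_max_of_le_right (le_max_left _ _)).trans hlam
  have hl4 := (le_max_of_le_right (le_max_right _ _)).trans hlam
  have hlam1 : 1 ≤ lam := hC.2.1.trans hl1
  have hθ : 0 < 32 * K₂ * C + 1 := add_pos_of_nonneg_of_pos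
    (mul_nonneg (mul_nonneg (by norm_num) hK₂.1) hC0.le) one_pos
  have key := convexity_aux hC.1 hK₁.1 hK₂.1 (norm_nonneg z) hz hp (norm_nonneg _)
    (w.gradN_nonneg k₁ k₂ lam (incr B k₁ k₂ p)) (norm_nonneg _) hlam1 hl3 hl4
    (hC.2.2 lam hl1 p) (norm_le_norm_add_norm_sub _ _) (hK₁.2 lam z (incr B k₁ k₂ p))
    (hK₂.2 lam hlam1 _ hθ z (incr B k₁ k₂ p))
  have hn := hC'.2.2 lam hl2 p
  exact lower_aux hC0' key hn.1 hn.2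

end CarlemanWeight

end

section

/-! ### The tail function -/

/-- This is the purpose of $\lambda(\delta)$: the weight $e^{\lambda\psi}$ is at most
$\delta^{-1/2}$, so errors of size $\delta$ have weighted size at most $\sqrt\delta$. -/
lemma exp_lamOf_mul {B : Box} {s ν δ : ℝ} (hs : B.ξ < s) (hν : 1 ≤ ν) (hδ : 0 < δ) :
    Real.exp (lamOf B s ν δ * tNu B s ν) = (√δ)⁻¹ := by
  have hT := (tNu_pos B hs hν).ne'
  have e : lamOf B s ν δ * tNu B s ν = -Real.log (√δ) := by
    rw [lamOf, Real.log_rpow hδ, Real.log_sqrt hδ.le]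
    field_simp
  rw [e, Real.exp_neg, Real.exp_log (Real.sqrt_pos.2 hδ)]

lemma lt_lamOf {B : Box} {s ν δ lam : ℝ} (hs : B.ξ < s) (hν : 1 ≤ ν) (hδ : 0 < δ)
    (h : δ < Real.exp (-2 * lam * tNu B s ν)) : lam < lamOf B s ν δ := by
  have hT := tNu_pos B hs hν
  have h1 := (Real.log_lt_iff_lt_exp hδ).2 h
  rw [lamOf, Real.log_rpow hδ, div_mul_eq_mul_div, lt_div_iff₀ (by positivity)]
  linarith

lemma lamOf_pos {B : Box} {s ν δ : ℝ} (hs : B.ξ < s) (hν : 1 ≤ ν) (hδ : 0 < δ) (hδ1 : δ < 1) :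
    0 < lamOf B s ν δ := by
  refine lt_lamOf hs hν hδ ?_
  simpa using hδ1

lemma hasBoundaryData_iff_sub_mem {B : Box} {m : ℕ} {Q W : Hm B m} {g₀ g₁ : E3 → ℂ}
    (hQ : HasBoundaryData Q g₀ g₁) : HasBoundaryData W g₀ g₁ ↔ W - Q ∈ zeroData B m := by
  have hz : W - Q ∈ zeroData B m ↔ HasBoundaryData (W - Q) 0 0 := Iff.rfl
  rw [hz, hasBoundaryData_zero_iff]
  obtain ⟨q0, q1, q2, q3⟩ := hQ
  have hp : ∀ φ ψ : E3 → ℝ, IsTest φ → IsTest ψ → ∀ f g f' g' : L2 B,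
      pair φ (f - f') + pair ψ (g - g') = (pair φ f + pair ψ g) - (pair φ f' + pair ψ g') := by
    intro φ ψ hφ hψ f g f' g'
    obtain ⟨S, hS⟩ := hφ.pair_clm (B := B)
    obtain ⟨T, hT⟩ := hψ.pair_clm (B := B)
    simp only [← hS, ← hT, map_sub]
    ring
  simp only [map_sub]
  constructor
  · rintro ⟨-, -, w2, w3⟩
    refine ⟨fun φ hφ i => ?_, fun φ hφ hd => ?_⟩
    · rw [hp _ _ (hφ.pd i) hφ, w2 φ hφ i, q2 φ hφ i, sub_self]
    · rw [hp _ _ (hφ.pd 2) hφ, w3 φ hφ hd, q3 φ hφ hd, sub_self]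
  · rintro ⟨w2, w3⟩
    refine ⟨q0, q1, fun φ hφ i => ?_, fun φ hφ hd => ?_⟩
    · have := w2 φ hφ i
      rw [hp _ _ (hφ.pd i) hφ, sub_eq_zero] at this
      rw [this, q2 φ hφ i]
    · have := w3 φ hφ hd
      rw [hp _ _ (hφ.pd 2) hφ, sub_eq_zero] at this
      rw [this, q3 φ hφ hd]

lemma tailI_eq {B : Box} {s ν : ℝ} (hs : B.ξ < s) {w : CarlemanWeight B} (hw : w.ψ = expFn B s ν)
    (μ α : ℝ) (V : Hm B 3) : tailI B s ν μ α V = ‖w.E μ (lap V)‖ ^ 2 + α * ‖V‖ ^ 2 := by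
  rw [tailI, norm_sq_eq_integral (w.E μ (lap V)), ← integral_const_mul]
  congr 1
  refine integral_congr_ae ?_
  filter_upwards [w.coeFn_E μ (lap V),
    Box.ae_vol (p := fun x => x 2 ∈ Ioo (-B.ξ) B.d) fun x hx => hx.2.2] with x h4 h5
  rw [h4, norm_mul, mul_pow, mul_left_comm, exp_mul_cwf hs μ h5, ← hw,
    Complex.norm_real, Real.norm_of_nonneg (w.e_pos μ _).le, mul_comm]
  rfl

/-- The tail function exists and is unique. -/
lemma existsUnique_isTail {B : Box} {s ν : ℝ} (hs : B.ξ < s) (hν : 1 ≤ ν) {δ : ℝ} (hδ : 0 < δ)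
    {ψ₀ ψ₁ : E3 → ℂ} {Q : Hm B 3} (hQ : HasBoundaryData Q ψ₀ ψ₁) :
    ∃! V, IsTail B s ν δ ψ₀ ψ₁ V := by
  obtain ⟨w, hw⟩ := exists_weight B hs hν
  have hset : {W | HasBoundaryData W ψ₀ ψ₁} = (fun W => W - Q) ⁻¹' (zeroData B 3 : Set (Hm B 3)) :=
    ext fun W => hasBoundaryData_iff_sub_mem hQ
  have hmain := existsUnique_isMinimizer (K := {W | HasBoundaryData W ψ₀ ψ₁})
    (f := tailI B s ν (lamOf B s ν δ) δ) ?_ ⟨Q, hQ⟩ ?_ ?_ ?_ (c := δ / 4) (by positivity) ?_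
  · exact hmain
  · rw [hset]
    exact (zeroData.isClosed B 3).preimage (by fun_prop)
  · rw [hset]
    intro x hx y hy a b _ _ hab
    have e : a • x + b • y - Q = a • (x - Q) + b • (y - Q) := by
      have hQ1 : Q = a • Q + b • Q := by rw [← add_smul, hab, one_smul]
      conv_lhs => rw [hQ1]
      rw [smul_sub, smul_sub]
      abel
    rw [mem_preimage, e]
    exact (zeroData B 3).add_mem ((zeroData B 3).smul_mem _ hx) ((zeroData B 3).smul_mem _ hy)
  · have e : tailI B s ν (lamOf B s ν δ) δ = fun V =>
        ‖w.E (lamOf B s ν δ) (lapL B 3 V)‖ ^ 2 + δ * ‖V‖ ^ 2 :=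
      funext fun V => by rw [tailI_eq hs hw, lapL_apply]
    rw [e]
    fun_prop
  · intro V
    rw [tailI_eq hs hw]
    positivity
  · intro x _ y _
    rw [tailI_eq hs hw, tailI_eq hs hw, tailI_eq hs hw, ← lapL_apply, ← lapL_apply, ← lapL_apply]
    -- The parallelogram law makes the regularizing term uniformly convex at midpoints with constant
    -- $\delta/4$.
    have hpar : ∀ {G : Type} [NormedAddCommGroup G] [InnerProductSpace ℝ G] (a b : G),
        ‖(1 / 2 : ℝ) • a + (1 / 2 : ℝ) • b‖ ^ 2 + 1 / 4 * ‖a - b‖ ^ 2 = (‖a‖ ^ 2 + ‖b‖ ^ 2) / 2 := by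
      intro G _ _ a b
      rw [← smul_add, norm_smul, mul_pow, norm_add_sq_real, norm_sub_sq_real]
      norm_num
      ring
    have h1 := hpar (w.E (lamOf B s ν δ) (lapL B 3 x)) (w.E (lamOf B s ν δ) (lapL B 3 y))
    have h2 := hpar x y
    rw [map_add, map_smul, map_smul, map_add, map_smul, map_smul]
    nlinarith [sq_nonneg ‖w.E (lamOf B s ν δ) (lapL B 3 x) - w.E (lamOf B s ν δ) (lapL B 3 y)‖]

/-- Each of the three components is at most $e^{\lambda T}\|u\|$, and $\sqrt3\le2$. -/
lemma CarlemanWeight.norm_gradE_le {B : Box} (w : CarlemanWeight B) {T : ℝ}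
    (hψ : ∀ z ∈ Ioo (-B.ξ) B.d, w.ψ z ≤ T) {lam : ℝ} (hl : 0 ≤ lam) (u : Hm B 3) :
    ‖w.gradE lam u‖ ≤ 2 * Real.exp (lam * T) * ‖u‖ := by
  refine le_of_sq_le_sq ?_ (by positivity)
  rw [w.norm_gradE_sq, Fin.sum_univ_three]
  have h : ∀ i, ‖w.E lam (D (unitIdx i) u)‖ ^ 2 ≤ (Real.exp (lam * T) * ‖u‖) ^ 2 := fun i => by
    refine pow_le_pow_left₀ (norm_nonneg _) ((w.norm_E_le hψ hl _).trans ?_) 2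
    exact mul_le_mul_of_nonneg_left (norm_D_le _ u) (Real.exp_pos _).le
  nlinarith [h 0, h 1, h 2, sq_nonneg (Real.exp (lam * T) * ‖u‖)]

/-- The value of the tail functional at the competitor is of order $\delta$. Minimality therefore
bounds $\|V\|$ uniformly in $\delta$ and the weighted Laplacian by a multiple of $\sqrt\delta$. -/
lemma tail_aux {δ L v n A q W : ℝ} (hδ : 0 < δ) (hL : 0 ≤ L) (hv : 0 ≤ v)
    (hq0 : 0 ≤ q) (hq : q ≤ L * √δ) (hW0 : 0 ≤ W) (hW : W ≤ v + 1)
    (h : A ^ 2 + δ * n ^ 2 ≤ q ^ 2 + δ * W ^ 2) :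
    n ≤ (L + 1) * (1 + v) ∧ A + q ≤ 2 * (L + 1) * √δ * (1 + v) := by
  have hs : √δ ^ 2 = δ := Real.sq_sqrt hδ.le
  have hs0 : 0 < √δ := Real.sqrt_pos.2 hδ
  have h1 : q ^ 2 ≤ L ^ 2 * δ := by rw [← hs, ← mul_pow]; gcongr
  have h2 : W ^ 2 ≤ (1 + v) ^ 2 := by gcongr; linarith
  have h3 : L ^ 2 + (1 + v) ^ 2 ≤ ((L + 1) * (1 + v)) ^ 2 := by
    have e : ((L + 1) * (1 + v)) ^ 2 = (1 + v) ^ 2 + L ^ 2 * (1 + v) ^ 2 + 2 * L * (1 + v) ^ 2 := by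
      ring
    have : L ^ 2 * 1 ≤ L ^ 2 * (1 + v) ^ 2 := by gcongr; nlinarith
    have : 0 ≤ 2 * L * (1 + v) ^ 2 := by positivity
    linarith
  have h4 : A ^ 2 + δ * n ^ 2 ≤ δ * ((L + 1) * (1 + v)) ^ 2 := by nlinarith
  have hn2 : n ^ 2 ≤ ((L + 1) * (1 + v)) ^ 2 := by
    refine le_of_mul_le_mul_left ?_ hδ
    nlinarith [sq_nonneg A]
  have hA2 : A ^ 2 ≤ (√δ * ((L + 1) * (1 + v))) ^ 2 := by
    rw [mul_pow, hs]
    have : 0 ≤ δ * n ^ 2 := by positivity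
    linarith
  have hn3 := le_of_sq_le_sq hn2 (by positivity)
  have hA3 := le_of_sq_le_sq hA2 (by positivity)
  refine ⟨hn3, ?_⟩
  have : L * √δ ≤ √δ * ((L + 1) * (1 + v)) := by
    have : 0 ≤ √δ * (L * v + 1 + v) := by positivity
    nlinarith
  nlinarith

lemma tail_sum_aux {C₁ C₂ L v σ : ℝ} (hC₁ : 0 ≤ C₁) (hC₂ : 0 ≤ C₂) (hL : 0 ≤ L) (hv : 0 ≤ v)
    (hσ : 0 ≤ σ) : C₁ * (2 * (L + 1) * σ * (1 + v)) + 2 * σ ≤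
      ((C₁ + C₂) * (2 * (L + 1)) + 2) * (1 + v) * σ := by
  have h1 : 0 ≤ C₂ * (2 * (L + 1) * σ * (1 + v)) := by positivity
  have h2 : 0 ≤ σ * v := by positivity
  have h3 : 0 ≤ C₁ * (2 * (L + 1) * σ * (1 + v)) := by positivity
  linarith

/-- Bounds of the tail function in terms of the exact one. -/
lemma exists_tail_bounds {B : Box} {s ν : ℝ} (hs : B.ξ < s) (hν : 1 ≤ ν) {w : CarlemanWeight B}
    (hw : w.ψ = expFn B s ν) : ∃ C lam₀ : ℝ, 1 ≤ C ∧ 1 ≤ lam₀ ∧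
      ∀ (ψ₀s ψ₁s : E3 → ℂ) (Qs Vs : Hm B 3), HasBoundaryData Qs ψ₀s ψ₁s →
      IsExactTail ψ₀s ψ₁s Vs → ∀ δ : ℝ, 0 < δ → δ < 1 → ∀ (ψ₀ ψ₁ : E3 → ℂ) (Q : Hm B 3),
      HasBoundaryData Q ψ₀ ψ₁ → ‖Q - Qs‖ < δ → ∀ V, IsTail B s ν δ ψ₀ ψ₁ V →
      ‖V‖ ≤ C * (1 + ‖Vs‖) ∧ (lam₀ ≤ lamOf B s ν δ →
        ‖w.gradE (lamOf B s ν δ) (V - Vs)‖ ≤ C * (1 + ‖Vs‖) * √δ ∧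
        ‖restr (show 2 ≤ 3 by norm_num) (V - Vs)‖ ≤
          C * (1 + ‖Vs‖) * √δ * √(lamOf B s ν δ)) := by
  have hψ0 : ∀ z ∈ Ioo (-B.ξ) B.d, 0 ≤ w.ψ z := fun z hz => by
    rw [hw]; exact (expFn_mem hs hν hz).1
  have hψ1 : ∀ z ∈ Ioo (-B.ξ) B.d, w.ψ z ≤ tNu B s ν := fun z hz => by
    rw [hw]; exact (expFn_mem hs hν hz).2
  obtain ⟨C₁, l₁, hC₁, hl₁, h₁⟩ := w.carleman
  obtain ⟨C₂, l₂, hC₂, hl₂, h₂⟩ := w.exists_norm_restr_le hψ0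
  obtain ⟨L, hL0, hL⟩ := exists_bound (lapL B 3)
  refine ⟨(C₁ + C₂) * (2 * (L + 1)) + 2, max l₁ l₂, ?_, hl₁.trans (le_max_left _ _), ?_⟩
  · have : 0 ≤ (C₁ + C₂) * (2 * (L + 1)) := by positivity
    linarith
  intro ψ₀s ψ₁s Qs Vs hQs hVs δ hδ hδ1 ψ₀ ψ₁ Q hQ hQQ V hV
  set lam := lamOf B s ν δ with hlam
  have hlam0 : 0 < lam := lamOf_pos hs hν hδ hδ1
  have hsq : √δ * √δ = δ := Real.mul_self_sqrt hδ.le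
  have hsq0 : 0 < √δ := Real.sqrt_pos.2 hδ
  have hexp : Real.exp (lam * tNu B s ν) * δ = √δ := by
    rw [hlam, exp_lamOf_mul hs hν hδ]
    nth_rewrite 2 [← hsq]
    field_simp
  -- The competitor: it has the noisy boundary data, and $\Delta W=\Delta(Q-Q_*)$ is small because
  -- $V_*$ is harmonic.
  set W := Vs + (Q - Qs) with hWd
  have hW : HasBoundaryData W ψ₀ ψ₁ := by
    rw [hasBoundaryData_iff_sub_mem hQ]
    have e : W - Q = Vs - Qs := by rw [hWd]; abel
    rw [e]
    exact (hasBoundaryData_iff_sub_mem hQs).1 hVs.1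
  have hlapV : lapL B 3 Vs = 0 := by
    rw [lapL_apply]
    refine Lp.ext ?_
    filter_upwards [hVs.2, Lp.coeFn_zero ℂ 2 B.vol] with x h1 h2
    rw [h1, h2]; rfl
  have hlapW : lapL B 3 W = lapL B 3 (Q - Qs) := by rw [hWd, map_add, hlapV, zero_add]
  have hEle : ‖w.E lam (lapL B 3 (Q - Qs))‖ ≤ L * √δ := by
    calc _ ≤ Real.exp (lam * tNu B s ν) * ‖lapL B 3 (Q - Qs)‖ := w.norm_E_le hψ1 hlam0.le _
      _ ≤ Real.exp (lam * tNu B s ν) * (L * δ) := by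
          refine mul_le_mul_of_nonneg_left ((hL _).trans ?_) (Real.exp_pos _).le
          exact mul_le_mul_of_nonneg_left hQQ.le hL0
      _ = L * (Real.exp (lam * tNu B s ν) * δ) := by ring
      _ = _ := by rw [hexp]
  have hWn : ‖W‖ ≤ ‖Vs‖ + 1 := (norm_add_le _ _).trans (by gcongr; exact (hQQ.trans hδ1).le)
  have hmin : tailI B s ν lam δ V ≤ tailI B s ν lam δ W := hV.2 hW
  rw [tailI_eq hs hw, tailI_eq hs hw, ← lapL_apply, ← lapL_apply, hlapW] at hmin
  obtain ⟨a1, a2⟩ := tail_aux hδ hL0 (norm_nonneg Vs)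
    (norm_nonneg _) hEle (norm_nonneg W) hWn hmin
  have hV0 : 0 ≤ 1 + ‖Vs‖ := by positivity
  refine ⟨a1.trans ?_, fun hl => ?_⟩
  · refine mul_le_mul_of_nonneg_right ?_ hV0
    have : 0 ≤ (C₁ + C₂ - 1) * (2 * (L + 1)) := mul_nonneg (by linarith) (by positivity)
    nlinarith
  -- The boundary data of $V$ and $W$ coincide, so the Carleman estimate applies to their
  -- difference, while $W-V_*=Q-Q_*$ is small by assumption.
  have hVW : V - W ∈ zeroData B 3 := by
    have h1 := (hasBoundaryData_iff_sub_mem hQ).1 hV.1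
    have h2 := (hasBoundaryData_iff_sub_mem hQ).1 hW
    have e : V - W = (V - Q) - (W - Q) := by abel
    rw [e]
    exact (zeroData B 3).sub_mem h1 h2
  have hN : ‖w.E lam (lap (V - W))‖ ≤ 2 * (L + 1) * √δ * (1 + ‖Vs‖) := by
    rw [← lapL_apply, map_sub, map_sub, hlapW]
    exact (norm_sub_le _ _).trans a2
  have hl1 : 1 ≤ lam := hl₁.trans ((le_max_left _ _).trans hl)
  have hX0 : 0 ≤ 2 * (L + 1) * √δ * (1 + ‖Vs‖) := by positivity
  have e3 : V - Vs = (V - W) + (Q - Qs) := by rw [hWd]; abel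
  have h5 := h₁ lam ((le_max_left _ _).trans hl) _ hVW
  rw [← w.norm_gradE_sq, ← w.norm_hessE_sq] at h5
  have h6 := (CarlemanWeight.carleman_aux hl1 h5).2.1
  have h7 := (h₂ lam ((le_max_right _ _).trans hl) _ hVW).1
  constructor
  · rw [e3, map_add]
    have h8 : ‖w.gradE lam (V - W)‖ ≤ C₁ * (2 * (L + 1) * √δ * (1 + ‖Vs‖)) := by
      refine le_of_sq_le_sq (h6.trans ?_) (by positivity)
      rw [mul_pow]
      exact mul_le_mul (le_self_pow₀ hC₁ two_ne_zero) (pow_le_pow_left₀ (norm_nonneg _) hN 2)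
        (by positivity) (by positivity)
    have h9 : ‖w.gradE lam (Q - Qs)‖ ≤ 2 * √δ := by
      refine (w.norm_gradE_le hψ1 hlam0.le _).trans ?_
      rw [mul_assoc, ← hexp]
      exact mul_le_mul_of_nonneg_left (mul_le_mul_of_nonneg_left hQQ.le (Real.exp_pos _).le)
        zero_le_two
    refine (norm_add_le _ _).trans ((add_le_add h8 h9).trans ?_)
    exact tail_sum_aux (by positivity) (by linarith) hL0 (norm_nonneg Vs) hsq0.le
  · have hsl : 1 ≤ √lam := Real.one_le_sqrt.2 hl1
    have hsl2 : √lam ^ 2 = lam := Real.sq_sqrt hlam0.le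
    -- Second derivatives enter the Carleman estimate with the factor $\lambda^{-1}$, which costs
    -- $\sqrt\lambda$ here.
    have h8 : ‖restr (show 2 ≤ 3 by norm_num) (V - W)‖ ≤
        C₂ * (2 * (L + 1) * √δ * (1 + ‖Vs‖)) * √lam := by
      refine le_of_sq_le_sq ?_ (by positivity)
      rw [mul_pow, hsl2, mul_pow]
      rw [inv_mul_le_iff₀ hlam0, mul_comm lam] at h7
      refine h7.trans (mul_le_mul_of_nonneg_right ?_ hlam0.le)
      exact mul_le_mul (le_self_pow₀ hC₂ two_ne_zero) (pow_le_pow_left₀ (norm_nonneg _) hN 2)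
        (by positivity) (by positivity)
    have h9 : ‖restr (show 2 ≤ 3 by norm_num) (Q - Qs)‖ ≤ √δ * √lam := by
      refine (norm_restr_le _ _).trans (hQQ.le.trans ?_)
      have : √δ ≤ 1 := Real.sqrt_le_one.2 hδ1.le
      calc δ = √δ * √δ := hsq.symm
        _ ≤ √δ * √lam := by gcongr; linarith
    have e4 : restr (show 2 ≤ 3 by norm_num) (V - Vs) =
        restr (show 2 ≤ 3 by norm_num) (V - W) + restr (show 2 ≤ 3 by norm_num) (Q - Qs) := by
      rw [e3]
      exact map_add (restrL B (show 2 ≤ 3 by norm_num)) _ _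
    rw [e4]
    refine (norm_add_le _ _).trans ((add_le_add h8 h9).trans ?_)
    have h10 := tail_sum_aux (C₁ := C₂) (C₂ := C₁) (L := L) (by positivity) (by linarith) hL0
      (norm_nonneg Vs) (show 0 ≤ √δ * √lam by positivity)
    rw [add_comm C₁ C₂]
    refine le_trans ?_ (h10.trans (le_of_eq (by ring)))
    have : 0 ≤ √δ * √lam := by positivity
    linarith

end

section

/-! ### The functional near the exact solution -/

/-- $N(z,z)-N(z',z')=N(z-z',z)+N(z',z-z')$: every term contains the difference once, and the weight
can be placed on it. -/
lemma QuadMap.val_eq_add {X Y : Type*} [NormedAddCommGroup X] [NormedSpace ℝ X]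
    [NormedAddCommGroup Y] [NormedSpace ℝ Y] (Q : QuadMap X Y) (z z' : X) :
    Q.val z = Q.val z' + (Q.A (z - z') + Q.N (z - z') z + Q.N z' (z - z')) := by
  simp only [val, map_sub, sub_apply]
  abel

lemma QuadMap.val_eq_of_val_eq_zero {X Y : Type*} [NormedAddCommGroup X] [NormedSpace ℝ X]
    [NormedAddCommGroup Y] [NormedSpace ℝ Y] (Q : QuadMap X Y) {z z' : X} (h : Q.val z' = 0)
    {a b : Y} (hA : Q.A (z - z') = a + b) :
    Q.val z = a + b + Q.N (z - z') z + Q.N z' (z - z') := by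
  rw [Q.val_eq_add z z', h, hA, zero_add]

lemma norm_incr_le {B : Box} {k₁ k₂ : ℝ} (p : HK0 B 3 k₁ k₂) : ‖incr B k₁ k₂ p‖ ≤ ‖p‖ := by
  have e : incr B k₁ k₂ p = ((incr B k₁ k₂ p).1, 0) := rfl
  rw [e, Prod.norm_def, norm_zero]
  refine max_le (Lp.norm_le_norm_of_ae_le ?_) (norm_nonneg _)
  filter_upwards [CarlemanWeight.coeFn_incr p] with k h1
  rw [h1]
  exact le_rfl

lemma norm_compLpL_restrL_le {B : Box} {k₁ k₂ : ℝ} {m n : ℕ} (h : m ≤ n) (f : HK B n k₁ k₂) :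
    ‖(restrL B h).compLpL 2 (kVol k₁ k₂) f‖ ≤ ‖f‖ := by
  refine Lp.norm_le_norm_of_ae_le ?_
  filter_upwards [(restrL B h).coeFn_compLpL f] with k h1
  rw [h1]
  exact norm_restr_le h _

lemma norm_dataPt_le {B : Box} {k₁ k₂ : ℝ} (F : HK B 4 k₁ k₂) (V : Hm B 3) :
    ‖dataPt F V‖ ≤ ‖F‖ + ‖V‖ := by
  rw [dataPt, Prod.norm_def]
  refine max_le ((norm_compLpL_restrL_le _ F).trans ?_) ?_
  · exact le_add_of_nonneg_right (norm_nonneg _)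
  · exact le_add_of_nonneg_left (norm_nonneg _)

lemma norm_point_le {B : Box} {k₁ k₂ : ℝ} (p : HK0 B 3 k₁ k₂) (F : HK B 4 k₁ k₂) (V : Hm B 3) :
    ‖incr B k₁ k₂ p + dataPt F V‖ ≤ ‖p‖ + ‖F‖ + ‖V‖ := by
  refine (norm_add_le _ _).trans ((add_le_add (norm_incr_le p) (norm_dataPt_le F V)).trans ?_)
  rw [add_assoc]

set_option maxHeartbeats 1000000 in
/-- Strict convexity of the functional. -/
lemma CarlemanWeight.exists_lsq_convexity {B : Box} (w : CarlemanWeight B)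
    (hψ : ∀ z ∈ Ioo (-B.ξ) B.d, 0 ≤ w.ψ z) (k₁ k₂ : ℝ) :
    ∃ (c : ℝ) (lam₁ : ℝ → ℝ), 0 < c ∧ (∀ S, 1 ≤ lam₁ S) ∧ ∀ S lam ρ : ℝ, lam₁ S ≤ lam →
      ∀ (V : Hm B 3) (F : HK B 4 k₁ k₂) (p₁ p₂ : HK0 B 3 k₁ k₂), ‖p₁‖ + ‖F‖ + ‖V‖ ≤ S →
      ‖p₂ - p₁‖ ≤ S →
      c / lam * normHK (show 2 ≤ 3 by norm_num) (p₂ - p₁) ^ 2 + ρ * ‖p₂ - p₁‖ ^ 2 ≤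
        (weightedQ w k₁ k₂ lam V F).lsq ρ p₂ - (weightedQ w k₁ k₂ lam V F).lsq ρ p₁ -
          (weightedQ w k₁ k₂ lam V F).lsqDer ρ p₁ (p₂ - p₁) ∧
      c * normHK (show 1 ≤ 3 by norm_num) (p₂ - p₁) ^ 2 + ρ * ‖p₂ - p₁‖ ^ 2 ≤
        (weightedQ w k₁ k₂ lam V F).lsq ρ p₂ - (weightedQ w k₁ k₂ lam V F).lsq ρ p₁ -
          (weightedQ w k₁ k₂ lam V F).lsqDer ρ p₁ (p₂ - p₁) := by
  refine (w.exists_convexity hψ k₁ k₂).elim fun c h' => h'.elim fun lam₁ h => ?_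
  refine ⟨c, lam₁, h.1, h.2.1, fun S lam ρ hl V F p₁ p₂ h1 h2 => ?_⟩
  have key := h.2.2 S lam hl (incr B k₁ k₂ p₁ + dataPt F V) ((norm_point_le p₁ F V).trans h1)
    (p₂ - p₁) ((norm_incr_le _).trans h2)
  have e := (weightedQ w k₁ k₂ lam V F).lsq_add ρ p₁ (p₂ - p₁)
  rw [add_sub_cancel] at e
  rw [e]
  have e1 : (weightedQ w k₁ k₂ lam V F).der p₁ (p₂ - p₁) = w.EK k₁ k₂ lam
      ((opQ B k₁ k₂).der (incr B k₁ k₂ p₁ + dataPt F V) (incr B k₁ k₂ (p₂ - p₁))) :=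
    QuadMap.der_pull _ _ _ _ _ _
  have e2 : (weightedQ w k₁ k₂ lam V F).val p₁ = w.EK k₁ k₂ lam
      ((opQ B k₁ k₂).val (incr B k₁ k₂ p₁ + dataPt F V)) :=
    QuadMap.val_pull _ _ _ _ _
  have e3 : (weightedQ w k₁ k₂ lam V F).N (p₂ - p₁) (p₂ - p₁) = w.EK k₁ k₂ lam
      ((opQ B k₁ k₂).N (incr B k₁ k₂ (p₂ - p₁)) (incr B k₁ k₂ (p₂ - p₁))) := rfl
  rw [e1, e2, e3]
  exact ⟨add_le_add_left key.1 _, add_le_add_left key.2 _⟩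

lemma opQ_val_eq_zero {B : Box} {k₁ k₂ : ℝ} {V : Hm B 3} {F : HK B 4 k₁ k₂} {p : HK0 B 3 k₁ k₂}
    (h : ∀ᵐ k ∂kVol k₁ k₂, ∀ᵐ x ∂B.vol, opL k₂ V (addF p F) k x = 0) :
    (opQ B k₁ k₂).val (incr B k₁ k₂ p + dataPt F V) = 0 := by
  refine Lp.ext ?_
  filter_upwards [h, opL_ae _ (addF_ae p F V), Lp.coeFn_zero (L2 B) 2 (kVol k₁ k₂)] with k h1 h2 h3
  rw [h3]
  refine Lp.ext ?_
  have e2 : (incr B k₁ k₂ p + dataPt F V).2 = V := zero_add V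
  rw [e2] at h2
  filter_upwards [h1, h2, Lp.coeFn_zero ℂ 2 B.vol] with x h4 h5 h6
  rw [h5, h4, Pi.zero_apply, h6, Pi.zero_apply]

namespace CarlemanWeight

variable {B : Box} (w : CarlemanWeight B)

lemma gradN_le {T : ℝ} (hψ : ∀ z ∈ Ioo (-B.ξ) B.d, w.ψ z ≤ T) {lam : ℝ} (hl : 0 ≤ lam)
    {k₁ k₂ : ℝ} (z : HK B 3 k₁ k₂ × Hm B 3) :
    w.gradN k₁ k₂ lam z ≤ 2 * Real.exp (lam * T) * ‖z.1‖ + ‖w.gradE lam z.2‖ := by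
  rw [gradN, compPair_apply, Prod.norm_def]
  have h : ‖(w.gradE lam).compLpL 2 (kVol k₁ k₂) z.1‖ ≤ 2 * Real.exp (lam * T) * ‖z.1‖ := by
    refine Lp.norm_le_mul_norm_of_ae_le_mul ?_
    filter_upwards [(w.gradE lam).coeFn_compLpL z.1] with k h1
    rw [h1]
    exact w.norm_gradE_le hψ hl _
  refine max_le (h.trans ?_) ?_
  · exact le_add_of_nonneg_right (norm_nonneg _)
  · exact le_add_of_nonneg_left (by positivity)

lemma norm_EK_le {T : ℝ} (hψ : ∀ z ∈ Ioo (-B.ξ) B.d, w.ψ z ≤ T) {lam : ℝ} (hl : 0 ≤ lam)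
    {k₁ k₂ : ℝ} (f : Lp (L2 B) 2 (kVol k₁ k₂)) :
    ‖w.EK k₁ k₂ lam f‖ ≤ Real.exp (lam * T) * ‖f‖ := by
  refine Lp.norm_le_mul_norm_of_ae_le_mul ?_
  filter_upwards [w.coeFn_EK lam f] with k h1
  rw [h1]
  exact w.norm_E_le hψ hl _

lemma norm_add₄_le_aux {X : Type*} [NormedAddCommGroup X] {l a b c : X} {K x y g : ℝ}
    (ha : ‖a‖ ≤ K * g) (hb : ‖b‖ ≤ K * g * x) (hc : ‖c‖ ≤ K * y * g) :
    ‖l + a + b + c‖ ≤ ‖l‖ + K * (1 + x + y) * g := by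
  have h1 := norm_add_le (l + a + b) c
  have h2 := norm_add₃_le (a := l) (b := a) (c := b)
  linarith

/-- Continuity of the quadratic map in the weighted norms. -/
lemma exists_norm_EK_val_le (k₁ k₂ : ℝ) : ∃ K : ℝ, 0 ≤ K ∧ ∀ (lam : ℝ)
    (z z' : HK B 3 k₁ k₂ × Hm B 3), (opQ B k₁ k₂).val z' = 0 →
    ‖w.EK k₁ k₂ lam ((opQ B k₁ k₂).val z)‖ ≤
      ‖w.EK k₁ k₂ lam ((lapL B 3).compLpL 2 (kVol k₁ k₂) (z - z').1)‖ +
      K * (1 + ‖z‖ + ‖z'‖) * w.gradN k₁ k₂ lam (z - z') := by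
  refine (w.exists_norm_EK_opQ_le k₁ k₂).elim fun K hK => ?_
  refine ⟨K, hK.1, fun lam z z' hz' => ?_⟩
  have e : (opQ B k₁ k₂).val z = (lapL B 3).compLpL 2 (kVol k₁ k₂) (z - z').1 +
      (dzI B).compLpL 2 (kVol k₁ k₂) (kqv (Hm B 3) k₁ k₂ (z - z')) +
      (opQ B k₁ k₂).N (z - z') z + (opQ B k₁ k₂).N z' (z - z') :=
    (opQ B k₁ k₂).val_eq_of_val_eq_zero hz' (opQ_A (z - z'))
  have e' := (congrArg (w.EK k₁ k₂ lam) e).trans (map_add₄ (w.EK k₁ k₂ lam) _ _ _ _)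
  refine (congrArg norm e').le.trans ?_
  exact norm_add₄_le_aux (hK.2 lam (z - z') z).1 (hK.2 lam (z - z') z).2.2
    (hK.2 lam z' (z - z')).2.1

end CarlemanWeight

end

/-! ### The functional at the exact solution and the reconstructed coefficient. -/

section

/-- With $\sigma=\sqrt\delta$ the weighted residual is of order $\sigma$ and its square of order
$\sigma^2\le\sigma$. The regularizing term $\sigma\|p_*\|^2$ accounts for the order $\sqrt\delta$ of
the sum. -/
lemma lsq_value_aux {L K T σ δ l g e γ z z' n : ℝ} (hL : 0 ≤ L) (hK : 0 ≤ K) (hT : 0 ≤ T)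
    (hσ : 0 ≤ σ) (hσ1 : σ ≤ 1) (he : e * δ = σ) (he0 : 0 ≤ e) {f : ℝ}
    (hf : f ≤ δ)
    (hl : l ≤ e * (L * f)) (hγ : γ ≤ 2 * e * f + g) (hg : g ≤ T * σ) (hγ0 : 0 ≤ γ)
    (hz : z ≤ T + T + T)
    (hz' : z' ≤ T + T + T) (hn0 : 0 ≤ n) (hn : n ≤ l + K * (1 + z + z') * γ) {p : ℝ} (hp0 : 0 ≤ p)
    (hp : p ≤ T) :
    n ^ 2 + σ * p ^ 2 ≤ ((L + K * (1 + 6 * T) * (2 + T)) ^ 2 + T ^ 2) * σ := by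
  have h1 : e * f ≤ σ := by rw [← he]; gcongr
  have h2 : l ≤ L * σ := by nlinarith
  have h3 : γ ≤ (2 + T) * σ := by linarith
  have h4 : n ≤ (L + K * (1 + 6 * T) * (2 + T)) * σ := by
    calc n ≤ l + K * (1 + z + z') * γ := hn
      _ ≤ L * σ + K * (1 + 6 * T) * ((2 + T) * σ) := by
          refine add_le_add h2 (mul_le_mul ?_ h3 hγ0 (by positivity))
          exact mul_le_mul_of_nonneg_left (by linarith) hK
      _ = _ := by ring
  calc n ^ 2 + σ * p ^ 2 ≤ ((L + K * (1 + 6 * T) * (2 + T)) * σ) ^ 2 + σ * T ^ 2 := by gcongr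
    _ = (L + K * (1 + 6 * T) * (2 + T)) ^ 2 * (σ * σ) + T ^ 2 * σ := by ring
    _ ≤ (L + K * (1 + 6 * T) * (2 + T)) ^ 2 * σ + T ^ 2 * σ := by
        gcongr
        exact mul_le_of_le_one_left hσ hσ1
    _ = _ := by ring

/-- The functional is small at the exact solution. -/
lemma CarlemanWeight.exists_lsq_exact_le {B : Box} {s ν : ℝ} (hs : B.ξ < s) (hν : 1 ≤ ν)
    {w : CarlemanWeight B} (hw : w.ψ = expFn B s ν) (k₁ k₂ : ℝ) :
    ∃ M : ℝ → ℝ, (∀ T, 0 ≤ M T) ∧ ∀ T δ : ℝ, 0 < δ → δ < 1 → ∀ (V Vs : Hm B 3)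
      (F Fs : HK B 4 k₁ k₂) (ps : HK0 B 3 k₁ k₂), ‖V‖ ≤ T → ‖Vs‖ ≤ T → ‖F‖ ≤ T → ‖Fs‖ ≤ T →
      ‖ps‖ ≤ T → ‖F - Fs‖ ≤ δ → ‖w.gradE (lamOf B s ν δ) (V - Vs)‖ ≤ T * √δ →
      (opQ B k₁ k₂).val (incr B k₁ k₂ ps + dataPt Fs Vs) = 0 →
      (weightedQ w k₁ k₂ (lamOf B s ν δ) V F).lsq (√δ) ps ≤ M T * √δ := by
  have hψ1 : ∀ z ∈ Ioo (-B.ξ) B.d, w.ψ z ≤ tNu B s ν := fun z hz => by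
    rw [hw]; exact (expFn_mem hs hν hz).2
  obtain ⟨L, hL0, hL⟩ := exists_bound ((lapL B 3).compLpL 2 (kVol k₁ k₂))
  refine (w.exists_norm_EK_val_le k₁ k₂).elim fun K hK => ?_
  refine ⟨fun T => (L + K * (1 + 6 * T) * (2 + T)) ^ 2 + T ^ 2, fun T => by positivity,
    fun T δ hδ hδ1 V Vs F Fs ps hV hVs hF hFs hps hFF hG h0 => ?_⟩
  have hlam0 : 0 < lamOf B s ν δ := lamOf_pos hs hν hδ hδ1
  -- The exact solution cancels in the difference, which consists of the data errors $F-F_*$ and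
  -- $V-V_*$ only.
  have hd : incr B k₁ k₂ ps + dataPt F V - (incr B k₁ k₂ ps + dataPt Fs Vs) =
      ((restrL B (show 3 ≤ 4 by norm_num)).compLpL 2 (kVol k₁ k₂) (F - Fs), V - Vs) := by
    rw [add_sub_add_left_eq_sub, dataPt, dataPt, Prod.mk_sub_mk, ← map_sub]
  have hn := hK.2 (lamOf B s ν δ) (incr B k₁ k₂ ps + dataPt F V) (incr B k₁ k₂ ps + dataPt Fs Vs) h0
  rw [hd] at hn
  set f := (restrL B (show 3 ≤ 4 by norm_num)).compLpL 2 (kVol k₁ k₂) (F - Fs) with hf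
  have hfn : ‖f‖ ≤ δ := (norm_compLpL_restrL_le _ _).trans hFF
  have e2 : (weightedQ w k₁ k₂ (lamOf B s ν δ) V F).val ps = w.EK k₁ k₂ (lamOf B s ν δ)
      ((opQ B k₁ k₂).val (incr B k₁ k₂ ps + dataPt F V)) :=
    QuadMap.val_pull _ _ _ _ _
  have hl : ‖w.EK k₁ k₂ (lamOf B s ν δ) ((lapL B 3).compLpL 2 (kVol k₁ k₂) f)‖ ≤
      Real.exp (lamOf B s ν δ * tNu B s ν) * (L * ‖f‖) :=
    (w.norm_EK_le hψ1 hlam0.le _).trans (mul_le_mul_of_nonneg_left (hL f) (Real.exp_pos _).le)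
  have hg := w.gradN_le hψ1 hlam0.le (k₁ := k₁) (k₂ := k₂) (f, V - Vs)
  have hsq : √δ ^ 2 = δ := Real.sq_sqrt hδ.le
  have hexp : Real.exp (lamOf B s ν δ * tNu B s ν) * δ = √δ := by
    rw [exp_lamOf_mul hs hν hδ, ← div_eq_inv_mul, Real.div_sqrt]
  rw [QuadMap.lsq, e2]
  exact lsq_value_aux hL0 hK.1 ((norm_nonneg V).trans hV) (Real.sqrt_nonneg δ)
    (Real.sqrt_le_one.2 hδ1.le) hexp (Real.exp_pos _).le hfn hl hg hG
    (w.gradN_nonneg _ _ _ _) ((norm_point_le ps F V).trans (add_le_add_three hps hF hV))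
    ((norm_point_le ps Fs Vs).trans (add_le_add_three hps hFs hVs)) (norm_nonneg _) hn
    (norm_nonneg _) hps

/-! ### The reconstructed coefficient -/

/-- The function `Δv + k² (∇v)² + 2 i k v_z`. -/
def coefL {B : Box} (k : ℝ) (v : Hm B 3) : L2 B := lap v + k ^ 2 • gdot B v v + k • dzI B v

/-- The function `v(k)` that belongs to `p + F` and `V`. -/
def vAt {B : Box} {k₁ k₂ : ℝ} (z : HK B 3 k₁ k₂ × Hm B 3) (k : ℝ) : Hm B 3 :=
  z.2 - ∫ κ in k..k₂, z.1 κ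

lemma coeff_ae {B : Box} {k₁ k₂ : ℝ} (p : HK0 B 3 k₁ k₂) (F : HK B 4 k₁ k₂) (V : Hm B 3) {k : ℝ}
    (hk : k ∈ Icc k₁ k₂) : coeff k₂ V (addF p F) k =ᵐ[B.vol]
      fun x => 1 - coefL k (vAt (incr B k₁ k₂ p + dataPt F V) k) x := by
  have e2 : (incr B k₁ k₂ p + dataPt F V).2 = V := zero_add V
  have hD : ∀ α, Dv k₂ V (addF p F) α k = D α (vAt (incr B k₁ k₂ p + dataPt F V) k) := fun α => by
    rw [vAt, e2]
    exact Dv_eq (addF_ae p F V) V α hk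
  set v := vAt (incr B k₁ k₂ p + dataPt F V) k with hv
  have hl : lap v = D (2 • unitIdx 0) v + D (2 • unitIdx 1) v + D (2 • unitIdx 2) v := by
    rw [lap, Fin.sum_univ_three]
  filter_upwards [Lp.coeFn_add (lap v + k ^ 2 • gdot B v v) (k • dzI B v),
    Lp.coeFn_add (lap v) (k ^ 2 • gdot B v v), Lp.coeFn_smul (k ^ 2) (gdot B v v),
    Lp.coeFn_smul k (dzI B v), coeFn_gdot v v, coeFn_dzI v,
    Lp.coeFn_add (D (2 • unitIdx 0) v + D (2 • unitIdx 1) v) (D (2 • unitIdx 2) v),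
    Lp.coeFn_add (D (2 • unitIdx 0) v) (D (2 • unitIdx 1) v)] with x h1 h2 h3 h4 h5 h6 h7 h8
  rw [coefL, h1, Pi.add_apply, h2, Pi.add_apply, h3, Pi.smul_apply, h4, Pi.smul_apply, h5, h6, hl,
    h7, Pi.add_apply, h8, Pi.add_apply, coeff]
  simp only [Fin.sum_univ_three, hD, Complex.real_smul]
  push_cast
  ring

namespace CarlemanWeight

variable {B : Box} (w : CarlemanWeight B)

/-- At $\lambda=0$ the weight is 1, so the weighted estimates of products also serve as unweighted
ones. -/
lemma norm_gradE_zero_le {T : ℝ} (hψ1 : ∀ z ∈ Ioo (-B.ξ) B.d, w.ψ z ≤ T) (u : Hm B 3) :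
    ‖w.gradE 0 u‖ ≤ 2 * ‖restr (show 2 ≤ 3 by norm_num) u‖ := by
  refine le_of_sq_le_sq ?_ (by positivity)
  rw [w.norm_gradE_sq, Fin.sum_univ_three]
  have h : ∀ i, ‖w.E 0 (D (unitIdx i) u)‖ ^ 2 ≤ ‖restr (show 2 ≤ 3 by norm_num) u‖ ^ 2 := fun i => by
    have h1 := w.norm_E_le hψ1 le_rfl (D (unitIdx i) u)
    rw [zero_mul, Real.exp_zero, one_mul, ← D_restr (show 2 ≤ 3 by norm_num) u
      (unitIdx_mem_multiIdx (by norm_num) i)] at h1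
    rw [← D_restr (show 2 ≤ 3 by norm_num) u (unitIdx_mem_multiIdx (by norm_num) i)]
    exact pow_le_pow_left₀ (norm_nonneg _) (h1.trans (norm_D_le _ _)) 2
  nlinarith [h 0, h 1, h 2, sq_nonneg ‖restr (show 2 ≤ 3 by norm_num) u‖]

/-- Continuity of the coefficient with respect to `v`. -/
lemma exists_norm_coefL_sub_le {T : ℝ} (hψ0 : ∀ z ∈ Ioo (-B.ξ) B.d, 0 ≤ w.ψ z)
    (hψ1 : ∀ z ∈ Ioo (-B.ξ) B.d, w.ψ z ≤ T) {k₁ k₂ : ℝ} (hk₁ : 0 < k₁) : ∃ C : ℝ, 0 ≤ C ∧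
      ∀ k ∈ Icc k₁ k₂, ∀ u v : Hm B 3, ‖coefL k u - coefL k v‖ ≤
        C * (1 + ‖u‖ + ‖v‖) * ‖restr (show 2 ≤ 3 by norm_num) (u - v)‖ := by
  obtain ⟨C, hC0, hC⟩ := w.exists_norm_E_gdot_le
  refine ⟨3 + 4 * |k₂| + 2 * C * k₂ ^ 2, by positivity, fun k hk u v => ?_⟩
  set r := ‖restr (show 2 ≤ 3 by norm_num) (u - v)‖ with hr
  have hr0 : 0 ≤ r := norm_nonneg _
  have hE := w.norm_le_norm_E hψ0 (le_refl (0 : ℝ))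
  have hg := w.norm_gradE_zero_le hψ1 (u - v)
  have h1 : ‖lap (u - v)‖ ≤ 3 * r := by
    have hi : ∀ i, ‖D (2 • unitIdx i) (u - v)‖ ≤ r := fun i => by
      have hm : 2 • unitIdx i ∈ multiIdx 2 := by rw [two_smul]; exact unitIdx_add_mem i i
      rw [← D_restr (show 2 ≤ 3 by norm_num) (u - v) hm]
      exact norm_D_le _ _
    rw [lap, Fin.sum_univ_three]
    refine norm_add₃_le.trans ?_
    linarith [hi 0, hi 1, hi 2]
  have h2 : ‖dzI B (u - v)‖ ≤ 4 * r :=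
    (hE _).trans ((w.norm_E_dzI_le 0 _).trans (by linarith))
  have h3 : ∀ y : Hm B 3, ‖gdot B y (u - v)‖ ≤ C * ‖y‖ * (2 * r) := fun y =>
    (hE _).trans ((hC 0 y (u - v)).trans (mul_le_mul_of_nonneg_left hg (by positivity)))
  -- By symmetry of the product of gradients, $(\nabla u)^2-(\nabla v)^2=\nabla
  -- u\cdot\nabla(u-v)+\nabla v\cdot\nabla(u-v)$.
  have e : coefL k u - coefL k v = lap (u - v) + k ^ 2 • (gdot B u (u - v) + gdot B v (u - v)) +
      k • dzI B (u - v) := by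
    rw [← lapL_apply, coefL, coefL, ← lapL_apply, ← lapL_apply, map_sub, map_sub, map_sub, map_sub,
      gdot_comm v u, smul_sub]
    module
  have hk0 : 0 ≤ k := hk₁.le.trans hk.1
  have hkk : k ≤ |k₂| := hk.2.trans (le_abs_self _)
  have hk2 : k ^ 2 ≤ k₂ ^ 2 := pow_le_pow_left₀ hk0 hk.2 2
  rw [e]
  refine norm_add₃_le.trans ?_
  rw [norm_smul, norm_smul, Real.norm_of_nonneg hk0, Real.norm_of_nonneg (sq_nonneg k)]
  have h4 : k * ‖dzI B (u - v)‖ ≤ |k₂| * (4 * r) := by gcongr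
  have h5 : k ^ 2 * ‖gdot B u (u - v) + gdot B v (u - v)‖ ≤
      k₂ ^ 2 * (C * ‖u‖ * (2 * r) + C * ‖v‖ * (2 * r)) := by
    refine mul_le_mul hk2 ((norm_add_le _ _).trans (add_le_add (h3 u) (h3 v))) (norm_nonneg _)
      (by positivity)
  have h6 : 0 ≤ (3 + 4 * |k₂|) * (‖u‖ + ‖v‖) * r := by positivity
  have h7 : 0 ≤ 2 * C * k₂ ^ 2 * r := by positivity
  nlinarith

end CarlemanWeight

lemma norm_vAt_le {B : Box} {k₁ k₂ : ℝ} (p : HK0 B 3 k₁ k₂) (F : HK B 4 k₁ k₂) (V : Hm B 3) {k : ℝ}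
    (hk : k ∈ Icc k₁ k₂) : ‖vAt (incr B k₁ k₂ p + dataPt F V) k‖ ≤
      (1 + √(k₂ - k₁)) * (‖p‖ + ‖F‖ + ‖V‖) := by
  set z := incr B k₁ k₂ p + dataPt F V
  have hz : ‖z‖ ≤ ‖p‖ + ‖F‖ + ‖V‖ := norm_point_le p F V
  refine (norm_sub_le _ _).trans ?_
  have h1 := norm_tail_le z.1 hk
  have h2 : √(k₂ - k₁) * ‖z.1‖ ≤ √(k₂ - k₁) * (‖p‖ + ‖F‖ + ‖V‖) :=
    mul_le_mul_of_nonneg_left ((norm_fst_le z).trans hz) (Real.sqrt_nonneg _)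
  have h3 := (norm_snd_le z).trans hz
  linarith

/-- Only the $H_2$ norm of $p-p'$ enters, so the rate for $p$ carries over to $v$ at each single
wavenumber. -/
lemma norm_restr_vAt_sub_le {B : Box} {k₁ k₂ : ℝ} (p p' : HK0 B 3 k₁ k₂) (F F' : HK B 4 k₁ k₂)
    (V V' : Hm B 3) {k : ℝ} (hk : k ∈ Icc k₁ k₂) :
    ‖restr (show 2 ≤ 3 by norm_num) (vAt (incr B k₁ k₂ p + dataPt F V) k -
      vAt (incr B k₁ k₂ p' + dataPt F' V') k)‖ ≤ ‖restr (show 2 ≤ 3 by norm_num) (V - V')‖ +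
        √(k₂ - k₁) * (normHK (show 2 ≤ 3 by norm_num) (p - p') + ‖F - F'‖) := by
  set z := incr B k₁ k₂ p + dataPt F V with hz
  set z' := incr B k₁ k₂ p' + dataPt F' V' with hz'
  have e1 : vAt z k - vAt z' k = (V - V') - ∫ κ in k..k₂, (z.1 - z'.1 : HK B 3 k₁ k₂) κ := by
    have a1 : z.2 = V := zero_add V
    have a2 : z'.2 = V' := zero_add V'
    rw [tail_sub _ _ hk, vAt, vAt, a1, a2]
    abel
  have e2 : z.1 - z'.1 = (incr B k₁ k₂ (p - p')).1 +
      (restrL B (show 3 ≤ 4 by norm_num)).compLpL 2 (kVol k₁ k₂) (F - F') := by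
    rw [map_sub, map_sub, Prod.fst_sub]
    exact add_sub_add_comm _ _ _ _
  have e3 : restr (show 2 ≤ 3 by norm_num) (vAt z k - vAt z' k) =
      restr (show 2 ≤ 3 by norm_num) (V - V') - ∫ κ in k..k₂,
        (restrL B (show 2 ≤ 3 by norm_num)).compLpL 2 (kVol k₁ k₂) (z.1 - z'.1) κ := by
    rw [comp_tail _ _ hk, e1]
    exact map_sub (restrL B (show 2 ≤ 3 by norm_num)) _ _
  rw [e3]
  refine (norm_sub_le _ _).trans (add_le_add le_rfl ((norm_tail_le _ hk).trans
    (mul_le_mul_of_nonneg_left ?_ (Real.sqrt_nonneg _))))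
  rw [e2, map_add, normHK_eq]
  exact (norm_add_le _ _).trans (add_le_add le_rfl
    ((norm_compLpL_restrL_le _ _).trans (norm_compLpL_restrL_le _ _)))

/-- Continuity of the reconstructed coefficient. -/
lemma CarlemanWeight.exists_eLpNorm_coeff_sub_le {B : Box} (w : CarlemanWeight B) {T₀ : ℝ}
    (hψ0 : ∀ z ∈ Ioo (-B.ξ) B.d, 0 ≤ w.ψ z) (hψ1 : ∀ z ∈ Ioo (-B.ξ) B.d, w.ψ z ≤ T₀) {k₁ k₂ : ℝ}
    (hk₁ : 0 < k₁) : ∃ C : ℝ, 0 ≤ C ∧ ∀ T : ℝ, ∀ (p ps : HK0 B 3 k₁ k₂) (F Fs : HK B 4 k₁ k₂)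
      (V Vs : Hm B 3), ‖p‖ ≤ T → ‖ps‖ ≤ T → ‖F‖ ≤ T → ‖Fs‖ ≤ T → ‖V‖ ≤ T → ‖Vs‖ ≤ T →
      ∀ cs : E3 → ℂ, (∀ k ∈ Icc k₁ k₂, ∀ᵐ x ∂B.vol, cs x = coeff k₂ Vs (addF ps Fs) k x) →
      ∀ k ∈ Icc k₁ k₂, eLpNorm (fun x => cs x - coeff k₂ V (addF p F) k x) 2 B.vol ≤
        ENNReal.ofReal (C * (1 + T) * (‖restr (show 2 ≤ 3 by norm_num) (V - Vs)‖ +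
          normHK (show 2 ≤ 3 by norm_num) (ps - p) + ‖F - Fs‖)) := by
  obtain ⟨C, hC0, hC⟩ := w.exists_norm_coefL_sub_le hψ0 hψ1 (k₂ := k₂) hk₁
  set σ := √(k₂ - k₁) with hσ
  have hσ0 : 0 ≤ σ := Real.sqrt_nonneg _
  refine ⟨C * (6 * (1 + σ)) * (1 + σ), by positivity,
    fun T p ps F Fs V Vs h1 h2 h3 h4 h5 h6 cs hcs k hk => ?_⟩
  have hT : 0 ≤ T := (norm_nonneg p).trans h1
  set u := vAt (incr B k₁ k₂ p + dataPt F V) k with hu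
  set us := vAt (incr B k₁ k₂ ps + dataPt Fs Vs) k with hus
  have hae : (fun x => cs x - coeff k₂ V (addF p F) k x) =ᵐ[B.vol]
      (coefL k u - coefL k us : L2 B) := by
    filter_upwards [hcs k hk, coeff_ae p F V hk, coeff_ae ps Fs Vs hk,
      Lp.coeFn_sub (coefL k u) (coefL k us)] with x a1 a2 a3 a4
    rw [a1, a2, a3, a4, Pi.sub_apply]
    ring
  rw [eLpNorm_congr_ae hae, ← ENNReal.ofReal_toReal (Lp.eLpNorm_ne_top _), ← Lp.norm_def]
  refine ENNReal.ofReal_le_ofReal ((hC k hk u us).trans ?_)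
  have b1 : ‖u‖ ≤ (1 + σ) * (3 * T) :=
    (norm_vAt_le p F V hk).trans (mul_le_mul_of_nonneg_left (by linarith) (by positivity))
  have b2 : ‖us‖ ≤ (1 + σ) * (3 * T) :=
    (norm_vAt_le ps Fs Vs hk).trans (mul_le_mul_of_nonneg_left (by linarith) (by positivity))
  have b3 := norm_restr_vAt_sub_le p ps F Fs V Vs hk
  have b4 : normHK (show 2 ≤ 3 by norm_num) (p - ps) =
      normHK (show 2 ≤ 3 by norm_num) (ps - p) := by
    rw [normHK_eq, normHK_eq, ← neg_sub ps p, map_neg, Prod.fst_neg, map_neg, norm_neg]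
  rw [b4] at b3
  have c1 : 0 ≤ ‖restr (show 2 ≤ 3 by norm_num) (V - Vs)‖ := norm_nonneg _
  have c2 : 0 ≤ normHK (show 2 ≤ 3 by norm_num) (ps - p) := Real.sqrt_nonneg _
  have c3 : 0 ≤ ‖F - Fs‖ := norm_nonneg _
  have c4 : 1 + ‖u‖ + ‖us‖ ≤ 6 * (1 + σ) * (1 + T) := by nlinarith
  calc _ ≤ C * (6 * (1 + σ) * (1 + T)) * ((1 + σ) * (‖restr (show 2 ≤ 3 by norm_num) (V - Vs)‖ +
          normHK (show 2 ≤ 3 by norm_num) (ps - p) + ‖F - Fs‖)) := by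
        refine mul_le_mul (mul_le_mul_of_nonneg_left c4 hC0) (b3.trans ?_) (norm_nonneg _)
          (by positivity)
        nlinarith
    _ = _ := by ring

end

section

/-! ### The gradient projection method for least squares functionals -/

namespace QuadMap

section

variable {X Y X' Y' : Type*} [NormedAddCommGroup X] [NormedSpace ℝ X] [NormedAddCommGroup Y]
  [NormedSpace ℝ Y] [NormedAddCommGroup X'] [NormedSpace ℝ X'] [NormedAddCommGroup Y']
  [NormedSpace ℝ Y'] (Q : QuadMap X Y)

/-- These crude bounds serve only to estimate the Lipschitz constant of the gradient, hence the
admissible step size; the growth of $e$ as $\delta\to0$ does not affect the rates in $\delta$. -/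
lemma norm_pull_le {S : Y →L[ℝ] Y'} {T : X' →L[ℝ] X} {z : X} {e M Z : ℝ} (he : 0 ≤ e)
    (hS : ∀ y, ‖S y‖ ≤ e * ‖y‖) (hT : ∀ x, ‖T x‖ ≤ ‖x‖) (hz : ‖z‖ ≤ Z) (hc : ‖Q.c‖ ≤ M)
    (hA : ‖Q.A‖ ≤ M) (hN : ‖Q.N‖ ≤ M) :
    ‖(Q.pull S T z).c‖ ≤ e * (M * (1 + Z) ^ 2) ∧ ‖(Q.pull S T z).A‖ ≤ e * (M * (1 + Z) ^ 2) ∧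
      ‖(Q.pull S T z).N‖ ≤ e * (M * (1 + Z) ^ 2) := by
  have hM : 0 ≤ M := (norm_nonneg _).trans hc
  have hZ : 0 ≤ Z := (norm_nonneg _).trans hz
  have hMZ : 0 ≤ M * Z := by positivity
  have hMZ2 : 0 ≤ M * Z ^ 2 := by positivity
  refine ⟨(hS _).trans ?_, ContinuousLinearMap.opNorm_le_bound _ (by positivity) fun x => ?_,
    ContinuousLinearMap.opNorm_le_bound _ (by positivity) fun x =>
      ContinuousLinearMap.opNorm_le_bound _ (by positivity) fun y => ?_⟩
  · refine mul_le_mul_of_nonneg_left ?_ he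
    have h1 : ‖Q.A z‖ ≤ M * Z := (Q.A.le_of_opNorm_le hA z).trans (by gcongr)
    have h2 : ‖Q.N z z‖ ≤ M * Z * Z := (Q.N.le_opNorm₂ z z).trans (by gcongr)
    refine (norm_add₃_le).trans ?_
    nlinarith
  · refine (hS _).trans ?_
    rw [mul_assoc]
    refine mul_le_mul_of_nonneg_left ?_ he
    refine (Q.norm_der_le hA hN hz (T x)).trans ?_
    refine mul_le_mul ?_ (hT x) (norm_nonneg _) (by positivity)
    nlinarith
  · have e1 : (Q.pull S T z).N x y = S (Q.N (T x) (T y)) := rfl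
    rw [e1]
    refine (hS _).trans ?_
    rw [mul_assoc, mul_assoc]
    refine mul_le_mul_of_nonneg_left ?_ he
    refine (Q.N.le_opNorm₂ _ _).trans ?_
    rw [← mul_assoc]
    refine mul_le_mul (mul_le_mul ?_ (hT x) (norm_nonneg _) (by positivity)) (hT y)
      (norm_nonneg _) (by positivity)
    nlinarith

end

variable {X Y : Type*} [NormedAddCommGroup X] [InnerProductSpace ℝ X]
  [NormedAddCommGroup Y] [InnerProductSpace ℝ Y] (Q : QuadMap X Y)

lemma lsq_nonneg {ρ : ℝ} (hρ : 0 ≤ ρ) (p : X) : 0 ≤ Q.lsq ρ p := by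
  rw [lsq]; positivity

lemma differentiable_lsq (ρ : ℝ) : Differentiable ℝ (Q.lsq ρ) := fun p =>
  (Q.hasFDerivAt_lsq ρ p).differentiableAt

variable [CompleteSpace X] {ρ : ℝ} {K : Set X}

lemma inner_gradient_lsq (p h : X) : inner ℝ (∇ (Q.lsq ρ) p) h = Q.lsqDer ρ p h :=
  inner_gradient_eq (Q.hasFDerivAt_lsq ρ p) h

/-- A strongly convex least squares functional has exactly one minimizer. -/
lemma existsUnique_isMinimizer_lsq (hρ : 0 < ρ) (hK : IsClosed K) (hne : K.Nonempty)
    (hconv : Convex ℝ K)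
    (h : ∀ p ∈ K, ∀ q ∈ K, ρ * ‖q - p‖ ^ 2 ≤ Q.lsq ρ q - Q.lsq ρ p - Q.lsqDer ρ p (q - p)) :
    ∃! p, IsMinimizer (Q.lsq ρ) K p := by
  refine existsUnique_isMinimizer hK hne hconv (Q.differentiable_lsq ρ).continuous
    (Q.lsq_nonneg hρ.le) (c := ρ / 4) (by positivity) fun x hx y hy => ?_
  set m := (1 / 2 : ℝ) • x + (1 / 2 : ℝ) • y with hm
  have hmK : m ∈ K := hconv hx hy (by norm_num) (by norm_num) (by norm_num)
  have ex : x - m = (1 / 2 : ℝ) • (x - y) := by rw [hm]; module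
  have ey : y - m = -((1 / 2 : ℝ) • (x - y)) := by rw [hm]; module
  -- Convexity is used from the midpoint towards both ends. The linear terms cancel in the sum, and
  -- each end lies at distance $\|x-y\|/2$.
  have h1 := h m hmK x hx
  have h2 := h m hmK y hy
  rw [ex, norm_smul] at h1
  rw [ey, norm_neg, norm_smul, map_neg] at h2
  have e : ‖(1 / 2 : ℝ)‖ = 1 / 2 := by norm_num
  rw [e] at h1 h2
  linarith

/-- Linear convergence of the gradient projection method. -/
lemma norm_sub_le_pow_mul (hρ : 0 < ρ) {R a ω r : ℝ} (hr : 0 ≤ r) (hω : 0 < ω)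
    (h : ∀ p ∈ Metric.closedBall (0 : X) R, ∀ q ∈ Metric.closedBall (0 : X) R,
      ρ * ‖q - p‖ ^ 2 ≤ Q.lsq ρ q - Q.lsq ρ p - Q.lsqDer ρ p (q - p))
    (hc : ‖Q.c‖ ≤ a) (hA : ‖Q.A‖ ≤ a) (hN : ‖Q.N‖ ≤ a)
    (hωL : ω * (2 * (a * (1 + 2 * R)) ^ 2 + 4 * a ^ 2 * (1 + R + R ^ 2) + 2 * ρ) ^ 2 ≤ 2 * ρ)
    (hωr : 1 - 2 * ω * ρ ≤ r ^ 2) {m : X} (hm : IsMinimizer (Q.lsq ρ) (Metric.closedBall 0 R) m)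
    {p : ℕ → X} (h0 : ‖p 0‖ ≤ R)
    (hp : ∀ n, IsProj (Metric.closedBall 0 R) (p n - ω • ∇ (Q.lsq ρ) (p n)) (p (n + 1))) (n : ℕ) :
    p n ∈ Metric.closedBall (0 : X) R ∧ ‖m - p n‖ ≤ r ^ n * ‖m - p 0‖ := by
  have hmem : ∀ n, p n ∈ Metric.closedBall (0 : X) R := fun n => by
    cases n with
    | zero => simpa using h0
    | succ n => exact (hp n).1
  refine ⟨hmem n, ?_⟩
  have hR : 0 ≤ R := (norm_nonneg _).trans h0
  have ha : 0 ≤ a := (norm_nonneg _).trans hc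
  induction n with
  | zero => simp
  | succ n ih =>
    have hpn := hmem n
    have hmb := hm.1
    have hn1 : ‖p n‖ ≤ R := by simpa using hpn
    have hn2 : ‖m‖ ≤ R := by simpa using hmb
    set L := 2 * (a * (1 + 2 * R)) ^ 2 + 4 * a ^ 2 * (1 + R + R ^ 2) + 2 * ρ with hL
    have hL0 : 0 ≤ L := by positivity
    have key := IsProj.norm_sub_sq_le (convex_closedBall 0 R) hm (Q.differentiable_lsq ρ m) (ρ := ρ)
      (L := L) (p := p n) hω ?_ ?_ hωL (hp n)
    · have h1 : ‖p (n + 1) - m‖ ^ 2 ≤ (r * ‖p n - m‖) ^ 2 := by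
        rw [mul_pow]
        exact key.trans (by gcongr)
      have h2 : ‖p (n + 1) - m‖ ≤ r * ‖p n - m‖ := (le_abs_self _).trans (abs_le_of_sq_le_sq h1 (by positivity))
      rw [norm_sub_rev m, pow_succ']
      rw [norm_sub_rev m] at ih
      calc _ ≤ r * ‖p n - m‖ := h2
        _ ≤ r * (r ^ n * ‖m - p 0‖) := by gcongr
        _ = _ := by ring
    -- Adding the convexity inequalities with interchanged points gives strong monotonicity of the
    -- gradient.
    · have h1 := h m hmb (p n) hpn
      have h2 := h (p n) hpn m hmb
      rw [← neg_sub (p n) m, map_neg, norm_neg] at h2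
      rw [inner_sub_left, inner_gradient_lsq, inner_gradient_lsq]
      linarith
    -- Testing the difference of the derivatives with the difference of the gradients itself turns
    -- the bound of functionals into one of gradients.
    · set g := ∇ (Q.lsq ρ) (p n) - ∇ (Q.lsq ρ) m with hg
      have h1 := (le_abs_self _).trans (Q.abs_lsqDer_sub_le hρ.le hc hA hN hn1 hn2 g)
      rw [← inner_gradient_lsq, ← inner_gradient_lsq, ← inner_sub_left, ← hg, ← hL,
        real_inner_self_eq_norm_sq, sq] at h1
      rcases (norm_nonneg g).eq_or_lt with h3 | h3
      · rw [← h3]; positivity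
      · exact le_of_mul_le_mul_right h1 h3

end QuadMap

/-- An upper bound for the step size of the gradient projection method, for given regularization
parameter and Lipschitz constant. -/
def stepBound (ρ L : ℝ) : ℝ := if 0 < ρ then min (1 / 2) (2 * ρ / (L ^ 2 + 1)) else 1 / 2

/-- The default value $1/2$ secures these bounds for arbitrary real arguments, since the step bound
is to be a function of unrestricted parameters; the same holds for `stepRate`. -/
lemma stepBound_mem (ρ L : ℝ) : 0 < stepBound ρ L ∧ stepBound ρ L < 1 := by
  rw [stepBound]
  split_ifs with h
  · exact ⟨by positivity, (min_le_left _ _).trans_lt (by norm_num)⟩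
  · norm_num

lemma mul_le_of_lt_stepBound {ρ L ω : ℝ} (hρ : 0 < ρ) (h : ω < stepBound ρ L) :
    ω * L ^ 2 ≤ 2 * ρ := by
  rw [stepBound, if_pos hρ] at h
  have h1 : ω < 2 * ρ / (L ^ 2 + 1) := h.trans_le (min_le_right _ _)
  rw [lt_div_iff₀ (by positivity)] at h1
  rcases le_or_gt 0 ω with h2 | h2
  · nlinarith
  · nlinarith [mul_nonneg (sq_nonneg L) (neg_nonneg.2 h2.le)]

/-- The rate of convergence of the gradient projection method. -/
def stepRate (ω ρ : ℝ) : ℝ := if 0 < ω * ρ then √(max (1 / 2) (1 - 2 * ω * ρ)) else 1 / 2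

lemma stepRate_mem (ω ρ : ℝ) : 0 < stepRate ω ρ ∧ stepRate ω ρ < 1 := by
  rw [stepRate]
  split_ifs with h
  · refine ⟨by positivity, ?_⟩
    rw [Real.sqrt_lt' one_pos, one_pow]
    exact max_lt (by norm_num) (by linarith)
  · norm_num

lemma le_stepRate_sq {ω ρ : ℝ} (hω : 0 < ω) (hρ : 0 < ρ) : 1 - 2 * ω * ρ ≤ stepRate ω ρ ^ 2 := by
  rw [stepRate, if_pos (by positivity), Real.sq_sqrt (by positivity)]
  exact le_max_right _ _

/-- The norms of the quadratic map of the weighted functional. -/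
lemma CarlemanWeight.exists_norm_weightedQ_le {B : Box} {s ν : ℝ} (hs : B.ξ < s) (hν : 1 ≤ ν)
    {w : CarlemanWeight B} (hw : w.ψ = expFn B s ν) (k₁ k₂ : ℝ) :
    ∃ M : ℝ, ∀ (δ Z : ℝ), 0 < δ → δ < 1 → ∀ (V : Hm B 3) (F : HK B 4 k₁ k₂), ‖F‖ + ‖V‖ ≤ Z →
      ‖(weightedQ w k₁ k₂ (lamOf B s ν δ) V F).c‖ ≤ (√δ)⁻¹ * (M * (1 + Z) ^ 2) ∧
      ‖(weightedQ w k₁ k₂ (lamOf B s ν δ) V F).A‖ ≤ (√δ)⁻¹ * (M * (1 + Z) ^ 2) ∧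
      ‖(weightedQ w k₁ k₂ (lamOf B s ν δ) V F).N‖ ≤ (√δ)⁻¹ * (M * (1 + Z) ^ 2) := by
  have hψ1 : ∀ z ∈ Ioo (-B.ξ) B.d, w.ψ z ≤ tNu B s ν := fun z hz => by
    rw [hw]; exact (expFn_mem hs hν hz).2
  refine ⟨max ‖(opQ B k₁ k₂).c‖ (max ‖(opQ B k₁ k₂).A‖ ‖(opQ B k₁ k₂).N‖),
    fun δ Z hδ hδ1 V F hZ => ?_⟩
  refine (opQ B k₁ k₂).norm_pull_le (by positivity) (fun y => ?_) norm_incr_le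
    ((norm_dataPt_le F V).trans hZ) (le_max_left _ _)
    ((le_max_left _ _).trans (le_max_right _ _)) ((le_max_right _ _).trans (le_max_right _ _))
  rw [← exp_lamOf_mul hs hν hδ]
  exact w.norm_EK_le hψ1 (lamOf_pos hs hν hδ hδ1).le y

end

section

/-! ### Rates of convergence -/

lemma normHK_add_le {B : Box} {m : ℕ} (h : m ≤ 3) {k₁ k₂ : ℝ} (p q : HK0 B 3 k₁ k₂) :
    normHK h (p + q) ≤ normHK h p + normHK h q := by
  rw [normHK_eq, normHK_eq, normHK_eq]
  have e : (incr B k₁ k₂ (p + q)).1 = (incr B k₁ k₂ p).1 + (incr B k₁ k₂ q).1 :=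
    congrArg Prod.fst (map_add (incr B k₁ k₂) p q)
  refine (congrArg norm ((congrArg _ e).trans
    (map_add ((restrL B h).compLpL 2 (kVol k₁ k₂)) _ _))).le.trans (norm_add_le _ _)

lemma normHK_le_norm {B : Box} {m : ℕ} (h : m ≤ 3) {k₁ k₂ : ℝ} (p : HK0 B 3 k₁ k₂) :
    normHK h p ≤ ‖p‖ := by
  rw [normHK_eq]
  exact (norm_compLpL_restrL_le h _).trans ((norm_fst_le _).trans (norm_incr_le p))

/-- The proof yields $\delta^{1/4}\lambda^{1/2}$ for the minimizer, $\delta^{1/2}\lambda^{1/2}$ for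
the tail and $\delta$ for the data. For $\delta\le1\le\lambda$ the common rate
$\delta^{1/4}\lambda^{3/4}$ dominates all three. -/
lemma rate_bounds {δ lam : ℝ} (hδ : 0 < δ) (hδ1 : δ ≤ 1) (hl : 1 ≤ lam) :
    δ ^ (1 / 4 : ℝ) * √lam ≤ δ ^ (1 / 4 : ℝ) * lam ^ (3 / 4 : ℝ) ∧
      √δ * √lam ≤ δ ^ (1 / 4 : ℝ) * lam ^ (3 / 4 : ℝ) ∧
      δ ≤ δ ^ (1 / 4 : ℝ) * lam ^ (3 / 4 : ℝ) := by
  have h1 : √lam ≤ lam ^ (3 / 4 : ℝ) := by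
    rw [Real.sqrt_eq_rpow]; exact Real.rpow_le_rpow_of_exponent_le hl (by norm_num)
  have h2 : √δ ≤ δ ^ (1 / 4 : ℝ) := by
    rw [Real.sqrt_eq_rpow]; exact Real.rpow_le_rpow_of_exponent_ge hδ hδ1 (by norm_num)
  have h3 : δ ≤ δ ^ (1 / 4 : ℝ) := by
    simpa using Real.rpow_le_rpow_of_exponent_ge hδ hδ1 (show (1 / 4 : ℝ) ≤ 1 by norm_num)
  have h4 : 1 ≤ lam ^ (3 / 4 : ℝ) := Real.one_le_rpow hl (by norm_num)
  have h5 : 0 ≤ δ ^ (1 / 4 : ℝ) := Real.rpow_nonneg hδ.le _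
  refine ⟨by gcongr, by gcongr, ?_⟩
  nlinarith

/-- In the convexity inequality from the minimizer to the exact solution, the derivative term is
nonnegative by the variational inequality and the minimum is nonnegative. What is left is
$(c/\lambda)N^2\le M\sqrt\delta$. -/
lemma le_of_convexity {c lam N ρ t Jm Js g M δ : ℝ} (hc : 0 < c) (hl : 0 < lam) (hδ : 0 ≤ δ)
    (hρ : 0 ≤ ρ) (hM : 0 ≤ M) (h : c / lam * N ^ 2 + ρ * t ^ 2 ≤ Js - Jm - g) (hg : 0 ≤ g)
    (hm : 0 ≤ Jm) (hs : Js ≤ M * √δ) : N ≤ √(M / c) * (δ ^ (1 / 4 : ℝ) * √lam) := by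
  have e : (δ ^ (1 / 4 : ℝ)) ^ 2 = √δ := by
    rw [Real.sqrt_eq_rpow, ← Real.rpow_natCast, ← Real.rpow_mul hδ]; norm_num
  have h1 : N ^ 2 ≤ (√(M / c) * (δ ^ (1 / 4 : ℝ) * √lam)) ^ 2 := by
    rw [mul_pow, mul_pow, e, Real.sq_sqrt hl.le, Real.sq_sqrt (by positivity)]
    have h2 : c / lam * N ^ 2 ≤ M * √δ := by nlinarith [mul_nonneg hρ (sq_nonneg t)]
    have h3 := mul_le_mul_of_nonneg_left h2 (show 0 ≤ lam / c by positivity)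
    calc N ^ 2 = lam / c * (c / lam * N ^ 2) := by field_simp
      _ ≤ _ := h3
      _ = _ := by ring
  exact (le_abs_self N).trans (abs_le_of_sq_le_sq h1 (by
    have := Real.rpow_nonneg hδ (1 / 4 : ℝ)
    positivity))

lemma coeff_rate_aux {C T A ε x n f t : ℝ} (hC : 0 ≤ C) (hT : 0 ≤ T)
    (hx : x ≤ T * ε) (hn : n ≤ A * ε + t) (hf : f ≤ ε) :
    C * (1 + T) * (x + n + f) ≤ C * (1 + T) * (T + A + 1) * ε + C * (1 + T) * t := by
  calc C * (1 + T) * (x + n + f) ≤ C * (1 + T) * ((T + A + 1) * ε + t) := by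
        refine mul_le_mul_of_nonneg_left ?_ (by positivity)
        linarith
    _ = _ := by ring

end

end Convexification

end

/-! ### The theorem: choice of the constants and assembly. -/

set_option maxHeartbeats 2000000 in
open Convexification in
theorem theorem4p6 (B : Box) (s : ℝ) (hs : B.ξ < s) :
    ∃ ν₀ : ℝ, 1 ≤ ν₀ ∧ ∀ ν : ℝ, ν₀ ≤ ν → ∀ k₁ k₂ : ℝ, 0 < k₁ → k₁ < k₂ →
    -- the constants, as functions of the quantities on which they may depend
    ∃ (lam₁ C₁ C₂ : ℝ → ℝ → ℝ → ℝ) (ω₀ : ℝ → ℝ → ℝ → ℝ → ℝ) (r : ℝ → ℝ → ℝ → ℝ → ℝ → ℝ),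
      (∀ R f v, 1 ≤ lam₁ R f v ∧ 0 < C₁ R f v ∧ 0 < C₂ R f v) ∧
      (∀ R f v δ, 0 < ω₀ R f v δ ∧ ω₀ R f v δ < 1) ∧
      (∀ ω R f v δ, 0 < r ω R f v δ ∧ r ω R f v δ < 1) ∧
    ∀ R : ℝ, 0 < R →
    -- the noiseless data and the exact solution
    ∀ (ψ₀s ψ₁s : E3 → ℂ) (Qs Vs : Hm B 3) (φ₀s φ₁s : E3 → ℝ → ℂ) (Fs : HK B 4 k₁ k₂),
      HasBoundaryData Qs ψ₀s ψ₁s → IsExactTail ψ₀s ψ₁s Vs → HasBoundaryDataK Fs φ₀s φ₁s →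
    -- the noisy data
    ∀ δ : ℝ, 0 < δ → δ < 1 →
    ∀ (ψ₀ ψ₁ : E3 → ℂ) (Q : Hm B 3) (φ₀ φ₁ : E3 → ℝ → ℂ) (F : HK B 4 k₁ k₂),
      HasBoundaryData Q ψ₀ ψ₁ → HasBoundaryDataK F φ₀ φ₁ → ‖Q - Qs‖ < δ → ‖F - Fs‖ < δ →
    -- the tail function exists and is unique
    (∃! V, IsTail B s ν δ ψ₀ ψ₁ V) ∧ ∀ V, IsTail B s ν δ ψ₀ ψ₁ V →
    -- `lam₁` is a threshold for the strict convexity of the functional on the closed ball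
    (∀ lam ρ : ℝ, lam₁ R ‖Fs‖ ‖Vs‖ ≤ lam → 0 < ρ →
      Differentiable ℝ (J B s ν k₁ k₂ lam ρ V F) ∧
      ∀ p₁ ∈ Metric.closedBall (0 : HK0 B 3 k₁ k₂) R,
      ∀ p₂ ∈ Metric.closedBall (0 : HK0 B 3 k₁ k₂) R,
        C₁ R ‖Fs‖ ‖Vs‖ / lam * normHK (j := 2) (by norm_num) (p₂ - p₁) ^ 2
            + ρ * ‖p₂ - p₁‖ ^ 2 ≤
          J B s ν k₁ k₂ lam ρ V F p₂ - J B s ν k₁ k₂ lam ρ V F p₁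
            - inner ℝ (∇ (J B s ν k₁ k₂ lam ρ V F) p₁) (p₂ - p₁) ∧
        C₁ R ‖Fs‖ ‖Vs‖ * normHK (j := 1) (by norm_num) (p₂ - p₁) ^ 2
            + ρ * ‖p₂ - p₁‖ ^ 2 ≤
          J B s ν k₁ k₂ lam ρ V F p₂ - J B s ν k₁ k₂ lam ρ V F p₁
            - inner ℝ (∇ (J B s ν k₁ k₂ lam ρ V F) p₁) (p₂ - p₁)) ∧
    -- the convergence estimates
    ∀ δ₁ : ℝ, 0 < δ₁ → δ₁ < Real.exp (-2 * lam₁ R ‖Fs‖ ‖Vs‖ * tNu B s ν) → δ < δ₁ →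
    ∀ (ps : HK0 B 3 k₁ k₂) (cs : E3 → ℂ), IsExactSolution Vs Fs ps cs → ‖ps‖ < R →
    (∃! pm, IsMinimizer (J B s ν k₁ k₂ (lamOf B s ν δ) (√δ) V F) (Metric.closedBall 0 R) pm) ∧
    ∀ pm, IsMinimizer (J B s ν k₁ k₂ (lamOf B s ν δ) (√δ) V F) (Metric.closedBall 0 R) pm →
      normHK (j := 2) (by norm_num) (ps - pm) ≤
        C₂ R ‖F‖ ‖Vs‖ * δ ^ (1 / 4 : ℝ) * lamOf B s ν δ ^ (3 / 4 : ℝ) ∧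
      (∀ k ∈ Icc k₁ k₂, eLpNorm (fun x => cs x - coeff k₂ V (addF pm F) k x) 2 B.vol ≤
        ENNReal.ofReal (C₂ R ‖F‖ ‖Vs‖ * δ ^ (1 / 4 : ℝ) * lamOf B s ν δ ^ (3 / 4 : ℝ))) ∧
      -- the gradient projection method
      ∀ ω : ℝ, 0 < ω → ω < ω₀ R ‖F‖ ‖Vs‖ δ →
      ∀ p : ℕ → HK0 B 3 k₁ k₂, ‖p 0‖ < R →
        (∀ n, IsProj (Metric.closedBall 0 R)
          (p n - ω • ∇ (J B s ν k₁ k₂ (lamOf B s ν δ) (√δ) V F) (p n)) (p (n + 1))) →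
        ∀ n : ℕ,
          ‖pm - p n‖ ≤ r ω R ‖F‖ ‖Vs‖ δ ^ n * ‖pm - p 0‖ ∧
          normHK (j := 2) (by norm_num) (ps - p n) ≤
            C₂ R ‖F‖ ‖Vs‖ * δ ^ (1 / 4 : ℝ) * lamOf B s ν δ ^ (3 / 4 : ℝ)
              + r ω R ‖F‖ ‖Vs‖ δ ^ n * ‖pm - p 0‖ ∧
          ∀ k ∈ Icc k₁ k₂, eLpNorm (fun x => cs x - coeff k₂ V (addF (p n) F) k x) 2 B.vol ≤
            ENNReal.ofReal (C₂ R ‖F‖ ‖Vs‖ * δ ^ (1 / 4 : ℝ) * lamOf B s ν δ ^ (3 / 4 : ℝ)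
              + C₂ R ‖F‖ ‖Vs‖ * r ω R ‖F‖ ‖Vs‖ δ ^ n * ‖pm - p 0‖) := by
  -- Since the constants may depend on $\nu$, every $\nu\ge1$ is admissible; convexity of $\psi$ is
  -- all that the Carleman estimate asks for besides monotonicity.
  refine ⟨1, le_rfl, fun ν hν k₁ k₂ hk₁ hk₂ => ?_⟩
  obtain ⟨w, hw⟩ := exists_weight B hs hν
  have hψ0 : ∀ z ∈ Ioo (-B.ξ) B.d, 0 ≤ w.ψ z := fun z hz => by
    rw [hw]; exact (expFn_mem hs hν hz).1
  have hψ1 : ∀ z ∈ Ioo (-B.ξ) B.d, w.ψ z ≤ tNu B s ν := fun z hz => by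
    rw [hw]; exact (expFn_mem hs hν hz).2
  refine (exists_tail_bounds hs hν hw).elim fun Ct h => h.elim fun lam₀ htail => ?_
  refine (w.exists_lsq_convexity hψ0 k₁ k₂).elim fun c h => h.elim fun l₁ hconv => ?_
  refine (w.exists_lsq_exact_le hs hν hw k₁ k₂).elim fun Me hexact => ?_
  refine (w.exists_eLpNorm_coeff_sub_le hψ0 hψ1 (k₂ := k₂) hk₁).elim fun Cc hcoeff => ?_
  refine (CarlemanWeight.exists_norm_weightedQ_le hs hν hw k₁ k₂).elim fun Mq hMq => ?_
  have hCt : 0 ≤ Ct := zero_le_one.trans htail.1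
  have hc := hconv.1
  -- One radius for all data: $2R$ for differences in the ball, 1 for the distance of $F$ and $F_*$
  -- (below $\delta<1$), and the bound of the tail function. It can thus be evaluated at $\|F_*\|$
  -- for the threshold and at $\|F\|$ for the rates. The absolute values keep it nonnegative for all
  -- arguments.
  set S : ℝ → ℝ → ℝ → ℝ := fun R f v => 2 * |R| + (|f| + 1) + Ct * (1 + |v|) with hS
  -- A bound for the coefficients of the weighted quadratic map; the factor $\delta^{-1/2}$ is the
  -- maximum of the weight.
  set a : ℝ → ℝ → ℝ → ℝ := fun f v δ =>
    (√δ)⁻¹ * (Mq * (1 + (|f| + Ct * (1 + |v|))) ^ 2) with ha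
  set A : ℝ → ℝ → ℝ → ℝ := fun R f v => √(Me (S R f v) / c) with hA
  set D : ℝ → ℝ → ℝ → ℝ := fun R f v => Cc * (1 + S R f v) with hD
  have hS0 : ∀ R f v, 0 ≤ S R f v := fun R f v => by rw [hS]; positivity
  have hA0 : ∀ R f v, 0 ≤ A R f v := fun R f v => Real.sqrt_nonneg _
  have hD0 : ∀ R f v, 0 ≤ D R f v := fun R f v => mul_nonneg hcoeff.1 (by linarith [hS0 R f v])
  have hDS : ∀ R f v, 0 ≤ D R f v * (S R f v + A R f v) := fun R f v =>
    mul_nonneg (hD0 R f v) (add_nonneg (hS0 R f v) (hA0 R f v))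
  -- It dominates the constant $A$ of the rate for $p$, the constant $D(S+A+1)$ of the rate for the
  -- coefficient, and the Lipschitz constant $D$ in front of the iteration error.
  set C₂ : ℝ → ℝ → ℝ → ℝ := fun R f v =>
    1 + A R f v + D R f v * (S R f v + A R f v + 1) with hC₂
  set ω₀ : ℝ → ℝ → ℝ → ℝ → ℝ := fun R f v δ => stepBound (√δ)
    (2 * (a f v δ * (1 + 2 * R)) ^ 2 + 4 * a f v δ ^ 2 * (1 + R + R ^ 2) + 2 * √δ) with hω₀
  refine ⟨fun R f v => max (l₁ (S R f v)) lam₀, fun _ _ _ => c, C₂, ω₀,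
    fun ω _ _ _ δ => stepRate ω (√δ), fun R f v => ⟨(hconv.2.1 _).trans (le_max_left _ _), hc, ?_⟩,
    fun R f v δ => stepBound_mem _ _, fun ω R f v δ => stepRate_mem _ _, ?_⟩
  · have := hA0 R f v
    have := hDS R f v
    have := hD0 R f v
    rw [hC₂]
    dsimp only
    nlinarith
  intro R hR ψ₀s ψ₁s Qs Vs φ₀s φ₁s Fs hQs hVs hFs δ hδ hδ1 ψ₀ ψ₁ Q φ₀ φ₁ F hQ hF hQQ hFF
  refine ⟨existsUnique_isTail hs hν hδ hQ, fun V hV => ?_⟩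
  have ht := htail.2.2 ψ₀s ψ₁s Qs Vs hQs hVs δ hδ hδ1 ψ₀ ψ₁ Q hQ hQQ V hV
  have hV1 : ‖V‖ ≤ Ct * (1 + ‖Vs‖) := ht.1
  have hVs1 : ‖Vs‖ ≤ Ct * (1 + ‖Vs‖) := by nlinarith [htail.1, norm_nonneg Vs]
  have hF1 : ‖F‖ ≤ ‖Fs‖ + 1 := by
    have := norm_le_norm_add_norm_sub' F Fs
    linarith
  have hFs1 : ‖Fs‖ ≤ ‖F‖ + 1 := by
    have := norm_le_norm_add_norm_sub' Fs F
    rw [norm_sub_rev] at this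
    linarith
  have hSR : ∀ f v, 0 ≤ f → 0 ≤ v → S R f v = 2 * R + (f + 1) + Ct * (1 + v) := by
    intro f v hf hv
    rw [hS]
    dsimp only
    rw [abs_of_pos hR, abs_of_nonneg hf, abs_of_nonneg hv]
  have hSs := hSR ‖Fs‖ ‖Vs‖ (norm_nonneg _) (norm_nonneg _)
  have hST := hSR ‖F‖ ‖Vs‖ (norm_nonneg _) (norm_nonneg _)
  have hball : ∀ p ∈ Metric.closedBall (0 : HK0 B 3 k₁ k₂) R, ‖p‖ ≤ R := fun p hp => by
    simpa using hp
  have hCV : 0 ≤ Ct * (1 + ‖Vs‖) := by positivity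
  -- The threshold sees only the exact data, because $\|F\|\le\|F_*\|+1$ and the tail function is
  -- bounded in terms of $\|V_*\|$.
  have key : ∀ lam ρ : ℝ, max (l₁ (S R ‖Fs‖ ‖Vs‖)) lam₀ ≤ lam →
      ∀ p₁ ∈ Metric.closedBall (0 : HK0 B 3 k₁ k₂) R,
      ∀ p₂ ∈ Metric.closedBall (0 : HK0 B 3 k₁ k₂) R,
      c / lam * normHK (show 2 ≤ 3 by norm_num) (p₂ - p₁) ^ 2 + ρ * ‖p₂ - p₁‖ ^ 2 ≤
        (weightedQ w k₁ k₂ lam V F).lsq ρ p₂ - (weightedQ w k₁ k₂ lam V F).lsq ρ p₁ -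
          (weightedQ w k₁ k₂ lam V F).lsqDer ρ p₁ (p₂ - p₁) ∧
      c * normHK (show 1 ≤ 3 by norm_num) (p₂ - p₁) ^ 2 + ρ * ‖p₂ - p₁‖ ^ 2 ≤
        (weightedQ w k₁ k₂ lam V F).lsq ρ p₂ - (weightedQ w k₁ k₂ lam V F).lsq ρ p₁ -
          (weightedQ w k₁ k₂ lam V F).lsqDer ρ p₁ (p₂ - p₁) := by
    intro lam ρ hl p₁ hp₁ p₂ hp₂
    refine hconv.2.2 (S R ‖Fs‖ ‖Vs‖) lam ρ ((le_max_left _ _).trans hl) V F p₁ p₂ ?_ ?_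
    · rw [hSs]
      linarith [hball p₁ hp₁]
    · rw [hSs]
      have := norm_sub_le p₂ p₁
      linarith [hball p₁ hp₁, hball p₂ hp₂, norm_nonneg Fs]
  refine ⟨fun lam ρ hl hρ => ?_, fun δ₁ hδ₁ hδ₁l hδδ₁ ps cs hps hpsR => ?_⟩
  · rw [J_eq_lsq hs hw]
    refine ⟨QuadMap.differentiable_lsq _ ρ, fun p₁ hp₁ p₂ hp₂ => ?_⟩
    rw [QuadMap.inner_gradient_lsq]
    exact key lam ρ hl p₁ hp₁ p₂ hp₂
  -- The condition on $\delta_1$ says precisely that $\lambda(\delta)$ exceeds the threshold for all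
  -- smaller $\delta$.
  have hlt := (lt_lamOf hs hν hδ (hδδ₁.trans hδ₁l)).le
  set lam := lamOf B s ν δ with hlam
  have hlam1 : 1 ≤ lam := ((hconv.2.1 _).trans (le_max_left _ _)).trans hlt
  have ht2 := ht.2 ((le_max_right _ _).trans hlt)
  have hsδ : 0 < √δ := Real.sqrt_pos.2 hδ
  have hrate := rate_bounds hδ hδ1.le hlam1
  have key2 : ∀ p ∈ Metric.closedBall (0 : HK0 B 3 k₁ k₂) R,
      ∀ q ∈ Metric.closedBall (0 : HK0 B 3 k₁ k₂) R, √δ * ‖q - p‖ ^ 2 ≤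
        (weightedQ w k₁ k₂ lam V F).lsq (√δ) q - (weightedQ w k₁ k₂ lam V F).lsq (√δ) p -
          (weightedQ w k₁ k₂ lam V F).lsqDer (√δ) p (q - p) := by
    intro p hp q hq
    refine le_trans (le_add_of_nonneg_left ?_) (key lam (√δ) hlt p hp q hq).1
    positivity
  rw [J_eq_lsq hs hw]
  have hne : (Metric.closedBall (0 : HK0 B 3 k₁ k₂) R).Nonempty := ⟨0, by simpa using hR.le⟩
  refine ⟨QuadMap.existsUnique_isMinimizer_lsq _ hsδ Metric.isClosed_closedBall hne
    (convex_closedBall 0 R) key2, fun pm hpm => ?_⟩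
  set T := S R ‖F‖ ‖Vs‖ with hT
  set ε := δ ^ (1 / 4 : ℝ) * lam ^ (3 / 4 : ℝ) with hε
  have hε0 : 0 ≤ ε := hδ.le.trans hrate.2.2
  have hpsb : ps ∈ Metric.closedBall (0 : HK0 B 3 k₁ k₂) R := by simpa using hpsR.le
  have hFn := norm_nonneg F
  have hTV : Ct * (1 + ‖Vs‖) ≤ T := by rw [hST]; linarith
  have hTF : ‖F‖ ≤ T := by rw [hST]; linarith
  have hTFs : ‖Fs‖ ≤ T := by rw [hST]; linarith
  have hTR : R ≤ T := by rw [hST]; linarith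
  have hval := hexact.2 T δ hδ hδ1 V Vs F Fs ps (hV1.trans hTV) (hVs1.trans hTV) hTF hTFs
    (hpsR.le.trans hTR) hFF.le (ht2.1.trans (mul_le_mul_of_nonneg_right hTV hsδ.le))
    (opQ_val_eq_zero hps.1)
  -- The exact solution lies in the ball, so it is admissible in the variational inequality at the
  -- minimizer.
  have hgrad : 0 ≤ (weightedQ w k₁ k₂ lam V F).lsqDer (√δ) pm (ps - pm) := by
    rw [← QuadMap.inner_gradient_lsq]
    exact hpm.inner_gradient_nonneg (convex_closedBall 0 R) (QuadMap.differentiable_lsq _ _ _) hpsb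
  have hN := le_of_convexity hc (zero_lt_one.trans_le hlam1) hδ.le hsδ.le (hexact.1 T)
    (key lam (√δ) hlt pm hpm.1 ps hpsb).1 hgrad (QuadMap.lsq_nonneg _ hsδ.le _) hval
  have hN2 : normHK (show 2 ≤ 3 by norm_num) (ps - pm) ≤ A R ‖F‖ ‖Vs‖ * ε :=
    hN.trans (mul_le_mul_of_nonneg_left hrate.1 (Real.sqrt_nonneg _))
  -- The slack $t$ is zero for the minimizer and $r^n\|p_{\min}-p_0\|$ for the iterates, so one
  -- estimate covers both.
  have hest : ∀ p ∈ Metric.closedBall (0 : HK0 B 3 k₁ k₂) R, ∀ t : ℝ,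
      normHK (show 2 ≤ 3 by norm_num) (ps - p) ≤ A R ‖F‖ ‖Vs‖ * ε + t → ∀ k ∈ Icc k₁ k₂,
      eLpNorm (fun x => cs x - coeff k₂ V (addF p F) k x) 2 B.vol ≤
        ENNReal.ofReal (D R ‖F‖ ‖Vs‖ * (T + A R ‖F‖ ‖Vs‖ + 1) * ε + D R ‖F‖ ‖Vs‖ * t) := by
    intro p hp t htt k hk
    refine (hcoeff.2 T p ps F Fs V Vs ((hball p hp).trans hTR) (hpsR.le.trans hTR) hTF hTFs
      (hV1.trans hTV) (hVs1.trans hTV) cs hps.2 k hk).trans (ENNReal.ofReal_le_ofReal ?_)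
    refine coeff_rate_aux hcoeff.1 (hS0 _ _ _) (ht2.2.trans ?_) htt (hFF.le.trans hrate.2.2)
    rw [mul_assoc]
    exact mul_le_mul hTV hrate.2.1 (by positivity) (hS0 _ _ _)
  have hCA : A R ‖F‖ ‖Vs‖ ≤ C₂ R ‖F‖ ‖Vs‖ := by
    have := hDS R ‖F‖ ‖Vs‖
    have := hD0 R ‖F‖ ‖Vs‖
    rw [hC₂]
    dsimp only
    nlinarith
  have hCD : D R ‖F‖ ‖Vs‖ ≤ C₂ R ‖F‖ ‖Vs‖ := by
    have := hDS R ‖F‖ ‖Vs‖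
    have := hA0 R ‖F‖ ‖Vs‖
    rw [hC₂]
    dsimp only
    nlinarith
  have hCDT : D R ‖F‖ ‖Vs‖ * (T + A R ‖F‖ ‖Vs‖ + 1) ≤ C₂ R ‖F‖ ‖Vs‖ := by
    have := hA0 R ‖F‖ ‖Vs‖
    rw [hC₂]
    dsimp only
    linarith
  have hCε : ∀ x, x ≤ C₂ R ‖F‖ ‖Vs‖ → x * ε ≤
      C₂ R ‖F‖ ‖Vs‖ * δ ^ (1 / 4 : ℝ) * lam ^ (3 / 4 : ℝ) := fun x hx => by
    rw [mul_assoc, ← hε]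
    exact mul_le_mul_of_nonneg_right hx hε0
  refine ⟨hN2.trans (hCε _ hCA), fun k hk => ?_, fun ω hω hωω₀ p hp0 hp n => ?_⟩
  · refine (hest pm hpm.1 0 (by linarith) k hk).trans (ENNReal.ofReal_le_ofReal ?_)
    rw [mul_zero, add_zero]
    exact hCε _ hCDT
  have hb := hMq δ (|‖F‖| + Ct * (1 + |‖Vs‖|)) hδ hδ1 V F (by
    rw [abs_norm, abs_norm]; linarith)
  have hconvn := QuadMap.norm_sub_le_pow_mul _ hsδ (stepRate_mem ω (√δ)).1.le hω key2 hb.1 hb.2.1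
    hb.2.2 (mul_le_of_lt_stepBound hsδ hωω₀) (le_stepRate_sq hω hsδ) hpm hp0.le hp n
  set t := stepRate ω (√δ) ^ n * ‖pm - p 0‖ with htd
  have ht0 : 0 ≤ t := mul_nonneg (pow_nonneg (stepRate_mem ω (√δ)).1.le n) (norm_nonneg _)
  have htri : normHK (show 2 ≤ 3 by norm_num) (ps - p n) ≤ A R ‖F‖ ‖Vs‖ * ε + t := by
    have h1 := normHK_add_le (show 2 ≤ 3 by norm_num) (ps - pm) (pm - p n)
    rw [sub_add_sub_cancel] at h1
    exact h1.trans (add_le_add hN2 ((normHK_le_norm _ _).trans hconvn.2))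
  refine ⟨hconvn.2, htri.trans (add_le_add_left (hCε _ hCA) _), fun k hk => ?_⟩
  refine (hest (p n) hconvn.1 t htri k hk).trans (ENNReal.ofReal_le_ofReal ?_)
  refine add_le_add (hCε _ hCDT) ?_
  exact (mul_le_mul_of_nonneg_right hCD ht0).trans_eq (mul_assoc _ _ _).symm
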